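/- **Setting.** Let $\mathbb K\in\{\mathbb R,\mathbb C\}$, $N\in\mathbb N$, $N\ge 1$, and let $Z=(Z_0,\dots,Z_{N-1})$ be a random vector with independent components and law $\mathbb P_Z$ on $\mathbb R^N$, each $Z_i$ being standard normal, Gamma distributed (shape $\alpha+1$ with $\alpha>-1$, rate $1$), or Beta distributed on $(-1,1)$ (density proportional to $(1-x)^\alpha(1+x)^\beta$ with $\alpha,\beta>-1$). Let $I=\prod_i I_i$ with $I_i=\mathbb R,\ (0,\infty),\ (-1,1)$ in the three cases, and let $\rho(z)_i=z_i$ if $Z_i$ is Gamma distributed and $\rho(z)_i=1$ otherwise; $\rho(z)^{\alpha/2}=\prod_i\rho(z)_i^{\alpha_i/2}$ for $\alpha\in\mathbb N_0^N$. For a Hilbert space $E$ and $k\in\mathbb N_0$ let $H^k_\rho(\mathbb R^N,\mathbb P_Z;E)$ be the space of all $f\in L_2(\mathbb R^N,\mathbb P_Z;E)$ which have weak derivatives $\partial^\alpha f$ on $I$ with $\rho^{\alpha/2}\partial^\alpha f\in L_2(\mathbb R^N,\mathbb P_Z;E)$ for all $|\alpha|\le k$, with norm $\|f\|^2=\sum_{|\alpha|\le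 k}\|\rho^{\alpha/2}\partial^\alpha f\|_{L_2}^2$. Let $V,H$ be separable Hilbert spaces over $\mathbb K$, $V\hookrightarrow H$ continuously and densely, and for $z\in\mathbb R^N$ let $a_z\colon V\times V\to\mathbb K$ be a sesquilinear form such that $z\mapsto a_z(u,u)$ is measurable for all $u\in V$. Assume that there are $K,\kappa>0$ such that for $\mathbb P_Z$-almost every $z$ and all $u,v\in V$ $$|a_z(u,v)|\le K\|u\|_V\|v\|_V,\qquad \operatorname{Re}a_z(u,u)\ge\kappa\|u\|_V^2,\qquad a_z(u,v)=\overline{a_z(v,u)}.$$ Let $A_z$ be the operator in $H$ associated with $a_z$. Assume that there is a Hilbert space $D\hookrightarrow V$ with $\operatorname{dom}(A_z)=D$ for $\mathbb P_Z$-almost every $z$, the graph norms of $A_z$ being equivalent to $\|\cdot\|_D$ with constants independent of $z$ for $\mathbb P_Z$-almost every $z$. Let $\mathbf H=L_2(\mathbb R^N,\mathbb P_Z;H)$, and let $\mathbf A$ be the operator in $\mathbf H$ given by $(\mathbf Af)(z)=A_zf(z)$ on $\operatorname{dom}(\mathbf A)=\{f\in\mathbf H:\ f(z)\in\operatorname{dom}(A_z)\text{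 a.e.},\ \int\|A_zf(z)\|_H^2\,\mathrm d\mathbb P_Z<\infty\}$. Let $\mathcal P^N_n$ be the polynomials in $N$ variables of total degree at most $n$, and let $\mathbf R_n$ be the orthogonal projection of $\mathbf H$ onto $\mathcal P_n^N\otimes H$. Let $\mathbf R_n\mathbf A\mathbf R_n$ denote the operator in $\mathcal P^N_n\otimes H$ associated with the restriction of the form $\mathbf a(f,g)=\int a_z(f(z),g(z))\,\mathrm d\mathbb P_Z(z)$ to $\mathcal P_n^N\otimes V$, extended by zero to $\mathbf H$. **Theorem.** Let $\ell\in\mathbb N$, $\ell\ge1$. Assume in addition that $z\mapsto a_z(u,v)$ belongs to $C^{2\ell}(\mathbb R^N)$ for all $u,v\in V$, and that there is a constant $C_{2\ell}\ge0$ such that $$|\rho(z)^{\alpha/2}\,\partial_z^\alpha a_z(u,v)|\le C_{2\ell}\|u\|_D\|v\|_H$$ for $\mathbb P_Z$-almost every $z\in\mathbb R^N$ and all $u\in D$, $v\in V$, $\alpha\in\mathbb N_0^N$ with $|\alpha|\le2\ell$. Then $-\mathbf A$ and $-\mathbf R_n\mathbf A\mathbf R_n$ generate $C_0$-semigroups $(\mathbf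 T(t))_{t\ge0}$ and $(\mathbf T_n(t))_{t\ge0}$ on $\mathbf H$, and for every $\bar T>0$ there is a constant $C_{\bar T,\ell}>0$ such that $$\|\mathbf T_n(t)\mathbf R_n f-\mathbf T(t)f\|_{\mathbf H}\le C_{\bar T,\ell}\,n^{-\ell}\,\|f\|_{H^{2\ell}_\rho(\mathbb R^N,\mathbb P_Z;D)}$$ for all $f\in H^{2\ell}_\rho(\mathbb R^N,\mathbb P_Z;D)$, $n\in\mathbb N$ with $n\ge1$, and $t\in[0,\bar T]$. In particular, for $\mathbf u_0\in H^{2\ell}_\rho(\mathbb R^N,\mathbb P_Z;D)$ the mild solutions $\mathbf u$ of $\mathbf u'=-\mathbf A\mathbf u$, $\mathbf u(0)=\mathbf u_0$, and $\mathbf u_n$ of $\mathbf u_n'=-\mathbf R_n\mathbf A\mathbf R_n\mathbf u_n$, $\mathbf u_n(0)=\mathbf R_n\mathbf u_0$, satisfy $$\|\mathbf u_n(t)-\mathbf u(t)\|_{\mathbf H}\le C_{\bar T,\ell}\,n^{-\ell}\,\|\mathbf u_0\|_{H^{2\ell}_\rho(\mathbb R^N,\mathbb P_Z;D)}\qquad(t\in[0,\bar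 T],\ n\ge 1).$$ -/

import Mathlib

open MeasureTheory ProbabilityTheory Filter Topology Set
open scoped NNReal ENNReal ContDiff

namespace RandomEvolution

noncomputable section

/-! ### The admissible one-dimensional laws -/

/-- A standard normal law, a Gamma law with shape `α + 1` and rate `1`, or a Beta law
on `(-1, 1)` with parameters `α, β > -1`. -/
inductive NoiseLaw : Type
  | normal : NoiseLaw
  | gamma (α : ℝ) (hα : -1 < α) : NoiseLaw
  | beta (α β : ℝ) (hα : -1 < α) (hβ : -1 < β) : NoiseLaw

namespace NoiseLaw

/-- The probability measure on `ℝ` described by a law. -/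
def measure : NoiseLaw → Measure ℝ
  | normal => gaussianReal 0 1
  | gamma α _ => gammaMeasure (α + 1) 1
  | beta α β _ _ => volume.withDensity fun x =>
      ENNReal.ofReal ((Ioo (-1 : ℝ) 1).indicator (fun x =>
        Real.Gamma (α + β + 2) /
            ((2 : ℝ) ^ (α + β + 1) * Real.Gamma (α + 1) * Real.Gamma (β + 1)) *
          ((1 - x) ^ α * (1 + x) ^ β)) x)

/-- The open interval that carries the law and on which its density is positive. -/
def interval : NoiseLaw → Set ℝ
  | normal => univ
  | gamma _ _ => Ioi 0
  | beta _ _ _ _ => Ioo (-1) 1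

/-- The weight `ρ`: equal to `1` for normal and Beta laws, to `x` for Gamma laws. -/
def weight : NoiseLaw → ℝ → ℝ
  | normal => fun _ => 1
  | gamma _ _ => fun x => x
  | beta _ _ _ _ => fun _ => 1

end NoiseLaw

/-- The law of the random vector `(Z 0, …, Z (N - 1))` on `ℝ^N`. -/
def jointLaw {Ω : Type*} [MeasurableSpace Ω] (P : Measure Ω) {N : ℕ} (Z : Fin N → Ω → ℝ) :
    Measure (Fin N → ℝ) :=
  P.map fun x i => Z i x

variable {N : ℕ}

/-- The open box in `ℝ^N` that carries the joint law of independent components. -/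
def box (law : Fin N → NoiseLaw) : Set (Fin N → ℝ) :=
  {z | ∀ i, z i ∈ (law i).interval}

/-- The scalar weight `ρ(z)^(α/2) = ∏ i, ρ(z)_i ^ (α i / 2)`. -/
def weightPow (law : Fin N → NoiseLaw) (α : Fin N → ℕ) (z : Fin N → ℝ) : ℝ :=
  ∏ i, (law i).weight (z i) ^ ((α i : ℝ) / 2)

/-! ### Multi-indices, derivatives and weighted Sobolev spaces -/

/-- The finite set of multi-indices `α` with `|α| ≤ k`. -/
def multiIndices (N k : ℕ) : Finset (Fin N → ℕ) :=
  (Fintype.piFinset fun _ => Finset.range (k + 1)).filter fun α => ∑ i, α i ≤ k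

theorem mem_multiIndices {k : ℕ} {α : Fin N → ℕ} :
    α ∈ multiIndices N k ↔ ∑ i, α i ≤ k := by
  simp only [multiIndices, Finset.mem_filter, Fintype.mem_piFinset, Finset.mem_range,
    and_iff_right_iff_imp]
  intro h i
  have := Finset.single_le_sum (f := α) (fun _ _ => Nat.zero_le _) (Finset.mem_univ i)
  omega

/-- The classical partial derivative in the `i`-th coordinate. -/
def partialDeriv {F : Type*} [NormedAddCommGroup F] [NormedSpace ℝ F] (i : Fin N)
    (f : (Fin N → ℝ) → F) : (Fin N → ℝ) → F :=
  fun z => fderiv ℝ f z (Pi.single i 1)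

/-- The classical derivative `∂^α f`, that is `∂_0^(α 0) ∂_1^(α 1) ⋯ f`. -/
def multiDeriv {F : Type*} [NormedAddCommGroup F] [NormedSpace ℝ F] (α : Fin N → ℕ)
    (f : (Fin N → ℝ) → F) : (Fin N → ℝ) → F :=
  (List.finRange N).foldr (fun i g => (partialDeriv i)^[α i] g) f

section Sobolev

variable (𝕜 : Type*) [RCLike 𝕜] {E : Type*} [NormedAddCommGroup E] [NormedSpace 𝕜 E]

/-- `g` is the weak derivative `∂^α f` on the open set `U` of the vector-valued function `f`,
tested against real test functions `φ ∈ C_c^∞(U)` (with respect to Lebesgue measure). -/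
def IsWeakDeriv (U : Set (Fin N → ℝ)) (α : Fin N → ℕ) (f g : (Fin N → ℝ) → E) : Prop :=
  letI : NormedSpace ℝ E := NormedSpace.restrictScalars ℝ 𝕜 E
  LocallyIntegrableOn f U ∧ LocallyIntegrableOn g U ∧
    ∀ φ : (Fin N → ℝ) → ℝ, ContDiff ℝ ∞ φ → HasCompactSupport φ → tsupport φ ⊆ U →
      ∫ z in U, multiDeriv α φ z • f z = (-1 : ℝ) ^ (∑ i, α i) • ∫ z in U, φ z • g z

open Classical in
/-- The weak derivative `∂^α f` on `U` (unique almost everywhere); `0` if there is none. -/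
def weakDeriv (U : Set (Fin N → ℝ)) (α : Fin N → ℕ) (f : (Fin N → ℝ) → E) :
    (Fin N → ℝ) → E :=
  if h : ∃ g, IsWeakDeriv 𝕜 U α f g then h.choose else 0

/-- Membership in the weighted Sobolev space `H_ρ^k(ℝ^N, μ; E)`, where `μ` is the law of a
random vector with independent components distributed as prescribed by `law`. -/
def MemSobolev (law : Fin N → NoiseLaw) (μ : Measure (Fin N → ℝ)) (k : ℕ)
    (f : (Fin N → ℝ) → E) : Prop :=
  MemLp f 2 μ ∧ ∀ α : Fin N → ℕ, ∑ i, α i ≤ k →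
    (∃ g, IsWeakDeriv 𝕜 (box law) α f g) ∧
      MemLp (fun z => (weightPow law α z : 𝕜) • weakDeriv 𝕜 (box law) α f z) 2 μ

/-- The norm of `H_ρ^k(ℝ^N, μ; E)`. -/
def sobolevNorm (law : Fin N → NoiseLaw) (μ : Measure (Fin N → ℝ)) (k : ℕ)
    (f : (Fin N → ℝ) → E) : ℝ :=
  √(∑ α ∈ multiIndices N k,
    (eLpNorm (fun z => (weightPow law α z : 𝕜) • weakDeriv 𝕜 (box law) α f z) 2 μ).toReal ^ 2)

end Sobolev

/-! ### Unbounded operators, semigroups and mild solutions -/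

section Semigroup

variable {𝕜 : Type*} [RCLike 𝕜]

/-- The graph norm of an unbounded operator. -/
def graphNorm {X : Type*} [NormedAddCommGroup X] [NormedSpace 𝕜 X] (A : X →ₗ.[𝕜] X)
    (x : A.domain) : ℝ :=
  √(‖A x‖ ^ 2 + ‖(x : X)‖ ^ 2)

/-- `(T t)_{t ≥ 0}` is a `C₀`-semigroup (only the values at `t ≥ 0` matter). -/
structure IsC0Semigroup {X : Type*} [NormedAddCommGroup X] [NormedSpace 𝕜 X]
    (T : ℝ → X →L[𝕜] X) : Prop where
  zero : T 0 = ContinuousLinearMap.id 𝕜 X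
  add : ∀ s t, 0 ≤ s → 0 ≤ t → T (s + t) = (T s).comp (T t)
  continuousOn : ∀ x, ContinuousOn (fun t => T t x) (Ici 0)

/-- `B` is the generator of the `C₀`-semigroup `T`: for all `x, y` one has `x ∈ dom B` and
`B x = y` if and only if `(T h x - x) / h → y` as `h → 0+`. -/
def Generates {X : Type*} [NormedAddCommGroup X] [NormedSpace 𝕜 X] (B : X →ₗ.[𝕜] X)
    (T : ℝ → X →L[𝕜] X) : Prop :=
  IsC0Semigroup T ∧ ∀ x y : X, (x, y) ∈ B.graph ↔
    Tendsto (fun h : ℝ => ((h⁻¹ : ℝ) : 𝕜) • (T h x - x)) (𝓝[>] 0) (𝓝 y)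

/-- `u` is a mild solution of `u' = B u`, `u 0 = x₀` on `[0, ∞)`: it is continuous, and for all
`t ≥ 0` one has `∫ s in 0..t, u s ∈ dom B` and `u t = x₀ + B (∫ s in 0..t, u s)`. -/
def IsMildSolution {X : Type*} [NormedAddCommGroup X] [NormedSpace 𝕜 X]
    (B : X →ₗ.[𝕜] X) (x₀ : X) (u : ℝ → X) : Prop :=
  letI : NormedSpace ℝ X := NormedSpace.restrictScalars ℝ 𝕜 X
  ContinuousOn u (Ici 0) ∧ ∀ t, 0 ≤ t → (∫ s in (0 : ℝ)..t, u s, u t - x₀) ∈ B.graph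

end Semigroup

/-! ### Random forms and their operators -/

section Forms

variable {𝕜 : Type*} [RCLike 𝕜]
  {H : Type*} [NormedAddCommGroup H] [InnerProductSpace 𝕜 H]
  {V : Type*} [NormedAddCommGroup V] [InnerProductSpace 𝕜 V]

/-- The set of pairs `(x, y)` in `H × H` with `x ∈ V` (through the embedding `j : V → H`) and
`b(x, v) = (y | v)_H` for all `v ∈ V`. Mathlib's `inner` is conjugate-linear in the first slot,
so `(y | v)_H` is `inner 𝕜 v y`. -/
def formGraph (j : V →L[𝕜] H) (b : V →ₗ[𝕜] V →ₗ⋆[𝕜] 𝕜) : Submodule 𝕜 (H × H) where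
  carrier := {p | ∃ w : V, j w = p.1 ∧ ∀ v : V, b w v = inner 𝕜 (j v) p.2}
  zero_mem' := ⟨0, by simp, by simp⟩
  add_mem' := by
    rintro p q ⟨w, hw, hw'⟩ ⟨w₁, h₁, h₁'⟩
    refine ⟨w + w₁, by simp [hw, h₁], fun v => ?_⟩
    simp [hw' v, h₁' v, inner_add_right]
  smul_mem' := by
    rintro c p ⟨w, hw, hw'⟩
    refine ⟨c • w, by simp [hw], fun v => ?_⟩
    simp [hw' v, inner_smul_right]

/-- The operator in `H` associated with the form `b` on `V`. -/
def formOperator (j : V →L[𝕜] H) (b : V →ₗ[𝕜] V →ₗ⋆[𝕜] 𝕜) : H →ₗ.[𝕜] H :=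
  (formGraph j b).toLinearPMap

/-- If `V` is embedded densely in `H`, then `formOperator` has graph `formGraph`. -/
theorem formOperator_graph (j : V →L[𝕜] H) (hj : Function.Injective j) (hd : DenseRange j)
    (b : V →ₗ[𝕜] V →ₗ⋆[𝕜] 𝕜) : (formOperator j b).graph = formGraph j b := by
  refine Submodule.toLinearPMap_graph_eq _ ?_
  rintro ⟨x, y⟩ ⟨w, hw, hw'⟩ (rfl : x = 0)
  have hw0 : w = 0 := hj (by simpa using hw)
  subst hw0
  exact hd.eq_zero_of_inner_right 𝕜 fun v => by simpa using (hw' v).symm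

variable (μ : Measure (Fin N → ℝ))

/-- The graph of the multiplication operator `(𝐀 f)(z) = A_z (f z)` in `𝐇 = L²(ℝ^N, μ; H)`:
pairs `(f, g)` with `f z ∈ dom A_z` and `A_z (f z) = g z` for `μ`-almost every `z`. -/
def multiplicationGraph (A : (Fin N → ℝ) → H →ₗ.[𝕜] H) :
    Submodule 𝕜 (Lp H 2 μ × Lp H 2 μ) where
  carrier := {p | ∀ᵐ z ∂μ, (p.1 z, p.2 z) ∈ (A z).graph}
  zero_mem' := by
    filter_upwards [Lp.coeFn_zero H 2 μ] with z hz
    change ((0 : Lp H 2 μ) z, (0 : Lp H 2 μ) z) ∈ (A z).graph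
    rw [hz]
    exact (A z).graph.zero_mem
  add_mem' := by
    rintro p q hp hq
    filter_upwards [hp, hq, Lp.coeFn_add p.1 q.1, Lp.coeFn_add p.2 q.2] with z h₁ h₂ h₃ h₄
    change ((p.1 + q.1) z, (p.2 + q.2) z) ∈ (A z).graph
    rw [h₃, h₄]
    exact (A z).graph.add_mem h₁ h₂
  smul_mem' := by
    rintro c p hp
    filter_upwards [hp, Lp.coeFn_smul c p.1, Lp.coeFn_smul c p.2] with z h₁ h₂ h₃
    change ((c • p.1) z, (c • p.2) z) ∈ (A z).graph
    rw [h₂, h₃]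
    exact (A z).graph.smul_mem c h₁

/-- The operator `𝐀` in `L²(ℝ^N, μ; H)` associated with the family `(A_z)_z`. -/
def multiplicationOperator (A : (Fin N → ℝ) → H →ₗ.[𝕜] H) : Lp H 2 μ →ₗ.[𝕜] Lp H 2 μ :=
  (multiplicationGraph μ A).toLinearPMap

/-- The graph of `multiplicationOperator` is `multiplicationGraph`. -/
theorem multiplicationOperator_graph (A : (Fin N → ℝ) → H →ₗ.[𝕜] H) :
    (multiplicationOperator μ A).graph = multiplicationGraph μ A := by
  refine Submodule.toLinearPMap_graph_eq _ ?_
  rintro ⟨f, g⟩ hfg (rfl : f = 0)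
  refine (Lp.eq_zero_iff_ae_eq_zero).2 ?_
  have hfg' : ∀ᵐ z ∂μ, ((0 : Lp H 2 μ) z, g z) ∈ (A z).graph := hfg
  filter_upwards [hfg', Lp.coeFn_zero H 2 μ] with z h₁ h₂
  exact (A z).graph_fst_eq_zero_snd h₁ (by simpa using h₂)

/-- The subspace `𝒫_n^N ⊗ E` of `L²(ℝ^N, μ; E)`: the `E`-valued polynomials of total degree at
most `n`. -/
def polySubspace (𝕜 : Type*) [RCLike 𝕜] (E : Type*) [NormedAddCommGroup E]
    [InnerProductSpace 𝕜 E] (n : ℕ) : Submodule 𝕜 (Lp E 2 μ) where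
  carrier := {f | ∃ c : (Fin N → ℕ) → E,
    f =ᵐ[μ] fun z => ∑ α ∈ multiIndices N n, ((∏ i, z i ^ α i : ℝ) : 𝕜) • c α}
  zero_mem' := ⟨0, by
    filter_upwards [Lp.coeFn_zero E 2 μ] with z hz
    rw [hz]
    simp⟩
  add_mem' := by
    rintro f g ⟨c, hc⟩ ⟨d, hd⟩
    refine ⟨c + d, ?_⟩
    filter_upwards [hc, hd, Lp.coeFn_add f g] with z h₁ h₂ h₃
    rw [h₃, Pi.add_apply, h₁, h₂]
    simp only [Pi.add_apply, smul_add, Finset.sum_add_distrib]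
  smul_mem' := by
    rintro k f ⟨c, hc⟩
    refine ⟨k • c, ?_⟩
    filter_upwards [hc, Lp.coeFn_smul k f] with z h₁ h₂
    simp only [h₂, Pi.smul_apply, h₁, Finset.smul_sum]
    exact Finset.sum_congr rfl fun α _ => smul_comm _ _ _

/-- The vector-valued polynomial chaos approximation `𝐑_n` of order `n`: the orthogonal
projection of `L²(ℝ^N, μ; H)` onto `𝒫_n^N ⊗ H`. (That subspace is closed for complete `H`;
the closure is taken only so that the projection is available without a proof of this.) -/
def pcProjection (n : ℕ) [CompleteSpace H] : Lp H 2 μ →L[𝕜] Lp H 2 μ :=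
  (polySubspace μ 𝕜 H n).topologicalClosure.starProjection

/-- The embedding of `𝐕 = L²(ℝ^N, μ; V)` into `𝐇 = L²(ℝ^N, μ; H)` induced by `j : V → H`. -/
def liftEmbedding (j : V →L[𝕜] H) : Lp V 2 μ →L[𝕜] Lp H 2 μ :=
  j.compLpL 2 μ

/-- The form `𝐚(f, g) = ∫ a_z(f z, g z) dμ(z)`. -/
def integratedForm (a : (Fin N → ℝ) → V →ₗ[𝕜] V →ₗ⋆[𝕜] 𝕜) (f g : Lp V 2 μ) : 𝕜 :=
  ∫ z, a z (f z) (g z) ∂μ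

/-- The graph of the operator `𝐑_n 𝐀 𝐑_n`: the operator in `𝒫_n^N ⊗ H` associated with the
restriction of `𝐚` to `𝒫_n^N ⊗ V`, extended by zero to `𝐇`. So `(x, y)` belongs to the graph iff
`𝐑_n x ∈ 𝒫_n^N ⊗ V`, `y ∈ 𝒫_n^N ⊗ H` and `𝐚(𝐑_n x, v) = (y | v)_𝐇` for all `v ∈ 𝒫_n^N ⊗ V`.
(Integrability is stated along with the value of the integral `𝐚(𝐑_n x, v)`; it is automatic if
`z ↦ a_z(u, v)` is measurable and bounded and `μ` has moments of all orders.) -/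
def galerkinGraph [CompleteSpace H] (j : V →L[𝕜] H) (a : (Fin N → ℝ) → V →ₗ[𝕜] V →ₗ⋆[𝕜] 𝕜)
    (n : ℕ) : Submodule 𝕜 (Lp H 2 μ × Lp H 2 μ) where
  carrier := {p | p.2 ∈ polySubspace μ 𝕜 H n ∧
    ∃ w ∈ polySubspace μ 𝕜 V n, liftEmbedding μ j w = pcProjection (𝕜 := 𝕜) μ n p.1 ∧
      ∀ v ∈ polySubspace μ 𝕜 V n, Integrable (fun z => a z (w z) (v z)) μ ∧
        integratedForm μ a w v = inner 𝕜 (liftEmbedding μ j v) p.2}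
  zero_mem' := by
    have h0 : ∀ v : Lp V 2 μ, (fun z => a z ((0 : Lp V 2 μ) z) (v z)) =ᵐ[μ] 0 := by
      intro v
      filter_upwards [Lp.coeFn_zero V 2 μ] with z hz
      rw [hz]
      simp
    refine ⟨Submodule.zero_mem _, 0, Submodule.zero_mem _, by simp, fun v _ => ⟨?_, ?_⟩⟩
    · exact (integrable_congr (h0 v)).2 (integrable_zero _ _ _)
    · rw [integratedForm, integral_congr_ae (h0 v)]
      simp
  add_mem' := by
    rintro p q ⟨hp, w, hw, hwp, hp'⟩ ⟨hq, w', hw', hwq, hq'⟩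
    have h0 : ∀ v : Lp V 2 μ, (fun z => a z ((w + w') z) (v z)) =ᵐ[μ]
        fun z => a z (w z) (v z) + a z (w' z) (v z) := by
      intro v
      filter_upwards [Lp.coeFn_add w w'] with z hz
      simp only [hz, Pi.add_apply, map_add, LinearMap.add_apply]
    refine ⟨Submodule.add_mem _ hp hq, w + w', Submodule.add_mem _ hw hw', ?_, fun v hv => ?_⟩
    · rw [map_add, hwp, hwq, Prod.fst_add, map_add]
    · obtain ⟨i₁, e₁⟩ := hp' v hv
      obtain ⟨i₂, e₂⟩ := hq' v hv
      refine ⟨(integrable_congr (h0 v)).2 (i₁.add i₂), ?_⟩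
      rw [integratedForm, integral_congr_ae (h0 v), integral_add i₁ i₂, Prod.snd_add,
        inner_add_right, ← e₁, ← e₂, integratedForm, integratedForm]
  smul_mem' := by
    rintro c p ⟨hp, w, hw, hwp, hp'⟩
    have h0 : ∀ v : Lp V 2 μ, (fun z => a z ((c • w) z) (v z)) =ᵐ[μ]
        fun z => c * a z (w z) (v z) := by
      intro v
      filter_upwards [Lp.coeFn_smul c w] with z hz
      simp only [hz, Pi.smul_apply, map_smul, LinearMap.smul_apply, smul_eq_mul]
    refine ⟨Submodule.smul_mem _ c hp, c • w, Submodule.smul_mem _ c hw, ?_, fun v hv => ?_⟩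
    · rw [map_smul, hwp, Prod.smul_fst, map_smul]
    · obtain ⟨i₁, e₁⟩ := hp' v hv
      refine ⟨(integrable_congr (h0 v)).2 (i₁.const_mul c), ?_⟩
      rw [integratedForm, integral_congr_ae (h0 v), integral_const_mul, Prod.smul_snd,
        inner_smul_right, ← e₁, integratedForm]

/-- The operator `𝐑_n 𝐀 𝐑_n` in `𝐇`. -/
def galerkinOperator [CompleteSpace H] (j : V →L[𝕜] H)
    (a : (Fin N → ℝ) → V →ₗ[𝕜] V →ₗ⋆[𝕜] 𝕜) (n : ℕ) : Lp H 2 μ →ₗ.[𝕜] Lp H 2 μ :=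
  (galerkinGraph μ j a n).toLinearPMap

end Forms

end

end RandomEvolution

open RandomEvolution

/-!
The Galerkin semigroups converge at the rate `n ^ (-ℓ)` because the implicit Euler iterates of the
exact problem keep, uniformly in the step size, the `2 ℓ` weighted derivatives of the initial value
in the parameter, and because a function with `2 ℓ` weighted derivatives is approximated by
polynomials of degree `n` with an `L²` error of order `n ^ (-ℓ)`.

*Generation.* The multiplication operator `𝐀` and the Galerkin operators `𝐑_n 𝐀 𝐑_n` are maximal
monotone: `1 + h 𝐀` is inverted pointwise, with a measurable choice of the solution
(`RandomForm.maxMonotone_multiplicationOperator`), and the Galerkin equations are solved by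
Lax–Milgram (`RandomForm.maxMonotone_galerkinOperator`). Maximal monotone operators generate
contraction semigroups (`MaxMonotone.generates`), the orbits are the only mild solutions
(`MaxMonotone.eq_semigroup_of_isMildSolution`), and the orbits are limits of the implicit Euler
scheme (`MaxMonotone.tendsto_euler`). It is therefore enough to compare the Euler schemes of the two
operators, with constants that do not depend on the step size.

*Polynomial approximation.* The density `w` of each one-dimensional law satisfies a Pearson equation
`(σ w)' = τ w`. Its orthonormal polynomials are eigenfunctions of `σ ∂² + τ ∂`, their derivatives are
eigenfunctions of an operator of the same type, and the products of the eigenvalues grow like `m ^ k`.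
Weighted integration by parts and Bessel's inequality then bound the coefficients of a function by
its weak derivatives with the weights `√σ ^ k`. Polynomials being dense, this gives the rate
`n ^ (-k)` for the squared truncation error (`pow_mul_integral_norm_sub_chaosSum_sq_le`). Only pure
derivatives `∂_i ^ k` enter, since a multi-index of large total degree has a large component; and
`σ ≤ ρ` in all three cases, so the norm of `H^k_ρ` dominates them. The projection
`𝐑_n` is the truncation of the expansion at the total degree `n` (`starProjection_polySubspace`).

*Regularity.* By continuity, the almost sure assumptions on the form hold at every point of the box,
so that the form and its derivatives are represented by bounded operators from `D` to `H`
(`RandomForm.exists_smoothFamily`). Differentiating the Euler equations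
`u_m + h A_z u_m = u_{m-1}` along coordinate lines gives equations for the derivatives with lower
order terms on the right-hand side (`SmoothFamily.hasWeakDerivAt_eulerChain`). Testing with `A_z` bounds
`‖∂^l u_m‖_H` and the `ℓ²`-norm in time of `‖∂^l u_m‖_D`, both with weights and uniformly in `h`
(`exists_energy_bound`). Hence the truncation errors of the iterates have the rate `n ^ (-ℓ)` in `H`
and, after summation over the time steps, in `D` (`exists_chaos_rate_eulerPoint`).

*Comparison.* The projected iterates `𝐑_n u_m` solve the Euler equations of the Galerkin operator up to
the defects `𝐑_n 𝐀 (1 - S_n) u_m`, where `S_n` truncates the expansion in `D`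
(`RandomForm.resolvent_galerkin_eq`). Contractions do not amplify defects, so the error is at most
`‖u_m - 𝐑_n u_m‖` plus the accumulated defects, which the Cauchy–Schwarz inequality in time bounds by
`√t` times the summed truncation errors in `D` (`RandomForm.norm_resolvent_pow_sub_le`). As the number
of steps tends to infinity this becomes the estimate for the semigroups, at first for polynomial
initial values, whose iterates can be differentiated pointwise, and then for all functions in the
Sobolev space, since truncation does not increase the weighted norms of the derivatives
(`RandomForm.exists_semigroup_rate_of_weakChain`).
-/

/-! ### Semigroups generated by maximal monotone operators -/

namespace RandomEvolution

section MaximalMonotone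

variable {𝕜 : Type*} [RCLike 𝕜] {X : Type*} [NormedAddCommGroup X] [InnerProductSpace 𝕜 X]

/-- A linear operator `A` in a Hilbert space is maximal monotone if `Re (A x | x) ≥ 0` and
`1 + r A` is onto for every `r > 0`. -/
structure MaxMonotone (A : X →ₗ.[𝕜] X) : Prop where
  mono : ∀ {x y : X}, (x, y) ∈ A.graph → 0 ≤ RCLike.re (inner 𝕜 x y)
  surj : ∀ {r : ℝ}, 0 < r → ∀ g : X, ∃ x y : X, (x, y) ∈ A.graph ∧ x + (r : 𝕜) • y = g

namespace MaxMonotone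

variable {A : X →ₗ.[𝕜] X}

theorem norm_le (hA : MaxMonotone A) {r : ℝ} (hr : 0 ≤ r) {x y : X} (h : (x, y) ∈ A.graph) :
    ‖x‖ ≤ ‖x + (r : 𝕜) • y‖ := by
  have h1 : ‖x‖ ^ 2 ≤ RCLike.re (inner 𝕜 x (x + (r : 𝕜) • y)) := by
    rw [inner_add_right, inner_smul_right, map_add, RCLike.re_ofReal_mul, inner_self_eq_norm_sq]
    nlinarith [mul_nonneg hr (hA.mono h)]
  have h2 := re_inner_le_norm (𝕜 := 𝕜) x (x + (r : 𝕜) • y)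
  by_contra! hlt
  nlinarith [norm_nonneg x, norm_nonneg (x + (r : 𝕜) • y)]

theorem exists_resolvent (hA : MaxMonotone A) {r : ℝ} (hr : 0 < r) :
    ∃ J : X →L[𝕜] X, ‖J‖ ≤ 1 ∧ ∀ g : X, (J g, ((r⁻¹ : ℝ) : 𝕜) • (g - J g)) ∈ A.graph := by
  choose x y hg hxy using hA.surj hr
  have hr' : (r : 𝕜) ≠ 0 := by exact_mod_cast hr.ne'
  have uniq : ∀ {x₁ y₁ g : X}, (x₁, y₁) ∈ A.graph → x₁ + (r : 𝕜) • y₁ = g → x₁ = x g := by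
    intro x₁ y₁ g h₁ h₂
    have h₃ : (x₁ - x g, y₁ - y g) ∈ A.graph := A.graph.sub_mem h₁ (hg g)
    have h₄ := hA.norm_le hr.le h₃
    have h₅ : x₁ - x g + (r : 𝕜) • (y₁ - y g) = 0 := by
      rw [smul_sub, sub_add_sub_comm, h₂, hxy, sub_self]
    rw [h₅, norm_zero] at h₄
    exact sub_eq_zero.1 (norm_le_zero_iff.1 h₄)
  let L : X →ₗ[𝕜] X :=
    { toFun := x
      map_add' := fun g₁ g₂ => (uniq (A.graph.add_mem (hg g₁) (hg g₂)) (by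
        simp only [smul_add]
        rw [add_add_add_comm, hxy, hxy])).symm
      map_smul' := fun c g => (uniq (A.graph.smul_mem c (hg g)) (by
        rw [smul_comm (r : 𝕜) c, ← smul_add, hxy])).symm }
  refine ⟨L.mkContinuous 1 fun g => ?_, L.mkContinuous_norm_le zero_le_one _, fun g => ?_⟩
  · rw [one_mul]
    have := hA.norm_le hr.le (hg g)
    rwa [hxy] at this
  · have : ((r⁻¹ : ℝ) : 𝕜) • (g - x g) = y g := by
      rw [← hxy g, hxy g, ← hxy g, hxy g]
      nth_rewrite 1 [← hxy g]
      rw [add_sub_cancel_left, smul_smul, RCLike.ofReal_inv, inv_mul_cancel₀ hr', one_smul]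
    change (x g, ((r⁻¹ : ℝ) : 𝕜) • (g - x g)) ∈ A.graph
    rw [this]
    exact hg g

open Classical in
/-- The resolvent `(1 + r A)⁻¹` of a maximal monotone operator, for `r > 0`; `0` for `r ≤ 0`. -/
noncomputable def resolvent (hA : MaxMonotone A) (r : ℝ) : X →L[𝕜] X :=
  if hr : 0 < r then (hA.exists_resolvent hr).choose else 0

theorem norm_resolvent_le (hA : MaxMonotone A) (r : ℝ) : ‖hA.resolvent r‖ ≤ 1 := by
  unfold resolvent
  split_ifs with hr
  · exact (hA.exists_resolvent hr).choose_spec.1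
  · simp

theorem resolvent_mem_graph (hA : MaxMonotone A) {r : ℝ} (hr : 0 < r) (g : X) :
    (hA.resolvent r g, ((r⁻¹ : ℝ) : 𝕜) • (g - hA.resolvent r g)) ∈ A.graph := by
  unfold resolvent
  rw [dif_pos hr]
  exact (hA.exists_resolvent hr).choose_spec.2 g

theorem resolvent_eq (hA : MaxMonotone A) {r : ℝ} (hr : 0 < r) {x y : X}
    (h : (x, y) ∈ A.graph) : hA.resolvent r (x + (r : 𝕜) • y) = x := by
  have hr' : (r : 𝕜) ≠ 0 := by exact_mod_cast hr.ne'
  have h₄ := hA.norm_le hr.le (A.graph.sub_mem (hA.resolvent_mem_graph hr (x + (r : 𝕜) • y)) h)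
  set w := hA.resolvent r (x + (r : 𝕜) • y)
  have h₅ : w - x + (r : 𝕜) • (((r⁻¹ : ℝ) : 𝕜) • (x + (r : 𝕜) • y - w) - y) = 0 := by
    rw [smul_sub, smul_smul, RCLike.ofReal_inv, mul_inv_cancel₀ hr', one_smul]
    abel
  change ‖w - x‖ ≤ ‖w - x + (r : 𝕜) • (((r⁻¹ : ℝ) : 𝕜) • (x + (r : 𝕜) • y - w) - y)‖ at h₄
  rw [h₅, norm_zero] at h₄
  exact sub_eq_zero.1 (norm_le_zero_iff.1 h₄)

theorem norm_resolvent_apply_le (hA : MaxMonotone A) (r : ℝ) (x : X) :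
    ‖hA.resolvent r x‖ ≤ ‖x‖ := by
  simpa using (hA.resolvent r).le_of_opNorm_le (hA.norm_resolvent_le r) x

theorem resolvent_commute (hA : MaxMonotone A) (r s : ℝ) :
    Commute (hA.resolvent r) (hA.resolvent s) := by
  by_cases hr : 0 < r
  swap
  · simp [resolvent, hr]
  by_cases hs : 0 < s
  swap
  · simp [resolvent, hs]
  have hr' : (r : 𝕜) ≠ 0 := by exact_mod_cast hr.ne'
  have hs' : (s : 𝕜) ≠ 0 := by exact_mod_cast hs.ne'
  ext g
  -- `w` solves `w + r A w = J_s g`, hence `(1 + s A) (w + r A w) = g`; the two factors commute.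
  set v := hA.resolvent s g with hv
  set w := hA.resolvent r v with hw
  have h₁ := hA.resolvent_mem_graph hr v
  have h₂ := hA.resolvent_mem_graph hs g
  rw [← hw] at h₁
  rw [← hv] at h₂
  have h₃ := A.graph.sub_mem h₂ h₁
  have h₄ : (((r⁻¹ : ℝ) : 𝕜) • (v - w),
      ((r⁻¹ : ℝ) : 𝕜) • (((s⁻¹ : ℝ) : 𝕜) • (g - v) - ((r⁻¹ : ℝ) : 𝕜) • (v - w))) ∈ A.graph :=
    A.graph.smul_mem _ h₃
  have h₅ := A.graph.add_mem h₁ (A.graph.smul_mem (s : 𝕜) h₄)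
  have h₆ := hA.resolvent_eq hr h₅
  have h₇ := hA.resolvent_eq hs h₁
  change w = hA.resolvent s (hA.resolvent r g)
  have key : w + (s : 𝕜) • ((r⁻¹ : ℝ) : 𝕜) • (v - w) + (r : 𝕜) • (((r⁻¹ : ℝ) : 𝕜) • (v - w) +
      (s : 𝕜) • (((r⁻¹ : ℝ) : 𝕜) •
        (((s⁻¹ : ℝ) : 𝕜) • (g - v) - ((r⁻¹ : ℝ) : 𝕜) • (v - w)))) = g := by
    rw [RCLike.ofReal_inv, RCLike.ofReal_inv]
    match_scalars <;> field_simp <;> ring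
  have h₆' : hA.resolvent r g = w + (s : 𝕜) • ((r⁻¹ : ℝ) : 𝕜) • (v - w) := by
    rw [← key]
    exact h₆
  rw [h₆', h₇]

/-- The domain is dense: a vector orthogonal to it is `x + A x` for some `x`, and monotonicity
gives `x = 0`. -/
theorem dense_domain [CompleteSpace X] (hA : MaxMonotone A) : Dense (A.domain : Set X) := by
  rw [Submodule.dense_iff_topologicalClosure_eq_top, Submodule.topologicalClosure_eq_top_iff,
    Submodule.eq_bot_iff]
  intro g hg
  obtain ⟨x, y, hxy, rfl⟩ := hA.surj one_pos g
  have h := hg x (A.mem_domain_of_mem_graph hxy)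
  have h1 := congrArg RCLike.re h
  rw [RCLike.ofReal_one, one_smul, inner_add_right, map_add, inner_self_eq_norm_sq, map_zero] at h1
  have h2 := hA.mono hxy
  have hx : x = 0 := by
    rw [← norm_eq_zero]
    nlinarith [norm_nonneg x]
  have hy : y = 0 := A.graph_fst_eq_zero_snd hxy hx
  simp [hx, hy]

theorem sub_resolvent_eq (hA : MaxMonotone A) {r : ℝ} (hr : 0 < r) {x y : X}
    (h : (x, y) ∈ A.graph) : x - hA.resolvent r x = (r : 𝕜) • hA.resolvent r y := by
  nth_rewrite 1 [← hA.resolvent_eq hr h]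
  rw [map_add, map_smul, add_sub_cancel_left]

/-- Pointwise convergence on a dense set extends to the whole space for equibounded families. -/
theorem tendsto_of_dense {ι : Type*} {l : Filter ι} {F : ι → X →L[𝕜] X} {G : X →L[𝕜] X}
    {M : ℝ} (hF : ∀ i, ‖F i‖ ≤ M) {S : Set X} (hS : Dense S)
    (h : ∀ x ∈ S, Tendsto (fun i => F i x) l (𝓝 (G x))) (x : X) :
    Tendsto (fun i => F i x) l (𝓝 (G x)) := by
  rw [Metric.tendsto_nhds]
  intro ε hε
  have hM : 0 < |M| + ‖G‖ + 1 := by positivity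
  obtain ⟨y, hy, hxy⟩ := Metric.dense_iff.1 hS x (ε / 2 / (|M| + ‖G‖ + 1)) (by positivity)
  rw [Metric.mem_ball, dist_eq_norm, lt_div_iff₀ hM] at hy
  filter_upwards [Metric.tendsto_nhds.1 (h y hxy) (ε / 2) (by positivity)] with i hi
  rw [dist_eq_norm] at hi ⊢
  have e : F i x - G x = (F i y - G y) - F i (y - x) + G (y - x) := by
    simp only [map_sub]
    abel
  have h1 : ‖F i (y - x)‖ ≤ |M| * ‖y - x‖ :=
    (F i).le_of_opNorm_le ((hF i).trans (le_abs_self M)) _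
  have h2 := G.le_opNorm (y - x)
  rw [e]
  refine (norm_add_le _ _).trans_lt ?_
  have := norm_sub_le (F i y - G y) (F i (y - x))
  nlinarith [norm_nonneg (y - x)]

theorem tendsto_resolvent [CompleteSpace X] (hA : MaxMonotone A) (x : X) :
    Tendsto (fun r => hA.resolvent r x) (𝓝[>] 0) (𝓝 x) := by
  refine tendsto_of_dense (G := ContinuousLinearMap.id 𝕜 X) hA.norm_resolvent_le
    hA.dense_domain (fun x hx => ?_) x
  obtain ⟨y, hy⟩ := A.mem_domain_iff.1 hx
  rw [tendsto_iff_norm_sub_tendsto_zero]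
  have h0 : Tendsto (fun r : ℝ => r * ‖y‖) (𝓝[>] 0) (𝓝 0) := by
    have : Tendsto (fun r : ℝ => r * ‖y‖) (𝓝 0) (𝓝 (0 * ‖y‖)) :=
      tendsto_id.mul_const _
    rw [zero_mul] at this
    exact this.mono_left nhdsWithin_le_nhds
  refine squeeze_zero' (Eventually.of_forall fun _ => norm_nonneg _) ?_ h0
  filter_upwards [self_mem_nhdsWithin] with r hr
  rw [norm_sub_rev, ContinuousLinearMap.id_apply, hA.sub_resolvent_eq hr hy, norm_smul]
  rw [RCLike.norm_ofReal, abs_of_pos hr]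
  exact mul_le_mul_of_nonneg_left (hA.norm_resolvent_apply_le r y) (le_of_lt hr)

end MaxMonotone

theorem norm_pow_apply_sub_le {a b : X →L[𝕜] X} (hab : Commute a b) (ha : ‖a‖ ≤ 1)
    (hb : ‖b‖ ≤ 1) (m : ℕ) (x : X) : ‖(a ^ m) x - (b ^ m) x‖ ≤ m * ‖a x - b x‖ := by
  have hc : ∀ {c : X →L[𝕜] X}, ‖c‖ ≤ 1 → ∀ y, ‖c y‖ ≤ ‖y‖ := fun h y => by
    simpa using ContinuousLinearMap.le_of_opNorm_le _ h y
  have hcm : ∀ {c : X →L[𝕜] X}, ‖c‖ ≤ 1 → ∀ (m : ℕ) y, ‖(c ^ m) y‖ ≤ ‖y‖ := by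
    intro c h m
    induction m with
    | zero => intro y; simp
    | succ m ih =>
      intro y
      rw [pow_succ]
      exact (ih _).trans (hc h y)
  induction m with
  | zero => simp
  | succ m ih =>
    have h1 : (a ^ m) (b x) = b ((a ^ m) x) := DFunLike.congr_fun (hab.pow_left m).eq x
    have e : (a ^ (m + 1)) x - (b ^ (m + 1)) x =
        (a ^ m) (a x - b x) + b ((a ^ m) x - (b ^ m) x) := by
      rw [pow_succ, pow_succ', map_sub, map_sub, h1]
      simp
    rw [e]
    refine (norm_add_le _ _).trans ?_
    have h2 := hcm ha m (a x - b x)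
    have h3 := hc hb ((a ^ m) x - (b ^ m) x)
    rw [Nat.cast_succ]
    linarith

end MaximalMonotone

end RandomEvolution

/-! ### The exponential of the Yosida approximation -/

namespace RandomEvolution

section ExpAux

theorem norm_exp_le_exp_norm (𝕜 : Type*) [RCLike 𝕜] {B : Type*} [NormedRing B]
    [NormedAlgebra 𝕜 B] [CompleteSpace B] [NormOneClass B] (x : B) :
    ‖NormedSpace.exp x‖ ≤ Real.exp ‖x‖ := by
  rw [NormedSpace.exp_eq_tsum 𝕜, Real.exp_eq_exp_ℝ, NormedSpace.exp_eq_tsum ℝ]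
  have h1 : ∀ n : ℕ, ‖((n.factorial : 𝕜)⁻¹) • x ^ n‖ ≤ ((n.factorial : ℝ)⁻¹) • ‖x‖ ^ n := by
    intro n
    rw [norm_smul, norm_inv, RCLike.norm_natCast, smul_eq_mul]
    exact mul_le_mul_of_nonneg_left (norm_pow_le x n) (by positivity)
  exact tsum_of_norm_bounded (NormedSpace.expSeries_summable' (𝕂 := ℝ) ‖x‖).hasSum h1

theorem exp_add_of_commute (𝕜 : Type*) [RCLike 𝕜] {B : Type*} [NormedRing B]
    [NormedAlgebra 𝕜 B] [CompleteSpace B] {x y : B} (h : Commute x y) :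
    NormedSpace.exp (x + y) = NormedSpace.exp x * NormedSpace.exp y := by
  let _ : NormedAlgebra ℚ B := NormedAlgebra.restrictScalars ℚ 𝕜 B
  exact NormedSpace.exp_add_of_commute h

variable {𝕜 : Type*} [RCLike 𝕜]

theorem tendsto_ofReal_punctured : Tendsto (fun h : ℝ => (h : 𝕜)) (𝓝[>] 0) (𝓝[≠] 0) := by
  refine tendsto_nhdsWithin_iff.2 ⟨?_, ?_⟩
  · have : Tendsto (fun h : ℝ => (h : 𝕜)) (𝓝 0) (𝓝 ((0 : ℝ) : 𝕜)) :=
      RCLike.continuous_ofReal.tendsto 0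
    rw [RCLike.ofReal_zero] at this
    exact this.mono_left nhdsWithin_le_nhds
  · filter_upwards [self_mem_nhdsWithin] with h hh
    simpa using (ne_of_gt hh : h ≠ 0)

theorem tendsto_slope_exp {B : Type*} [NormedRing B] [NormedAlgebra 𝕜 B] [CompleteSpace B]
    (a : B) :
    Tendsto (fun h : ℝ => ((h⁻¹ : ℝ) : 𝕜) • (NormedSpace.exp ((h : 𝕜) • a) - 1)) (𝓝[>] 0)
      (𝓝 a) := by
  have h1 : HasDerivAt (fun t : 𝕜 => NormedSpace.exp (t • a)) a 0 := by
    simpa using hasDerivAt_exp_smul_const (𝕂 := 𝕜) a (0 : 𝕜)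
  have h2 := h1.tendsto_slope_zero.comp (tendsto_ofReal_punctured (𝕜 := 𝕜))
  refine h2.congr fun h => ?_
  simp

end ExpAux

section MaximalMonotone

variable {𝕜 : Type*} [RCLike 𝕜] {X : Type*} [NormedAddCommGroup X] [InnerProductSpace 𝕜 X]

/-- Two powers of commuting contractions differ by at most the difference of the slopes. -/
theorem norm_pow_apply_sub_le_slope {a b : X →L[𝕜] X} (hab : Commute a b) (ha : ‖a‖ ≤ 1)
    (hb : ‖b‖ ≤ 1) {t : ℝ} (ht : 0 < t) {m : ℕ} (hm : 0 < m) (x : X) :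
    ‖(a ^ m) x - (b ^ m) x‖ ≤
      t * ‖(((t / m)⁻¹ : ℝ) : 𝕜) • (a x - x) - (((t / m)⁻¹ : ℝ) : 𝕜) • (b x - x)‖ := by
  have hm' : (0 : ℝ) < m := by exact_mod_cast hm
  refine (norm_pow_apply_sub_le hab ha hb m x).trans (le_of_eq ?_)
  rw [← smul_sub, sub_sub_sub_cancel_right, norm_smul, RCLike.norm_ofReal,
    abs_of_pos (by positivity)]
  field_simp

theorem tendsto_div_nat_punctured {t : ℝ} (ht : 0 < t) :
    Tendsto (fun m : ℕ => t / (m : ℝ)) atTop (𝓝[>] 0) := by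
  refine tendsto_nhdsWithin_iff.2 ⟨tendsto_const_div_atTop_nhds_zero_nat t, ?_⟩
  filter_upwards [eventually_gt_atTop 0] with m hm
  have hm' : (0 : ℝ) < m := by exact_mod_cast hm
  exact div_pos ht hm'

namespace MaxMonotone

variable {A : X →ₗ.[𝕜] X}

/-- Minus the Yosida approximation of `A`. -/
noncomputable def yosida (hA : MaxMonotone A) (r : ℝ) : X →L[𝕜] X :=
  ((r⁻¹ : ℝ) : 𝕜) • (hA.resolvent r - 1)

/-- The semigroup generated by minus the Yosida approximation of `A`. -/
noncomputable def yosidaExp (hA : MaxMonotone A) (r t : ℝ) : X →L[𝕜] X :=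
  NormedSpace.exp ((t : 𝕜) • hA.yosida r)

theorem yosida_apply (hA : MaxMonotone A) {r : ℝ} (hr : 0 < r) {x y : X}
    (h : (x, y) ∈ A.graph) : hA.yosida r x = -hA.resolvent r y := by
  have hr' : (r : 𝕜) ≠ 0 := by exact_mod_cast hr.ne'
  have h1 := hA.sub_resolvent_eq hr h
  change ((r⁻¹ : ℝ) : 𝕜) • (hA.resolvent r x - x) = _
  rw [← neg_sub, h1, smul_neg, smul_smul, RCLike.ofReal_inv, inv_mul_cancel₀ hr', one_smul]

theorem yosida_commute (hA : MaxMonotone A) (r s : ℝ) :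
    Commute (hA.yosida r) (hA.yosida s) := by
  refine Commute.smul_left (Commute.smul_right ?_ _) _
  exact ((hA.resolvent_commute r s).sub_left (Commute.one_left _)).sub_right (Commute.one_right _)

theorem yosida_commute_resolvent (hA : MaxMonotone A) (r s : ℝ) :
    Commute (hA.yosida r) (hA.resolvent s) :=
  ((hA.resolvent_commute r s).sub_left (Commute.one_left _)).smul_left _

theorem yosidaExp_zero (hA : MaxMonotone A) (r : ℝ) : hA.yosidaExp r 0 = 1 := by
  simp [yosidaExp, NormedSpace.exp_zero]

theorem yosidaExp_commute (hA : MaxMonotone A) (r s t u : ℝ) :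
    Commute (hA.yosidaExp r t) (hA.yosidaExp s u) :=
  (((hA.yosida_commute r s).smul_left _).smul_right _).exp

theorem yosidaExp_commute_resolvent (hA : MaxMonotone A) (r s t : ℝ) :
    Commute (hA.yosidaExp r t) (hA.resolvent s) :=
  ((hA.yosida_commute_resolvent r s).smul_left _).exp_left

variable [CompleteSpace X]

theorem yosidaExp_add (hA : MaxMonotone A) (r s t : ℝ) :
    hA.yosidaExp r (s + t) = hA.yosidaExp r s * hA.yosidaExp r t := by
  rw [yosidaExp, RCLike.ofReal_add, add_smul]
  exact exp_add_of_commute 𝕜 (((Commute.refl (hA.yosida r)).smul_left _).smul_right _)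

theorem yosidaExp_pow (hA : MaxMonotone A) (r t : ℝ) (m : ℕ) :
    hA.yosidaExp r t ^ m = hA.yosidaExp r (m * t) := by
  induction m with
  | zero => simp [yosidaExp_zero]
  | succ m ih => rw [pow_succ, ih, ← yosidaExp_add, Nat.cast_succ, add_one_mul]

theorem norm_yosidaExp_le (hA : MaxMonotone A) {r t : ℝ} (hr : 0 < r) (ht : 0 ≤ t) :
    ‖hA.yosidaExp r t‖ ≤ 1 := by
  cases subsingleton_or_nontrivial X with
  | inl h =>
    rw [Subsingleton.elim (hA.yosidaExp r t) 0, norm_zero]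
    exact zero_le_one
  | inr h =>
  have e : (t : 𝕜) • hA.yosida r =
      ((t / r : ℝ) : 𝕜) • hA.resolvent r + (-((t / r : ℝ) : 𝕜)) • (1 : X →L[𝕜] X) := by
    rw [yosida, smul_smul, smul_sub, neg_smul, ← sub_eq_add_neg, ← RCLike.ofReal_mul,
      div_eq_mul_inv]
  have e2 : NormedSpace.exp ((-((t / r : ℝ) : 𝕜)) • (1 : X →L[𝕜] X)) =
      ((Real.exp (-(t / r)) : ℝ) : 𝕜) • (1 : X →L[𝕜] X) := by
    rw [← Algebra.algebraMap_eq_smul_one, ← Algebra.algebraMap_eq_smul_one,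
      ← NormedSpace.algebraMap_exp_comm]
    congr 1
    rw [← RCLike.ofReal_neg, ← RCLike.algebraMap_eq_ofReal, ← NormedSpace.algebraMap_exp_comm, Real.exp_eq_exp_ℝ]
  rw [yosidaExp, e, exp_add_of_commute 𝕜 ((Commute.one_right _).smul_right _), e2]
  have h0 : 0 ≤ t / r := by positivity
  calc ‖NormedSpace.exp (((t / r : ℝ) : 𝕜) • hA.resolvent r) *
        ((Real.exp (-(t / r)) : ℝ) : 𝕜) • (1 : X →L[𝕜] X)‖
      ≤ ‖NormedSpace.exp (((t / r : ℝ) : 𝕜) • hA.resolvent r)‖ *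
        ‖((Real.exp (-(t / r)) : ℝ) : 𝕜) • (1 : X →L[𝕜] X)‖ := norm_mul_le _ _
    _ ≤ Real.exp (t / r) * Real.exp (-(t / r)) := by
        rw [norm_smul, norm_one, mul_one, RCLike.norm_ofReal, abs_of_pos (Real.exp_pos _)]
        refine mul_le_mul_of_nonneg_right ?_ (Real.exp_pos _).le
        refine (norm_exp_le_exp_norm 𝕜 _).trans (Real.exp_le_exp.2 ?_)
        rw [norm_smul, RCLike.norm_ofReal, abs_of_nonneg h0]
        exact mul_le_of_le_one_right h0 (hA.norm_resolvent_le r)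
    _ = 1 := by rw [← Real.exp_add, add_neg_cancel, Real.exp_zero]

theorem tendsto_slope_yosidaExp (hA : MaxMonotone A) (r : ℝ) (x : X) :
    Tendsto (fun h : ℝ => ((h⁻¹ : ℝ) : 𝕜) • (hA.yosidaExp r h x - x)) (𝓝[>] 0)
      (𝓝 (hA.yosida r x)) := by
  have h1 := tendsto_slope_exp (𝕜 := 𝕜) (hA.yosida r)
  exact ((ContinuousLinearMap.apply 𝕜 X x).continuous.tendsto _).comp h1

theorem norm_yosidaExp_sub_le (hA : MaxMonotone A) {r s t : ℝ} (hr : 0 < r) (hs : 0 < s)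
    (ht : 0 ≤ t) (x : X) :
    ‖hA.yosidaExp r t x - hA.yosidaExp s t x‖ ≤ t * ‖hA.yosida r x - hA.yosida s x‖ := by
  rcases ht.eq_or_lt with rfl | ht
  · simp [yosidaExp_zero]
  have h1 := ((((hA.tendsto_slope_yosidaExp r x).sub
    (hA.tendsto_slope_yosidaExp s x)).comp (tendsto_div_nat_punctured ht)).norm).const_mul t
  refine ge_of_tendsto h1 ?_
  filter_upwards [eventually_gt_atTop 0] with m hm
  have hm' : (m : ℝ) ≠ 0 := by exact_mod_cast hm.ne'
  have h2 := norm_pow_apply_sub_le_slope (hA.yosidaExp_commute r s (t / m) (t / m))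
    (hA.norm_yosidaExp_le hr (by positivity)) (hA.norm_yosidaExp_le hs (by positivity)) ht hm x
  rw [yosidaExp_pow, yosidaExp_pow, mul_div_cancel₀ t hm'] at h2
  exact h2

theorem tendsto_yosida (hA : MaxMonotone A) {x y : X} (h : (x, y) ∈ A.graph) :
    Tendsto (fun r => hA.yosida r x) (𝓝[>] 0) (𝓝 (-y)) := by
  refine (hA.tendsto_resolvent y).neg.congr' ?_
  filter_upwards [self_mem_nhdsWithin] with r hr
  exact (hA.yosida_apply hr h).symm

end MaxMonotone

/-- A sequence of contractions that converges pointwise on a dense set converges pointwise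
to a contraction. -/
theorem exists_limit_of_dense [CompleteSpace X] {F : ℕ → X →L[𝕜] X} (hF : ∀ n, ‖F n‖ ≤ 1)
    {S : Set X} (hS : Dense S) (h : ∀ x ∈ S, CauchySeq fun n => F n x) :
    ∃ G : X →L[𝕜] X, ‖G‖ ≤ 1 ∧ ∀ x, Tendsto (fun n => F n x) atTop (𝓝 (G x)) := by
  have hF' : ∀ n x, ‖F n x‖ ≤ ‖x‖ := fun n x => by simpa using (F n).le_of_opNorm_le (hF n) x
  have hc : ∀ x, ∃ y, Tendsto (fun n => F n x) atTop (𝓝 y) := by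
    intro x
    refine cauchySeq_tendsto_of_complete (Metric.cauchySeq_iff.2 fun ε hε => ?_)
    obtain ⟨y, hy, hyS⟩ := Metric.dense_iff.1 hS x (ε / 3) (by positivity)
    rw [Metric.mem_ball, dist_eq_norm] at hy
    obtain ⟨n₀, hn₀⟩ := Metric.cauchySeq_iff.1 (h y hyS) (ε / 3) (by positivity)
    refine ⟨n₀, fun m hm n hn => ?_⟩
    have h1 := hn₀ m hm n hn
    rw [dist_eq_norm] at h1 ⊢
    have e : F m x - F n x = (F m y - F n y) - F m (y - x) + F n (y - x) := by
      simp only [map_sub]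
      abel
    rw [e]
    have h2 := norm_add_le (F m y - F n y - F m (y - x)) (F n (y - x))
    have h3 := norm_sub_le (F m y - F n y) (F m (y - x))
    linarith [hF' m (y - x), hF' n (y - x)]
  choose f hf using hc
  have hf' : Tendsto (fun n x => F n x) atTop (𝓝 f) := tendsto_pi_nhds.2 hf
  refine ⟨continuousLinearMapOfTendsto F hf', ?_, hf⟩
  refine ContinuousLinearMap.opNorm_le_bound _ zero_le_one fun x => ?_
  rw [one_mul]
  exact le_of_tendsto (hf x).norm (Eventually.of_forall fun n => hF' n x)

end MaximalMonotone

end RandomEvolution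

/-! ### Generation, implicit Euler and mild solutions -/

namespace RandomEvolution

section MaximalMonotone

variable {𝕜 : Type*} [RCLike 𝕜] {X : Type*} [NormedAddCommGroup X] [InnerProductSpace 𝕜 X]

theorem mem_neg_graph {A : X →ₗ.[𝕜] X} {x y : X} : (x, y) ∈ (-A).graph ↔ (x, -y) ∈ A.graph := by
  simp only [LinearPMap.mem_graph_iff, LinearPMap.neg_apply]
  constructor
  · rintro ⟨w, h1, h2⟩
    exact ⟨w, h1, by rw [← h2, neg_neg]⟩
  · rintro ⟨w, h1, h2⟩
    exact ⟨w, h1, by rw [h2, neg_neg]⟩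

namespace MaxMonotone

variable {A : X →ₗ.[𝕜] X} [CompleteSpace X]

/-- The parameters `1 / (n + 1)` along which the Yosida approximations are taken tend to `0` from the
right. -/
theorem tendsto_yosida_seq_aux : Tendsto (fun n : ℕ => (1 : ℝ) / (n + 1)) atTop (𝓝[>] 0) :=
  tendsto_nhdsWithin_iff.2 ⟨tendsto_one_div_add_atTop_nhds_zero_nat,
    Eventually.of_forall fun n => by simp only [mem_Ioi]; positivity⟩

/-- The semigroups of the Yosida approximations converge: on the domain their distance is controlled
by that of the Yosida approximations, and they are contractions. -/
theorem exists_semigroup (hA : MaxMonotone A) (t : ℝ) : ∃ G : X →L[𝕜] X, ‖G‖ ≤ 1 ∧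
    (0 ≤ t → ∀ x, Tendsto (fun n : ℕ => hA.yosidaExp (1 / (n + 1)) t x) atTop (𝓝 (G x))) := by
  by_cases ht : 0 ≤ t
  swap
  · exact ⟨0, by simp, fun h => absurd h ht⟩
  have hpos : ∀ n : ℕ, (0 : ℝ) < 1 / (n + 1) := fun n => by positivity
  obtain ⟨G, h1, h2⟩ := exists_limit_of_dense (fun n => hA.norm_yosidaExp_le (hpos n) ht)
    hA.dense_domain (fun x hx => by
      obtain ⟨y, hy⟩ := A.mem_domain_iff.1 hx
      have h3 := ((hA.tendsto_yosida hy).comp tendsto_yosida_seq_aux).cauchySeq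
      refine Metric.cauchySeq_iff.2 fun ε hε => ?_
      obtain ⟨n₀, hn₀⟩ := Metric.cauchySeq_iff.1 h3 (ε / (t + 1)) (by positivity)
      refine ⟨n₀, fun m hm n hn => ?_⟩
      have h4 := hn₀ m hm n hn
      have h5 := hA.norm_yosidaExp_sub_le (hpos m) (hpos n) ht x
      rw [dist_eq_norm, lt_div_iff₀ (by positivity)] at h4
      rw [dist_eq_norm]
      simp only [Function.comp] at h4
      nlinarith [norm_nonneg (hA.yosida (1 / (m + 1)) x - hA.yosida (1 / (n + 1)) x)])
  exact ⟨G, h1, fun _ => h2⟩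

/-- The contraction semigroup generated by `-A`, as the limit of the semigroups of the Yosida
approximations; only the values at times `t ≥ 0` matter. -/
noncomputable def semigroup (hA : MaxMonotone A) (t : ℝ) : X →L[𝕜] X :=
  (hA.exists_semigroup t).choose

theorem norm_semigroup_le (hA : MaxMonotone A) (t : ℝ) : ‖hA.semigroup t‖ ≤ 1 :=
  (hA.exists_semigroup t).choose_spec.1

theorem norm_semigroup_apply_le (hA : MaxMonotone A) (t : ℝ) (x : X) :
    ‖hA.semigroup t x‖ ≤ ‖x‖ := by
  simpa using (hA.semigroup t).le_of_opNorm_le (hA.norm_semigroup_le t) x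

theorem tendsto_semigroup (hA : MaxMonotone A) {t : ℝ} (ht : 0 ≤ t) (x : X) :
    Tendsto (fun n : ℕ => hA.yosidaExp (1 / (n + 1)) t x) atTop (𝓝 (hA.semigroup t x)) :=
  (hA.exists_semigroup t).choose_spec.2 ht x

theorem semigroup_zero (hA : MaxMonotone A) : hA.semigroup 0 = ContinuousLinearMap.id 𝕜 X := by
  ext x
  refine tendsto_nhds_unique (hA.tendsto_semigroup le_rfl x) ?_
  simp [yosidaExp_zero]

theorem semigroup_add (hA : MaxMonotone A) {s t : ℝ} (hs : 0 ≤ s) (ht : 0 ≤ t) :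
    hA.semigroup (s + t) = (hA.semigroup s).comp (hA.semigroup t) := by
  ext x
  refine tendsto_nhds_unique (hA.tendsto_semigroup (add_nonneg hs ht) x) ?_
  rw [tendsto_iff_norm_sub_tendsto_zero]
  have h1 := tendsto_iff_norm_sub_tendsto_zero.1 (hA.tendsto_semigroup ht x)
  have h2 := tendsto_iff_norm_sub_tendsto_zero.1 (hA.tendsto_semigroup hs (hA.semigroup t x))
  have h3 := h1.add h2
  rw [add_zero] at h3
  refine squeeze_zero (fun _ => norm_nonneg _) (fun n => ?_) h3
  have e : hA.yosidaExp (1 / (n + 1)) (s + t) x - ((hA.semigroup s).comp (hA.semigroup t)) x =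
      hA.yosidaExp (1 / (n + 1)) s (hA.yosidaExp (1 / (n + 1)) t x - hA.semigroup t x) +
      (hA.yosidaExp (1 / (n + 1)) s (hA.semigroup t x) -
        hA.semigroup s (hA.semigroup t x)) := by
    rw [yosidaExp_add, map_sub]
    simp
  rw [e]
  refine (norm_add_le _ _).trans (add_le_add_left ?_ _)
  simpa using ContinuousLinearMap.le_of_opNorm_le _
    (hA.norm_yosidaExp_le (r := 1 / ((n : ℝ) + 1)) (by positivity) hs)
    (hA.yosidaExp (1 / (n + 1)) t x - hA.semigroup t x)

theorem semigroup_commute_resolvent (hA : MaxMonotone A) {t : ℝ} (ht : 0 ≤ t) (r : ℝ) :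
    Commute (hA.semigroup t) (hA.resolvent r) := by
  ext x
  refine tendsto_nhds_unique (hA.tendsto_semigroup ht (hA.resolvent r x)) ?_
  have h1 := ((hA.resolvent r).continuous.tendsto _).comp (hA.tendsto_semigroup ht x)
  refine h1.congr fun n => ?_
  exact (DFunLike.congr_fun (hA.yosidaExp_commute_resolvent (1 / ((n : ℝ) + 1)) r t).eq x).symm

theorem norm_semigroup_sub_yosidaExp_le (hA : MaxMonotone A) {r t : ℝ} (hr : 0 < r) (ht : 0 ≤ t)
    {x y : X} (h : (x, y) ∈ A.graph) :
    ‖hA.semigroup t x - hA.yosidaExp r t x‖ ≤ t * ‖-y - hA.yosida r x‖ := by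
  have h1 := ((hA.tendsto_semigroup ht x).sub_const (hA.yosidaExp r t x)).norm
  have h2 := ((((hA.tendsto_yosida h).comp tendsto_yosida_seq_aux).sub_const
    (hA.yosida r x)).norm).const_mul t
  exact le_of_tendsto_of_tendsto h1 h2 (Eventually.of_forall fun n =>
    hA.norm_yosidaExp_sub_le (by positivity) hr ht x)

theorem tendsto_slope_semigroup (hA : MaxMonotone A) {x y : X} (hxy : (x, y) ∈ A.graph) :
    Tendsto (fun h : ℝ => ((h⁻¹ : ℝ) : 𝕜) • (hA.semigroup h x - x)) (𝓝[>] 0) (𝓝 (-y)) := by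
  rw [Metric.tendsto_nhds]
  intro ε hε
  obtain ⟨r, hr', hr⟩ := (((Metric.tendsto_nhds.1 (hA.tendsto_yosida hxy)) (ε / 3)
    (by positivity)).and self_mem_nhdsWithin).exists
  filter_upwards [Metric.tendsto_nhds.1 (hA.tendsto_slope_yosidaExp r x) (ε / 3) (by positivity),
    self_mem_nhdsWithin] with h hh hpos
  have hpos : 0 < h := hpos
  rw [dist_eq_norm] at hr' hh ⊢
  have h1 := hA.norm_semigroup_sub_yosidaExp_le hr hpos.le hxy
  have h2 : ‖((h⁻¹ : ℝ) : 𝕜) • (hA.semigroup h x - hA.yosidaExp r h x)‖ ≤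
      ‖-y - hA.yosida r x‖ := by
    rw [norm_smul, RCLike.norm_ofReal, abs_of_pos (inv_pos.2 hpos), inv_mul_le_iff₀ hpos]
    exact h1
  rw [norm_sub_rev (-y)] at h2
  have e : ((h⁻¹ : ℝ) : 𝕜) • (hA.semigroup h x - x) - -y =
      ((h⁻¹ : ℝ) : 𝕜) • (hA.semigroup h x - hA.yosidaExp r h x) +
      (((h⁻¹ : ℝ) : 𝕜) • (hA.yosidaExp r h x - x) - hA.yosida r x) + (hA.yosida r x - -y) := by
    simp only [smul_sub]
    abel
  rw [e]
  refine (norm_add₃_le).trans_lt ?_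
  linarith

theorem tendsto_semigroup_zero (hA : MaxMonotone A) (x : X) :
    Tendsto (fun h => hA.semigroup h x) (𝓝[>] 0) (𝓝 x) := by
  refine tendsto_of_dense (G := ContinuousLinearMap.id 𝕜 X) hA.norm_semigroup_le
    hA.dense_domain (fun x hx => ?_) x
  obtain ⟨y, hy⟩ := A.mem_domain_iff.1 hx
  have h1 := (tendsto_ofReal_punctured (𝕜 := 𝕜)).mono_right nhdsWithin_le_nhds
  have h2 := (h1.smul (hA.tendsto_slope_semigroup hy)).add_const x
  rw [zero_smul, zero_add] at h2
  refine h2.congr' ?_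
  filter_upwards [self_mem_nhdsWithin] with h hpos
  have hh : (h : 𝕜) ≠ 0 := by exact_mod_cast (ne_of_gt hpos : h ≠ 0)
  rw [smul_smul, RCLike.ofReal_inv, mul_inv_cancel₀ hh, one_smul, sub_add_cancel]

theorem continuousOn_semigroup (hA : MaxMonotone A) (x : X) :
    ContinuousOn (fun t => hA.semigroup t x) (Ici 0) := by
  rw [Metric.continuousOn_iff]
  intro t ht ε hε
  obtain ⟨δ, hδ, h1⟩ := Metric.tendsto_nhdsWithin_nhds.1 (hA.tendsto_semigroup_zero x) ε hε
  have key : ∀ {s t : ℝ}, 0 ≤ s → s < t → t - s < δ →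
      dist (hA.semigroup t x) (hA.semigroup s x) < ε := by
    intro s t hs hst hd
    have e : hA.semigroup t x = hA.semigroup s (hA.semigroup (t - s) x) := by
      rw [← ContinuousLinearMap.comp_apply, ← hA.semigroup_add hs (sub_nonneg.2 hst.le),
        add_sub_cancel]
    rw [dist_eq_norm, e, ← map_sub]
    refine (hA.norm_semigroup_apply_le s _).trans_lt ?_
    rw [← dist_eq_norm]
    exact h1 (sub_pos.2 hst) (by rwa [Real.dist_eq, sub_zero, abs_of_pos (sub_pos.2 hst)])
  refine ⟨δ, hδ, fun s hs hst => ?_⟩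
  rw [Real.dist_eq] at hst
  rcases lt_trichotomy s t with h | h | h
  · rw [dist_comm]
    exact key hs h (by rwa [abs_sub_comm, abs_of_pos (sub_pos.2 h)] at hst)
  · rw [h, dist_self]
    exact hε
  · exact key ht h (by rwa [abs_of_pos (sub_pos.2 h)] at hst)

/-- Hille–Yosida theorem for maximal monotone operators. The generator extends `-A` by
`tendsto_slope_semigroup`, and a dissipative extension of `-A` cannot be proper, as `1 + A`
is onto. -/
theorem generates (hA : MaxMonotone A) : Generates (-A) hA.semigroup := by
  refine ⟨⟨hA.semigroup_zero, fun s t => hA.semigroup_add, hA.continuousOn_semigroup⟩,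
    fun x y => ?_⟩
  rw [mem_neg_graph]
  constructor
  · intro h
    simpa using hA.tendsto_slope_semigroup h
  · intro h
    obtain ⟨x', y', hxy, e⟩ := hA.surj one_pos (x - y)
    rw [RCLike.ofReal_one, one_smul] at e
    have h1 := h.sub (hA.tendsto_slope_semigroup hxy)
    have e1 : y - -y' = x - x' := by
      rw [eq_sub_iff_add_eq] at e
      rw [← e]
      abel
    rw [e1] at h1
    have h2 : Tendsto (fun s : ℝ => ((s⁻¹ : ℝ) : 𝕜) • (hA.semigroup s (x - x') - (x - x')))
        (𝓝[>] 0) (𝓝 (x - x')) := by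
      refine h1.congr fun s => ?_
      rw [map_sub, ← smul_sub]
      congr 1
      abel
    have h3 : Tendsto (fun s : ℝ => RCLike.re (inner 𝕜 (x - x')
        (((s⁻¹ : ℝ) : 𝕜) • (hA.semigroup s (x - x') - (x - x')))))
        (𝓝[>] 0) (𝓝 (RCLike.re (inner 𝕜 (x - x') (x - x')))) :=
      (RCLike.continuous_re.tendsto _).comp (tendsto_const_nhds.inner h2)
    have h4 : RCLike.re (inner 𝕜 (x - x') (x - x')) ≤ 0 := by
      refine le_of_tendsto h3 ?_
      filter_upwards [self_mem_nhdsWithin] with s hs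
      have hs : 0 < s := hs
      rw [inner_smul_right, RCLike.re_ofReal_mul]
      refine mul_nonpos_of_nonneg_of_nonpos (inv_pos.2 hs).le ?_
      rw [inner_sub_right, map_sub, inner_self_eq_norm_sq]
      have h5 := re_inner_le_norm (𝕜 := 𝕜) (x - x') (hA.semigroup s (x - x'))
      nlinarith [hA.norm_semigroup_apply_le s (x - x'), norm_nonneg (x - x')]
    have h5 : x - x' = 0 := by
      rw [inner_self_eq_norm_sq] at h4
      rw [← norm_eq_zero]
      nlinarith [norm_nonneg (x - x')]
    have h6 : x = x' := sub_eq_zero.1 h5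
    rw [h5, sub_neg_eq_add, add_eq_zero_iff_eq_neg] at e1
    rw [h6, e1, neg_neg]
    exact hxy

/-- The exponential formula: the implicit Euler scheme converges. -/
theorem tendsto_euler (hA : MaxMonotone A) {t : ℝ} (ht : 0 < t) (x : X) :
    Tendsto (fun m : ℕ => (hA.resolvent (t / m) ^ m) x) atTop (𝓝 (hA.semigroup t x)) := by
  have hpow : ∀ (r : ℝ) (m : ℕ), ‖hA.resolvent r ^ m‖ ≤ 1 := by
    intro r m
    induction m with
    | zero => exact ContinuousLinearMap.norm_id_le
    | succ m ih =>
      rw [pow_succ]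
      exact (norm_mul_le _ _).trans (mul_le_one₀ ih (norm_nonneg _) (hA.norm_resolvent_le r))
  have hpow2 : ∀ (s : ℝ), 0 ≤ s → ∀ m : ℕ, hA.semigroup s ^ m = hA.semigroup (m * s) := by
    intro s hs m
    induction m with
    | zero => simp only [pow_zero, Nat.cast_zero, zero_mul, semigroup_zero]; rfl
    | succ m ih =>
      rw [pow_succ, ih, Nat.cast_succ, add_one_mul, hA.semigroup_add (by positivity) hs]
      rfl
  refine tendsto_of_dense (fun m : ℕ => hpow (t / m) m) hA.dense_domain (fun x hx => ?_) x
  obtain ⟨y, hy⟩ := A.mem_domain_iff.1 hx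
  have h0 : Tendsto (fun h : ℝ => ((h⁻¹ : ℝ) : 𝕜) • (hA.resolvent h x - x)) (𝓝[>] 0) (𝓝 (-y)) :=
    hA.tendsto_yosida hy
  have h1 := ((((hA.tendsto_slope_semigroup hy).sub h0).comp
    (tendsto_div_nat_punctured ht)).norm).const_mul t
  rw [sub_self, norm_zero, mul_zero] at h1
  rw [tendsto_iff_norm_sub_tendsto_zero]
  refine squeeze_zero' (Eventually.of_forall fun _ => norm_nonneg _) ?_ h1
  filter_upwards [eventually_gt_atTop 0] with m hm
  have hm' : (m : ℝ) ≠ 0 := by exact_mod_cast hm.ne'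
  have h2 := norm_pow_apply_sub_le_slope
    (hA.semigroup_commute_resolvent (t := t / m) (by positivity) (t / m))
    (hA.norm_semigroup_le _) (hA.norm_resolvent_le _) ht hm x
  rw [hpow2 _ (by positivity), mul_div_cancel₀ t hm'] at h2
  rw [norm_sub_rev]
  exact h2

end MaxMonotone

/-- A differentiable curve from `0` whose velocity never points outwards stays at `0`. -/
theorem eq_zero_of_re_inner_nonpos [NormedSpace ℝ X] {d e : ℝ → X}
    (hc : ContinuousOn d (Ici 0)) (hd : ∀ t, 0 < t → HasDerivAt d (e t) t)
    (hn : ∀ t, 0 < t → RCLike.re (inner 𝕜 (d t) (e t)) ≤ 0) (h0 : d 0 = 0) {t : ℝ}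
    (ht : 0 ≤ t) : d t = 0 := by
  have h1 : ∀ t, 0 < t → HasDerivAt (fun s => RCLike.re (inner 𝕜 (d s) (d s)))
      (RCLike.re (inner 𝕜 (d t) (e t) + inner 𝕜 (e t) (d t))) t := fun t ht =>
    (RCLike.reCLM (K := 𝕜)).hasFDerivAt.comp_hasDerivAt t ((hd t ht).inner 𝕜 (hd t ht))
  have h2 : AntitoneOn (fun s => RCLike.re (inner 𝕜 (d s) (d s))) (Ici 0) := by
    refine antitoneOn_of_deriv_nonpos (convex_Ici 0) ?_ ?_ ?_
    · exact RCLike.continuous_re.comp_continuousOn (hc.inner hc)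
    · intro s hs
      rw [interior_Ici] at hs
      exact (h1 s hs).differentiableAt.differentiableWithinAt
    · intro s hs
      rw [interior_Ici] at hs
      rw [(h1 s hs).deriv, map_add, inner_re_symm (e s)]
      linarith [hn s hs]
  have h3 := h2 (mem_Ici.2 (le_refl (0 : ℝ))) (show t ∈ Ici 0 from ht) ht
  simp only [h0, inner_zero_left, map_zero, inner_self_eq_norm_sq] at h3
  rw [← norm_eq_zero]
  nlinarith [norm_nonneg (d t)]

namespace MaxMonotone

variable {A : X →ₗ.[𝕜] X} [CompleteSpace X]

theorem integral_semigroup_mem_graph (hA : MaxMonotone A) [NormedSpace ℝ X] [IsScalarTower ℝ 𝕜 X]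
    (x : X) {t : ℝ} (ht : 0 ≤ t) :
    (∫ s in (0 : ℝ)..t, hA.semigroup s x, hA.semigroup t x - x) ∈ (-A).graph := by
  rw [hA.generates.2]
  set v : ℝ → X := fun s => hA.semigroup (max s 0) x with hv
  have hvc : Continuous v := (hA.continuousOn_semigroup x).comp_continuous (by fun_prop)
    fun s => mem_Ici.2 (le_max_right _ _)
  have hvs : ∀ s, 0 ≤ s → v s = hA.semigroup s x := fun s hs => by rw [hv]; simp [hs]
  have hW : ∫ s in (0 : ℝ)..t, hA.semigroup s x = ∫ s in (0 : ℝ)..t, v s := by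
    refine intervalIntegral.integral_congr fun s hs => (hvs s ?_).symm
    rw [uIcc_of_le ht] at hs
    exact hs.1
  rw [hW]
  have hd : ∀ b, Tendsto (fun h : ℝ => h⁻¹ • ((∫ s in (0 : ℝ)..(b + h), v s) -
      ∫ s in (0 : ℝ)..b, v s)) (𝓝[>] 0) (𝓝 (v b)) := fun b =>
    ((hvc.integral_hasStrictDerivAt 0 b).hasDerivAt.tendsto_slope_zero).mono_left
      (nhdsWithin_mono _ fun _ h => ne_of_gt h)
  have h1 := (hd t).sub (hd 0)
  rw [hvs t ht, hvs 0 le_rfl, hA.semigroup_zero] at h1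
  refine h1.congr' ?_
  filter_upwards [self_mem_nhdsWithin] with h hpos
  have hpos : 0 < h := hpos
  have e1 : hA.semigroup h (∫ s in (0 : ℝ)..t, v s) = ∫ s in h..(t + h), v s := by
    rw [← ContinuousLinearMap.intervalIntegral_comp_comm _ (hvc.intervalIntegrable _ _)]
    have e2 := intervalIntegral.integral_comp_add_right (a := 0) (b := t) v h
    rw [zero_add] at e2
    rw [← e2]
    refine intervalIntegral.integral_congr fun s hs => ?_
    rw [uIcc_of_le ht] at hs
    rw [hvs s hs.1, hvs (s + h) (by linarith [hs.1]), add_comm s h,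
      hA.semigroup_add hpos.le hs.1]
    rfl
  rw [e1, ← smul_sub, RCLike.real_smul_eq_coe_smul (K := 𝕜), zero_add,
    intervalIntegral.integral_same, sub_zero]
  congr 1
  rw [← intervalIntegral.integral_add_adjacent_intervals (hvc.intervalIntegrable 0 h)
    (hvc.intervalIntegrable h (t + h))]
  abel

/-- Mild solutions are orbits of the semigroup: the primitive `d` of the difference of two mild
solutions satisfies `d' = -A d`. -/
theorem eq_semigroup_of_isMildSolution (hA : MaxMonotone A) {x₀ : X} {u : ℝ → X}
    (hu : IsMildSolution (-A) x₀ u) {t : ℝ} (ht : 0 ≤ t) : u t = hA.semigroup t x₀ := by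
  let _ : NormedSpace ℝ X := NormedSpace.restrictScalars ℝ 𝕜 X
  have _ : IsScalarTower ℝ 𝕜 X := RestrictScalars.isScalarTower ℝ 𝕜 X
  obtain ⟨hc, hu⟩ := hu
  set e : ℝ → X := fun s => u (max s 0) - hA.semigroup (max s 0) x₀ with he
  have hec : Continuous e := (hc.comp_continuous (by fun_prop) fun s => mem_Ici.2 (le_max_right _ _)).sub
    ((hA.continuousOn_semigroup x₀).comp_continuous (by fun_prop) fun s => mem_Ici.2 (le_max_right _ _))
  have hes : ∀ s, 0 ≤ s → e s = u s - hA.semigroup s x₀ := fun s hs => by rw [he]; simp [hs]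
  have hi : ∀ {f : ℝ → X}, ContinuousOn f (Ici 0) → ∀ {s : ℝ}, 0 ≤ s →
      IntervalIntegrable f volume 0 s := fun {f} hf {s} hs =>
    (hf.mono (by rw [uIcc_of_le hs]; exact Icc_subset_Ici_self)).intervalIntegrable
  have hg : ∀ s, 0 ≤ s → (∫ r in (0 : ℝ)..s, e r, -e s) ∈ A.graph := by
    intro s hs
    have h1 := (-A).graph.sub_mem (hu s hs) (hA.integral_semigroup_mem_graph x₀ hs)
    have h2 : ∫ r in (0 : ℝ)..s, e r =
        (∫ r in (0 : ℝ)..s, u r) - ∫ r in (0 : ℝ)..s, hA.semigroup r x₀ := by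
      rw [← intervalIntegral.integral_sub (hi hc hs) (hi (hA.continuousOn_semigroup x₀) hs)]
      refine intervalIntegral.integral_congr fun r hr => hes r ?_
      rw [uIcc_of_le hs] at hr
      exact hr.1
    rw [← mem_neg_graph, h2, hes s hs]
    convert h1 using 1
    simp
  have hd : ∀ s, HasDerivAt (fun s => ∫ r in (0 : ℝ)..s, e r) (e s) s := fun s =>
    (hec.integral_hasStrictDerivAt 0 s).hasDerivAt
  have h0 := eq_zero_of_re_inner_nonpos (𝕜 := 𝕜)
    (fun s _ => (hd s).continuousAt.continuousWithinAt) (fun s _ => hd s)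
    (fun s hs => by
      have h1 := hA.mono (hg s hs.le)
      rw [inner_neg_right, map_neg] at h1
      linarith) intervalIntegral.integral_same ht
  have h1 := A.graph_fst_eq_zero_snd (hg t ht) h0
  rw [neg_eq_zero, hes t ht, sub_eq_zero] at h1
  exact h1

end MaxMonotone

end MaximalMonotone

end RandomEvolution

/-! ### The Pearson equation and exponential moments of the one-dimensional laws -/

namespace RandomEvolution

namespace NoiseLaw

open Polynomial

/-- The leading coefficient `σ` of the Sturm–Liouville operator `σ ∂² + τ ∂` that has the
orthogonal polynomials of the law as eigenfunctions. For Beta laws it is `1 - x²`, which is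
smaller than the weight `1`. -/
noncomputable def sigma : NoiseLaw → ℝ[X]
  | normal => 1
  | gamma _ _ => X
  | beta _ _ _ _ => 1 - X ^ 2

/-- The drift coefficient `τ` of the Sturm–Liouville operator `σ ∂² + τ ∂` of the law. -/
noncomputable def tau : NoiseLaw → ℝ[X]
  | normal => -X
  | gamma α _ => C (α + 1) - X
  | beta α β _ _ => C (β - α) - C (α + β + 2) * X

/-- Minus the linear coefficient of `τ`. -/
def slope : NoiseLaw → ℝ
  | normal => 1
  | gamma _ _ => 1
  | beta α β _ _ => α + β + 2

/-- Minus the quadratic coefficient of `σ`. -/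
def curv : NoiseLaw → ℝ
  | normal => 0
  | gamma _ _ => 0
  | beta _ _ _ _ => 1

/-- The density of the law on its interval. -/
noncomputable def density : NoiseLaw → ℝ → ℝ
  | normal => fun x => (√(2 * Real.pi))⁻¹ * Real.exp (-(x ^ 2 / 2))
  | gamma α _ => fun x => (Real.Gamma (α + 1))⁻¹ * (x ^ α * Real.exp (-x))
  | beta α β _ _ => fun x => Real.Gamma (α + β + 2) /
      ((2 : ℝ) ^ (α + β + 1) * Real.Gamma (α + 1) * Real.Gamma (β + 1)) *
        ((1 - x) ^ α * (1 + x) ^ β)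

theorem slope_pos (L : NoiseLaw) : 0 < L.slope := by
  cases L with
  | normal => exact one_pos
  | gamma => exact one_pos
  | beta α β hα hβ => simp only [slope]; linarith

theorem curv_nonneg (L : NoiseLaw) : 0 ≤ L.curv := by
  cases L <;> simp [curv]

theorem interval_eq (L : NoiseLaw) : L.interval = {x | 0 < L.sigma.eval x} := by
  cases L with
  | normal => ext; simp [interval, sigma]
  | gamma => ext; simp [interval, sigma]
  | beta =>
    ext x
    simp only [interval, sigma, mem_Ioo, mem_ofPred_eq, eval_sub, eval_one, eval_pow, eval_X]
    constructor
    · rintro ⟨h1, h2⟩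
      nlinarith
    · intro h
      constructor <;> nlinarith

theorem sigma_pos (L : NoiseLaw) {x : ℝ} (hx : x ∈ L.interval) : 0 < L.sigma.eval x := by
  rwa [interval_eq] at hx

theorem isOpen_interval (L : NoiseLaw) : IsOpen L.interval := by
  cases L with
  | normal => exact isOpen_univ
  | gamma => exact isOpen_Ioi
  | beta => exact isOpen_Ioo

/-- On the interval of the law, `σ` is at most the weight `ρ`. -/
theorem sigma_le_weight (L : NoiseLaw) {x : ℝ} : L.sigma.eval x ≤ L.weight x := by
  cases L with
  | normal => simp [sigma, weight]
  | gamma => simp [sigma, weight]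
  | beta => simp [sigma, weight, sq_nonneg]

theorem density_pos (L : NoiseLaw) {x : ℝ} (hx : x ∈ L.interval) : 0 < L.density x := by
  cases L with
  | normal => simp only [density]; positivity
  | gamma α hα =>
    have h1 : 0 < Real.Gamma (α + 1) := Real.Gamma_pos_of_pos (by linarith)
    have h2 : 0 < x ^ α := Real.rpow_pos_of_pos hx _
    simp only [density]
    positivity
  | beta α β hα hβ =>
    have h1 : 0 < Real.Gamma (α + 1) := Real.Gamma_pos_of_pos (by linarith)
    have h2 : 0 < Real.Gamma (β + 1) := Real.Gamma_pos_of_pos (by linarith)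
    have h3 : 0 < Real.Gamma (α + β + 2) := Real.Gamma_pos_of_pos (by linarith)
    have h4 : 0 < (1 - x) ^ α := Real.rpow_pos_of_pos (by linarith [hx.2]) _
    have h5 : 0 < (1 + x) ^ β := Real.rpow_pos_of_pos (by linarith [hx.1]) _
    simp only [density]
    positivity

theorem contDiffOn_density (L : NoiseLaw) : ContDiffOn ℝ ∞ L.density L.interval := by
  intro x hx
  refine ContDiffAt.contDiffWithinAt ?_
  cases L with
  | normal => simp only [density]; fun_prop
  | gamma α hα =>
    have hx : x ≠ 0 := ne_of_gt hx
    simp only [density]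
    exact contDiffAt_const.mul ((contDiffAt_id.rpow contDiffAt_const hx).mul (by fun_prop))
  | beta α β hα hβ =>
    have h1 : 1 - x ≠ 0 := by linarith [hx.2]
    have h2 : 1 + x ≠ 0 := by linarith [hx.1]
    simp only [density]
    exact contDiffAt_const.mul (((contDiffAt_const.sub contDiffAt_id).rpow contDiffAt_const h1).mul
      ((contDiffAt_const.add contDiffAt_id).rpow contDiffAt_const h2))

/-- The Pearson equation `(σ w)' = τ w`. -/
theorem hasDerivAt_sigma_mul_density (L : NoiseLaw) {x : ℝ} (hx : x ∈ L.interval) :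
    HasDerivAt (fun x => L.sigma.eval x * L.density x) (L.tau.eval x * L.density x) x := by
  cases L with
  | normal =>
    simp only [sigma, tau, density, eval_one, one_mul, eval_neg, eval_X]
    have h1 : HasDerivAt (fun x : ℝ => -(x ^ 2 / 2)) (-x) x := by
      refine (((hasDerivAt_id x).pow 2).div_const 2).neg.congr_deriv ?_
      simp
    refine ((h1.exp).const_mul ((√(2 * Real.pi))⁻¹)).congr_deriv ?_
    ring
  | gamma α hα =>
    have hx : 0 < x := hx
    simp only [sigma, tau, density, eval_X, eval_sub, eval_C]
    have h1 := Real.hasDerivAt_rpow_const (x := x) (p := α) (Or.inl hx.ne')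
    have h2 : HasDerivAt (fun x : ℝ => Real.exp (-x)) (Real.exp (-x) * -1) x :=
      (hasDerivAt_neg x).exp
    have h3 := (hasDerivAt_id x).mul ((h1.mul h2).const_mul ((Real.Gamma (α + 1))⁻¹))
    refine h3.congr_deriv ?_
    rw [Real.rpow_sub_one hx.ne']
    simp only [id, Pi.mul_apply]
    field_simp
    ring
  | beta α β hα hβ =>
    have h1 : 0 < 1 - x := by linarith [hx.2]
    have h2 : 0 < 1 + x := by linarith [hx.1]
    simp only [sigma, tau, density, eval_X, eval_sub, eval_C, eval_mul, eval_one, eval_pow]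
    have h3 : HasDerivAt (fun x : ℝ => 1 - x ^ 2) (-(2 * x)) x := by
      refine (((hasDerivAt_id x).pow 2).const_sub 1).congr_deriv ?_
      simp
    have h4 : HasDerivAt (fun x : ℝ => (1 - x) ^ α) (-1 * α * (1 - x) ^ (α - 1)) x :=
      ((hasDerivAt_id x).const_sub 1).rpow_const (Or.inl h1.ne')
    have h5 : HasDerivAt (fun x : ℝ => (1 + x) ^ β) (1 * β * (1 + x) ^ (β - 1)) x :=
      ((hasDerivAt_id x).const_add 1).rpow_const (Or.inl h2.ne')
    have h6 := h3.mul ((h4.mul h5).const_mul (Real.Gamma (α + β + 2) /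
      ((2 : ℝ) ^ (α + β + 1) * Real.Gamma (α + 1) * Real.Gamma (β + 1))))
    refine h6.congr_deriv ?_
    rw [Real.rpow_sub_one h1.ne', Real.rpow_sub_one h2.ne']
    simp only [Pi.mul_apply]
    generalize Real.Gamma (α + β + 2) /
      ((2 : ℝ) ^ (α + β + 1) * Real.Gamma (α + 1) * Real.Gamma (β + 1)) = c
    field_simp
    ring

/-- The density extended by zero to the real line. -/
noncomputable def fullDensity (L : NoiseLaw) : ℝ → ℝ := L.interval.indicator L.density

theorem fullDensity_nonneg (L : NoiseLaw) (x : ℝ) : 0 ≤ L.fullDensity x :=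
  indicator_nonneg (fun _ hx => (L.density_pos hx).le) x

theorem measurable_fullDensity (L : NoiseLaw) : Measurable L.fullDensity := by
  unfold fullDensity
  refine Measurable.indicator ?_ L.isOpen_interval.measurableSet
  cases L <;> simp only [density] <;> fun_prop

theorem measure_eq (L : NoiseLaw) :
    L.measure = volume.withDensity fun x => ENNReal.ofReal (L.fullDensity x) := by
  cases L with
  | normal =>
    rw [measure, gaussianReal_of_var_ne_zero _ one_ne_zero]
    congr 1
    ext x
    rw [gaussianPDF, gaussianPDFReal]
    congr 1
    simp only [fullDensity, interval, density, indicator_univ, NNReal.coe_one, mul_one, sub_zero]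
    congr 2
    ring
  | gamma α hα =>
    rw [measure, gammaMeasure]
    refine withDensity_congr_ae ?_
    have h0 : ∀ᵐ x : ℝ, x ≠ 0 := by
      rw [ae_iff]
      simp
    filter_upwards [h0] with x hx
    rw [gammaPDF, gammaPDFReal]
    congr 1
    simp only [fullDensity, interval, density, one_div, Real.one_rpow, one_mul]
    by_cases h : 0 ≤ x
    · have h' : 0 < x := lt_of_le_of_ne h hx.symm
      rw [if_pos h, indicator_of_mem (show x ∈ Ioi (0 : ℝ) from h'), add_sub_cancel_right]
      ring
    · rw [if_neg h, indicator_of_notMem (fun h' : x ∈ Ioi (0 : ℝ) => h (le_of_lt h'))]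
  | beta α β hα hβ => rfl

theorem integrable_iff (L : NoiseLaw) {E : Type*} [NormedAddCommGroup E] [NormedSpace ℝ E]
    {f : ℝ → E} : Integrable f L.measure ↔ Integrable (fun x => L.fullDensity x • f x) := by
  rw [measure_eq, integrable_withDensity_iff_integrable_smul'
    L.measurable_fullDensity.ennreal_ofReal (Eventually.of_forall fun _ => ENNReal.ofReal_lt_top)]
  simp only [ENNReal.toReal_ofReal (L.fullDensity_nonneg _)]

theorem ae_mem_interval (L : NoiseLaw) : ∀ᵐ x ∂L.measure, x ∈ L.interval := by
  rw [measure_eq, ae_withDensity_iff L.measurable_fullDensity.ennreal_ofReal]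
  refine Eventually.of_forall fun x hx => ?_
  by_contra h
  exact hx (by simp [fullDensity, h])

/-- Each of the laws has some exponential moments. -/
theorem exists_integrable_exp (L : NoiseLaw) [IsFiniteMeasure L.measure] :
    ∃ c : ℝ, 0 < c ∧ Integrable (fun x => Real.exp (c * |x|)) L.measure := by
  cases L with
  | normal =>
    refine ⟨1, one_pos, ?_⟩
    change Integrable _ (gaussianReal 0 1)
    refine ((integrable_exp_mul_gaussianReal 1).add (integrable_exp_mul_gaussianReal (-1))).mono'
      (by fun_prop) (Eventually.of_forall fun x => ?_)
    rw [Real.norm_eq_abs, abs_of_pos (Real.exp_pos _), Pi.add_apply]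
    rcases abs_cases x with ⟨h, _⟩ | ⟨h, _⟩ <;> rw [h]
    · linarith [Real.exp_pos (-1 * x)]
    · rw [mul_neg, ← neg_mul]
      linarith [Real.exp_pos (1 * x)]
  | gamma α hα =>
    refine ⟨1 / 2, by norm_num, ?_⟩
    rw [integrable_iff]
    have h1 := (integrableOn_rpow_mul_exp_neg_mul_rpow hα (p := 1) one_pos (b := 1 / 2)
      (by norm_num)).const_mul ((Real.Gamma (α + 1))⁻¹)
    rw [← IntegrableOn, ← integrable_indicator_iff measurableSet_Ioi] at h1
    refine h1.congr (Eventually.of_forall fun x => ?_)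
    simp only [fullDensity, interval, density]
    by_cases hx : x ∈ Ioi (0 : ℝ)
    · have hx' : 0 < x := hx
      rw [indicator_of_mem hx, indicator_of_mem hx, abs_of_pos hx', Real.rpow_one, smul_eq_mul,
        mul_assoc, mul_assoc, ← Real.exp_add]
      congr 3
      ring
    · rw [indicator_of_notMem hx, indicator_of_notMem hx, zero_smul]
  | beta α β hα hβ =>
    refine ⟨1, one_pos, Integrable.of_bound (by fun_prop) (Real.exp 1) ?_⟩
    filter_upwards [ae_mem_interval (beta α β hα hβ)] with x hx
    rw [Real.norm_eq_abs, abs_of_pos (Real.exp_pos _), Real.exp_le_exp, one_mul]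
    exact abs_le.2 ⟨hx.1.le, hx.2.le⟩

end NoiseLaw

end RandomEvolution

/-! ### The product law -/

namespace RandomEvolution

open Polynomial

variable {N : ℕ}

theorem contDiff_eval (p : ℝ[X]) : ContDiff ℝ ∞ fun x : ℝ => p.eval x := by
  simpa only [Polynomial.coe_aeval_eq_eval] using p.contDiff_aeval (𝕜 := ℝ) ∞

/-- The product of the laws of the components. -/
noncomputable abbrev piLaw (law : Fin N → NoiseLaw) : Measure (Fin N → ℝ) :=
  Measure.pi fun i => (law i).measure

/-- The product of the polynomials `q i` in the separate variables `z i`. -/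
noncomputable def tensorPoly (q : Fin N → ℝ[X]) (z : Fin N → ℝ) : ℝ := ∏ i, (q i).eval (z i)

/-- The density of the product law with respect to Lebesgue measure, zero outside the box. -/
noncomputable def piDensity (law : Fin N → NoiseLaw) (z : Fin N → ℝ) : ℝ :=
  ∏ i, (law i).fullDensity (z i)

theorem continuous_tensorPoly (q : Fin N → ℝ[X]) : Continuous (tensorPoly q) :=
  continuous_finsetProd _ fun i _ => (q i).continuous.comp (continuous_apply i)

theorem tensorPoly_mul (p q : Fin N → ℝ[X]) (z : Fin N → ℝ) :
    tensorPoly p z * tensorPoly q z = tensorPoly (p * q) z := by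
  simp [tensorPoly, Finset.prod_mul_distrib]

theorem tensorPoly_update (q : Fin N → ℝ[X]) (i : Fin N) (r : ℝ[X]) (z : Fin N → ℝ) :
    tensorPoly (Function.update q i r) z =
      r.eval (z i) * ∏ k ∈ Finset.univ.erase i, (q k).eval (z k) := by
  rw [tensorPoly, ← Finset.mul_prod_erase _ _ (Finset.mem_univ i), Function.update_self]
  congr 1
  refine Finset.prod_congr rfl fun k hk => ?_
  rw [Function.update_of_ne (Finset.ne_of_mem_erase hk)]

variable (law : Fin N → NoiseLaw)

theorem piDensity_nonneg (z : Fin N → ℝ) : 0 ≤ piDensity law z :=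
  Finset.prod_nonneg fun i _ => (law i).fullDensity_nonneg _

theorem measurable_piDensity : Measurable (piDensity law) :=
  Finset.measurable_prod _ fun i _ => (law i).measurable_fullDensity.comp (measurable_pi_apply i)

theorem isOpen_box : IsOpen (box law) := by
  have : box law = ⋂ i, (fun z : Fin N → ℝ => z i) ⁻¹' (law i).interval := by
    ext z
    simp [box]
  rw [this]
  exact isOpen_iInter_of_finite fun i => (law i).isOpen_interval.preimage (continuous_apply i)

theorem piDensity_of_mem {z : Fin N → ℝ} (hz : z ∈ box law) :
    piDensity law z = ∏ i, (law i).density (z i) :=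
  Finset.prod_congr rfl fun i _ => indicator_of_mem (hz i) _

theorem piDensity_of_notMem {z : Fin N → ℝ} (hz : z ∉ box law) : piDensity law z = 0 := by
  simp only [box, mem_ofPred_eq, not_forall] at hz
  obtain ⟨i, hi⟩ := hz
  exact Finset.prod_eq_zero (Finset.mem_univ i) (indicator_of_notMem hi _)

theorem piDensity_pos {z : Fin N → ℝ} (hz : z ∈ box law) : 0 < piDensity law z := by
  rw [piDensity_of_mem law hz]
  exact Finset.prod_pos fun i _ => (law i).density_pos (hz i)

variable [∀ i, IsProbabilityMeasure (law i).measure]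

theorem integrable_fullDensity (L : NoiseLaw) [IsFiniteMeasure L.measure] :
    Integrable L.fullDensity := by
  have h := (L.integrable_iff (f := fun _ => (1 : ℝ))).1 (integrable_const 1)
  simpa using h

theorem piLaw_eq_withDensity :
    piLaw law = volume.withDensity fun z => ENNReal.ofReal (piDensity law z) := by
  refine (Measure.pi_eq fun s hs => ?_)
  rw [withDensity_apply _ (MeasurableSet.univ_pi hs)]
  have h1 : ∀ i, Integrable ((s i).indicator (law i).fullDensity) := fun i =>
    (integrable_fullDensity (law i)).indicator (hs i)
  have h2 : ∀ i, ∀ x, 0 ≤ (s i).indicator (law i).fullDensity x := fun i x =>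
    indicator_nonneg (fun x _ => (law i).fullDensity_nonneg x) x
  have h3 : ∀ i, (law i).measure (s i) =
      ENNReal.ofReal (∫ x, (s i).indicator (law i).fullDensity x) := by
    intro i
    rw [(law i).measure_eq, withDensity_apply _ (hs i), ofReal_integral_eq_lintegral_ofReal (h1 i)
      (Eventually.of_forall (h2 i)), ← lintegral_indicator (hs i)]
    refine lintegral_congr fun x => ?_
    by_cases hx : x ∈ s i <;> simp [hx]
  simp only [h3]
  rw [← ENNReal.ofReal_prod_of_nonneg fun i _ => integral_nonneg (h2 i),
    ← integral_fintype_prod_volume_eq_prod (𝕜 := ℝ),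
    ofReal_integral_eq_lintegral_ofReal
      (by rw [volume_pi]; exact Integrable.fintype_prod_dep h1)
      (Eventually.of_forall fun z => Finset.prod_nonneg fun i _ => h2 i _),
    ← lintegral_indicator (MeasurableSet.univ_pi hs)]
  refine lintegral_congr fun z => ?_
  by_cases hz : z ∈ univ.pi s
  · rw [indicator_of_mem hz, piDensity]
    congr 1
    exact Finset.prod_congr rfl fun i _ => (indicator_of_mem (hz i (mem_univ i)) _).symm
  · rw [indicator_of_notMem hz]
    simp only [Set.mem_pi, mem_univ, forall_const, not_forall] at hz
    obtain ⟨i, hi⟩ := hz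
    rw [Finset.prod_eq_zero (Finset.mem_univ i) (indicator_of_notMem hi _), ENNReal.ofReal_zero]

section

variable {E : Type*} [NormedAddCommGroup E] [NormedSpace ℝ E]

theorem integral_piLaw (f : (Fin N → ℝ) → E) :
    ∫ z, f z ∂(piLaw law) = ∫ z, piDensity law z • f z := by
  rw [piLaw_eq_withDensity, integral_withDensity_eq_integral_toReal_smul
    (measurable_piDensity law).ennreal_ofReal
    (Eventually.of_forall fun _ => ENNReal.ofReal_lt_top)]
  simp only [ENNReal.toReal_ofReal (piDensity_nonneg law _)]

end

theorem ae_piLaw_iff {p : (Fin N → ℝ) → Prop} :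
    (∀ᵐ z ∂(piLaw law), p z) ↔ ∀ᵐ z, z ∈ box law → p z := by
  rw [piLaw_eq_withDensity, ae_withDensity_iff (measurable_piDensity law).ennreal_ofReal]
  refine eventually_congr (Eventually.of_forall fun z => ?_)
  by_cases hz : z ∈ box law
  · simp [hz, piDensity_pos law hz]
  · simp [hz, piDensity_of_notMem law hz]

theorem ae_mem_box : ∀ᵐ z ∂(piLaw law), z ∈ box law :=
  (ae_piLaw_iff law).2 (Eventually.of_forall fun _ h => h)

/-- A property that holds almost surely and is closed in the box holds on the whole box. -/
theorem exists_seq_tendsto_of_ae {p : (Fin N → ℝ) → Prop} (hp : ∀ᵐ z ∂(piLaw law), p z)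
    {z : Fin N → ℝ} (hz : z ∈ box law) :
    ∃ u : ℕ → Fin N → ℝ, (∀ n, u n ∈ box law ∧ p (u n)) ∧ Tendsto u atTop (𝓝 z) := by
  have h1 : z ∈ closure {y | y ∈ box law ∧ p y} := by
    rw [mem_closure_iff_nhds]
    intro U hU
    have h2 := (ae_piLaw_iff law).1 hp
    have h3 : U ∩ box law ∈ 𝓝 z := inter_mem hU ((isOpen_box law).mem_nhds hz)
    have h4 : volume (U ∩ box law) ≠ 0 := (Measure.measure_pos_of_mem_nhds volume h3).ne'
    by_contra hne
    rw [not_nonempty_iff_eq_empty] at hne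
    refine h4 (measure_mono_null ?_ (ae_iff.1 h2))
    rintro y ⟨hyU, hy⟩ hyp
    have : y ∈ U ∩ {y | y ∈ box law ∧ p y} := ⟨hyU, hy, hyp hy⟩
    rw [hne] at this
    exact this
  obtain ⟨u, hu, hlim⟩ := mem_closure_iff_seq_limit.1 h1
  exact ⟨u, hu, hlim⟩

theorem integrable_polynomial (L : NoiseLaw) [IsFiniteMeasure L.measure] (q : ℝ[X]) :
    Integrable (fun x => q.eval x) L.measure := by
  have h1 : ∀ n : ℕ, Integrable (fun x : ℝ => x ^ n) L.measure := by
    intro n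
    obtain ⟨c, hc, hi⟩ := L.exists_integrable_exp
    refine (hi.const_mul (n.factorial / c ^ n)).mono' (by fun_prop)
      (Eventually.of_forall fun x => ?_)
    have h2 := Real.pow_div_factorial_le_exp (c * |x|) (by positivity) n
    rw [mul_pow, div_le_iff₀ (by positivity)] at h2
    rw [norm_pow, Real.norm_eq_abs, div_mul_eq_mul_div, le_div_iff₀ (by positivity)]
    linarith
  simp only [Polynomial.eval_eq_sum_range]
  exact integrable_finsetSum _ fun n _ => (h1 n).const_mul _

theorem integrable_tensorPoly (q : Fin N → ℝ[X]) : Integrable (tensorPoly q) (piLaw law) :=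
  Integrable.fintype_prod_dep fun i => integrable_polynomial (law i) (q i)

theorem memLp_tensorPoly (q : Fin N → ℝ[X]) : MemLp (tensorPoly q) 2 (piLaw law) := by
  rw [memLp_two_iff_integrable_sq (continuous_tensorPoly q).aestronglyMeasurable]
  refine (integrable_tensorPoly law (q * q)).congr (Eventually.of_forall fun z => ?_)
  simp only [sq, tensorPoly_mul]

/-! ### Cutoff functions -/

theorem exists_deriv_smoothTransition_bound : ∃ M : ℝ, ∀ x, |deriv Real.smoothTransition x| ≤ M := by
  have hc : Continuous (deriv Real.smoothTransition) :=
    (Real.smoothTransition.contDiff (n := 1)).continuous_deriv le_rfl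
  obtain ⟨M, hM⟩ := (isCompact_Icc (a := (0 : ℝ)) (b := 1)).exists_bound_of_continuousOn
    hc.continuousOn
  refine ⟨max M 0, fun x => ?_⟩
  by_cases hx : x ∈ Icc (0 : ℝ) 1
  · exact (hM x hx).trans (le_max_left _ _)
  · have h0 : deriv Real.smoothTransition x = 0 := by
      rw [mem_Icc, not_and_or, not_le, not_le] at hx
      rcases hx with hx | hx
      · have : Real.smoothTransition =ᶠ[𝓝 x] fun _ => 0 := by
          filter_upwards [eventually_lt_nhds hx] with y hy
          exact Real.smoothTransition.zero_of_nonpos hy.le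
        rw [this.deriv_eq, deriv_const]
      · have : Real.smoothTransition =ᶠ[𝓝 x] fun _ => 1 := by
          filter_upwards [eventually_gt_nhds hx] with y hy
          exact Real.smoothTransition.one_of_one_le hy.le
        rw [this.deriv_eq, deriv_const]
    rw [h0, abs_zero]
    exact le_max_right _ _

namespace NoiseLaw

/-- A smooth cutoff function that vanishes where `σ ≤ 1 / n` or `|x| ≥ 2 n`. -/
noncomputable def cutoff (L : NoiseLaw) (n : ℕ) (x : ℝ) : ℝ :=
  Real.smoothTransition (n * L.sigma.eval x - 1) *
    (Real.smoothTransition (2 - x / n) * Real.smoothTransition (2 + x / n))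

theorem contDiff_cutoff (L : NoiseLaw) (n : ℕ) : ContDiff ℝ ∞ (L.cutoff n) := by
  have h : ContDiff ℝ ∞ Real.smoothTransition := Real.smoothTransition.contDiff
  have hs : ContDiff ℝ ∞ fun x => L.sigma.eval x := contDiff_eval _
  unfold cutoff
  exact (h.comp (by fun_prop)).mul ((h.comp (by fun_prop)).mul (h.comp (by fun_prop)))

theorem cutoff_nonneg (L : NoiseLaw) (n : ℕ) (x : ℝ) : 0 ≤ L.cutoff n x :=
  mul_nonneg (Real.smoothTransition.nonneg _)
    (mul_nonneg (Real.smoothTransition.nonneg _) (Real.smoothTransition.nonneg _))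

theorem cutoff_le_one (L : NoiseLaw) (n : ℕ) (x : ℝ) : L.cutoff n x ≤ 1 :=
  mul_le_one₀ (Real.smoothTransition.le_one _)
    (mul_nonneg (Real.smoothTransition.nonneg _) (Real.smoothTransition.nonneg _))
    (mul_le_one₀ (Real.smoothTransition.le_one _) (Real.smoothTransition.nonneg _)
      (Real.smoothTransition.le_one _))

theorem hasCompactSupport_cutoff (L : NoiseLaw) {n : ℕ} (hn : 0 < n) :
    HasCompactSupport (L.cutoff n) ∧ tsupport (L.cutoff n) ⊆ L.interval := by
  have hn' : (0 : ℝ) < n := by exact_mod_cast hn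
  have hs : Function.support (L.cutoff n) ⊆
      {x | 1 ≤ n * L.sigma.eval x} ∩ Icc (-(2 * n : ℝ)) (2 * n) := by
    intro x hx
    have hx : L.cutoff n x ≠ 0 := hx
    rw [cutoff, mul_ne_zero_iff, mul_ne_zero_iff] at hx
    obtain ⟨h1, h2, h3⟩ := hx
    rw [Ne, Real.smoothTransition.zero_iff_nonpos, not_le] at h1 h2 h3
    have h2' : x / n < 2 := by linarith
    have h3' : -2 < x / n := by linarith
    rw [div_lt_iff₀ hn'] at h2'
    rw [lt_div_iff₀ hn'] at h3'
    exact ⟨by simp only [mem_ofPred_eq]; linarith, by linarith, by linarith⟩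
  have hcl : IsClosed ({x | 1 ≤ n * L.sigma.eval x} ∩ Icc (-(2 * n : ℝ)) (2 * n)) :=
    (isClosed_le continuous_const (by fun_prop)).inter isClosed_Icc
  have hts : tsupport (L.cutoff n) ⊆
      {x | 1 ≤ n * L.sigma.eval x} ∩ Icc (-(2 * n : ℝ)) (2 * n) := closure_minimal hs hcl
  refine ⟨?_, fun x hx => ?_⟩
  · exact HasCompactSupport.intro (isCompact_Icc (a := -(2 * n : ℝ)) (b := 2 * n)) fun x hx => by
      by_contra h
      exact hx (hs h).2
  · rw [interval_eq]
    have h1 := (hts hx).1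
    simp only [mem_ofPred_eq] at h1 ⊢
    by_contra! h
    nlinarith

theorem eventually_cutoff_eq_one (L : NoiseLaw) {x : ℝ} (hx : x ∈ L.interval) :
    ∀ᶠ n : ℕ in atTop, L.cutoff n =ᶠ[𝓝 x] fun _ => 1 := by
  have hs := L.sigma_pos hx
  filter_upwards [(tendsto_natCast_atTop_atTop (R := ℝ)).eventually_gt_atTop
    (2 / L.sigma.eval x), (tendsto_natCast_atTop_atTop (R := ℝ)).eventually_gt_atTop |x|]
    with n h1 h2
  rw [div_lt_iff₀ hs] at h1
  have hn : (0 : ℝ) < n := (abs_nonneg x).trans_lt h2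
  have c1 : Continuous fun y => (n : ℝ) * L.sigma.eval y := by fun_prop
  filter_upwards [(c1.tendsto x).eventually_const_lt h1,
    ((continuous_abs).tendsto x).eventually_lt_const h2] with y h3 h4
  have h5 : |y / n| ≤ 1 := by
    rw [abs_div, abs_of_pos hn, div_le_one hn]
    exact h4.le
  rw [abs_le] at h5
  rw [cutoff, Real.smoothTransition.one_of_one_le (by linarith),
    Real.smoothTransition.one_of_one_le (by linarith),
    Real.smoothTransition.one_of_one_le (by linarith)]
  norm_num

/-- The derivatives of the cutoff functions are controlled by `1 / σ`, uniformly in `n`. -/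
theorem exists_sigma_mul_deriv_cutoff_le (L : NoiseLaw) : ∃ M : ℝ, 0 ≤ M ∧ ∀ n : ℕ, 0 < n → ∀ x,
    |L.sigma.eval x * deriv (L.cutoff n) x| ≤
      M * (|(derivative L.sigma).eval x| + |L.sigma.eval x|) := by
  obtain ⟨M, hM⟩ := exists_deriv_smoothTransition_bound
  have hM0 : 0 ≤ M := (abs_nonneg _).trans (hM 0)
  refine ⟨2 * M, by positivity, fun n hn x => ?_⟩
  have hn' : (1 : ℝ) ≤ n := by exact_mod_cast hn
  have hS : ∀ y, HasDerivAt Real.smoothTransition (deriv Real.smoothTransition y) y := fun y =>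
    ((Real.smoothTransition.contDiff (n := 1)).differentiable one_ne_zero y).hasDerivAt
  have d1 : HasDerivAt (fun x => Real.smoothTransition (n * L.sigma.eval x - 1))
      (deriv Real.smoothTransition (n * L.sigma.eval x - 1) *
        (n * (derivative L.sigma).eval x)) x :=
    (hS _).comp x (((L.sigma.hasDerivAt x).const_mul _).sub_const 1)
  have d2 : HasDerivAt (fun x => Real.smoothTransition (2 - x / n))
      (deriv Real.smoothTransition (2 - x / n) * (-(1 / n))) x :=
    (hS _).comp x (((hasDerivAt_id x).div_const _).const_sub 2)
  have d3 : HasDerivAt (fun x => Real.smoothTransition (2 + x / n))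
      (deriv Real.smoothTransition (2 + x / n) * (1 / n)) x :=
    (hS _).comp x (((hasDerivAt_id x).div_const _).const_add 2)
  have hd : deriv (L.cutoff n) x = _ := (d1.mul (d2.mul d3)).deriv
  rw [hd]
  set s := L.sigma.eval x
  set s' := (derivative L.sigma).eval x
  have hb : ∀ y, |Real.smoothTransition y| ≤ 1 := fun y => by
    rw [abs_of_nonneg (Real.smoothTransition.nonneg _)]
    exact Real.smoothTransition.le_one _
  have hn1 : |1 / (n : ℝ)| ≤ 1 := by
    rw [abs_of_nonneg (by positivity), div_le_one (by positivity)]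
    exact hn'
  -- `y S'(y - 1)` is bounded, as `S'` vanishes outside `[0, 1]`
  have key : |s * (deriv Real.smoothTransition (n * s - 1) * (n * s'))| ≤ 2 * M * |s'| := by
    have h0 : |n * s| * |deriv Real.smoothTransition (n * s - 1)| ≤ 2 * M := by
      by_cases h : n * s ∈ Icc (1 : ℝ) 2
      · rw [abs_of_nonneg (by linarith [h.1])]
        exact mul_le_mul h.2 (hM _) (abs_nonneg _) (by norm_num)
      · have h0 : deriv Real.smoothTransition (n * s - 1) = 0 := by
          rw [mem_Icc, not_and_or, not_le, not_le] at h
          rcases h with h | h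
          · have : Real.smoothTransition =ᶠ[𝓝 (n * s - 1)] fun _ => 0 := by
              filter_upwards [eventually_lt_nhds (show n * s - 1 < 0 by linarith)] with y hy
              exact Real.smoothTransition.zero_of_nonpos hy.le
            rw [this.deriv_eq, deriv_const]
          · have : Real.smoothTransition =ᶠ[𝓝 (n * s - 1)] fun _ => 1 := by
              filter_upwards [eventually_gt_nhds (show 1 < n * s - 1 by linarith)] with y hy
              exact Real.smoothTransition.one_of_one_le hy.le
            rw [this.deriv_eq, deriv_const]
        rw [h0, abs_zero, mul_zero]
        positivity
    have e : s * (deriv Real.smoothTransition (n * s - 1) * (n * s')) =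
        (n * s) * deriv Real.smoothTransition (n * s - 1) * s' := by ring
    rw [e, abs_mul, abs_mul]
    exact mul_le_mul_of_nonneg_right h0 (abs_nonneg _)
  have hb1 := hb (2 - x / n)
  have hb2 := hb (2 + x / n)
  have hm1 := hM (2 - x / n)
  have hm2 := hM (2 + x / n)
  have hb0 : |Real.smoothTransition (n * s - 1)| ≤ 1 := hb _
  set B := Real.smoothTransition (2 - x / n)
  set C := Real.smoothTransition (2 + x / n)
  set B' := deriv Real.smoothTransition (2 - x / n)
  set C' := deriv Real.smoothTransition (2 + x / n)
  set A := Real.smoothTransition (n * s - 1)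
  set A' := deriv Real.smoothTransition (n * s - 1)
  have e : s * (A' * (n * s') * (B * C) + A * (B' * -(1 / n) * C + B * (C' * (1 / n)))) =
      s * (A' * (n * s')) * (B * C) +
        (s * A * (B' * -(1 / n) * C) + s * A * (B * (C' * (1 / n)))) := by ring
  have t1 : |s * (A' * (n * s')) * (B * C)| ≤ 2 * M * |s'| := by
    rw [abs_mul]
    refine (mul_le_of_le_one_right (abs_nonneg _) ?_).trans key
    rw [abs_mul]
    exact mul_le_one₀ hb1 (abs_nonneg _) hb2
  have t2 : |s * A * (B' * -(1 / n) * C)| ≤ M * |s| := by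
    simp only [abs_mul, abs_neg]
    calc |s| * |A| * (|B'| * |1 / (n : ℝ)| * |C|) ≤ |s| * 1 * (M * 1 * 1) := by gcongr
      _ = M * |s| := by ring
  have t3 : |s * A * (B * (C' * (1 / n)))| ≤ M * |s| := by
    simp only [abs_mul]
    calc |s| * |A| * (|B| * (|C'| * |1 / (n : ℝ)|)) ≤ |s| * 1 * (1 * (M * 1)) := by gcongr
      _ = M * |s| := by ring
  have := abs_add_le (s * (A' * (n * s')) * (B * C))
    (s * A * (B' * -(1 / n) * C) + s * A * (B * (C' * (1 / n))))
  have := abs_add_le (s * A * (B' * -(1 / n) * C)) (s * A * (B * (C' * (1 / n))))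
  simp only [Pi.mul_apply]
  rw [e]
  linarith

end NoiseLaw

end RandomEvolution

/-! ### Weighted integration by parts -/

namespace RandomEvolution

open Polynomial

variable {N : ℕ}

theorem partialDeriv_eq_deriv {F : Type*} [NormedAddCommGroup F] [NormedSpace ℝ F] {i : Fin N}
    {f : (Fin N → ℝ) → F} {z : Fin N → ℝ} (hf : DifferentiableAt ℝ f z) :
    HasDerivAt (fun s => f (Function.update z i s)) (partialDeriv i f z) (z i) := by
  have h1 : HasFDerivAt f (fderiv ℝ f z) (Function.update z i (z i)) := by
    rw [Function.update_eq_self]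
    exact hf.hasFDerivAt
  exact h1.comp_hasDerivAt (z i) (hasDerivAt_update z i (z i))

section

variable {E : Type*} [NormedAddCommGroup E] [NormedSpace ℝ E]

/-- `g` is the weak first-order partial derivative of `f` in direction `i` on the box. -/
def IsWeakPartial (law : Fin N → NoiseLaw) (i : Fin N) (f g : (Fin N → ℝ) → E) : Prop :=
  ∀ φ : (Fin N → ℝ) → ℝ, ContDiff ℝ ∞ φ → HasCompactSupport φ → tsupport φ ⊆ box law →
    ∫ z in box law, partialDeriv i φ z • f z = -∫ z in box law, φ z • g z

end

namespace NoiseLaw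

/-- The product of a cutoff function, a polynomial and the density of the law. -/
noncomputable def testFun (L : NoiseLaw) (n : ℕ) (r : ℝ[X]) (x : ℝ) : ℝ :=
  L.cutoff n x * (r.eval x * L.density x)

theorem contDiff_testFun (L : NoiseLaw) {n : ℕ} (hn : 0 < n) (r : ℝ[X]) :
    ContDiff ℝ ∞ (L.testFun n r) := by
  rw [contDiff_iff_contDiffAt]
  intro x
  by_cases hx : x ∈ L.interval
  · have hr : ContDiff ℝ ∞ fun x => r.eval x := contDiff_eval r
    exact (L.contDiff_cutoff n).contDiffAt.mul (hr.contDiffAt.mul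
      (L.contDiffOn_density.contDiffAt (L.isOpen_interval.mem_nhds hx)))
  · have h1 : x ∉ tsupport (L.cutoff n) := fun h => hx ((L.hasCompactSupport_cutoff hn).2 h)
    have h2 : L.testFun n r =ᶠ[𝓝 x] fun _ => 0 := by
      filter_upwards [notMem_tsupport_iff_eventuallyEq.1 h1] with y hy
      rw [testFun, hy, Pi.zero_apply, zero_mul]
    exact contDiffAt_const.congr_of_eventuallyEq h2

theorem tsupport_testFun_subset (L : NoiseLaw) (n : ℕ) (r : ℝ[X]) :
    tsupport (L.testFun n r) ⊆ tsupport (L.cutoff n) :=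
  closure_mono fun x hx hx' => hx (by rw [testFun, hx', zero_mul])

theorem hasDerivAt_testFun (L : NoiseLaw) (n : ℕ) (r : ℝ[X]) {x : ℝ} (hx : x ∈ L.interval) :
    HasDerivAt (L.testFun n (L.sigma * r))
      ((L.sigma.eval x * deriv (L.cutoff n) x) * (r.eval x * L.density x) +
        L.cutoff n x * ((L.tau * r + L.sigma * derivative r).eval x * L.density x)) x := by
  have h1 : HasDerivAt (L.cutoff n) (deriv (L.cutoff n) x) x :=
    ((L.contDiff_cutoff n).differentiable (by simp) x).hasDerivAt
  have h2 := (L.hasDerivAt_sigma_mul_density hx).mul (r.hasDerivAt x)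
  have h3 := h1.mul h2
  refine (h3.congr_of_eventuallyEq (Eventually.of_forall fun y => ?_)).congr_deriv ?_
  · simp only [testFun, eval_mul, Pi.mul_apply]
    ring
  · simp only [eval_mul, eval_add, Pi.mul_apply]
    ring

end NoiseLaw

theorem tsupport_prod_subset {f : Fin N → ℝ → ℝ} :
    tsupport (fun z : Fin N → ℝ => ∏ i, f i (z i)) ⊆ univ.pi fun i => tsupport (f i) := by
  refine closure_minimal (fun z hz i _ => ?_) (isClosed_set_pi fun i _ => isClosed_tsupport _)
  have hz : ∏ i, f i (z i) ≠ 0 := hz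
  exact subset_tsupport _ (Finset.prod_ne_zero_iff.1 hz i (Finset.mem_univ i))

section

variable {E : Type*} [NormedAddCommGroup E] [NormedSpace ℝ E]
  (law : Fin N → NoiseLaw) [∀ i, IsProbabilityMeasure (law i).measure]

theorem setIntegral_box_eq {F G : (Fin N → ℝ) → E}
    (h : ∀ z ∈ box law, F z = piDensity law z • G z) :
    ∫ z in box law, F z = ∫ z, G z ∂(piLaw law) := by
  rw [integral_piLaw, setIntegral_congr_fun (isOpen_box law).measurableSet h]
  exact setIntegral_eq_integral_of_forall_compl_eq_zero
    fun z hz => by rw [piDensity_of_notMem law hz, zero_smul]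

/-- Integration by parts against a polynomial times the weight `σ_i ^ (l + 1)`. The boundary
terms are removed by the cutoff functions. -/
theorem integral_by_parts {i : Fin N} {f g : (Fin N → ℝ) → E} (hfg : IsWeakPartial law i f g)
    (l : ℕ) (q : Fin N → ℝ[X])
    (hf : ∀ p : ℝ[X], Integrable (fun z =>
      tensorPoly (Function.update q i ((law i).sigma ^ l * p)) z • f z) (piLaw law))
    (hg : Integrable (fun z =>
      tensorPoly (Function.update q i ((law i).sigma ^ (l + 1) * q i)) z • g z) (piLaw law)) :
    ∫ z, tensorPoly (Function.update q i ((law i).sigma ^ (l + 1) * q i)) z • g z ∂(piLaw law) =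
      -∫ z, tensorPoly (Function.update q i ((law i).tau * ((law i).sigma ^ l * q i) +
        (law i).sigma * derivative ((law i).sigma ^ l * q i))) z • f z ∂(piLaw law) := by
  set σ := (law i).sigma with hσ
  set τ := (law i).tau with hτ
  set r := σ ^ l * q i with hr
  have e0 : σ ^ (l + 1) * q i = σ * r := by rw [hr]; ring
  rw [e0] at hg ⊢
  -- products of the cutoff functions
  let χ : ℕ → (Fin N → ℝ) → ℝ := fun n z => ∏ k, (law k).cutoff n (z k)
  let χ' : ℕ → (Fin N → ℝ) → ℝ := fun n z =>
    (σ.eval (z i) * deriv ((law i).cutoff n) (z i)) *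
      ∏ k ∈ Finset.univ.erase i, (law k).cutoff n (z k)
  have hχ0 : ∀ n z, ‖χ n z‖ ≤ 1 := fun n z => by
    rw [Real.norm_eq_abs, abs_of_nonneg (Finset.prod_nonneg fun k _ => (law k).cutoff_nonneg _ _)]
    exact Finset.prod_le_one (fun k _ => (law k).cutoff_nonneg _ _)
      fun k _ => (law k).cutoff_le_one _ _
  have hχc : ∀ n, Continuous (χ n) := fun n =>
    continuous_finsetProd _ fun k _ =>
      ((law k).contDiff_cutoff n).continuous.comp (continuous_apply k)
  have hχ'c : ∀ n, Continuous (χ' n) := fun n =>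
    ((σ.continuous.comp (continuous_apply i)).mul
      ((((law i).contDiff_cutoff n).continuous_deriv (by simp)).comp (continuous_apply i))).mul
      (continuous_finsetProd _ fun k _ =>
        ((law k).contDiff_cutoff n).continuous.comp (continuous_apply k))
  have hχ1 : ∀ z ∈ box law, ∀ᶠ n in atTop, χ n z = 1 := by
    intro z hz
    have h1 : ∀ᶠ n in atTop, ∀ k, (law k).cutoff n =ᶠ[𝓝 (z k)] fun _ => 1 :=
      eventually_all.2 fun k => (law k).eventually_cutoff_eq_one (hz k)
    filter_upwards [h1] with n hn
    exact Finset.prod_eq_one fun k _ => (hn k).eq_of_nhds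
  have hχ'1 : ∀ z ∈ box law, ∀ᶠ n in atTop, χ' n z = 0 := by
    intro z hz
    filter_upwards [(law i).eventually_cutoff_eq_one (hz i)] with n hn
    simp only [χ', hn.deriv_eq, deriv_const, mul_zero, zero_mul]
  obtain ⟨M, hM0, hM⟩ := (law i).exists_sigma_mul_deriv_cutoff_le
  have hχ'0 : ∀ n, 0 < n → ∀ z, ‖χ' n z‖ ≤
      M * (|(derivative σ).eval (z i)| + |σ.eval (z i)|) := fun n hn z => by
    rw [norm_mul, Real.norm_eq_abs, Real.norm_eq_abs]
    refine (mul_le_of_le_one_right (abs_nonneg _) ?_).trans (hM n hn (z i))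
    rw [abs_of_nonneg (Finset.prod_nonneg fun k _ => (law k).cutoff_nonneg _ _)]
    exact Finset.prod_le_one (fun k _ => (law k).cutoff_nonneg _ _)
      fun k _ => (law k).cutoff_le_one _ _
  -- the integrable functions
  have hf1 : Integrable (fun z => tensorPoly (Function.update q i (τ * r + σ * derivative r)) z •
      f z) (piLaw law) := by
    have e : τ * r + σ * derivative r =
        σ ^ l * (τ * q i + (l : ℝ[X]) * derivative σ * q i + σ * derivative (q i)) := by
      rw [hr]
      cases l with
      | zero => simp
      | succ l =>
        rw [derivative_mul, derivative_pow_succ]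
        simp only [map_add, map_natCast, map_one, Nat.cast_add, Nat.cast_one]
        ring
    rw [e]
    exact hf _
  have hf2 : Integrable (fun z => tensorPoly (Function.update q i r) z • f z) (piLaw law) := hf _
  have hf3 : ∀ p : ℝ[X], Integrable (fun z => |p.eval (z i)| *
      ‖tensorPoly (Function.update q i r) z • f z‖) (piLaw law) := by
    intro p
    have h1 := (hf (p * q i)).norm
    refine h1.congr (Eventually.of_forall fun z => ?_)
    simp only [tensorPoly_update, hr, eval_mul, norm_smul, Real.norm_eq_abs, abs_mul]
    ring
  -- the identity with cutoff functions
  have key : ∀ n : ℕ, 0 < n →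
      ∫ z, (χ' n z • (tensorPoly (Function.update q i r) z • f z) +
        χ n z • (tensorPoly (Function.update q i (τ * r + σ * derivative r)) z • f z))
          ∂(piLaw law) =
      -∫ z, χ n z • (tensorPoly (Function.update q i (σ * r)) z • g z) ∂(piLaw law) := by
    intro n hn
    let φ : (Fin N → ℝ) → ℝ := fun z =>
      ∏ k, (law k).testFun n (Function.update q i (σ * r) k) (z k)
    have hφ : ContDiff ℝ ∞ φ := contDiff_prod fun k _ =>
      ((law k).contDiff_testFun hn _).comp (contDiff_apply ℝ ℝ k)
    have hsub : tsupport φ ⊆ univ.pi fun k => tsupport ((law k).cutoff n) :=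
      tsupport_prod_subset.trans
        (Set.pi_mono fun k _ => (law k).tsupport_testFun_subset n _)
    have hφc : HasCompactSupport φ :=
      (isCompact_univ_pi fun k => ((law k).hasCompactSupport_cutoff hn).1).of_isClosed_subset
        (isClosed_tsupport _) hsub
    have hφb : tsupport φ ⊆ box law := fun z hz k =>
      ((law k).hasCompactSupport_cutoff hn).2 (hsub hz k (mem_univ k))
    have h1 := hfg φ hφ hφc hφb
    rw [setIntegral_box_eq law (F := fun z => φ z • g z)
      (G := fun z => χ n z • (tensorPoly (Function.update q i (σ * r)) z • g z)) ?_,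
      setIntegral_box_eq law (G := fun z => (χ' n z • (tensorPoly (Function.update q i r) z • f z) +
        χ n z • (tensorPoly (Function.update q i (τ * r + σ * derivative r)) z • f z))) ?_] at h1
    · exact h1
    · intro z hz
      have h2 : HasDerivAt (fun s => φ (Function.update z i s)) (partialDeriv i φ z) (z i) :=
        partialDeriv_eq_deriv (hφ.differentiable (by simp) z)
      have h3 := ((law i).hasDerivAt_testFun n r (hz i)).mul_const
        (∏ k ∈ Finset.univ.erase i, (law k).testFun n (q k) (z k))
      have h4 : (fun s => φ (Function.update z i s)) = fun s =>
          (law i).testFun n (σ * r) s *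
            ∏ k ∈ Finset.univ.erase i, (law k).testFun n (q k) (z k) := by
        funext s
        simp only [φ]
        rw [← Finset.mul_prod_erase _ _ (Finset.mem_univ i), Function.update_self,
          Function.update_self]
        congr 1
        refine Finset.prod_congr rfl fun k hk => ?_
        rw [Function.update_of_ne (Finset.ne_of_mem_erase hk),
          Function.update_of_ne (Finset.ne_of_mem_erase hk)]
      rw [h4] at h2
      rw [h2.unique h3]
      simp only [smul_smul, ← add_smul]
      congr 1
      simp only [χ, χ', tensorPoly_update, piDensity_of_mem law hz, NoiseLaw.testFun,
        ← Finset.mul_prod_erase _ _ (Finset.mem_univ i), Finset.prod_mul_distrib]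
      ring
    · intro z hz
      simp only [smul_smul]
      congr 1
      simp only [φ, χ, tensorPoly, piDensity_of_mem law hz, NoiseLaw.testFun,
        Finset.prod_mul_distrib]
      ring
  -- passage to the limit
  have l1 : Tendsto (fun n => ∫ z, χ n z • (tensorPoly (Function.update q i (σ * r)) z • g z)
      ∂(piLaw law)) atTop
      (𝓝 (∫ z, tensorPoly (Function.update q i (σ * r)) z • g z ∂(piLaw law))) := by
    refine tendsto_integral_of_dominated_convergence _
      (fun n => (hχc n).aestronglyMeasurable.smul hg.aestronglyMeasurable) hg.norm
      (fun n => Eventually.of_forall fun z => ?_) ?_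
    · rw [norm_smul]
      exact mul_le_of_le_one_left (norm_nonneg _) (hχ0 n z)
    · filter_upwards [ae_mem_box law] with z hz
      refine tendsto_const_nhds.congr' ?_
      filter_upwards [hχ1 z hz] with n hn
      rw [hn, one_smul]
  have l2 : Tendsto (fun n => ∫ z, (χ' (n + 1) z • (tensorPoly (Function.update q i r) z • f z) +
      χ (n + 1) z • (tensorPoly (Function.update q i (τ * r + σ * derivative r)) z • f z))
        ∂(piLaw law)) atTop
      (𝓝 (∫ z, tensorPoly (Function.update q i (τ * r + σ * derivative r)) z • f z
        ∂(piLaw law))) := by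
    refine tendsto_integral_of_dominated_convergence
      (fun z => M * (|(derivative σ).eval (z i)| * ‖tensorPoly (Function.update q i r) z • f z‖ +
        |σ.eval (z i)| * ‖tensorPoly (Function.update q i r) z • f z‖) +
        ‖tensorPoly (Function.update q i (τ * r + σ * derivative r)) z • f z‖)
      (fun n => ((hχ'c _).aestronglyMeasurable.smul hf2.aestronglyMeasurable).add
        ((hχc _).aestronglyMeasurable.smul hf1.aestronglyMeasurable))
      ((((hf3 _).add (hf3 _)).const_mul M).add hf1.norm)
      (fun n => Eventually.of_forall fun z => ?_) ?_
    · refine (norm_add_le _ _).trans (add_le_add ?_ ?_)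
      · rw [norm_smul, ← add_mul, ← mul_assoc]
        exact mul_le_mul_of_nonneg_right (hχ'0 _ n.succ_pos z) (norm_nonneg _)
      · rw [norm_smul]
        exact mul_le_of_le_one_left (norm_nonneg _) (hχ0 _ z)
    · filter_upwards [ae_mem_box law] with z hz
      refine tendsto_const_nhds.congr' ?_
      filter_upwards [(tendsto_add_atTop_nat 1).eventually (hχ1 z hz),
        (tendsto_add_atTop_nat 1).eventually (hχ'1 z hz)] with n hn hn'
      rw [hn, hn', one_smul, zero_smul, zero_add]
  have l3 := (l1.comp (tendsto_add_atTop_nat 1)).neg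
  have l4 := tendsto_nhds_unique (l2.congr fun n => key (n + 1) n.succ_pos) l3
  rw [l4, neg_neg]

end

end RandomEvolution

/-! ### Orthogonal polynomials of the one-dimensional laws -/

namespace RandomEvolution

open Polynomial

namespace NoiseLaw

/-- The operator `r ↦ τ r + σ r'`; it is `r ↦ (σ w r)' / w` for the density `w`. -/
noncomputable def drift (L : NoiseLaw) (r : ℝ[X]) : ℝ[X] := L.tau * r + L.sigma * derivative r

/-- The Sturm–Liouville operator `σ ∂² + τ ∂`. -/
noncomputable def sturmLiouville (L : NoiseLaw) : ℝ[X] →ₗ[ℝ] ℝ[X] where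
  toFun p := L.drift (derivative p)
  map_add' p q := by simp only [drift, map_add]; ring
  map_smul' c p := by
    simp only [drift, map_smul, RingHom.id_apply, smul_add, mul_smul_comm]

theorem drift_mul (L : NoiseLaw) (r q : ℝ[X]) :
    L.drift (r * q) = L.drift r * q + L.sigma * r * derivative q := by
  simp only [drift, derivative_mul]
  ring

/-- The eigenvalues of the Sturm–Liouville operators of the derivatives of order `l` of the
orthogonal polynomials. -/
def eigenvalue (L : NoiseLaw) (m l : ℕ) : ℝ := (m - l) * (L.slope + (m + l - 1) * L.curv)

theorem eigenvalue_strictMono (L : NoiseLaw) : StrictMono fun m => L.eigenvalue m 0 := by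
  refine strictMono_nat_of_lt_succ fun m => ?_
  have h1 := L.slope_pos
  have h2 := L.curv_nonneg
  simp only [eigenvalue, Nat.cast_zero, sub_zero, add_zero]
  push_cast
  nlinarith [mul_nonneg (Nat.cast_nonneg (α := ℝ) m) h2]

theorem monomial_mem_degreeLT {a : ℝ} {j k : ℕ} (h : j < k) : C a * X ^ j ∈ degreeLT ℝ k := by
  rw [mem_degreeLT]
  exact (degree_C_mul_X_pow_le j a).trans_lt (by exact_mod_cast h)

theorem sturmLiouville_X_pow (L : NoiseLaw) (k : ℕ) :
    L.sturmLiouville (X ^ k) + L.eigenvalue k 0 • X ^ k ∈ degreeLT ℝ k := by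
  have key : ∃ a b : ℝ, L.sturmLiouville (X ^ k) + L.eigenvalue k 0 • X ^ k =
      C (a * k) * X ^ (k - 1) + C (b * (k * (k - 1))) * X ^ (k - 2) := by
    change ∃ a b : ℝ, L.drift (derivative (X ^ k)) + L.eigenvalue k 0 • X ^ k = _
    rcases k with _ | _ | k
    · refine ⟨0, 0, ?_⟩
      simp [drift, eigenvalue]
    · cases L with
      | normal =>
        refine ⟨0, 0, ?_⟩
        simp [drift, eigenvalue, tau, sigma, slope, curv]
      | gamma α hα =>
        refine ⟨α + 1, 0, ?_⟩
        simp [drift, eigenvalue, tau, sigma, slope, curv]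
      | beta α β hα hβ =>
        refine ⟨β - α, 0, ?_⟩
        simp [drift, eigenvalue, tau, sigma, slope, curv, smul_eq_C_mul]
    · cases L with
      | normal =>
        refine ⟨0, 1, ?_⟩
        simp [drift, eigenvalue, tau, sigma, slope, curv, smul_eq_C_mul]
        ring
      | gamma α hα =>
        refine ⟨α + 1 + k + 1, 0, ?_⟩
        simp [drift, eigenvalue, tau, sigma, slope, curv, smul_eq_C_mul]
        ring
      | beta α β hα hβ =>
        refine ⟨β - α, 1, ?_⟩
        simp [drift, eigenvalue, tau, sigma, slope, curv, smul_eq_C_mul]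
        ring
  obtain ⟨a, b, h⟩ := key
  rw [h]
  refine Submodule.add_mem _ ?_ ?_
  · rcases k with _ | k
    · simp
    · exact monomial_mem_degreeLT (by omega)
  · rcases k with _ | _ | k
    · simp
    · simp
    · exact monomial_mem_degreeLT (by omega)

/-- Below the degree `m` the operator is triangular, and its diagonal entries differ from the `m`-th
one, so that the shifted operator is onto. -/
theorem exists_sturmLiouville_solution (L : NoiseLaw) (m : ℕ) :
    ∀ k ≤ m, ∀ g ∈ degreeLT ℝ k, ∃ h ∈ degreeLT ℝ k,
      L.sturmLiouville h + L.eigenvalue m 0 • h = g := by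
  intro k
  induction k with
  | zero =>
    intro _ g hg
    refine ⟨0, Submodule.zero_mem _, ?_⟩
    rw [mem_degreeLT] at hg
    have : g = 0 := by
      rw [Nat.cast_zero, Nat.WithBot.lt_zero_iff, degree_eq_bot] at hg
      exact hg
    simp [this]
  | succ k ih =>
    intro hk g hg
    have hlam : L.eigenvalue m 0 - L.eigenvalue k 0 ≠ 0 :=
      (sub_pos.2 (L.eigenvalue_strictMono hk)).ne'
    set c := g.coeff k / (L.eigenvalue m 0 - L.eigenvalue k 0) with hc
    set low := L.sturmLiouville (X ^ k) + L.eigenvalue k 0 • X ^ k with hlow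
    have h1 : g - C (g.coeff k) * X ^ k ∈ degreeLT ℝ k := by
      rw [mem_degreeLT, degree_lt_iff_coeff_zero]
      rw [mem_degreeLT, degree_lt_iff_coeff_zero] at hg
      intro j hj
      rw [coeff_sub, coeff_C_mul_X_pow]
      split_ifs with h
      · rw [h, sub_self]
      · rw [sub_zero]
        exact hg j (by omega)
    obtain ⟨h, hh, he⟩ := ih (by omega) (g - C (g.coeff k) * X ^ k - c • low)
      (Submodule.sub_mem _ h1 (Submodule.smul_mem _ _ (L.sturmLiouville_X_pow k)))
    refine ⟨h + C c * X ^ k, Submodule.add_mem _ (degreeLT_mono (Nat.le_succ k) hh)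
      (monomial_mem_degreeLT (Nat.lt_succ_self k)), ?_⟩
    have e : L.sturmLiouville (C c * X ^ k) + L.eigenvalue m 0 • (C c * X ^ k) =
        c • low + C (g.coeff k) * X ^ k := by
      have hc' : g.coeff k = c * (L.eigenvalue m 0 - L.eigenvalue k 0) := by
        rw [hc, div_mul_cancel₀ _ hlam]
      rw [← smul_eq_C_mul, map_smul, hlow, hc', ← smul_eq_C_mul]
      module
    rw [map_add, smul_add, add_add_add_comm, he, e]
    ring

/-- Correcting `X ^ m` by lower order terms gives an eigenfunction. -/
theorem exists_eigenpolynomial (L : NoiseLaw) (m : ℕ) : ∃ p : ℝ[X], p.Monic ∧ p.natDegree = m ∧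
    L.sturmLiouville p = -L.eigenvalue m 0 • p := by
  obtain ⟨h, hh, he⟩ := L.exists_sturmLiouville_solution m m le_rfl _ (L.sturmLiouville_X_pow m)
  rw [mem_degreeLT] at hh
  refine ⟨X ^ m - h, monic_X_pow_sub hh, ?_, ?_⟩
  · refine natDegree_eq_of_degree_eq_some ?_
    rw [degree_sub_eq_left_of_degree_lt (by rwa [degree_X_pow]), degree_X_pow]
  · rw [map_sub, neg_smul, smul_sub, neg_sub, sub_eq_sub_iff_add_eq_add, ← he]
    abel

end NoiseLaw

/-- The function `1` has weak derivative `0`. -/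
theorem isWeakPartial_one (law : Fin 1 → NoiseLaw) :
    IsWeakPartial law 0 (fun _ => (1 : ℝ)) fun _ => 0 := by
  intro φ hφ hφc hφb
  have hd : Continuous (partialDeriv 0 φ) :=
    (hφ.continuous_fderiv (by simp)).clm_apply continuous_const
  have hdc : HasCompactSupport (partialDeriv 0 φ) := hφc.fderiv_apply (𝕜 := ℝ) _
  simp only [smul_eq_mul, mul_one, mul_zero, integral_zero, neg_zero]
  rw [setIntegral_eq_integral_of_forall_compl_eq_zero]
  · have h := integral_mul_fderiv_eq_neg_fderiv_mul_of_integrable (μ := (volume : Measure (Fin 1 → ℝ)))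
      (f := fun _ => (1 : ℝ)) (g := φ) (v := Pi.single 0 1) (by simp)
      (by simp only [one_mul]; exact hd.integrable_of_hasCompactSupport hdc)
      (by simpa only [one_mul] using hφ.continuous.integrable_of_hasCompactSupport hφc)
      (by fun_prop) (fun x _ => hφ.differentiable (by simp) x)
    simp only [one_mul, fderiv_fun_const, Pi.zero_apply, zero_apply, zero_mul,
      integral_zero, neg_zero] at h
    exact h
  · intro z hz
    have h1 : z ∉ tsupport φ := fun h => hz (hφb h)
    have h2 : φ =ᶠ[𝓝 z] fun _ => 0 := notMem_tsupport_iff_eventuallyEq.1 h1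
    simp [partialDeriv, h2.fderiv_eq]

namespace NoiseLaw

variable (L : NoiseLaw) [IsProbabilityMeasure L.measure]

theorem integral_drift (r : ℝ[X]) : ∫ x, (L.drift r).eval x ∂L.measure = 0 := by
  have h1 : ∀ p : Fin 1 → ℝ[X], tensorPoly p = fun z => (p 0).eval (z 0) := fun p => by
    funext z
    simp [tensorPoly]
  have hp : ∀ p : ℝ[X], Integrable (fun z : Fin 1 → ℝ => p.eval (z 0))
      (piLaw fun _ : Fin 1 => L) := fun p => by
    have := integrable_tensorPoly (fun _ : Fin 1 => L) fun _ => p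
    rwa [h1] at this
  have h := integral_by_parts (fun _ : Fin 1 => L) (isWeakPartial_one fun _ => L) 0 (fun _ => r)
    (fun p => by simpa [h1] using hp p) (by simp)
  simp only [h1, Function.update_self, smul_eq_mul, mul_zero, integral_zero, mul_one, pow_zero,
    one_mul] at h
  have h2 := integral_comp_eval (μ := fun _ : Fin 1 => L.measure) (i := 0)
    (f := fun x => (L.drift r).eval x) ((L.drift r).continuous.aestronglyMeasurable)
  rw [← h2]
  exact neg_eq_zero.1 h.symm

theorem integral_sq_pos {p : ℝ[X]} (hp : p ≠ 0) : 0 < ∫ x, (p * p).eval x ∂L.measure := by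
  have hnn : ∀ x, 0 ≤ (p * p).eval x := fun x => by rw [eval_mul]; exact mul_self_nonneg _
  rw [integral_pos_iff_support_of_nonneg hnn (integrable_polynomial L _), pos_iff_ne_zero]
  intro h0
  have h1 : ∀ᵐ x ∂L.measure, p.eval x = 0 := by
    rw [ae_iff]
    refine measure_mono_null (fun x hx => ?_) h0
    simp only [Function.mem_support, eval_mul]
    exact mul_self_ne_zero.2 hx
  have h2 : L.measure {x | p.eval x = 0} = 0 := by
    have hfin : {x | p.eval x = 0}.Finite := by
      refine (p.roots.toFinset.finite_toSet).subset fun x hx => ?_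
      simpa [hp] using hx
    rw [L.measure_eq]
    exact withDensity_absolutelyContinuous _ _ (hfin.measure_zero volume)
  have h3 : ∀ᵐ x ∂L.measure, False := by
    filter_upwards [h1, measure_eq_zero_iff_ae_notMem.1 h2] with x hx hx'
    exact hx' hx
  rw [eventually_false_iff_eq_bot, ae_eq_bot] at h3
  exact IsProbabilityMeasure.ne_zero L.measure h3

/-- The Sturm–Liouville operator is symmetric with respect to the law, with Dirichlet form
`∫ σ p' q'`. -/
theorem integral_sturmLiouville_mul (p q : ℝ[X]) :
    ∫ x, (L.sturmLiouville p * q).eval x ∂L.measure =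
      -∫ x, (L.sigma * derivative p * derivative q).eval x ∂L.measure := by
  have h := L.integral_drift (derivative p * q)
  rw [drift_mul] at h
  simp only [eval_add] at h
  rw [integral_add (integrable_polynomial L _) (integrable_polynomial L _)] at h
  exact eq_neg_of_add_eq_zero_left h

/-- Normalised eigenfunctions; they are orthogonal because the operator is symmetric and its
eigenvalues are distinct. -/
theorem exists_orthPoly : ∃ p : ℕ → ℝ[X], (∀ m, (p m).natDegree = m ∧ p m ≠ 0) ∧
    (∀ m, L.sturmLiouville (p m) = -L.eigenvalue m 0 • p m) ∧
    ∀ m n, ∫ x, (p m * p n).eval x ∂L.measure = if m = n then 1 else 0 := by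
  choose e he1 he2 he3 using L.exists_eigenpolynomial
  have hpos : ∀ m, 0 < ∫ x, (e m * e m).eval x ∂L.measure := fun m =>
    L.integral_sq_pos (he1 m).ne_zero
  set c : ℕ → ℝ := fun m => (√(∫ x, (e m * e m).eval x ∂L.measure))⁻¹ with hc
  have hc0 : ∀ m, c m ≠ 0 := fun m => inv_ne_zero (Real.sqrt_pos.2 (hpos m)).ne'
  have horth : ∀ m n, m ≠ n → ∫ x, (e m * e n).eval x ∂L.measure = 0 := by
    intro m n hmn
    have h1 := L.integral_sturmLiouville_mul (e m) (e n)
    have h2 := L.integral_sturmLiouville_mul (e n) (e m)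
    rw [he3, mul_right_comm] at h2
    rw [he3] at h1
    rw [← h1, smul_mul_assoc, smul_mul_assoc, mul_comm (e n)] at h2
    simp only [eval_smul, smul_eq_mul, integral_const_mul] at h2
    have h3 : (L.eigenvalue m 0 - L.eigenvalue n 0) *
        ∫ x, (e m * e n).eval x ∂L.measure = 0 := by linarith
    exact (mul_eq_zero.1 h3).resolve_left
      (sub_ne_zero.2 (L.eigenvalue_strictMono.injective.ne hmn))
  refine ⟨fun m => c m • e m, fun m => ⟨?_, ?_⟩, fun m => ?_, fun m n => ?_⟩
  · rw [natDegree_smul _ (hc0 m), he2]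
  · exact smul_ne_zero (hc0 m) (he1 m).ne_zero
  · rw [map_smul, he3, smul_comm]
  · have h1 : ∀ x, (c m • e m * c n • e n).eval x = c m * c n * (e m * e n).eval x := fun x => by
      simp only [eval_mul, eval_smul, smul_eq_mul]
      ring
    simp only [h1, integral_const_mul]
    split_ifs with h
    · subst h
      have h2 := Real.mul_self_sqrt (hpos m).le
      have h3 := (Real.sqrt_pos.2 (hpos m)).ne'
      rw [hc]
      simp only
      nth_rewrite 3 [← h2]
      field_simp
    · rw [horth m n h, mul_zero]

/-- The orthonormal polynomials of the law: `orthPoly m` has degree `m`. -/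
noncomputable def orthPoly (m : ℕ) : ℝ[X] := L.exists_orthPoly.choose m

theorem natDegree_orthPoly (m : ℕ) : (L.orthPoly m).natDegree = m :=
  (L.exists_orthPoly.choose_spec.1 m).1

theorem orthPoly_ne_zero (m : ℕ) : L.orthPoly m ≠ 0 := (L.exists_orthPoly.choose_spec.1 m).2

theorem sturmLiouville_orthPoly (m : ℕ) :
    L.sturmLiouville (L.orthPoly m) = -L.eigenvalue m 0 • L.orthPoly m :=
  L.exists_orthPoly.choose_spec.2.1 m

theorem integral_orthPoly_mul (m n : ℕ) :
    ∫ x, (L.orthPoly m * L.orthPoly n).eval x ∂L.measure = if m = n then 1 else 0 :=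
  L.exists_orthPoly.choose_spec.2.2 m n

theorem derivative_tau (L : NoiseLaw) : derivative L.tau = C (-L.slope) := by
  cases L <;> simp [tau, slope]

theorem derivative_derivative_sigma (L : NoiseLaw) :
    derivative (derivative L.sigma) = C (-(2 * L.curv)) := by
  cases L with
  | normal => simp [sigma, curv]
  | gamma => simp [sigma, curv]
  | beta =>
    simp only [sigma, curv, derivative_sub, derivative_one, derivative_X_pow, zero_sub,
      derivative_neg, derivative_mul, derivative_C, zero_mul, Nat.cast_ofNat, zero_add]
    simp

/-- The derivatives of the orthogonal polynomials are eigenfunctions as well. -/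
theorem iterate_derivative_orthPoly (m l : ℕ) :
    L.sigma * derivative^[l + 2] (L.orthPoly m) +
      (L.tau + (l : ℝ[X]) * derivative L.sigma) * derivative^[l + 1] (L.orthPoly m) =
      C (-L.eigenvalue m l) * derivative^[l] (L.orthPoly m) := by
  induction l with
  | zero =>
    have h := L.sturmLiouville_orthPoly m
    rw [smul_eq_C_mul] at h
    change L.drift (derivative (L.orthPoly m)) = _ at h
    rw [drift] at h
    simp only [Function.iterate_succ', Function.iterate_zero, Function.comp, id, Nat.cast_zero,
      zero_mul, add_zero]
    rw [← h]
    ring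
  | succ l ih =>
    have h := congrArg derivative ih
    simp only [derivative_add, derivative_mul, ← Function.iterate_succ_apply' (f := derivative),
      derivative_natCast, zero_mul, zero_add, derivative_tau, derivative_derivative_sigma,
      derivative_C] at h
    have e : C (-L.eigenvalue m (l + 1)) =
        C (-L.eigenvalue m l) - C (-L.slope) - (l : ℝ[X]) * C (-(2 * L.curv)) := by
      rw [← C_eq_natCast, ← C_mul, ← C_sub, ← C_sub]
      congr 1
      simp only [eigenvalue]
      push_cast
      ring
    rw [e, Nat.cast_succ]
    linear_combination h

/-- The same eigenvalue equation in divergence form. -/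
theorem drift_sigma_pow_mul (m l : ℕ) :
    L.drift (L.sigma ^ l * derivative^[l + 1] (L.orthPoly m)) =
      C (-L.eigenvalue m l) * (L.sigma ^ l * derivative^[l] (L.orthPoly m)) := by
  have h := L.iterate_derivative_orthPoly m l
  have e : L.sigma * derivative (L.sigma ^ l) = L.sigma ^ l * ((l : ℝ[X]) * derivative L.sigma) := by
    cases l with
    | zero => simp
    | succ l =>
      rw [derivative_pow_succ]
      simp only [map_add, map_natCast, map_one, Nat.cast_add, Nat.cast_one]
      ring
  rw [drift, derivative_mul, ← Function.iterate_succ_apply' derivative]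
  linear_combination L.sigma ^ l * h + derivative^[l + 1] (L.orthPoly m) * e

/-- The product of the eigenvalues of the orders below `l`. -/
def eigenvalueProd (L : NoiseLaw) (m l : ℕ) : ℝ := ∏ k ∈ Finset.range l, L.eigenvalue m k

theorem integral_iterate_derivative_mul (m n l : ℕ) :
    ∫ x, (L.sigma ^ l * (derivative^[l] (L.orthPoly m) *
      derivative^[l] (L.orthPoly n))).eval x ∂L.measure =
      if m = n then L.eigenvalueProd m l else 0 := by
  induction l with
  | zero => simpa [eigenvalueProd] using L.integral_orthPoly_mul m n
  | succ l ih =>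
    have h := L.integral_drift (L.sigma ^ l * derivative^[l + 1] (L.orthPoly m) *
      derivative^[l] (L.orthPoly n))
    rw [drift_mul, drift_sigma_pow_mul, ← Function.iterate_succ_apply' derivative] at h
    simp only [eval_add] at h
    rw [integral_add (integrable_polynomial L _) (integrable_polynomial L _), mul_assoc, mul_assoc]
      at h
    simp only [eval_mul (p := C _), eval_C, integral_const_mul] at h
    rw [ih] at h
    have e : L.sigma ^ (l + 1) * (derivative^[l + 1] (L.orthPoly m) *
        derivative^[l + 1] (L.orthPoly n)) = L.sigma * (L.sigma ^ l *
          derivative^[l + 1] (L.orthPoly m)) * derivative^[l + 1] (L.orthPoly n) := by ring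
    rw [e, eq_neg_of_add_eq_zero_right h]
    split_ifs
    · rw [eigenvalueProd, eigenvalueProd, Finset.prod_range_succ]
      ring
    · ring

theorem eigenvalue_nonneg (L : NoiseLaw) {m l : ℕ} (h : l ≤ m) : 0 ≤ L.eigenvalue m l := by
  have h1 := L.slope_pos
  have h2 := L.curv_nonneg
  have h3 : (l : ℝ) ≤ m := by exact_mod_cast h
  rcases m.eq_zero_or_pos with rfl | hm
  · have : l = 0 := by omega
    simp [eigenvalue, this]
  · have h4 : (1 : ℝ) ≤ m := by exact_mod_cast hm
    have h5 : (0 : ℝ) ≤ l := by positivity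
    exact mul_nonneg (by linarith) (by nlinarith [mul_nonneg (show (0 : ℝ) ≤ m + l - 1 by linarith) h2])

theorem eigenvalueProd_nonneg (L : NoiseLaw) (m l : ℕ) : 0 ≤ L.eigenvalueProd m l := by
  rcases le_or_gt l (m + 1) with h | h
  · exact Finset.prod_nonneg fun k hk => L.eigenvalue_nonneg (by
      have := Finset.mem_range.1 hk
      omega)
  · refine (Finset.prod_eq_zero (i := m) (Finset.mem_range.2 (by omega)) ?_).ge
    simp [eigenvalue]

/-- The products of `k` eigenvalues grow at least like `m ^ k`. -/
theorem pow_le_eigenvalueProd (L : NoiseLaw) (m k : ℕ) :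
    (m : ℝ) ^ k ≤ (2 / L.slope) ^ k * L.eigenvalueProd m k + (2 * k) ^ k := by
  have h1 := L.slope_pos
  have h2 := L.curv_nonneg
  rcases lt_or_ge m (2 * k) with h | h
  · have h3 : (m : ℝ) ≤ 2 * k := by exact_mod_cast h.le
    have h4 := pow_le_pow_left₀ (Nat.cast_nonneg m) h3 k
    have h5 : 0 ≤ (2 / L.slope) ^ k * L.eigenvalueProd m k :=
      mul_nonneg (by positivity) (L.eigenvalueProd_nonneg m k)
    linarith
  · have h3 : (L.slope / 2 * m) ^ k ≤ L.eigenvalueProd m k := by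
      rw [eigenvalueProd, ← Finset.card_range k, ← Finset.prod_const, Finset.card_range]
      refine Finset.prod_le_prod (fun _ _ => by positivity) fun l hl => ?_
      have hl : l + 1 ≤ k := Finset.mem_range.1 hl
      have h4 : (l : ℝ) + 1 ≤ k := by exact_mod_cast hl
      have h5 : (2 : ℝ) * k ≤ m := by exact_mod_cast h
      have h6 : (0 : ℝ) ≤ l := by positivity
      have h7 : (m : ℝ) / 2 ≤ m - l := by linarith
      have h8 : 0 ≤ (m + l - 1 : ℝ) * L.curv := mul_nonneg (by linarith) h2
      calc L.slope / 2 * m = m / 2 * L.slope := by ring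
        _ ≤ (m - l) * (L.slope + (m + l - 1) * L.curv) :=
          mul_le_mul h7 (by linarith) h1.le (by linarith)
    have h4 : (2 / L.slope) ^ k * (L.slope / 2 * m) ^ k = (m : ℝ) ^ k := by
      rw [← mul_pow]
      congr 1
      field_simp
    have h5 := mul_le_mul_of_nonneg_left h3 (show (0 : ℝ) ≤ (2 / L.slope) ^ k by positivity)
    have h6 : (0 : ℝ) ≤ (2 * k) ^ k := by positivity
    linarith

end NoiseLaw

end RandomEvolution

/-! ### The Bessel inequality for vector-valued functions -/

namespace RandomEvolution

section Bessel

variable {X : Type*} [MeasurableSpace X] {μ : Measure X} {ι : Type*}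
  {E : Type*} [NormedAddCommGroup E] [InnerProductSpace ℝ E]

theorem integrable_smul_of_memLp {E : Type*} [NormedAddCommGroup E] [NormedSpace ℝ E]
    {e : X → ℝ} {G : X → E} (he : MemLp e 2 μ) (hG : MemLp G 2 μ) :
    Integrable (fun x => e x • G x) μ := by
  have := hG.smul he (r := 1)
  exact memLp_one_iff_integrable.1 this

theorem memLp_sum_smul {E : Type*} [NormedAddCommGroup E] [NormedSpace ℝ E]
    {e : ι → X → ℝ} (he : ∀ α, MemLp (e α) 2 μ) (S : Finset ι) (c : ι → E) :
    MemLp (fun x => ∑ α ∈ S, e α x • c α) 2 μ := by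
  refine memLp_finsetSum S fun α _ => ?_
  exact ((ContinuousLinearMap.id ℝ ℝ).smulRight (c α)).comp_memLp' (he α)

theorem integrable_norm_sq_of_memLp {E : Type*} [NormedAddCommGroup E] {G : X → E}
    (hG : MemLp G 2 μ) : Integrable (fun x => ‖G x‖ ^ 2) μ :=
  hG.integrable_norm_pow two_ne_zero

/-- Parseval's identity for finite sums `∑ e_α c_α` with orthogonal scalar functions `e_α`. -/
theorem integral_norm_sum_smul_sq [DecidableEq ι] {e : ι → X → ℝ} (he : ∀ α, MemLp (e α) 2 μ) {Λ : ι → ℝ}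
    (horth : ∀ α β, ∫ x, e α x * e β x ∂μ = if α = β then Λ α else 0)
    (S : Finset ι) (c : ι → E) :
    ∫ x, ‖∑ α ∈ S, e α x • c α‖ ^ 2 ∂μ = ∑ α ∈ S, Λ α * ‖c α‖ ^ 2 := by
  have h1 : ∀ x, ‖∑ α ∈ S, e α x • c α‖ ^ 2 =
      ∑ α ∈ S, ∑ β ∈ S, (e α x * e β x) * inner ℝ (c α) (c β) := by
    intro x
    rw [← real_inner_self_eq_norm_sq, sum_inner]
    refine Finset.sum_congr rfl fun α _ => ?_
    rw [inner_sum]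
    refine Finset.sum_congr rfl fun β _ => ?_
    rw [real_inner_smul_left, real_inner_smul_right]
    ring
  have hint : ∀ α β, Integrable (fun x => e α x * e β x) μ := fun α β =>
    integrable_smul_of_memLp (he α) (he β)
  simp_rw [h1]
  rw [integral_finsetSum]
  · refine Finset.sum_congr rfl fun α hα => ?_
    rw [integral_finsetSum]
    · simp_rw [integral_mul_const, horth]
      simp [hα]
    · exact fun β _ => (hint α β).mul_const _
  · exact fun α _ => integrable_finsetSum _ fun β _ => (hint α β).mul_const _

variable [CompleteSpace E]

theorem integral_norm_sub_sum_smul_sq [DecidableEq ι] {e : ι → X → ℝ} (he : ∀ α, MemLp (e α) 2 μ) {Λ : ι → ℝ}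
    (horth : ∀ α β, ∫ x, e α x * e β x ∂μ = if α = β then Λ α else 0)
    {G : X → E} (hG : MemLp G 2 μ) {c : ι → E} (hc : ∀ α, ∫ x, e α x • G x ∂μ = Λ α • c α)
    (S : Finset ι) :
    ∫ x, ‖G x - ∑ α ∈ S, e α x • c α‖ ^ 2 ∂μ =
      ∫ x, ‖G x‖ ^ 2 ∂μ - ∑ α ∈ S, Λ α * ‖c α‖ ^ 2 := by
  have hs := memLp_sum_smul he S c
  have h1 : ∀ x, ‖G x - ∑ α ∈ S, e α x • c α‖ ^ 2 = ‖G x‖ ^ 2 -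
      2 * ∑ α ∈ S, inner ℝ (c α) (e α x • G x) + ‖∑ α ∈ S, e α x • c α‖ ^ 2 := by
    intro x
    rw [norm_sub_sq_real, inner_sum]
    congr 3
    refine Finset.sum_congr rfl fun α _ => ?_
    rw [real_inner_smul_right, real_inner_smul_right, real_inner_comm]
  have hint : ∀ α, Integrable (fun x => e α x • G x) μ := fun α =>
    integrable_smul_of_memLp (he α) hG
  have h2 : Integrable (fun x => ∑ α ∈ S, inner ℝ (c α) (e α x • G x)) μ :=
    integrable_finsetSum _ fun α _ => (hint α).const_inner (c α)
  simp_rw [h1]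
  have h4 : Integrable (fun x => ‖G x‖ ^ 2 - 2 * ∑ α ∈ S, inner ℝ (c α) (e α x • G x)) μ :=
    (integrable_norm_sq_of_memLp hG).sub (h2.const_mul 2)
  rw [integral_add h4 (integrable_norm_sq_of_memLp hs), integral_sub (integrable_norm_sq_of_memLp hG)
      (h2.const_mul 2), integral_norm_sum_smul_sq he horth, integral_const_mul,
    integral_finsetSum _ fun α _ => (hint α).const_inner (c α)]
  have h3 : ∀ α, ∫ x, inner ℝ (c α) (e α x • G x) ∂μ = Λ α * ‖c α‖ ^ 2 := by
    intro α
    rw [integral_inner (hint α), hc, real_inner_smul_right, real_inner_self_eq_norm_sq]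
  simp_rw [h3]
  ring

theorem sum_mul_norm_sq_le_integral [DecidableEq ι] {e : ι → X → ℝ} (he : ∀ α, MemLp (e α) 2 μ) {Λ : ι → ℝ}
    (horth : ∀ α β, ∫ x, e α x * e β x ∂μ = if α = β then Λ α else 0)
    {G : X → E} (hG : MemLp G 2 μ) {c : ι → E} (hc : ∀ α, ∫ x, e α x • G x ∂μ = Λ α • c α)
    (S : Finset ι) : ∑ α ∈ S, Λ α * ‖c α‖ ^ 2 ≤ ∫ x, ‖G x‖ ^ 2 ∂μ := by
  have h := integral_norm_sub_sum_smul_sq he horth hG hc S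
  have : 0 ≤ ∫ x, ‖G x - ∑ α ∈ S, e α x • c α‖ ^ 2 ∂μ := integral_nonneg fun x => by positivity
  linarith

end Bessel

/-! ### Polynomial chaos coefficients of weak derivatives -/

open Polynomial

variable {N : ℕ} (law : Fin N → NoiseLaw) [∀ i, IsProbabilityMeasure (law i).measure]

/-- The orthonormal tensor polynomial with multi-index `α`, differentiated `l` times in the
`i`-th coordinate. -/
noncomputable def chaosDeriv (i : Fin N) (l : ℕ) (α : Fin N → ℕ) : (Fin N → ℝ) → ℝ :=
  tensorPoly (Function.update (fun k => (law k).orthPoly (α k)) i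
    (derivative^[l] ((law i).orthPoly (α i))))

/-- The orthonormal tensor polynomial with multi-index `α`. -/
noncomputable def chaos (α : Fin N → ℕ) : (Fin N → ℝ) → ℝ :=
  tensorPoly fun k => (law k).orthPoly (α k)

theorem chaosDeriv_zero (i : Fin N) (α : Fin N → ℕ) : chaosDeriv law i 0 α = chaos law α := by
  simp [chaosDeriv, chaos]

theorem integral_tensorPoly (q : Fin N → ℝ[X]) :
    ∫ z, tensorPoly q z ∂(piLaw law) = ∏ k, ∫ x, (q k).eval x ∂(law k).measure := by
  simp only [tensorPoly]
  exact integral_fintype_prod_eq_prod (𝕜 := ℝ) fun k x => (q k).eval x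

theorem integral_chaosDeriv_mul (i : Fin N) (l : ℕ) (α β : Fin N → ℕ) :
    ∫ z, (law i).sigma.eval (z i) ^ l * (chaosDeriv law i l α z * chaosDeriv law i l β z)
      ∂(piLaw law) = if α = β then (law i).eigenvalueProd (α i) l else 0 := by
  have h1 : ∀ z, (law i).sigma.eval (z i) ^ l *
      (chaosDeriv law i l α z * chaosDeriv law i l β z) =
      tensorPoly (Function.update (fun k => (law k).orthPoly (α k) * (law k).orthPoly (β k)) i
        ((law i).sigma ^ l * (derivative^[l] ((law i).orthPoly (α i)) *
          derivative^[l] ((law i).orthPoly (β i))))) z := by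
    intro z
    simp only [chaosDeriv, tensorPoly_update, eval_mul, eval_pow, Finset.prod_mul_distrib]
    ring
  simp_rw [h1]
  rw [integral_tensorPoly, ← Finset.mul_prod_erase _ _ (Finset.mem_univ i)]
  rw [Function.update_self, NoiseLaw.integral_iterate_derivative_mul]
  have h2 : ∏ k ∈ Finset.univ.erase i, ∫ x, (Function.update (fun k => (law k).orthPoly (α k) *
      (law k).orthPoly (β k)) i ((law i).sigma ^ l * (derivative^[l] ((law i).orthPoly (α i)) *
          derivative^[l] ((law i).orthPoly (β i)))) k).eval x ∂(law k).measure =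
      ∏ k ∈ Finset.univ.erase i, if α k = β k then 1 else 0 := by
    refine Finset.prod_congr rfl fun k hk => ?_
    rw [Function.update_of_ne (Finset.ne_of_mem_erase hk), NoiseLaw.integral_orthPoly_mul]
  rw [h2]
  by_cases h : α = β
  · subst h
    simp
  · rw [if_neg h]
    obtain ⟨k, hk⟩ := Function.ne_iff.1 h
    by_cases hki : k = i
    · subst hki
      simp [hk]
    · rw [Finset.prod_eq_zero (Finset.mem_erase.2 ⟨hki, Finset.mem_univ k⟩) (by simp [hk]),
        mul_zero]

theorem sqrt_sigma_pow_sq {L : NoiseLaw} {x : ℝ} (hx : x ∈ L.interval) (l : ℕ) :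
    √(L.sigma.eval x) ^ l * √(L.sigma.eval x) ^ l = L.sigma.eval x ^ l := by
  rw [← mul_pow, Real.mul_self_sqrt (L.sigma_pos hx).le]

/-- Polynomials times `√σ_i ^ l` are square integrable. -/
theorem memLp_sqrt_sigma_mul (i : Fin N) (l : ℕ) (q : Fin N → ℝ[X]) :
    MemLp (fun z => √((law i).sigma.eval (z i)) ^ l * tensorPoly q z) 2 (piLaw law) := by
  have hm : Continuous fun z : Fin N → ℝ => √((law i).sigma.eval (z i)) ^ l * tensorPoly q z := by
    have := (law i).sigma.continuous
    have := continuous_tensorPoly q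
    fun_prop
  rw [memLp_two_iff_integrable_sq hm.aestronglyMeasurable]
  refine (integrable_tensorPoly law (Function.update (q * q) i
    ((law i).sigma ^ l * (q i * q i)))).congr ?_
  filter_upwards [ae_mem_box law] with z hz
  rw [mul_pow, sq (√_ ^ l), sqrt_sigma_pow_sq (hz i), sq, tensorPoly_mul, tensorPoly_update]
  have : tensorPoly (q * q) z = (q i * q i).eval (z i) *
      ∏ k ∈ Finset.univ.erase i, ((q * q) k).eval (z k) := by
    rw [← tensorPoly_update, ← Pi.mul_apply, Function.update_eq_self]
  rw [this]
  simp only [eval_mul, eval_pow]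
  ring

section Moments

variable {E : Type*} [NormedAddCommGroup E]

/-- The polynomial chaos coefficient of `f` with multi-index `α`. -/
noncomputable def coef [NormedSpace ℝ E] (f : (Fin N → ℝ) → E) (α : Fin N → ℕ) : E :=
  ∫ z, chaos law α z • f z ∂(piLaw law)

variable [InnerProductSpace ℝ E]

theorem memLp_chaos (α : Fin N → ℕ) : MemLp (chaos law α) 2 (piLaw law) :=
  memLp_tensorPoly law _

/-- A chain `F 0, F 1, …, F k` of successive weak derivatives in direction `i`, square integrable
with the weights `√σ_i ^ l`. -/
structure WeakChain (i : Fin N) (k : ℕ) (F : ℕ → (Fin N → ℝ) → E) : Prop where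
  weak : ∀ l < k, IsWeakPartial law i (F l) (F (l + 1))
  memLp : ∀ l ≤ k, MemLp (fun z => √((law i).sigma.eval (z i)) ^ l • F l z) 2 (piLaw law)

variable {law}

theorem WeakChain.integrable {i : Fin N} {k : ℕ} {F : ℕ → (Fin N → ℝ) → E}
    (hF : WeakChain law i k F) {l : ℕ} (hl : l ≤ k) (q : Fin N → ℝ[X]) (p : ℝ[X]) :
    Integrable (fun z => tensorPoly (Function.update q i ((law i).sigma ^ l * p)) z • F l z)
      (piLaw law) := by
  refine (integrable_smul_of_memLp (memLp_sqrt_sigma_mul law i l (Function.update q i p))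
    (hF.memLp l hl)).congr ?_
  filter_upwards [ae_mem_box law] with z hz
  rw [tensorPoly_update, tensorPoly_update, smul_smul, eval_mul, eval_pow,
    ← sqrt_sigma_pow_sq (hz i)]
  congr 1
  ring

/-- The coefficients of the weighted derivatives are those of the function, multiplied by the
products of eigenvalues. -/
theorem WeakChain.integral_smul {i : Fin N} {k : ℕ} {F : ℕ → (Fin N → ℝ) → E}
    (hF : WeakChain law i k F) (α : Fin N → ℕ) : ∀ l ≤ k,
    ∫ z, tensorPoly (Function.update (fun k => (law k).orthPoly (α k)) i
      ((law i).sigma ^ l * derivative^[l] ((law i).orthPoly (α i)))) z • F l z ∂(piLaw law) =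
      (law i).eigenvalueProd (α i) l • coef law (F 0) α := by
  intro l
  induction l with
  | zero =>
    intro _
    have h : ((law i).sigma ^ 0 * derivative^[0] ((law i).orthPoly (α i))) =
        (fun k => (law k).orthPoly (α k)) i := by simp
    rw [h, Function.update_eq_self]
    simp [NoiseLaw.eigenvalueProd, coef, chaos]
  | succ l ih =>
    intro hl
    set b : Fin N → ℝ[X] := fun k => (law k).orthPoly (α k) with hb
    set q : Fin N → ℝ[X] := Function.update b i (derivative^[l + 1] ((law i).orthPoly (α i)))
      with hq
    have h1 : ∀ r, Function.update q i r = Function.update b i r := fun r => by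
      rw [hq, Function.update_idem]
    have hqi : q i = derivative^[l + 1] ((law i).orthPoly (α i)) := by
      rw [hq, Function.update_self]
    have h2 := integral_by_parts law (hF.weak l (by omega)) l q
      (fun p => hF.integrable (by omega) q p) (hF.integrable hl q _)
    rw [h1, h1, hqi] at h2
    have h3 := (law i).drift_sigma_pow_mul (α i) l
    rw [NoiseLaw.drift] at h3
    rw [h3] at h2
    rw [h2]
    have h4 : ∀ z, tensorPoly (Function.update b i (C (-(law i).eigenvalue (α i) l) *
        ((law i).sigma ^ l * derivative^[l] ((law i).orthPoly (α i))))) z • F l z =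
        (-(law i).eigenvalue (α i) l) • tensorPoly (Function.update b i
          ((law i).sigma ^ l * derivative^[l] ((law i).orthPoly (α i)))) z • F l z := by
      intro z
      rw [tensorPoly_update, tensorPoly_update, smul_smul, eval_mul, eval_C, mul_assoc]
    simp_rw [h4]
    rw [MeasureTheory.integral_smul, ih (by omega), neg_smul, neg_neg, smul_smul, NoiseLaw.eigenvalueProd,
      NoiseLaw.eigenvalueProd, Finset.prod_range_succ, mul_comm]

theorem integral_norm_chaosDeriv_sum_sq (i : Fin N) (l : ℕ) (S : Finset (Fin N → ℕ))
    (c : (Fin N → ℕ) → E) :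
    ∫ z, ‖√((law i).sigma.eval (z i)) ^ l • ∑ α ∈ S, chaosDeriv law i l α z • c α‖ ^ 2
      ∂(piLaw law) = ∑ α ∈ S, (law i).eigenvalueProd (α i) l * ‖c α‖ ^ 2 := by
  rw [← integral_norm_sum_smul_sq
    (e := fun α z => √((law i).sigma.eval (z i)) ^ l * chaosDeriv law i l α z)
    (Λ := fun α => (law i).eigenvalueProd (α i) l)
    (fun α => memLp_sqrt_sigma_mul law i l _) (fun α β => ?_)]
  · simp only [Finset.smul_sum, smul_smul]
  · rw [← integral_chaosDeriv_mul]
    refine integral_congr_ae ?_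
    filter_upwards [ae_mem_box law] with z hz
    rw [← sqrt_sigma_pow_sq (hz i)]
    ring

variable [CompleteSpace E]

theorem WeakChain.sum_le {i : Fin N} {k : ℕ} {F : ℕ → (Fin N → ℝ) → E}
    (hF : WeakChain law i k F) {l : ℕ} (hl : l ≤ k) (S : Finset (Fin N → ℕ)) :
    ∑ α ∈ S, (law i).eigenvalueProd (α i) l * ‖coef law (F 0) α‖ ^ 2 ≤
      ∫ z, ‖√((law i).sigma.eval (z i)) ^ l • F l z‖ ^ 2 ∂(piLaw law) := by
  refine sum_mul_norm_sq_le_integral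
    (e := fun α z => √((law i).sigma.eval (z i)) ^ l * chaosDeriv law i l α z)
    (Λ := fun α => (law i).eigenvalueProd (α i) l)
    (fun α => memLp_sqrt_sigma_mul law i l _) (fun α β => ?_) (hF.memLp l hl) (fun α => ?_) S
  · rw [← integral_chaosDeriv_mul]
    refine integral_congr_ae ?_
    filter_upwards [ae_mem_box law] with z hz
    rw [← sqrt_sigma_pow_sq (hz i)]
    ring
  · rw [← hF.integral_smul α l hl]
    refine integral_congr_ae ?_
    filter_upwards [ae_mem_box law] with z hz
    simp only [chaosDeriv, tensorPoly_update, smul_smul, eval_mul, eval_pow]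
    rw [← sqrt_sigma_pow_sq (hz i)]
    congr 1
    ring

end Moments

end RandomEvolution

/-! ### Density of polynomials in spaces of square integrable functions -/

namespace RandomEvolution

open Polynomial

theorem exists_eq_sum_of_natDegree_le {r : ℕ → ℝ[X]} (hr : ∀ b, (r b).natDegree = b ∧ r b ≠ 0)
    (m : ℕ) : ∀ p : ℝ[X], p.natDegree ≤ m →
      ∃ c : ℕ → ℝ, p = ∑ b ∈ Finset.range (m + 1), C (c b) * r b := by
  induction m with
  | zero =>
    intro p hp
    have h0 := (hr 0).2
    rw [eq_C_of_natDegree_eq_zero (hr 0).1] at h0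
    have h1 : (r 0).coeff 0 ≠ 0 := fun h => h0 (by rw [h, map_zero])
    refine ⟨fun _ => p.coeff 0 / (r 0).coeff 0, ?_⟩
    rw [Finset.sum_range_one, eq_C_of_natDegree_le_zero hp]
    conv_rhs => rw [eq_C_of_natDegree_eq_zero (hr 0).1]
    rw [← C_mul]
    simp [h1]
  | succ m ih =>
    intro p hp
    have h1 : (r (m + 1)).coeff (m + 1) ≠ 0 := by
      have := leadingCoeff_ne_zero.2 (hr (m + 1)).2
      rwa [leadingCoeff, (hr (m + 1)).1] at this
    set a : ℝ := p.coeff (m + 1) / (r (m + 1)).coeff (m + 1) with ha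
    obtain ⟨c, hc⟩ := ih (p - C a * r (m + 1)) (by
      refine natDegree_le_iff_coeff_eq_zero.2 fun k hk => ?_
      rcases (Nat.succ_le_of_lt hk).eq_or_lt with h | h
      · rw [← h, Nat.succ_eq_add_one, coeff_sub, coeff_C_mul, ha, div_mul_cancel₀ _ h1, sub_self]
      · rw [coeff_sub, coeff_C_mul, coeff_eq_zero_of_natDegree_lt (hp.trans_lt h),
          coeff_eq_zero_of_natDegree_lt ((hr (m + 1)).1.trans_lt h), mul_zero, sub_zero])
    refine ⟨Function.update c (m + 1) a, ?_⟩
    rw [Finset.sum_range_succ, Function.update_self, Finset.sum_congr rfl fun b hb => by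
      rw [Function.update_of_ne (Finset.mem_range.1 hb).ne], ← hc]
    ring

variable {N : ℕ}

/-- Tensor polynomials of total degree at most `n` are combinations of the tensor products, of
total degree at most `n`, of any families of polynomials with one member of each degree. -/
theorem exists_tensorPoly_eq_sum {r : Fin N → ℕ → ℝ[X]}
    (hr : ∀ k b, (r k b).natDegree = b ∧ r k b ≠ 0) {n : ℕ} (p : Fin N → ℝ[X])
    (hp : ∑ k, (p k).natDegree ≤ n) :
    ∃ m : (Fin N → ℕ) → ℝ, ∀ z, tensorPoly p z =
      ∑ β ∈ multiIndices N n, m β * tensorPoly (fun k => r k (β k)) z := by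
  classical
  choose c hc using fun k => exists_eq_sum_of_natDegree_le (hr k) _ (p k) le_rfl
  set S := Fintype.piFinset fun k => Finset.range ((p k).natDegree + 1) with hS
  refine ⟨fun β => if β ∈ S then ∏ k, c k (β k) else 0, fun z => ?_⟩
  have hsub : S ⊆ multiIndices N n := by
    intro β hβ
    refine mem_multiIndices.2 ((Finset.sum_le_sum fun k _ => ?_).trans hp)
    have := Fintype.mem_piFinset.1 hβ k
    simpa [Nat.lt_succ_iff] using this
  rw [← Finset.sum_subset hsub fun β _ hβ => by beta_reduce; rw [if_neg hβ, zero_mul]]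
  have h1 : tensorPoly p z = ∏ k, ∑ b ∈ Finset.range ((p k).natDegree + 1),
      c k b * (r k b).eval (z k) := by
    rw [tensorPoly]
    refine Finset.prod_congr rfl fun k _ => ?_
    conv_lhs => rw [hc k]
    simp [eval_finsetSum]
  rw [h1, Finset.prod_univ_sum]
  refine Finset.sum_congr rfl fun β hβ => ?_
  beta_reduce
  rw [if_pos hβ, tensorPoly, Finset.prod_mul_distrib]

variable (law : Fin N → NoiseLaw) [∀ i, IsProbabilityMeasure (law i).measure]

theorem exists_tensorPoly_eq_sum_chaos {n : ℕ} (p : Fin N → ℝ[X])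
    (hp : ∑ k, (p k).natDegree ≤ n) :
    ∃ m : (Fin N → ℕ) → ℝ, ∀ z, tensorPoly p z =
      ∑ β ∈ multiIndices N n, m β * chaos law β z :=
  exists_tensorPoly_eq_sum (r := fun k => (law k).orthPoly)
    (fun k b => ⟨(law k).natDegree_orthPoly b, (law k).orthPoly_ne_zero b⟩) p hp

theorem exists_chaos_eq_sum {n : ℕ} {α : Fin N → ℕ} (hα : α ∈ multiIndices N n) :
    ∃ m : (Fin N → ℕ) → ℝ, ∀ z, chaos law α z =
      ∑ β ∈ multiIndices N n, m β * ∏ k, z k ^ β k := by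
  obtain ⟨m, hm⟩ := exists_tensorPoly_eq_sum (N := N) (r := fun _ b => X ^ b)
    (fun k b => ⟨natDegree_X_pow b, pow_ne_zero _ X_ne_zero⟩)
    (fun k => (law k).orthPoly (α k)) (n := n) (by
      simp only [NoiseLaw.natDegree_orthPoly]
      exact mem_multiIndices.1 hα)
  refine ⟨m, fun z => ?_⟩
  rw [chaos, hm]
  simp [tensorPoly]

theorem exists_integrable_exp_dual (L : (Fin N → ℝ) →L[ℝ] ℝ) :
    ∃ δ : ℝ, 0 < δ ∧ ∀ t, |t| < δ → MemLp (fun z => Real.exp (t * L z)) 2 (piLaw law) := by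
  choose c hc hi using fun i => (law i).exists_integrable_exp
  set v : Fin N → ℝ := fun i => L (Pi.single i 1) with hv
  have hL : ∀ z, L z = ∑ i, z i * v i := by
    intro z
    have : z = ∑ i, z i • (Pi.single i (1 : ℝ) : Fin N → ℝ) := by
      ext k
      simp [Finset.sum_apply, Pi.single_apply]
    conv_lhs => rw [this]
    simp [hv]
  obtain ⟨δ, hδ, hδv⟩ : ∃ δ : ℝ, 0 < δ ∧ ∀ i, 2 * δ * |v i| ≤ c i := by
    have h1 : ∀ᶠ δ : ℝ in 𝓝[>] 0, ∀ i, 2 * δ * |v i| < c i := by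
      refine eventually_all.2 fun i => ?_
      have : Tendsto (fun δ : ℝ => 2 * δ * |v i|) (𝓝[>] 0) (𝓝 (2 * 0 * |v i|)) :=
        tendsto_nhdsWithin_of_tendsto_nhds (Continuous.tendsto (by fun_prop) 0)
      exact this.eventually_lt_const (by simpa using hc i)
    obtain ⟨δ, h2, h3⟩ := (h1.and self_mem_nhdsWithin).exists
    exact ⟨δ, h3, fun i => (h2 i).le⟩
  refine ⟨δ, hδ, fun t ht => ?_⟩
  have hm : Continuous fun z => Real.exp (t * L z) := by fun_prop
  rw [memLp_two_iff_integrable_sq hm.aestronglyMeasurable]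
  have h4 : Integrable (fun z : Fin N → ℝ => ∏ i, Real.exp (c i * |z i|)) (piLaw law) :=
    Integrable.fintype_prod_dep hi
  refine h4.mono' (by fun_prop) (Eventually.of_forall fun z => ?_)
  rw [← Real.exp_sum, Real.norm_eq_abs, abs_of_nonneg (by positivity), ← Real.exp_nat_mul, hL]
  refine Real.exp_le_exp.2 ?_
  rw [Finset.mul_sum, Finset.mul_sum]
  refine Finset.sum_le_sum fun i _ => ?_
  calc ((2 : ℕ) : ℝ) * (t * (z i * v i)) ≤ |((2 : ℕ) : ℝ) * (t * (z i * v i))| := le_abs_self _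
    _ = (2 * |t| * |v i|) * |z i| := by
        simp only [abs_mul, Nat.cast_ofNat, abs_two]
        ring
    _ ≤ (2 * δ * |v i|) * |z i| := by gcongr
    _ ≤ c i * |z i| := by
        gcongr
        exact hδv i

variable {law} in
/-- Because the law has exponential moments, a square integrable scalar function that is orthogonal
to all polynomials vanishes: the analytic functions `ζ ↦ ∫ exp (ζ L) h^±` agree near `0`, hence at
`ζ = i`, and `h^+`, `h^-` have the same characteristic function. -/
theorem ae_eq_zero_of_integral_tensorPoly_mul {h : (Fin N → ℝ) → ℝ} (hh : MemLp h 2 (piLaw law))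
    (h0 : ∀ q, ∫ z, tensorPoly q z * h z ∂(piLaw law) = 0) : h =ᵐ[piLaw law] 0 := by
  set μ := piLaw law with hμ
  have hint : Integrable h μ := hh.integrable one_le_two
  have hpos : AEMeasurable (fun z => ENNReal.ofReal (h z)) μ :=
    hint.aestronglyMeasurable.aemeasurable.ennreal_ofReal
  have hneg : AEMeasurable (fun z => ENNReal.ofReal (-h z)) μ :=
    hint.neg.aestronglyMeasurable.aemeasurable.ennreal_ofReal
  have hposfin : ∫⁻ z, ENNReal.ofReal (h z) ∂μ ≠ ⊤ := hint.lintegral_lt_top.ne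
  have hnegfin : ∫⁻ z, ENNReal.ofReal (-h z) ∂μ ≠ ⊤ := hint.neg.lintegral_lt_top.ne
  set ν₁ := μ.withDensity fun z => ENNReal.ofReal (h z) with hν₁
  set ν₂ := μ.withDensity fun z => ENNReal.ofReal (-h z) with hν₂
  have : IsFiniteMeasure ν₁ := isFiniteMeasure_withDensity hposfin
  have : IsFiniteMeasure ν₂ := isFiniteMeasure_withDensity hnegfin
  -- integrability against `ν₁` and `ν₂` of functions that are square integrable for `μ`
  have hi : ∀ (s : ℝ), |s| ≤ 1 → ∀ {F : Type} [NormedAddCommGroup F] [NormedSpace ℝ F]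
      (f : (Fin N → ℝ) → F), MemLp f 2 μ →
      Integrable (fun z => (ENNReal.ofReal (s * h z)).toReal • f z) μ := by
    intro s hs F _ _ f hf
    refine integrable_smul_of_memLp ?_ hf
    refine (hh.norm).mono ?_ (Eventually.of_forall fun z => ?_)
    · exact ((hint.const_mul s).aestronglyMeasurable.aemeasurable.ennreal_ofReal.ennreal_toReal
        ).aestronglyMeasurable
    · rw [ENNReal.toReal_ofReal', Real.norm_eq_abs, abs_of_nonneg (le_max_right _ _), norm_norm,
        Real.norm_eq_abs]
      refine max_le ((le_abs_self _).trans ?_) (abs_nonneg _)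
      rw [abs_mul]
      exact mul_le_of_le_one_left (abs_nonneg _) hs
  have hi₁ : ∀ {F : Type} [NormedAddCommGroup F] [NormedSpace ℝ F] (f : (Fin N → ℝ) → F),
      MemLp f 2 μ → Integrable (fun z => (ENNReal.ofReal (h z)).toReal • f z) μ := by
    intro F _ _ f hf
    simpa using hi 1 (by simp) f hf
  have hi₂ : ∀ {F : Type} [NormedAddCommGroup F] [NormedSpace ℝ F] (f : (Fin N → ℝ) → F),
      MemLp f 2 μ → Integrable (fun z => (ENNReal.ofReal (-h z)).toReal • f z) μ := by
    intro F _ _ f hf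
    simpa using hi (-1) (by simp) f hf
  -- the difference of the integrals against `ν₁` and `ν₂`
  have hdiff : ∀ f : (Fin N → ℝ) → ℂ, MemLp f 2 μ →
      ∫ z, f z ∂ν₁ - ∫ z, f z ∂ν₂ = ∫ z, h z • f z ∂μ := by
    intro f hf
    rw [hν₁, hν₂, integral_withDensity_eq_integral_toReal_smul₀ hpos (by simp),
      integral_withDensity_eq_integral_toReal_smul₀ hneg (by simp),
      ← integral_sub (hi₁ f hf) (hi₂ f hf)]
    refine integral_congr_ae (Eventually.of_forall fun z => ?_)
    simp only [ENNReal.toReal_ofReal', ← sub_smul]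
    congr 1
    rcases le_total 0 (h z) with h1 | h1
    · rw [max_eq_left h1, max_eq_right (by linarith), sub_zero]
    · rw [max_eq_right h1, max_eq_left (by linarith), zero_sub, neg_neg]
  have key : ν₁ = ν₂ := by
    refine Measure.ext_of_charFunDual ?_
    ext L
    obtain ⟨δ, hδ, hexp⟩ := exists_integrable_exp_dual law L
    have hsub₁ : ∀ t, |t| < δ → t ∈ integrableExpSet (fun z => L z) ν₁ := by
      intro t ht
      rw [integrableExpSet, mem_ofPred_eq, hν₁, integrable_withDensity_iff_integrable_smul₀' hpos
        (by simp)]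
      exact hi₁ _ (hexp t ht)
    have hsub₂ : ∀ t, |t| < δ → t ∈ integrableExpSet (fun z => L z) ν₂ := by
      intro t ht
      rw [integrableExpSet, mem_ofPred_eq, hν₂, integrable_withDensity_iff_integrable_smul₀' hneg
        (by simp)]
      exact hi₂ _ (hexp t ht)
    have hint₁ : ∀ t, |t| < δ → t ∈ interior (integrableExpSet (fun z => L z) ν₁) := fun t ht =>
      mem_interior.2 ⟨Ioo (-δ) δ, fun s hs => hsub₁ s (abs_lt.2 hs), isOpen_Ioo, abs_lt.1 ht⟩
    have hint₂ : ∀ t, |t| < δ → t ∈ interior (integrableExpSet (fun z => L z) ν₂) := fun t ht =>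
      mem_interior.2 ⟨Ioo (-δ) δ, fun s hs => hsub₂ s (abs_lt.2 hs), isOpen_Ioo, abs_lt.1 ht⟩
    set U : Set ℂ := Complex.re ⁻¹' Ioo (-δ) δ with hU
    have hUpre : IsPreconnected U :=
      ((convex_Ioo (-δ) δ).linear_preimage Complex.reLm).isPreconnected
    have ha₁ : AnalyticOnNhd ℂ (complexMGF (fun z => L z) ν₁) U := fun ζ hζ =>
      analyticAt_complexMGF (hint₁ _ (abs_lt.2 hζ))
    have ha₂ : AnalyticOnNhd ℂ (complexMGF (fun z => L z) ν₂) U := fun ζ hζ =>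
      analyticAt_complexMGF (hint₂ _ (abs_lt.2 hζ))
    have h0U : (0 : ℂ) ∈ U := by simp [hU, hδ]
    -- all moments of `L` agree
    have hmom : ∀ (n : ℕ) (q : Fin N → ℝ[X]), Integrable (fun z => L z ^ n * tensorPoly q z * h z) μ ∧
        MemLp (fun z => L z ^ n * tensorPoly q z) 2 μ ∧
        ∫ z, L z ^ n * tensorPoly q z * h z ∂μ = 0 := by
      set v : Fin N → ℝ := fun i => L (Pi.single i 1) with hv
      have hL : ∀ z, L z = ∑ i, z i * v i := by
        intro z
        have : z = ∑ i, z i • (Pi.single i (1 : ℝ) : Fin N → ℝ) := by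
          ext k
          simp [Finset.sum_apply, Pi.single_apply]
        conv_lhs => rw [this]
        simp [hv]
      intro n
      induction n with
      | zero =>
        intro q
        simp only [pow_zero, one_mul]
        exact ⟨integrable_smul_of_memLp (memLp_tensorPoly law q) hh, memLp_tensorPoly law q, h0 q⟩
      | succ n ih =>
        intro q
        have h1 : ∀ z, L z ^ (n + 1) * tensorPoly q z =
            ∑ i, v i * (L z ^ n * tensorPoly (Function.update q i (X * q i)) z) := by
          intro z
          have h2 : ∀ i, tensorPoly (Function.update q i (X * q i)) z = z i * tensorPoly q z := by
            intro i
            have h3 := tensorPoly_update q i (q i) z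
            rw [Function.update_eq_self] at h3
            rw [tensorPoly_update, h3, eval_mul, eval_X, mul_assoc]
          simp_rw [h2]
          rw [pow_succ]
          conv_lhs => rw [mul_assoc, hL z, Finset.sum_mul, Finset.mul_sum]
          refine Finset.sum_congr rfl fun i _ => ?_
          rw [← hL z]
          ring
        have hL2 : MemLp (fun z => L z ^ (n + 1) * tensorPoly q z) 2 μ := by
          simp_rw [h1]
          exact memLp_finsetSum _ fun i _ => (ih _).2.1.const_mul _
        refine ⟨integrable_smul_of_memLp hL2 hh, hL2, ?_⟩
        simp_rw [h1, Finset.sum_mul, mul_assoc (v _)]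
        rw [integral_finsetSum _ fun i _ => (ih _).1.const_mul _]
        simp_rw [integral_const_mul, (ih _).2.2, mul_zero, Finset.sum_const_zero]
    have hder : ∀ n, iteratedDeriv n (complexMGF (fun z => L z) ν₁) 0 =
        iteratedDeriv n (complexMGF (fun z => L z) ν₂) 0 := by
      intro n
      rw [iteratedDeriv_complexMGF (hint₁ _ (by simpa using hδ)),
        iteratedDeriv_complexMGF (hint₂ _ (by simpa using hδ)), ← sub_eq_zero]
      have hone : ∀ z : Fin N → ℝ, tensorPoly (fun _ => 1) z = 1 := fun z => by simp [tensorPoly]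
      obtain ⟨-, hm2, hm3⟩ := hmom n fun _ => 1
      simp only [hone, mul_one] at hm2 hm3
      have hm4 : MemLp (fun z => ((L z : ℝ) : ℂ) ^ n * Complex.exp (0 * (L z : ℂ))) 2 μ := by
        have := (hm2.ofReal (K := ℂ))
        refine this.congr_norm ?_ ?_
        · fun_prop
        · exact Eventually.of_forall fun z => by simp
      rw [hdiff _ hm4]
      have : ∀ z, h z • (((L z : ℝ) : ℂ) ^ n * Complex.exp (0 * (L z : ℂ))) =
          ((L z ^ n * h z : ℝ) : ℂ) := by
        intro z
        simp [mul_comm]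
      simp_rw [this]
      rw [integral_complex_ofReal, hm3, Complex.ofReal_zero]
    have hev : complexMGF (fun z => L z) ν₁ =ᶠ[𝓝 0] complexMGF (fun z => L z) ν₂ := by
      have e₁ := (ha₁ 0 h0U).hasFPowerSeriesAt
      have e₂ := (ha₂ 0 h0U).hasFPowerSeriesAt
      simp_rw [hder] at e₁
      filter_upwards [e₁.eventually_hasSum, e₂.eventually_hasSum] with y h1 h2
      simpa using h1.unique h2
    have hI : Complex.I ∈ U := by simp [hU, hδ]
    have := ha₁.eqOn_of_preconnected_of_eventuallyEq ha₂ hUpre h0U hev hI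
    rw [charFunDual_apply, charFunDual_apply]
    simpa [complexMGF, mul_comm] using this
  have h1 := (withDensity_eq_iff hpos hneg hposfin).1 key
  filter_upwards [h1] with z hz
  rcases le_total 0 (h z) with h2 | h2
  · rw [ENNReal.ofReal_of_nonpos (p := -h z) (by linarith), ENNReal.ofReal_eq_zero] at hz
    exact le_antisymm hz h2
  · rw [ENNReal.ofReal_of_nonpos h2, eq_comm, ENNReal.ofReal_eq_zero] at hz
    simp only [Pi.zero_apply]
    linarith

variable {law} in
/-- Completeness of the polynomial chaos. -/
theorem ae_eq_zero_of_coef_eq_zero {E : Type*} [NormedAddCommGroup E] [InnerProductSpace ℝ E]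
    [CompleteSpace E] [SecondCountableTopology E] {f : (Fin N → ℝ) → E}
    (hf : MemLp f 2 (piLaw law)) (h0 : ∀ α, coef law f α = 0) : f =ᵐ[piLaw law] 0 := by
  refine ae_eq_zero_of_forall_inner (𝕜 := ℝ) fun e => ?_
  refine ae_eq_zero_of_integral_tensorPoly_mul (hf.const_inner e) fun q => ?_
  obtain ⟨m, hm⟩ := exists_tensorPoly_eq_sum_chaos law q le_rfl
  have h1 : ∀ β, Integrable (fun z => chaos law β z • f z) (piLaw law) := fun β =>
    integrable_smul_of_memLp (memLp_chaos law β) hf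
  have h2 : ∀ z, tensorPoly q z * inner ℝ e (f z) =
      ∑ β ∈ multiIndices N (∑ k, (q k).natDegree), m β * inner ℝ e (chaos law β z • f z) := by
    intro z
    rw [hm, Finset.sum_mul]
    refine Finset.sum_congr rfl fun β _ => ?_
    rw [real_inner_smul_right, mul_assoc]
  simp_rw [h2]
  rw [integral_finsetSum _ fun β _ => ((h1 β).const_inner e).const_mul _]
  refine Finset.sum_eq_zero fun β _ => ?_
  have h3 : ∫ z, inner ℝ e (chaos law β z • f z) ∂(piLaw law) = inner ℝ e (coef law f β) :=
    integral_inner (h1 β) e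
  rw [integral_const_mul, h3, h0, inner_zero_right, mul_zero]

end RandomEvolution

/-! ### The polynomial chaos projection and its rate of convergence -/

namespace RandomEvolution

theorem toReal_eLpNorm_sq {X : Type*} [MeasurableSpace X] {μ : Measure X} {E : Type*}
    [NormedAddCommGroup E] {f : X → E} (hf : MemLp f 2 μ) :
    (eLpNorm f 2 μ).toReal ^ 2 = ∫ x, ‖f x‖ ^ 2 ∂μ := by
  rw [hf.eLpNorm_eq_integral_rpow_norm two_ne_zero ENNReal.ofNat_ne_top,
    ENNReal.toReal_ofReal (by positivity), ← Real.rpow_natCast _ 2, ← Real.rpow_mul (by positivity)]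
  simp

theorem norm_Lp_sq {X : Type*} [MeasurableSpace X] {μ : Measure X} {E : Type*}
    [NormedAddCommGroup E] (f : Lp E 2 μ) : ‖f‖ ^ 2 = ∫ x, ‖f x‖ ^ 2 ∂μ := by
  rw [Lp.norm_def, toReal_eLpNorm_sq (Lp.memLp f)]

variable {N : ℕ} (law : Fin N → NoiseLaw)

/-- The constant in the polynomial chaos approximation estimate: the sum covers the eigenvalue
products of order `k` both above and below the degree `2 * k`, and the factor `N ^ k` comes from
passing from the total degree to the largest component. -/
noncomputable def chaosConst (k : ℕ) : ℝ :=
  (N : ℝ) ^ k * ∑ i, ((2 / (law i).slope) ^ k + (2 * k) ^ k)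

theorem chaosConst_nonneg (k : ℕ) : 0 ≤ chaosConst law k := by
  have := fun i => (law i).slope_pos
  exact mul_nonneg (by positivity) (Finset.sum_nonneg fun i _ => by have := this i; positivity)

variable [∀ i, IsProbabilityMeasure (law i).measure]

theorem integral_chaos_mul (α β : Fin N → ℕ) :
    ∫ z, chaos law α z * chaos law β z ∂(piLaw law) = if α = β then 1 else 0 := by
  have h1 : ∀ z, chaos law α z * chaos law β z =
      tensorPoly (fun k => (law k).orthPoly (α k) * (law k).orthPoly (β k)) z := fun z => by
    rw [chaos, chaos, tensorPoly_mul]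
    rfl
  simp_rw [h1]
  rw [integral_tensorPoly]
  simp_rw [NoiseLaw.integral_orthPoly_mul]
  by_cases h : α = β
  · simp [h]
  · obtain ⟨k, hk⟩ := Function.ne_iff.1 h
    rw [if_neg h]
    exact Finset.prod_eq_zero (Finset.mem_univ k) (if_neg hk)

section Projection

variable {E : Type*} [NormedAddCommGroup E] [NormedSpace ℝ E]

/-- The truncated polynomial chaos expansion of `f`, of total degree at most `n`. -/
noncomputable def chaosSum (n : ℕ) (f : (Fin N → ℝ) → E) (z : Fin N → ℝ) : E :=
  ∑ α ∈ multiIndices N n, chaos law α z • coef law f α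

theorem memLp_chaosSum (n : ℕ) (f : (Fin N → ℝ) → E) : MemLp (chaosSum law n f) 2 (piLaw law) :=
  memLp_sum_smul (memLp_chaos law) _ _

theorem coef_congr {f g : (Fin N → ℝ) → E} (h : f =ᵐ[piLaw law] g) : coef law f = coef law g := by
  ext α
  refine integral_congr_ae ?_
  filter_upwards [h] with z hz
  rw [hz]

theorem chaosSum_congr {f g : (Fin N → ℝ) → E} (h : f =ᵐ[piLaw law] g) (n : ℕ) :
    chaosSum law n f = chaosSum law n g := by
  ext z
  simp only [chaosSum, coef_congr law h]

theorem coef_sub {f g : (Fin N → ℝ) → E} (hf : MemLp f 2 (piLaw law))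
    (hg : MemLp g 2 (piLaw law)) (α : Fin N → ℕ) :
    coef law (fun z => f z - g z) α = coef law f α - coef law g α := by
  simp only [coef, smul_sub]
  exact integral_sub (integrable_smul_of_memLp (memLp_chaos law α) hf)
    (integrable_smul_of_memLp (memLp_chaos law α) hg)

theorem coef_clm {F : Type*} [NormedAddCommGroup F] [NormedSpace ℝ F] [CompleteSpace E]
    [CompleteSpace F] (T : E →L[ℝ] F) {f : (Fin N → ℝ) → E} (hf : MemLp f 2 (piLaw law))
    (α : Fin N → ℕ) : coef law (fun z => T (f z)) α = T (coef law f α) := by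
  rw [coef, coef, ← T.integral_comp_comm
    (integrable_smul_of_memLp (memLp_chaos law α) hf)]
  simp only [map_smul]

theorem chaosSum_clm {F : Type*} [NormedAddCommGroup F] [NormedSpace ℝ F] [CompleteSpace E]
    [CompleteSpace F] (T : E →L[ℝ] F) {f : (Fin N → ℝ) → E} (hf : MemLp f 2 (piLaw law))
    (n : ℕ) (z : Fin N → ℝ) : chaosSum law n (fun z => T (f z)) z = T (chaosSum law n f z) := by
  simp only [chaosSum, coef_clm law T hf, map_sum, map_smul]

variable [CompleteSpace E]

theorem coef_sum_chaos_smul (S : Finset (Fin N → ℕ)) (c : (Fin N → ℕ) → E) (β : Fin N → ℕ) :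
    coef law (fun z => ∑ α ∈ S, chaos law α z • c α) β = if β ∈ S then c β else 0 := by
  have h1 : ∀ α, Integrable (fun z => chaos law β z * chaos law α z) (piLaw law) := fun α =>
    integrable_smul_of_memLp (memLp_chaos law β) (memLp_chaos law α)
  simp only [coef, Finset.smul_sum, smul_smul]
  rw [integral_finsetSum _ fun α _ => (h1 α).smul_const _]
  simp_rw [integral_smul_const, integral_chaos_mul]
  simp

theorem coef_sub_chaosSum {n : ℕ} {f : (Fin N → ℝ) → E} (hf : MemLp f 2 (piLaw law))
    {α : Fin N → ℕ} (hα : α ∈ multiIndices N n) :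
    coef law (fun z => f z - chaosSum law n f z) α = 0 := by
  rw [coef_sub law hf (memLp_chaosSum law n f)]
  have := coef_sum_chaos_smul law (multiIndices N n) (coef law f) α
  rw [if_pos hα] at this
  exact sub_eq_zero.2 this.symm

/-- A linear combination of chaos polynomials of degree at most `n` with
coefficients in `E` is an element of `polySubspace`. -/
theorem mem_polySubspace_of_ae_eq {𝕜 : Type*} [RCLike 𝕜] {E : Type*} [NormedAddCommGroup E]
    [InnerProductSpace 𝕜 E] [NormedSpace ℝ E] [IsScalarTower ℝ 𝕜 E]
    {n : ℕ} {f : Lp E 2 (piLaw law)} {e : (Fin N → ℕ) → E}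
    (hf : f =ᵐ[piLaw law] fun z => ∑ α ∈ multiIndices N n, chaos law α z • e α) :
    f ∈ polySubspace (piLaw law) 𝕜 E n := by
  choose! m hm using fun α (hα : α ∈ multiIndices N n) => exists_chaos_eq_sum law hα
  refine ⟨fun β => ∑ α ∈ multiIndices N n, m α β • e α, ?_⟩
  filter_upwards [hf] with z hz
  rw [hz]
  simp only [← RCLike.real_smul_eq_coe_smul (K := 𝕜), Finset.smul_sum]
  rw [Finset.sum_comm]
  refine Finset.sum_congr rfl fun α hα => ?_
  rw [hm α hα, Finset.sum_smul]
  refine Finset.sum_congr rfl fun β _ => ?_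
  rw [smul_smul, mul_comm]

/-- The truncated polynomial chaos expansion is the orthogonal projection onto the vector-valued
polynomials. -/
theorem starProjection_polySubspace {𝕜 : Type*} [RCLike 𝕜] {E : Type*} [NormedAddCommGroup E]
    [InnerProductSpace 𝕜 E] [NormedSpace ℝ E] [IsScalarTower ℝ 𝕜 E] [CompleteSpace E]
    (n : ℕ) (f : Lp E 2 (piLaw law)) :
    (polySubspace (piLaw law) 𝕜 E n).topologicalClosure.starProjection f =
      (memLp_chaosSum law n f).toLp := by
  have hreal : ∀ (r : ℝ) (e : E), r • e = (r : 𝕜) • e := fun r e => RCLike.real_smul_eq_coe_smul r e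
  refine Submodule.eq_starProjection_of_mem_orthogonal ?_ ?_
  · exact Submodule.le_topologicalClosure _
      (mem_polySubspace_of_ae_eq law (memLp_chaosSum law n f).coeFn_toLp)
  · rw [Submodule.orthogonal_closure, Submodule.mem_orthogonal]
    rintro w ⟨c, hc⟩
    choose! m hm using fun β (hβ : β ∈ multiIndices N n) =>
      exists_tensorPoly_eq_sum_chaos law (n := n) (fun k => Polynomial.X ^ β k) (by
        simp only [Polynomial.natDegree_X_pow]
        exact mem_multiIndices.1 hβ)
    have hg : MemLp (fun z => f z - chaosSum law n f z) 2 (piLaw law) :=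
      (Lp.memLp f).sub (memLp_chaosSum law n f)
    set d : (Fin N → ℕ) → E := fun α => ∑ β ∈ multiIndices N n, m β α • c β with hd
    have h1 : (fun z => inner 𝕜 (w z) ((f - (memLp_chaosSum law n f).toLp) z)) =ᵐ[piLaw law]
        fun z => ∑ α ∈ multiIndices N n,
          inner 𝕜 (d α) (chaos law α z • (f z - chaosSum law n f z)) := by
      filter_upwards [hc, Lp.coeFn_sub f (memLp_chaosSum law n f).toLp,
        (memLp_chaosSum law n f).coeFn_toLp] with z h1 h2 h3
      have h5 : ∀ (α : Fin N → ℕ) (g : E), inner 𝕜 (d α) (chaos law α z • g) =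
          inner 𝕜 (chaos law α z • d α) g := by
        intro α g
        rw [hreal, hreal, inner_smul_left, inner_smul_right, RCLike.conj_ofReal]
      simp_rw [h5]
      rw [h1, h2, Pi.sub_apply, h3, ← sum_inner]
      congr 1
      simp only [hd, Finset.smul_sum]
      rw [Finset.sum_comm]
      refine Finset.sum_congr rfl fun β hβ => ?_
      have h4 := hm β hβ z
      simp only [tensorPoly, Polynomial.eval_pow, Polynomial.eval_X] at h4
      rw [h4, ← hreal, Finset.sum_smul]
      refine Finset.sum_congr rfl fun α _ => ?_
      rw [smul_smul, mul_comm]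
    have h2 : ∀ α, Integrable (fun z => chaos law α z • (f z - chaosSum law n f z)) (piLaw law) :=
      fun α => integrable_smul_of_memLp (memLp_chaos law α) hg
    rw [L2.inner_def, integral_congr_ae h1, integral_finsetSum _ fun α _ => (h2 α).const_inner _]
    refine Finset.sum_eq_zero fun α hα => ?_
    have h3 := coef_sub_chaosSum law (Lp.memLp f) hα
    rw [coef] at h3
    rw [integral_inner (h2 α), h3, inner_zero_right]

end Projection

section Convergence

variable {E : Type*} [NormedAddCommGroup E] [InnerProductSpace ℝ E]

theorem integral_norm_chaosSum_sq (f : (Fin N → ℝ) → E) (n : ℕ) :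
    ∫ z, ‖chaosSum law n f z‖ ^ 2 ∂(piLaw law) =
      ∑ α ∈ multiIndices N n, ‖coef law f α‖ ^ 2 := by
  have := integral_norm_sum_smul_sq (memLp_chaos law) (integral_chaos_mul law)
    (multiIndices N n) (coef law f)
  simpa [chaosSum] using this

variable [CompleteSpace E]

variable {law} in
theorem integral_norm_sub_chaosSum_sq {f : (Fin N → ℝ) → E} (hf : MemLp f 2 (piLaw law)) (n : ℕ) :
    ∫ z, ‖f z - chaosSum law n f z‖ ^ 2 ∂(piLaw law) =
      ∫ z, ‖f z‖ ^ 2 ∂(piLaw law) - ∑ α ∈ multiIndices N n, ‖coef law f α‖ ^ 2 := by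
  have := integral_norm_sub_sum_smul_sq (memLp_chaos law) (integral_chaos_mul law) hf
    (c := coef law f) (fun α => by rw [one_smul, coef]) (multiIndices N n)
  simpa [chaosSum] using this

theorem sum_norm_coef_sq_le {f : (Fin N → ℝ) → E} (hf : MemLp f 2 (piLaw law))
    (S : Finset (Fin N → ℕ)) :
    ∑ α ∈ S, ‖coef law f α‖ ^ 2 ≤ ∫ z, ‖f z‖ ^ 2 ∂(piLaw law) := by
  have := sum_mul_norm_sq_le_integral (memLp_chaos law) (integral_chaos_mul law) hf
    (c := coef law f) (fun α => by rw [one_smul, coef]) S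
  simpa using this

theorem multiIndices_mono {m n : ℕ} (h : m ≤ n) : multiIndices N m ⊆ multiIndices N n :=
  fun _ hα => mem_multiIndices.2 ((mem_multiIndices.1 hα).trans h)

variable {law} in
theorem tendsto_integral_norm_sub_chaosSum_sq [SecondCountableTopology E] {f : (Fin N → ℝ) → E}
    (hf : MemLp f 2 (piLaw law)) :
    Tendsto (fun n => ∫ z, ‖f z - chaosSum law n f z‖ ^ 2 ∂(piLaw law)) atTop (𝓝 0) := by
  set U : ℕ → Submodule ℝ (Lp E 2 (piLaw law)) := fun n =>
    (polySubspace (piLaw law) ℝ E n).topologicalClosure with hU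
  have hproj : ∀ n (g : Lp E 2 (piLaw law)), (U n).starProjection g =
      (memLp_chaosSum law n g).toLp := starProjection_polySubspace law
  have hmono : Monotone U := by
    intro m n hmn
    refine Submodule.topologicalClosure_mono ?_
    rintro g ⟨c, hc⟩
    refine ⟨fun α => if α ∈ multiIndices N m then c α else 0, ?_⟩
    filter_upwards [hc] with z hz
    rw [hz, ← Finset.sum_subset (multiIndices_mono hmn) fun α _ hα => by
      rw [if_neg hα, smul_zero]]
    exact Finset.sum_congr rfl fun α hα => by rw [if_pos hα]
  have hdense : ⊤ ≤ (⨆ n, U n).topologicalClosure := by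
    rw [top_le_iff, Submodule.topologicalClosure_eq_top_iff, Submodule.eq_bot_iff]
    intro g hg
    have h1 : ∀ n, (U n).starProjection g = 0 := fun n =>
      (Submodule.starProjection_apply_eq_zero_iff _).2
        (Submodule.orthogonal_le (le_iSup U n) hg)
    refine (Lp.eq_zero_iff_ae_eq_zero).2 (ae_eq_zero_of_coef_eq_zero (Lp.memLp g) fun α => ?_)
    have h2 := h1 (∑ i, α i)
    rw [hproj] at h2
    have h3 : ∫ z, ‖chaosSum law (∑ i, α i) g z‖ ^ 2 ∂(piLaw law) = 0 := by
      rw [← toReal_eLpNorm_sq (memLp_chaosSum law _ g), ← Lp.norm_toLp _ (memLp_chaosSum law _ g),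
        h2]
      simp
    rw [integral_norm_chaosSum_sq, Finset.sum_eq_zero_iff_of_nonneg fun _ _ => by positivity] at h3
    simpa using h3 α (mem_multiIndices.2 le_rfl)
  have h1 := Submodule.starProjection_tendsto_self U hmono hf.toLp hdense
  have h2 : Tendsto (fun n => ‖hf.toLp - (U n).starProjection hf.toLp‖ ^ 2) atTop (𝓝 0) := by
    have := (tendsto_const_nhds (x := hf.toLp)).sub h1
    simpa using (this.norm.pow 2)
  refine h2.congr fun n => ?_
  rw [hproj, norm_Lp_sq]
  refine integral_congr_ae ?_
  filter_upwards [Lp.coeFn_sub hf.toLp (memLp_chaosSum law n hf.toLp).toLp,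
    (memLp_chaosSum law n hf.toLp).coeFn_toLp, hf.coeFn_toLp] with z h3 h4 h5
  rw [h3, Pi.sub_apply, h4, h5, chaosSum_congr law hf.coeFn_toLp]

/-- Large multi-indices have a large eigenvalue product in one of the directions. -/
theorem pow_le_sum_eigenvalueProd {n k : ℕ} {α : Fin N → ℕ} (hα : α ∉ multiIndices N n) :
    (n : ℝ) ^ k ≤ (N : ℝ) ^ k *
      ∑ i, ((2 / (law i).slope) ^ k * (law i).eigenvalueProd (α i) k + (2 * k) ^ k) := by
  rw [mem_multiIndices, not_le] at hα
  obtain ⟨i, hi⟩ : ∃ i, n ≤ N * α i := by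
    by_contra! h
    have h1 : ∑ i, N * α i ≤ ∑ _i : Fin N, n := Finset.sum_le_sum fun i _ => (h i).le
    rw [← Finset.mul_sum, Finset.sum_const, Finset.card_univ, Fintype.card_fin, smul_eq_mul] at h1
    rcases Nat.eq_zero_or_pos N with h2 | h2
    · subst h2
      simp at hα
    · exact absurd (Nat.le_of_mul_le_mul_left h1 h2) (by omega)
  have h0 : ∀ i, 0 ≤ (2 / (law i).slope) ^ k * (law i).eigenvalueProd (α i) k + (2 * k) ^ k := by
    intro i
    have := (law i).slope_pos
    have := (law i).eigenvalueProd_nonneg (α i) k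
    positivity
  calc (n : ℝ) ^ k ≤ ((N : ℝ) * α i) ^ k := by
        gcongr
        exact_mod_cast hi
    _ = (N : ℝ) ^ k * (α i : ℝ) ^ k := mul_pow _ _ _
    _ ≤ (N : ℝ) ^ k * ((2 / (law i).slope) ^ k * (law i).eigenvalueProd (α i) k + (2 * k) ^ k) := by
        gcongr
        exact (law i).pow_le_eigenvalueProd (α i) k
    _ ≤ _ := by
        gcongr
        exact Finset.single_le_sum (f := fun i => (2 / (law i).slope) ^ k *
          (law i).eigenvalueProd (α i) k + (2 * k) ^ k) (fun i _ => h0 i) (Finset.mem_univ i)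

variable {law} in
/-- The rate of convergence of the polynomial chaos expansion for functions with `k` weighted weak
derivatives in each coordinate direction. -/
theorem pow_mul_integral_norm_sub_chaosSum_sq_le [SecondCountableTopology E] {k : ℕ}
    {F : Fin N → ℕ → (Fin N → ℝ) → E} (hF : ∀ i, WeakChain law i k (F i)) {f : (Fin N → ℝ) → E}
    (h0 : ∀ i, F i 0 = f) (hf : MemLp f 2 (piLaw law)) (n : ℕ) :
    (n : ℝ) ^ k * ∫ z, ‖f z - chaosSum law n f z‖ ^ 2 ∂(piLaw law) ≤
      chaosConst law k * (∫ z, ‖f z‖ ^ 2 ∂(piLaw law) +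
        ∑ i, ∫ z, ‖√((law i).sigma.eval (z i)) ^ k • F i k z‖ ^ 2 ∂(piLaw law)) := by
  set Y := ∫ z, ‖f z‖ ^ 2 ∂(piLaw law) with hY
  set W : Fin N → ℝ := fun i =>
    ∫ z, ‖√((law i).sigma.eval (z i)) ^ k • F i k z‖ ^ 2 ∂(piLaw law) with hW
  have hY0 : 0 ≤ Y := integral_nonneg fun z => by positivity
  have hW0 : ∀ i, 0 ≤ W i := fun i => integral_nonneg fun z => by positivity
  -- the part of the expansion between the degrees `n` and `m`
  have h1 : ∀ m, n ≤ m → (n : ℝ) ^ k * (∑ α ∈ multiIndices N m, ‖coef law f α‖ ^ 2 -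
      ∑ α ∈ multiIndices N n, ‖coef law f α‖ ^ 2) ≤ chaosConst law k * (Y + ∑ i, W i) := by
    intro m hm
    rw [← Finset.sum_sdiff_eq_sub (multiIndices_mono hm), Finset.mul_sum]
    set S := multiIndices N m \ multiIndices N n with hS
    calc ∑ α ∈ S, (n : ℝ) ^ k * ‖coef law f α‖ ^ 2
        ≤ ∑ α ∈ S, ((N : ℝ) ^ k * ∑ i, ((2 / (law i).slope) ^ k *
          (law i).eigenvalueProd (α i) k + (2 * k) ^ k)) * ‖coef law f α‖ ^ 2 := by
          refine Finset.sum_le_sum fun α hα => ?_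
          gcongr
          exact pow_le_sum_eigenvalueProd law (Finset.mem_sdiff.1 hα).2
      _ = (N : ℝ) ^ k * ∑ i, ((2 / (law i).slope) ^ k *
          (∑ α ∈ S, (law i).eigenvalueProd (α i) k * ‖coef law f α‖ ^ 2) +
          (2 * k) ^ k * ∑ α ∈ S, ‖coef law f α‖ ^ 2) := by
          simp only [Finset.mul_sum, Finset.sum_mul, ← Finset.sum_add_distrib]
          rw [Finset.sum_comm]
          refine Finset.sum_congr rfl fun i _ => Finset.sum_congr rfl fun α _ => ?_
          ring
      _ ≤ (N : ℝ) ^ k * ∑ i, ((2 / (law i).slope) ^ k * (Y + ∑ i, W i) +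
          (2 * k) ^ k * (Y + ∑ i, W i)) := by
          have h2 : ∀ i, ∑ α ∈ S, (law i).eigenvalueProd (α i) k * ‖coef law f α‖ ^ 2 ≤
              Y + ∑ i, W i := by
            intro i
            have h3 := (hF i).sum_le le_rfl S
            rw [h0 i] at h3
            have h4 : W i ≤ ∑ i, W i :=
              Finset.single_le_sum (fun i _ => hW0 i) (Finset.mem_univ i)
            have h5 : ∑ α ∈ S, (law i).eigenvalueProd (α i) k * ‖coef law f α‖ ^ 2 ≤ W i := h3
            linarith
          have h3 : ∑ α ∈ S, ‖coef law f α‖ ^ 2 ≤ Y + ∑ i, W i := by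
            have := sum_norm_coef_sq_le law hf S
            have h4 : 0 ≤ ∑ i, W i := Finset.sum_nonneg fun i _ => hW0 i
            linarith
          gcongr with i _
          · have := (law i).slope_pos
            positivity
          · exact h2 i
      _ = chaosConst law k * (Y + ∑ i, W i) := by
          rw [chaosConst, mul_assoc, Finset.sum_mul]
          simp only [add_mul]
  have h2 : ∀ m, n ≤ m → (n : ℝ) ^ k * (∫ z, ‖f z - chaosSum law n f z‖ ^ 2 ∂(piLaw law) -
      ∫ z, ‖f z - chaosSum law m f z‖ ^ 2 ∂(piLaw law)) ≤ chaosConst law k * (Y + ∑ i, W i) := by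
    intro m hm
    refine le_of_eq_of_le ?_ (h1 m hm)
    rw [integral_norm_sub_chaosSum_sq hf, integral_norm_sub_chaosSum_sq hf]
    ring
  have h3 := ((tendsto_const_nhds (x := ∫ z, ‖f z - chaosSum law n f z‖ ^ 2 ∂(piLaw law))).sub
    (tendsto_integral_norm_sub_chaosSum_sq hf)).const_mul ((n : ℝ) ^ k)
  rw [sub_zero] at h3
  exact le_of_tendsto h3 (eventually_atTop.2 ⟨n, h2⟩)

variable {law} in
/-- Truncation of the expansion does not increase the weighted norms of the derivatives. -/
theorem WeakChain.integral_norm_chaosDeriv_sum_sq_le {i : Fin N} {k : ℕ}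
    {F : ℕ → (Fin N → ℝ) → E} (hF : WeakChain law i k F) {l : ℕ} (hl : l ≤ k) (m : ℕ) :
    ∫ z, ‖√((law i).sigma.eval (z i)) ^ l •
      ∑ α ∈ multiIndices N m, chaosDeriv law i l α z • coef law (F 0) α‖ ^ 2 ∂(piLaw law) ≤
      ∫ z, ‖√((law i).sigma.eval (z i)) ^ l • F l z‖ ^ 2 ∂(piLaw law) := by
  rw [integral_norm_chaosDeriv_sum_sq]
  exact hF.sum_le hl _

end Convergence

end RandomEvolution

/-! ### Weak differentiability of vector-valued functions of one variable -/

namespace RandomEvolution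

section WeakDerivative

variable {D H : Type*} [NormedAddCommGroup D] [NormedSpace ℝ D] [NormedAddCommGroup H]
  [NormedSpace ℝ H]

/-- `f` is differentiable at `s` with derivative `f'` in the weak topology. -/
def HasWeakDerivAt (f : ℝ → H) (f' : H) (s : ℝ) : Prop :=
  ∀ L : H →L[ℝ] ℝ, HasDerivAt (fun t => L (f t)) (L f') s

theorem HasWeakDerivAt.add {f g : ℝ → H} {f' g' : H} {s : ℝ} (hf : HasWeakDerivAt f f' s)
    (hg : HasWeakDerivAt g g' s) : HasWeakDerivAt (fun t => f t + g t) (f' + g') s := fun L => by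
  simpa only [map_add] using (hf L).fun_add (hg L)

theorem HasWeakDerivAt.sub {f g : ℝ → H} {f' g' : H} {s : ℝ} (hf : HasWeakDerivAt f f' s)
    (hg : HasWeakDerivAt g g' s) : HasWeakDerivAt (fun t => f t - g t) (f' - g') s := fun L => by
  simpa only [map_sub] using (hf L).fun_sub (hg L)

theorem HasWeakDerivAt.const_smul (c : ℝ) {f : ℝ → H} {f' : H} {s : ℝ}
    (hf : HasWeakDerivAt f f' s) : HasWeakDerivAt (fun t => c • f t) (c • f') s := fun L => by
  simpa only [map_smul] using (hf L).fun_const_smul c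

theorem HasWeakDerivAt.sum {ι : Type*} (S : Finset ι) {f : ι → ℝ → H} {f' : ι → H} {s : ℝ}
    (hf : ∀ i ∈ S, HasWeakDerivAt (f i) (f' i) s) :
    HasWeakDerivAt (fun t => ∑ i ∈ S, f i t) (∑ i ∈ S, f' i) s := fun L => by
  simpa only [map_sum] using HasDerivAt.fun_sum fun i hi => hf i hi L

theorem HasWeakDerivAt.clm (T : D →L[ℝ] H) {f : ℝ → D} {f' : D} {s : ℝ}
    (hf : HasWeakDerivAt f f' s) : HasWeakDerivAt (fun t => T (f t)) (T f') s :=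
  fun L => hf (L.comp T)

theorem hasWeakDerivAt_const (c : H) (s : ℝ) : HasWeakDerivAt (fun _ => c) 0 s := fun L => by
  simpa only [map_zero] using hasDerivAt_const s (L c)

theorem _root_.HasDerivAt.hasWeakDerivAt {f : ℝ → H} {f' : H} {s : ℝ} (hf : HasDerivAt f f' s) :
    HasWeakDerivAt f f' s := fun L => L.hasFDerivAt.comp_hasDerivAt s hf

theorem exists_norm_le_of_weakly_bounded {x : ℕ → H}
    (hx : ∀ L : H →L[ℝ] ℝ, ∃ C, ∀ n, ‖L (x n)‖ ≤ C) : ∃ C, ∀ n, ‖x n‖ ≤ C := by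
  obtain ⟨C, hC⟩ := banach_steinhaus (g := fun n => NormedSpace.inclusionInDoubleDual ℝ H (x n))
    (fun L => by simpa using hx L)
  refine ⟨C, fun n => ?_⟩
  have h1 := hC n
  have h2 : ‖NormedSpace.inclusionInDoubleDual ℝ H (x n)‖ = ‖x n‖ :=
    (NormedSpace.inclusionInDoubleDualLi ℝ).norm_map (x n)
  rwa [h2] at h1

/-- If all sequences of difference quotients are bounded, then the function is Lipschitz at the
point. -/
theorem exists_eventually_norm_sub_le {E : Type*} [NormedAddCommGroup E] [NormedSpace ℝ E]
    {f : ℝ → E} {s : ℝ} (h : ∀ t : ℕ → ℝ, Tendsto t atTop (𝓝[≠] s) →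
      ∃ C, ∀ n, ‖(t n - s)⁻¹ • (f (t n) - f s)‖ ≤ C) :
    ∃ C, 0 ≤ C ∧ ∀ᶠ t in 𝓝 s, ‖f t - f s‖ ≤ C * |t - s| := by
  by_contra! hcon
  have h1 : ∀ n : ℕ, ∃ t, |t - s| < 1 / (n + 1 : ℝ) ∧ (n : ℝ) * |t - s| < ‖f t - f s‖ := by
    intro n
    have h2 := hcon n n.cast_nonneg
    have h3 : ∀ᶠ t in 𝓝 s, |t - s| < 1 / (n + 1 : ℝ) := by
      filter_upwards [Metric.ball_mem_nhds s (ε := 1 / (n + 1 : ℝ)) (by positivity)] with t ht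
      simpa [Real.dist_eq] using ht
    obtain ⟨t, h4, h5⟩ := (h2.and_eventually h3).exists
    exact ⟨t, h5, h4⟩
  choose t ht ht' using h1
  have hne : ∀ n, t n ≠ s := by
    intro n hn
    have := ht' n
    rw [hn] at this
    simp at this
  obtain ⟨C, hC⟩ := h t (by
    refine tendsto_nhdsWithin_iff.2 ⟨?_, Eventually.of_forall hne⟩
    rw [tendsto_iff_dist_tendsto_zero]
    exact squeeze_zero (fun n => dist_nonneg) (fun n => by rw [Real.dist_eq]; exact (ht n).le)
      tendsto_one_div_add_atTop_nhds_zero_nat)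
  obtain ⟨n, hn⟩ := exists_nat_gt C
  have h2 := hC n
  have h3 : 0 < |t n - s| := abs_pos.2 (sub_ne_zero.2 (hne n))
  rw [norm_smul, norm_inv, Real.norm_eq_abs, inv_mul_le_iff₀ h3] at h2
  have := ht' n
  nlinarith

theorem HasWeakDerivAt.exists_bounded_slope {f : ℝ → H} {f' : H} {s : ℝ}
    (hf : HasWeakDerivAt f f' s) {t : ℕ → ℝ} (ht : Tendsto t atTop (𝓝[≠] s)) :
    ∃ C, ∀ n, ‖(t n - s)⁻¹ • (f (t n) - f s)‖ ≤ C := by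
  refine exists_norm_le_of_weakly_bounded fun L => ?_
  have h1 := (hasDerivAt_iff_tendsto_slope.1 (hf L)).comp ht
  obtain ⟨C, hC⟩ := (h1.norm.isBoundedUnder_le).bddAbove_range
  refine ⟨C, fun n => ?_⟩
  have := hC (mem_range_self n)
  simpa [slope, map_sub] using this

theorem HasWeakDerivAt.exists_norm_sub_le {f : ℝ → H} {f' : H} {s : ℝ}
    (hf : HasWeakDerivAt f f' s) : ∃ C, 0 ≤ C ∧ ∀ᶠ t in 𝓝 s, ‖f t - f s‖ ≤ C * |t - s| :=
  exists_eventually_norm_sub_le fun _ ht => hf.exists_bounded_slope ht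

/-- By the uniform boundedness principle, an operator function that is differentiable in the weak
operator topology is Lipschitz at the point for the operator norm. -/
theorem exists_norm_sub_le_of_forall_hasWeakDerivAt [CompleteSpace D] {A : ℝ → D →L[ℝ] H}
    {A' : D →L[ℝ] H} {s : ℝ} (hA : ∀ d, HasWeakDerivAt (fun t => A t d) (A' d) s) :
    ∃ C, 0 ≤ C ∧ ∀ᶠ t in 𝓝 s, ‖A t - A s‖ ≤ C * |t - s| :=
  exists_eventually_norm_sub_le fun _ ht => banach_steinhaus fun d => (hA d).exists_bounded_slope ht

theorem hasDerivAt_zero_of_sq {g : ℝ → ℝ} {s C : ℝ} (h : ∀ᶠ t in 𝓝 s, |g t| ≤ C * |t - s| ^ 2) :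
    HasDerivAt g 0 s := by
  rw [hasDerivAt_iff_isLittleO]
  have h0 : g s = 0 := by simpa using h.self_of_nhds
  simp only [h0, sub_zero, smul_zero]
  have h1 : g =O[𝓝 s] fun t => (t - s) ^ 2 := by
    refine Asymptotics.IsBigO.of_bound C ?_
    filter_upwards [h] with t ht
    simpa using ht
  refine h1.trans_isLittleO ?_
  have h2 : (fun t : ℝ => t - s) =o[𝓝 s] fun _ => (1 : ℝ) := by
    rw [Asymptotics.isLittleO_one_iff]
    have : Tendsto (fun t : ℝ => t - s) (𝓝 s) (𝓝 (s - s)) :=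
      (continuous_id.sub continuous_const).tendsto s
    simpa using this
  simpa [sq] using h2.mul_isBigO (Asymptotics.isBigO_refl (fun t : ℝ => t - s) (𝓝 s))

/-- The product rule for an operator function applied to a vector function. -/
theorem HasWeakDerivAt.clm_apply [CompleteSpace D] {A : ℝ → D →L[ℝ] H} {A' : D →L[ℝ] H}
    {f : ℝ → D} {f' : D} {s : ℝ} (hA : ∀ d, HasWeakDerivAt (fun t => A t d) (A' d) s)
    (hf : HasWeakDerivAt f f' s) :
    HasWeakDerivAt (fun t => A t (f t)) (A' (f s) + A s f') s := by
  intro L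
  obtain ⟨C₁, hC₁, h₁⟩ := exists_norm_sub_le_of_forall_hasWeakDerivAt hA
  obtain ⟨C₂, hC₂, h₂⟩ := hf.exists_norm_sub_le
  have h3 : HasDerivAt (fun t => L ((A t - A s) (f t - f s))) 0 s := by
    refine hasDerivAt_zero_of_sq (C := ‖L‖ * C₁ * C₂) ?_
    filter_upwards [h₁, h₂] with t h4 h5
    calc |L ((A t - A s) (f t - f s))| ≤ ‖L‖ * (‖A t - A s‖ * ‖f t - f s‖) :=
          (L.le_opNorm _).trans (by gcongr; exact (A t - A s).le_opNorm _)
      _ ≤ ‖L‖ * ((C₁ * |t - s|) * (C₂ * |t - s|)) := by gcongr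
      _ = ‖L‖ * C₁ * C₂ * |t - s| ^ 2 := by ring
  have h4 := ((hA (f s) L).add (((hf.clm (A s)).sub (hasWeakDerivAt_const (A s (f s)) s)) L)).add h3
  rw [add_zero, sub_zero, ← map_add] at h4
  refine h4.congr_of_eventuallyEq (Eventually.of_forall fun t => ?_)
  simp only [Pi.add_apply, sub_apply, map_sub]
  abel

/-- Solutions of `B t (w t) = u t` are differentiable where `B s` has a left inverse. -/
theorem HasWeakDerivAt.of_clm_apply_eq [CompleteSpace D] {B : ℝ → D →L[ℝ] H} {B' : D →L[ℝ] H}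
    {u : ℝ → H} {u' : H} {w : ℝ → D} {w' : D} {s : ℝ}
    (hB : ∀ d, HasWeakDerivAt (fun t => B t d) (B' d) s) (hu : HasWeakDerivAt u u' s)
    (hw : ∀ᶠ t in 𝓝 s, B t (w t) = u t) (G : H →L[ℝ] D) (hG : ∀ d, G (B s d) = d)
    (hw' : B s w' = u' - B' (w s)) : HasWeakDerivAt w w' s := by
  obtain ⟨C₁, hC₁, h₁⟩ := exists_norm_sub_le_of_forall_hasWeakDerivAt hB
  obtain ⟨C₂, hC₂, h₂⟩ := hu.exists_norm_sub_le
  have hws := hw.self_of_nhds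
  have hid : ∀ᶠ t in 𝓝 s, w t - w s =
      G (u t - u s) - G ((B t - B s) (w s)) - G ((B t - B s) (w t - w s)) := by
    filter_upwards [hw] with t ht
    rw [← map_sub, ← map_sub]
    conv_lhs => rw [← hG (w t - w s)]
    congr 1
    simp only [map_sub, sub_apply, ht, hws]
    abel
  -- `w` is Lipschitz at `s`
  have hlip : ∃ C, 0 ≤ C ∧ ∀ᶠ t in 𝓝 s, ‖w t - w s‖ ≤ C * |t - s| := by
    refine ⟨2 * (‖G‖ * (C₂ + C₁ * ‖w s‖)), by positivity, ?_⟩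
    have hsmall : ∀ᶠ t in 𝓝 s, ‖G‖ * (C₁ * |t - s|) ≤ 1 / 2 := by
      have : Tendsto (fun t : ℝ => ‖G‖ * (C₁ * |t - s|)) (𝓝 s) (𝓝 (‖G‖ * (C₁ * |s - s|))) :=
        Continuous.tendsto (by fun_prop) s
      exact this.eventually_le_const (by simp)
    filter_upwards [h₁, h₂, hid, hsmall] with t h3 h4 h5 h6
    have e1 : ‖G (u t - u s)‖ ≤ ‖G‖ * (C₂ * |t - s|) :=
      (G.le_opNorm _).trans (by gcongr)
    have e2 : ‖G ((B t - B s) (w s))‖ ≤ ‖G‖ * (C₁ * |t - s| * ‖w s‖) :=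
      (G.le_opNorm _).trans (by gcongr; exact (ContinuousLinearMap.le_opNorm _ _).trans (by gcongr))
    have e3 : ‖G ((B t - B s) (w t - w s))‖ ≤ ‖G‖ * (C₁ * |t - s|) * ‖w t - w s‖ := by
      rw [mul_assoc]
      exact (G.le_opNorm _).trans
        (by gcongr; exact (ContinuousLinearMap.le_opNorm _ _).trans (by gcongr))
    have e4 : ‖w t - w s‖ ≤ ‖G‖ * (C₂ * |t - s|) + ‖G‖ * (C₁ * |t - s| * ‖w s‖) +
        1 / 2 * ‖w t - w s‖ := by
      conv_lhs => rw [h5]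
      refine (norm_sub_le _ _).trans (add_le_add ((norm_sub_le _ _).trans (add_le_add e1 e2)) ?_)
      exact e3.trans (by gcongr)
    linarith
  obtain ⟨C₃, hC₃, h₃⟩ := hlip
  intro L
  have h3 : HasDerivAt (fun t => L (G ((B t - B s) (w t - w s)))) 0 s := by
    refine hasDerivAt_zero_of_sq (C := ‖L‖ * ‖G‖ * C₁ * C₃) ?_
    filter_upwards [h₁, h₃] with t h4 h5
    calc |L (G ((B t - B s) (w t - w s)))| ≤ ‖L‖ * (‖G‖ * (‖B t - B s‖ * ‖w t - w s‖)) :=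
          (L.le_opNorm _).trans (by
            gcongr
            exact (G.le_opNorm _).trans (by gcongr; exact (B t - B s).le_opNorm _))
      _ ≤ ‖L‖ * (‖G‖ * ((C₁ * |t - s|) * (C₃ * |t - s|))) := by gcongr
      _ = ‖L‖ * ‖G‖ * C₁ * C₃ * |t - s| ^ 2 := by ring
  have h4 := (((hu.sub (hasWeakDerivAt_const (u s) s)).clm G).sub
    (((hB (w s)).sub (hasWeakDerivAt_const (B s (w s)) s)).clm G) L).sub h3
  rw [sub_zero, sub_zero, sub_zero, ← map_sub, ← hw', hG] at h4
  have h5 : HasDerivAt (fun t => L (w t - w s)) (L w') s := by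
    refine h4.congr_of_eventuallyEq ?_
    filter_upwards [hid] with t ht
    rw [ht]
    simp only [Pi.sub_apply, sub_apply, map_sub]
  have h6 := h5.add_const (L (w s))
  refine h6.congr_of_eventuallyEq (Eventually.of_forall fun t => ?_)
  simp

end WeakDerivative

/-! ### Weak derivatives along coordinate lines are weak partial derivatives -/

variable {N : ℕ} {E : Type*} [NormedAddCommGroup E] [InnerProductSpace ℝ E] [CompleteSpace E]

theorem isWeakPartial_of_hasWeakDerivAt (law : Fin N → NoiseLaw) (i : Fin N)
    {f g : (Fin N → ℝ) → E} (hf : LocallyIntegrableOn f (box law))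
    (hg : LocallyIntegrableOn g (box law))
    (h : ∀ z ∈ box law, HasWeakDerivAt (fun t => f (Function.update z i t)) (g z) (z i)) :
    IsWeakPartial law i f g := by
  intro φ hφ hφc hφb
  have hd : Continuous (partialDeriv i φ) :=
    (hφ.continuous_fderiv (by simp)).clm_apply continuous_const
  have hsupp : tsupport (partialDeriv i φ) ⊆ tsupport φ := by
    refine closure_minimal (fun z hz => ?_) (isClosed_tsupport φ)
    by_contra h1
    have h2 : φ =ᶠ[𝓝 z] fun _ => 0 := notMem_tsupport_iff_eventuallyEq.1 h1
    exact hz (by simp [partialDeriv, h2.fderiv_eq])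
  have hint : ∀ {ψ : (Fin N → ℝ) → ℝ}, Continuous ψ → tsupport ψ ⊆ tsupport φ →
      ∀ {F : (Fin N → ℝ) → E}, LocallyIntegrableOn F (box law) → Integrable (fun z => ψ z • F z) := by
    intro ψ hψ hs F hF
    have h1 : IntegrableOn F (tsupport φ) :=
      (hF.mono_set hφb).integrableOn_isCompact hφc
    have h2 : IntegrableOn (fun z => ψ z • F z) (tsupport φ) :=
      h1.continuousOn_smul hψ.continuousOn hφc
    refine (integrableOn_iff_integrable_of_support_subset fun z hz => hs ?_).1 h2
    refine subset_tsupport _ fun h3 => hz ?_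
    simp [h3]
  have hout : ∀ {ψ : (Fin N → ℝ) → ℝ}, tsupport ψ ⊆ tsupport φ → ∀ F : (Fin N → ℝ) → E,
      ∫ z in box law, ψ z • F z = ∫ z, ψ z • F z := by
    intro ψ hs F
    refine setIntegral_eq_integral_of_forall_compl_eq_zero fun z hz => ?_
    have : ψ z = 0 := image_eq_zero_of_notMem_tsupport fun h1 => hz (hφb (hs h1))
    rw [this, zero_smul]
  rw [hout hsupp, hout le_rfl]
  refine ext_inner_left ℝ fun e => ?_
  have i1 := hint hd hsupp hf
  have i2 := hint hφ.continuous le_rfl hg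
  have i3 := hint hφ.continuous le_rfl hf
  rw [inner_neg_right, ← integral_inner i1 e, ← integral_inner i2 e]
  have key := integral_bilinear_hasLineDerivAt_right_eq_neg_left_of_integrable
    (μ := (volume : Measure (Fin N → ℝ))) (B := ContinuousLinearMap.mul ℝ ℝ)
    (f := fun z => inner ℝ e (f z)) (f' := fun z => inner ℝ e (g z)) (g := φ)
    (g' := partialDeriv i φ) (v := Pi.single i 1)
    (by simpa [real_inner_smul_right, mul_comm] using i2.const_inner (𝕜 := ℝ) e)
    (by simpa [real_inner_smul_right, mul_comm] using i1.const_inner (𝕜 := ℝ) e)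
    (by simpa [real_inner_smul_right, mul_comm] using i3.const_inner (𝕜 := ℝ) e)
    (fun z hz => by
      have h1 := h z (hφb hz) (innerSL ℝ e)
      have h2 : (fun t : ℝ => inner ℝ e (f (z + t • Pi.single i 1))) =
          fun t => inner ℝ e (f (Function.update z i (z i + t))) := by
        funext t
        congr 2
        ext k
        by_cases hk : k = i
        · subst hk
          simp
        · simp [hk]
      rw [HasLineDerivAt, h2]
      have h3 : HasDerivAt (fun t => inner ℝ e (f (Function.update z i t))) (inner ℝ e (g z))
          (z i + 0) := by simpa using h1
      simpa using h3.comp_const_add (z i) 0)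
    (fun z _ => (hφ.differentiable (by simp) z).hasFDerivAt.hasLineDerivAt _)
  simp only [ContinuousLinearMap.mul_apply'] at key
  simp only [real_inner_smul_right]
  simpa only [mul_comm] using key

end RandomEvolution

/-! ### The implicit Euler step and its energy estimate -/

namespace RandomEvolution

section EulerStep

variable {D H : Type*} [NormedAddCommGroup D] [InnerProductSpace ℝ D]
  [NormedAddCommGroup H] [InnerProductSpace ℝ H]

/-- If `A : D → H` is bounded below, surjective and monotone with respect to `J : D → H`, then
`J + h A` is bijective: its range is closed, and a vector `A d` orthogonal to it vanishes. -/
theorem bijective_add_smul [CompleteSpace D] [CompleteSpace H] (J A : D →L[ℝ] H) {c h : ℝ} (hc : 0 < c) (hh : 0 < h)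
    (hlow : ∀ d, c * ‖d‖ ≤ ‖A d‖) (hsurj : Function.Surjective A)
    (hmono : ∀ d, 0 ≤ inner ℝ (J d) (A d)) : Function.Bijective (J + h • A) := by
  have hlow' : ∀ d, h * c * ‖d‖ ≤ ‖(J + h • A) d‖ := by
    intro d
    have h1 : (h * ‖A d‖) ^ 2 ≤ ‖(J + h • A) d‖ ^ 2 := by
      rw [add_apply, smul_apply, norm_add_sq_real, norm_smul,
        real_inner_smul_right, Real.norm_of_nonneg hh.le]
      have := mul_nonneg hh.le (hmono d)
      nlinarith [sq_nonneg ‖J d‖]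
    have h2 := abs_le_of_sq_le_sq' h1 (norm_nonneg _)
    have h3 := hlow d
    nlinarith [h2.2]
  have hanti : AntilipschitzWith (Real.toNNReal (h * c)⁻¹) (J + h • A) := by
    refine (J + h • A).antilipschitz_of_bound fun d => ?_
    rw [Real.coe_toNNReal _ (by positivity), inv_mul_eq_div, le_div_iff₀ (by positivity), mul_comm]
    exact hlow' d
  refine ⟨hanti.injective, ?_⟩
  have hclosed : IsClosed ((J + h • A).range : Set H) :=
    hanti.isClosed_range (J + h • A).uniformContinuous
  have horth : (J + h • A).rangeᗮ = ⊥ := by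
    rw [Submodule.eq_bot_iff]
    intro y hy
    obtain ⟨d, rfl⟩ := hsurj y
    have h1 := (Submodule.mem_orthogonal _ _).1 hy ((J + h • A) d) ⟨d, rfl⟩
    rw [add_apply, smul_apply, inner_add_left,
      real_inner_smul_left, real_inner_self_eq_norm_sq] at h1
    have h2 : h * ‖A d‖ ^ 2 = 0 := le_antisymm (by linarith [hmono d]) (by positivity)
    simpa [hh.ne'] using h2
  have htop := (Submodule.topologicalClosure_eq_top_iff).2 horth
  rw [IsClosed.submodule_topologicalClosure_eq hclosed] at htop
  exact LinearMap.range_eq_top.1 htop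

/-- The solution `d` of `J d + h A d = g`. -/
noncomputable def eulerSolve (J A : D →L[ℝ] H) (h : ℝ) (g : H) : D :=
  Function.invFun (J + h • A) g

theorem eulerSolve_spec {J A : D →L[ℝ] H} {h : ℝ} (hb : Function.Bijective (J + h • A)) (g : H) :
    J (eulerSolve J A h g) + h • A (eulerSolve J A h g) = g :=
  Function.rightInverse_invFun hb.2 g

/-- One implicit Euler step `J x + h A x = J y + h F` increases the energy `⟪J x, A x⟫` by at most
`h ‖F‖²`, and it gains `h ‖A x‖²`. -/
theorem energy_step {J A : D →L[ℝ] H} (hsymm : ∀ d e, inner ℝ (J d) (A e) = inner ℝ (A d) (J e))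
    (hmono : ∀ d, 0 ≤ inner ℝ (J d) (A d)) {h : ℝ} (hh : 0 ≤ h) {x y : D} {F : H}
    (hxy : J x + h • A x = J y + h • F) :
    inner ℝ (J x) (A x) + h * ‖A x‖ ^ 2 ≤ inner ℝ (J y) (A y) + h * ‖F‖ ^ 2 := by
  have h1 := congrArg (fun v => inner ℝ v (A x)) hxy
  simp only [inner_add_left, real_inner_smul_left, real_inner_self_eq_norm_sq] at h1
  have h2 := hmono (x - y)
  have h3 : inner ℝ (J x) (A y) = inner ℝ (J y) (A x) := by
    rw [hsymm, real_inner_comm]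
  simp only [map_sub, inner_sub_left, inner_sub_right] at h2
  have h4 : inner ℝ F (A x) ≤ (‖F‖ ^ 2 + ‖A x‖ ^ 2) / 2 := by
    have := real_inner_le_norm F (A x)
    nlinarith [sq_nonneg (‖F‖ - ‖A x‖)]
  have h5 := mul_le_mul_of_nonneg_left h4 hh
  nlinarith

/-- Discrete maximal regularity: the derivatives `X m l` of the implicit Euler iterates satisfy
the weighted energy estimate, with constants that do not depend on the step size. -/
theorem exists_energy_bound (J : D →L[ℝ] H) {c C : ℝ} (hc : 0 < c) (hC : 0 ≤ C) (l : ℕ) :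
    ∃ K : ℝ, 0 ≤ K ∧ ∀ (A : ℕ → D →L[ℝ] H) (s h : ℝ), 0 ≤ s → 0 < h →
      (∀ d, c * ‖d‖ ≤ ‖A 0 d‖) → (∀ d e, inner ℝ (J d) (A 0 e) = inner ℝ (A 0 d) (J e)) →
      (∀ d, c * ‖J d‖ ^ 2 ≤ inner ℝ (J d) (A 0 d)) →
      (∀ r ≤ l, ∀ d, s ^ r * ‖A r d‖ ≤ C * ‖d‖) →
      ∀ X : ℕ → ℕ → D, (∀ m, ∀ r ≤ l, J (X (m + 1) r) + h • A 0 (X (m + 1) r) =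
          J (X m r) - h • ∑ j ∈ Finset.range r, (r.choose j : ℝ) • A (r - j) (X (m + 1) j)) →
      ∀ M, ‖s ^ l • J (X M l)‖ ^ 2 + h * ∑ m ∈ Finset.range M, ‖s ^ l • X (m + 1) l‖ ^ 2 ≤
        K * ∑ j ∈ Finset.range (l + 1), ‖s ^ j • X 0 j‖ ^ 2 := by
  induction l using Nat.strong_induction_on with
  | _ l ih =>
  choose! K hK0 hK using ih
  -- the constant bounds the initial energy and the lower-order terms
  set K₁ : ℝ := ‖J‖ * C + ∑ j ∈ Finset.range l, l * (l.choose j * C) ^ 2 * K j with hK₁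
  have hK₁0 : 0 ≤ K₁ := by
    refine add_nonneg (by positivity) (Finset.sum_nonneg fun j hj => ?_)
    have := hK0 j (Finset.mem_range.1 hj)
    positivity
  refine ⟨(c⁻¹ + (c ^ 2)⁻¹) * K₁, by positivity, ?_⟩
  intro A s h hs hh hlow hsymm hcoer hbound X hX M
  have hmono : ∀ d, 0 ≤ inner ℝ (J d) (A 0 d) := fun d =>
    (mul_nonneg hc.le (sq_nonneg _)).trans (hcoer d)
  set S : ℝ := ∑ j ∈ Finset.range (l + 1), ‖s ^ j • X 0 j‖ ^ 2 with hS
  set F : ℕ → H := fun m =>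
    -∑ j ∈ Finset.range l, (l.choose j : ℝ) • A (l - j) (X (m + 1) j) with hF
  set q : ℕ → ℝ := fun m => inner ℝ (J (s ^ l • X m l)) (A 0 (s ^ l • X m l)) with hq
  -- energy inequality summed over the steps
  have hstep : ∀ m, q (m + 1) + h * ‖A 0 (s ^ l • X (m + 1) l)‖ ^ 2 ≤
      q m + h * ‖s ^ l • F m‖ ^ 2 := by
    intro m
    refine energy_step hsymm hmono hh.le ?_
    have := congrArg (fun v => s ^ l • v) (hX m l le_rfl)
    simp only [smul_add, smul_sub, map_smul] at this ⊢
    rw [smul_comm h (s ^ l) (A 0 _), this, hF]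
    simp only [smul_neg, sub_eq_add_neg]
    rw [smul_comm]
  have hsum : ∀ M, q M + h * ∑ m ∈ Finset.range M, ‖A 0 (s ^ l • X (m + 1) l)‖ ^ 2 ≤
      q 0 + h * ∑ m ∈ Finset.range M, ‖s ^ l • F m‖ ^ 2 := by
    intro M
    induction M with
    | zero => simp
    | succ M ihM =>
      rw [Finset.sum_range_succ, Finset.sum_range_succ, mul_add, mul_add]
      linarith [hstep M]
  -- the source terms
  have hFb : ∀ m, ‖s ^ l • F m‖ ^ 2 ≤
      ∑ j ∈ Finset.range l, l * (l.choose j * C) ^ 2 * ‖s ^ j • X (m + 1) j‖ ^ 2 := by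
    intro m
    have h1 : ‖s ^ l • F m‖ ≤ ∑ j ∈ Finset.range l, (l.choose j * C) * ‖s ^ j • X (m + 1) j‖ := by
      rw [hF]
      simp only [smul_neg, norm_neg, Finset.smul_sum]
      refine (norm_sum_le _ _).trans (Finset.sum_le_sum fun j hj => ?_)
      have hj' := Finset.mem_range.1 hj
      have h2 := hbound (l - j) (Nat.sub_le _ _) (s ^ j • X (m + 1) j)
      rw [map_smul, norm_smul, Real.norm_of_nonneg (by positivity)] at h2
      rw [norm_smul, norm_smul, Real.norm_of_nonneg (by positivity),
        Real.norm_of_nonneg (by positivity)]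
      calc s ^ l * ((l.choose j : ℝ) * ‖A (l - j) (X (m + 1) j)‖)
          = (l.choose j : ℝ) * (s ^ (l - j) * (s ^ j * ‖A (l - j) (X (m + 1) j)‖)) := by
            rw [← mul_assoc (s ^ (l - j)), ← pow_add, Nat.sub_add_cancel hj'.le]
            ring
        _ ≤ (l.choose j : ℝ) * (C * ‖s ^ j • X (m + 1) j‖) := by gcongr
        _ = _ := by ring
    calc ‖s ^ l • F m‖ ^ 2
        ≤ (∑ j ∈ Finset.range l, (l.choose j * C) * ‖s ^ j • X (m + 1) j‖) ^ 2 := by gcongr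
      _ ≤ (Finset.range l).card *
          ∑ j ∈ Finset.range l, ((l.choose j * C) * ‖s ^ j • X (m + 1) j‖) ^ 2 :=
          sq_sum_le_card_mul_sum_sq
      _ = _ := by
          rw [Finset.card_range, Finset.mul_sum]
          refine Finset.sum_congr rfl fun j _ => ?_
          ring
  have hS0 : 0 ≤ S := Finset.sum_nonneg fun j _ => sq_nonneg _
  have hFsum : h * ∑ m ∈ Finset.range M, ‖s ^ l • F m‖ ^ 2 ≤
      (∑ j ∈ Finset.range l, l * (l.choose j * C) ^ 2 * K j) * S := by
    calc h * ∑ m ∈ Finset.range M, ‖s ^ l • F m‖ ^ 2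
        ≤ h * ∑ m ∈ Finset.range M, ∑ j ∈ Finset.range l,
          l * (l.choose j * C) ^ 2 * ‖s ^ j • X (m + 1) j‖ ^ 2 := by
          gcongr with m _
          exact hFb m
      _ = ∑ j ∈ Finset.range l, l * (l.choose j * C) ^ 2 *
          (h * ∑ m ∈ Finset.range M, ‖s ^ j • X (m + 1) j‖ ^ 2) := by
          rw [Finset.sum_comm, Finset.mul_sum]
          refine Finset.sum_congr rfl fun j _ => ?_
          rw [← Finset.mul_sum]
          ring
      _ ≤ ∑ j ∈ Finset.range l, l * (l.choose j * C) ^ 2 * (K j * S) := by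
          refine Finset.sum_le_sum fun j hj => ?_
          have hj' := Finset.mem_range.1 hj
          have h1 := hK j hj' A s h hs hh hlow hsymm hcoer
            (fun r hr d => hbound r (hr.trans hj'.le) d) X
            (fun m r hr => hX m r (hr.trans hj'.le)) M
          have h2 : ∑ r ∈ Finset.range (j + 1), ‖s ^ r • X 0 r‖ ^ 2 ≤ S := by
            refine Finset.sum_le_sum_of_subset_of_nonneg ?_ fun _ _ _ => sq_nonneg _
            exact Finset.range_mono (by omega)
          have h3 := mul_le_mul_of_nonneg_left h2 (hK0 j hj')
          have h4 := sq_nonneg ‖s ^ j • J (X M j)‖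
          have h5 : (0 : ℝ) ≤ l * (l.choose j * C) ^ 2 := by positivity
          exact mul_le_mul_of_nonneg_left (by linarith) h5
      _ = _ := by
          rw [Finset.sum_mul]
          refine Finset.sum_congr rfl fun j _ => ?_
          ring
  have hq0 : q 0 ≤ ‖J‖ * C * S := by
    have h1 : ‖s ^ l • X 0 l‖ ^ 2 ≤ S :=
      Finset.single_le_sum (f := fun j => ‖s ^ j • X 0 j‖ ^ 2) (fun _ _ => sq_nonneg _)
        (Finset.mem_range.2 (Nat.lt_succ_self l))
    have h2 := hbound 0 (Nat.zero_le _) (s ^ l • X 0 l)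
    rw [pow_zero, one_mul] at h2
    calc q 0 ≤ ‖J (s ^ l • X 0 l)‖ * ‖A 0 (s ^ l • X 0 l)‖ := real_inner_le_norm _ _
      _ ≤ (‖J‖ * ‖s ^ l • X 0 l‖) * (C * ‖s ^ l • X 0 l‖) := by
          gcongr
          exact J.le_opNorm _
      _ = ‖J‖ * C * ‖s ^ l • X 0 l‖ ^ 2 := by ring
      _ ≤ _ := by gcongr
  have htot : q M + h * ∑ m ∈ Finset.range M, ‖A 0 (s ^ l • X (m + 1) l)‖ ^ 2 ≤ K₁ * S := by
    rw [hK₁, add_mul]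
    linarith [hsum M]
  have hqM : c * ‖s ^ l • J (X M l)‖ ^ 2 ≤ q M := by
    have h1 : c * ‖J (s ^ l • X M l)‖ ^ 2 ≤ q M := hcoer (s ^ l • X M l)
    rwa [map_smul] at h1
  have hAsum : c ^ 2 * (h * ∑ m ∈ Finset.range M, ‖s ^ l • X (m + 1) l‖ ^ 2) ≤
      h * ∑ m ∈ Finset.range M, ‖A 0 (s ^ l • X (m + 1) l)‖ ^ 2 := by
    rw [mul_left_comm, Finset.mul_sum]
    gcongr with m _
    rw [← mul_pow]
    gcongr
    exact hlow _
  have hA0 : 0 ≤ h * ∑ m ∈ Finset.range M, ‖A 0 (s ^ l • X (m + 1) l)‖ ^ 2 := by positivity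
  have hq0' : 0 ≤ q M := hmono _
  have e1 : ‖s ^ l • J (X M l)‖ ^ 2 ≤ c⁻¹ * (K₁ * S) := by
    rw [inv_mul_eq_div, le_div_iff₀ hc, mul_comm]
    linarith
  have e2 : h * ∑ m ∈ Finset.range M, ‖s ^ l • X (m + 1) l‖ ^ 2 ≤ (c ^ 2)⁻¹ * (K₁ * S) := by
    rw [inv_mul_eq_div, le_div_iff₀ (by positivity), mul_comm]
    linarith
  rw [mul_assoc, add_mul]
  linarith

end EulerStep

end RandomEvolution

/-! ### Derivatives of the implicit Euler iterates in one coordinate direction -/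

namespace RandomEvolution

section Measurability

variable {Z : Type*} [MeasurableSpace Z] {D H : Type*} [NormedAddCommGroup D] [NormedSpace ℝ D]
  [NormedAddCommGroup H] [NormedSpace ℝ H]

theorem stronglyMeasurable_clm_apply [SecondCountableTopology D] [SecondCountableTopology H]
    {A : Z → D →L[ℝ] H} (hA : ∀ d, StronglyMeasurable fun z => A z d) {f : Z → D}
    (hf : StronglyMeasurable f) : StronglyMeasurable fun z => A z (f z) := by
  let _ : MeasurableSpace D := borel D
  have _ : BorelSpace D := ⟨rfl⟩
  have h1 : StronglyMeasurable (Function.uncurry fun (d : D) (z : Z) => A z d) :=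
    stronglyMeasurable_uncurry_of_continuous_of_stronglyMeasurable
      (fun z => (A z).continuous) hA
  exact h1.comp_measurable (hf.measurable.prodMk measurable_id)

end Measurability

section EulerStep

variable {D H : Type*} [NormedAddCommGroup D] [InnerProductSpace ℝ D] [CompleteSpace D]
  [NormedAddCommGroup H] [InnerProductSpace ℝ H] [CompleteSpace H]

/-- Measurable dependence of the solution of the Euler step on a parameter. The graph map
`(z, d) ↦ (z, J d + h A_z d)` is a measurable bijection between standard Borel spaces, so its
inverse is measurable. -/
theorem stronglyMeasurable_eulerSolve {Z : Type*} [MeasurableSpace Z] [StandardBorelSpace Z]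
    [SecondCountableTopology D] [SecondCountableTopology H] {J : D →L[ℝ] H} {A : Z → D →L[ℝ] H}
    {h : ℝ} (hA : ∀ d, StronglyMeasurable fun z => A z d)
    (hb : ∀ z, Function.Bijective (J + h • A z)) {g : Z → H} (hg : StronglyMeasurable g) :
    StronglyMeasurable fun z => eulerSolve J (A z) h (g z) := by
  let _ : MeasurableSpace D := borel D
  have _ : BorelSpace D := ⟨rfl⟩
  let _ : MeasurableSpace H := borel H
  have _ : BorelSpace H := ⟨rfl⟩
  set Φ : Z × D → Z × H := fun p => (p.1, (J + h • A p.1) p.2) with hΦ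
  have hm : Measurable Φ := by
    refine measurable_fst.prodMk ?_
    have h1 : StronglyMeasurable (Function.uncurry fun (d : D) (z : Z) => (J + h • A z) d) :=
      stronglyMeasurable_uncurry_of_continuous_of_stronglyMeasurable
        (fun z => (J + h • A z).continuous)
        (fun d => by
          simp only [add_apply, smul_apply]
          exact stronglyMeasurable_const.add ((hA d).const_smul h))
    exact h1.measurable.comp measurable_swap
  have hinj : Function.Injective Φ := by
    rintro ⟨z, d⟩ ⟨z', d'⟩ hp
    obtain ⟨rfl, h2⟩ := Prod.ext_iff.1 hp
    exact Prod.ext rfl ((hb z).1 h2)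
  have hemb := hm.measurableEmbedding hinj
  have h1 : Measurable fun z => (z, eulerSolve J (A z) h (g z)) := by
    refine hemb.measurable_comp_iff.1 ?_
    have h2 : (Φ ∘ fun z => (z, eulerSolve J (A z) h (g z))) = fun z => (z, g z) := by
      funext z
      exact Prod.ext rfl (eulerSolve_spec (hb z) (g z))
    rw [h2]
    exact measurable_id.prodMk hg.measurable
  exact (measurable_snd.comp h1).stronglyMeasurable

end EulerStep

variable {N : ℕ}

/-- The derivatives `A l = ∂_i^l A` of a family of operators `A 0 z : D → H` in the coordinate
direction `i`, with the weighted bounds of orders `l ≤ k`, together with the invertibility,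
symmetry and coercivity of `A 0 z` relative to the embedding `J : D → H`. -/
structure SmoothFamily {D H : Type*} [NormedAddCommGroup D] [InnerProductSpace ℝ D]
    [NormedAddCommGroup H] [InnerProductSpace ℝ H] (law : Fin N → NoiseLaw) (i : Fin N) (k : ℕ)
    (J : D →L[ℝ] H) (A : ℕ → (Fin N → ℝ) → D →L[ℝ] H) (c C : ℝ) : Prop where
  pos : 0 < c
  nonneg : 0 ≤ C
  deriv : ∀ l < k, ∀ z ∈ box law, ∀ d,
    HasWeakDerivAt (fun t => A l (Function.update z i t) d) (A (l + 1) z d) (z i)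
  bound : ∀ l ≤ k, ∀ z ∈ box law, ∀ d, √((law i).sigma.eval (z i)) ^ l * ‖A l z d‖ ≤ C * ‖d‖
  lower : ∀ z d, c * ‖d‖ ≤ ‖A 0 z d‖
  surj : ∀ z, Function.Surjective (A 0 z)
  symm : ∀ z d e, inner ℝ (J d) (A 0 z e) = inner ℝ (A 0 z d) (J e)
  coer : ∀ z d, c * ‖J d‖ ^ 2 ≤ inner ℝ (J d) (A 0 z d)
  meas : ∀ l ≤ k, ∀ d, StronglyMeasurable fun z => A l z d

/-- The successive derivatives in one direction of the solution `w` of `J w + h A w = u`, where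
`u l` is the derivative of order `l` of `u`. They are obtained by differentiating the equation
`l` times with the Leibniz rule. -/
noncomputable def eulerChain {Z D H : Type*} [NormedAddCommGroup D] [NormedSpace ℝ D]
    [NormedAddCommGroup H] [NormedSpace ℝ H] (J : D →L[ℝ] H) (A : ℕ → Z → D →L[ℝ] H) (h : ℝ)
    (u : ℕ → Z → H) (l : ℕ) (z : Z) : D :=
  Function.invFun (J + h • A 0 z)
    (u l z - h • ∑ j : Fin l, (l.choose j : ℝ) • A (l - j) z (eulerChain J A h u j z))
termination_by l
decreasing_by exact j.2

theorem sum_choose_succ_mul {M : Type*} [AddCommGroup M] [Module ℝ M] (x : ℕ → ℕ → M) (l : ℕ) :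
    ∑ j ∈ Finset.range l, (l.choose j : ℝ) • (x (l - j + 1) j + x (l - j) (j + 1)) + x 1 l =
      ∑ j ∈ Finset.range (l + 1), ((l + 1).choose j : ℝ) • x (l + 1 - j) j := by
  have h1 : ∑ j ∈ Finset.range (l + 1), (l.choose j : ℝ) • x (l + 1 - j) j =
      ∑ j ∈ Finset.range l, (l.choose j : ℝ) • x (l - j + 1) j + x 1 l := by
    rw [Finset.sum_range_succ]
    congr 1
    · refine Finset.sum_congr rfl fun j hj => ?_
      rw [Nat.sub_add_comm (Finset.mem_range.1 hj).le]
    · simp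
  have h2 : ∑ j ∈ Finset.range (l + 1), (l.choose j : ℝ) • x (l + 1 - j) j =
      ∑ j ∈ Finset.range l, (l.choose (j + 1) : ℝ) • x (l - j) (j + 1) + x (l + 1) 0 := by
    rw [Finset.sum_range_succ']
    simp [Nat.add_sub_add_right]
  rw [Finset.sum_range_succ' (fun j => ((l + 1).choose j : ℝ) • x (l + 1 - j) j)]
  simp only [Nat.choose_succ_succ', Nat.add_sub_add_right, Nat.cast_add, add_smul,
    Finset.sum_add_distrib, smul_add, Nat.choose_zero_right, Nat.cast_one, one_smul, Nat.sub_zero]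
  rw [add_assoc _ _ (x (l + 1) 0), ← h2, h1]
  abel

theorem eulerChain_eq {Z D H : Type*} [NormedAddCommGroup D] [NormedSpace ℝ D]
    [NormedAddCommGroup H] [NormedSpace ℝ H] {J : D →L[ℝ] H} {A : ℕ → Z → D →L[ℝ] H} {h : ℝ}
    (u : ℕ → Z → H) (l : ℕ) (z : Z) :
    eulerChain J A h u l z = Function.invFun (J + h • A 0 z)
      (u l z - h • ∑ j ∈ Finset.range l,
        (l.choose j : ℝ) • A (l - j) z (eulerChain J A h u j z)) := by
  rw [eulerChain, ← Fin.sum_univ_eq_sum_range (fun j => (l.choose j : ℝ) •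
    A (l - j) z (eulerChain J A h u j z))]

namespace SmoothFamily

variable {D H : Type*} [NormedAddCommGroup D] [InnerProductSpace ℝ D] [CompleteSpace D]
  [NormedAddCommGroup H] [InnerProductSpace ℝ H] [CompleteSpace H]
  {law : Fin N → NoiseLaw} {i : Fin N} {k : ℕ} {J : D →L[ℝ] H}
  {A : ℕ → (Fin N → ℝ) → D →L[ℝ] H} {c C : ℝ}

theorem bijective (hA : SmoothFamily law i k J A c C) {h : ℝ} (hh : 0 < h) (z : Fin N → ℝ) :
    Function.Bijective (J + h • A 0 z) :=
  bijective_add_smul J (A 0 z) hA.pos hh (hA.lower z) (hA.surj z) fun d =>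
    (mul_nonneg hA.pos.le (sq_nonneg _)).trans (hA.coer z d)

theorem eulerChain_spec (hA : SmoothFamily law i k J A c C) {h : ℝ} (hh : 0 < h)
    (u : ℕ → (Fin N → ℝ) → H) (l : ℕ) (z : Fin N → ℝ) :
    J (eulerChain J A h u l z) + h • A 0 z (eulerChain J A h u l z) =
      u l z - h • ∑ j ∈ Finset.range l,
        (l.choose j : ℝ) • A (l - j) z (eulerChain J A h u j z) := by
  rw [eulerChain_eq]
  exact eulerSolve_spec (hA.bijective hh z) _

theorem stronglyMeasurable_eulerChain [SecondCountableTopology D] [SecondCountableTopology H]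
    (hA : SmoothFamily law i k J A c C) {h : ℝ} (hh : 0 < h) {u : ℕ → (Fin N → ℝ) → H}
    (hu : ∀ l ≤ k, StronglyMeasurable (u l)) :
    ∀ l ≤ k, StronglyMeasurable (eulerChain J A h u l) := by
  intro l
  induction l using Nat.strong_induction_on with
  | _ l ih =>
  intro hl
  have h1 : eulerChain J A h u l = fun z => eulerSolve J (A 0 z) h
      (u l z - h • ∑ j ∈ Finset.range l,
        (l.choose j : ℝ) • A (l - j) z (eulerChain J A h u j z)) := by
    funext z
    exact eulerChain_eq u l z
  rw [h1]
  refine stronglyMeasurable_eulerSolve (hA.meas 0 (Nat.zero_le _)) (hA.bijective hh) ?_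
  refine (hu l hl).sub (StronglyMeasurable.const_smul ?_ h)
  refine Finset.stronglyMeasurable_fun_sum _ fun j hj => StronglyMeasurable.const_smul ?_ _
  have hj' := Finset.mem_range.1 hj
  exact stronglyMeasurable_clm_apply (hA.meas (l - j) (by omega)) (ih j hj' (by omega))

theorem update_mem_box_eventually {z : Fin N → ℝ} (hz : z ∈ box law) (i : Fin N) :
    ∀ᶠ t in 𝓝 (z i), Function.update z i t ∈ box law := by
  have h1 : Continuous fun t : ℝ => Function.update z i t := continuous_const.update i continuous_id
  refine h1.continuousAt.eventually_mem ?_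
  rw [Function.update_eq_self]
  exact (isOpen_box law).mem_nhds hz

/-- The functions of `eulerChain` are successive weak derivatives along coordinate lines. -/
theorem hasWeakDerivAt_eulerChain (hA : SmoothFamily law i k J A c C) {h : ℝ} (hh : 0 < h)
    {u : ℕ → (Fin N → ℝ) → H} (hu : ∀ l < k, ∀ z ∈ box law,
      HasWeakDerivAt (fun t => u l (Function.update z i t)) (u (l + 1) z) (z i)) :
    ∀ l < k, ∀ z ∈ box law, HasWeakDerivAt
      (fun t => eulerChain J A h u l (Function.update z i t)) (eulerChain J A h u (l + 1) z)
      (z i) := by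
  intro l
  induction l using Nat.strong_induction_on with
  | _ l ih =>
  intro hl z hz
  set w := eulerChain J A h u with hw
  have hB : ∀ d, HasWeakDerivAt (fun t => (J + h • A 0 (Function.update z i t)) d)
      ((h • A 1 z) d) (z i) := by
    intro d
    have h1 := (hasWeakDerivAt_const (J d) (z i)).add
      ((hA.deriv 0 (by omega) z hz d).const_smul h)
    rw [zero_add] at h1
    exact h1
  -- the derivative of the right-hand side of the equation for `w l`
  have hR : HasWeakDerivAt (fun t => u l (Function.update z i t) - h • ∑ j ∈ Finset.range l,
      (l.choose j : ℝ) • A (l - j) (Function.update z i t) (w j (Function.update z i t)))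
      (u (l + 1) z - h • ∑ j ∈ Finset.range l,
        (l.choose j : ℝ) • (A (l - j + 1) z (w j z) + A (l - j) z (w (j + 1) z))) (z i) := by
    refine (hu l hl z hz).sub (HasWeakDerivAt.const_smul h (HasWeakDerivAt.sum _ fun j hj =>
      HasWeakDerivAt.const_smul _ ?_))
    have hj' := Finset.mem_range.1 hj
    have h1 := HasWeakDerivAt.clm_apply (A := fun t => A (l - j) (Function.update z i t))
      (A' := A (l - j + 1) z) (fun d => hA.deriv (l - j) (by omega) z hz d)
      (ih j hj' (by omega) z hz)
    simpa only [Function.update_eq_self] using h1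
  have hb := hA.bijective hh z
  set G := (ContinuousLinearEquiv.ofBijective (J + h • A 0 z)
    (LinearMap.ker_eq_bot.2 hb.1) (LinearMap.range_eq_top.2 hb.2)) with hG
  refine HasWeakDerivAt.of_clm_apply_eq (B := fun t => J + h • A 0 (Function.update z i t))
    (B' := h • A 1 z) hB hR (Eventually.of_forall fun t => ?_) (G.symm : H →L[ℝ] D) (fun d => ?_) ?_
  · exact hA.eulerChain_spec hh u l (Function.update z i t)
  · rw [Function.update_eq_self]
    exact G.symm_apply_apply d
  · rw [Function.update_eq_self]
    have h1 := hA.eulerChain_spec hh u (l + 1) z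
    refine h1.trans ?_
    rw [← sum_choose_succ_mul (fun a b => A a z (w b z)) l, smul_add, smul_apply]
    abel

end SmoothFamily

end RandomEvolution

/-! ### Weighted regularity of the implicit Euler iterates -/

namespace RandomEvolution

variable {N : ℕ}

/-- The derivatives of order `l` of the `m`-th implicit Euler iterate with starting value `f 0`,
where `f l` are the derivatives of `f 0`. -/
noncomputable def eulerIter {Z D H : Type*} [NormedAddCommGroup D] [NormedSpace ℝ D]
    [NormedAddCommGroup H] [NormedSpace ℝ H] (J : D →L[ℝ] H) (A : ℕ → Z → D →L[ℝ] H) (h : ℝ)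
    (f : ℕ → Z → D) : ℕ → ℕ → Z → D
  | 0 => f
  | m + 1 => eulerChain J A h fun l z => J (eulerIter J A h f m l z)

/-- A chain of continuous functions that are successive derivatives in direction `i` and whose
weighted versions are square integrable. -/
structure SmoothChain {D : Type*} [NormedAddCommGroup D] [InnerProductSpace ℝ D]
    (law : Fin N → NoiseLaw) (i : Fin N) (k : ℕ) (f : ℕ → (Fin N → ℝ) → D) : Prop where
  deriv : ∀ l < k, ∀ z ∈ box law,
    HasWeakDerivAt (fun t => f l (Function.update z i t)) (f (l + 1) z) (z i)
  cont : ∀ l, Continuous (f l)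
  memLp : ∀ l, MemLp (fun z => √((law i).sigma.eval (z i)) ^ l • f l z) 2
    (Measure.pi fun i => (law i).measure)

theorem hasDerivAt_chaosDeriv (law : Fin N → NoiseLaw) [∀ i, IsProbabilityMeasure (law i).measure]
    (i : Fin N) (l : ℕ) (α : Fin N → ℕ) (z : Fin N → ℝ) :
    HasDerivAt (fun t => chaosDeriv law i l α (Function.update z i t))
      (chaosDeriv law i (l + 1) α z) (z i) := by
  simp only [chaosDeriv, tensorPoly_update, Function.iterate_succ_apply', Function.update_self]
  have h1 : ∀ t : ℝ, ∏ k ∈ Finset.univ.erase i,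
      ((law k).orthPoly (α k)).eval (Function.update z i t k) =
      ∏ k ∈ Finset.univ.erase i, ((law k).orthPoly (α k)).eval (z k) := fun t =>
    Finset.prod_congr rfl fun k hk => by rw [Function.update_of_ne (Finset.ne_of_mem_erase hk)]
  simp_rw [h1]
  exact (Polynomial.hasDerivAt _ _).mul_const _

theorem smoothChain_chaosDeriv (law : Fin N → NoiseLaw)
    [∀ i, IsProbabilityMeasure (law i).measure] {D : Type*} [NormedAddCommGroup D]
    [InnerProductSpace ℝ D] (i : Fin N) (k : ℕ) (S : Finset (Fin N → ℕ)) (c : (Fin N → ℕ) → D) :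
    SmoothChain law i k fun l z => ∑ α ∈ S, chaosDeriv law i l α z • c α where
  deriv l _ z _ := by
    refine HasWeakDerivAt.sum S fun α _ => HasDerivAt.hasWeakDerivAt ?_
    exact (hasDerivAt_chaosDeriv law i l α z).smul_const (c α)
  cont l := by
    have : ∀ α, Continuous (chaosDeriv law i l α) := fun α => continuous_tensorPoly _
    exact continuous_finsetSum _ fun α _ => (this α).smul continuous_const
  memLp l := by
    simp only [Finset.smul_sum, smul_smul]
    exact memLp_sum_smul (fun α => memLp_sqrt_sigma_mul law i l _) S c

section Iterates

variable {D H : Type*} [NormedAddCommGroup D] [InnerProductSpace ℝ D] [CompleteSpace D]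
  [NormedAddCommGroup H] [InnerProductSpace ℝ H] [CompleteSpace H]
  {law : Fin N → NoiseLaw} {i : Fin N} {k : ℕ} {J : D →L[ℝ] H}
  {A : ℕ → (Fin N → ℝ) → D →L[ℝ] H} {c C : ℝ}

namespace SmoothFamily

theorem eulerIter_spec (hA : SmoothFamily law i k J A c C) {h : ℝ} (hh : 0 < h)
    (f : ℕ → (Fin N → ℝ) → D) (m l : ℕ) (z : Fin N → ℝ) :
    J (eulerIter J A h f (m + 1) l z) + h • A 0 z (eulerIter J A h f (m + 1) l z) =
      J (eulerIter J A h f m l z) - h • ∑ j ∈ Finset.range l,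
        (l.choose j : ℝ) • A (l - j) z (eulerIter J A h f (m + 1) j z) :=
  hA.eulerChain_spec hh _ l z

theorem hasWeakDerivAt_eulerIter (hA : SmoothFamily law i k J A c C) {h : ℝ} (hh : 0 < h)
    {f : ℕ → (Fin N → ℝ) → D} (hf : SmoothChain law i k f) (m : ℕ) :
    ∀ l < k, ∀ z ∈ box law, HasWeakDerivAt
      (fun t => eulerIter J A h f m l (Function.update z i t)) (eulerIter J A h f m (l + 1) z)
      (z i) := by
  induction m with
  | zero => exact hf.deriv
  | succ m ih =>
    exact hA.hasWeakDerivAt_eulerChain hh fun l hl z hz => (ih l hl z hz).clm J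

theorem stronglyMeasurable_eulerIter [SecondCountableTopology D] [SecondCountableTopology H]
    (hA : SmoothFamily law i k J A c C) {h : ℝ} (hh : 0 < h)
    {f : ℕ → (Fin N → ℝ) → D} (hf : SmoothChain law i k f) (m : ℕ) :
    ∀ l ≤ k, StronglyMeasurable (eulerIter J A h f m l) := by
  induction m with
  | zero => exact fun l _ => (hf.cont l).stronglyMeasurable
  | succ m ih =>
    exact hA.stronglyMeasurable_eulerChain hh fun l hl => J.continuous.comp_stronglyMeasurable (ih l hl)

/-- The energy estimate for the iterates at almost every point of the box. -/
theorem exists_energy_bound_eulerIter (J : D →L[ℝ] H) {c C : ℝ} (hc : 0 < c) (hC : 0 ≤ C) (l : ℕ) :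
    ∃ K : ℝ, 0 ≤ K ∧ ∀ {i : Fin N} {A : ℕ → (Fin N → ℝ) → D →L[ℝ] H} {k : ℕ}, l ≤ k →
      SmoothFamily law i k J A c C → ∀ {h : ℝ}, 0 < h → ∀ (f : ℕ → (Fin N → ℝ) → D),
      ∀ z ∈ box law, ∀ M,
        ‖√((law i).sigma.eval (z i)) ^ l • J (eulerIter J A h f M l z)‖ ^ 2 +
          h * ∑ m ∈ Finset.range M,
            ‖√((law i).sigma.eval (z i)) ^ l • eulerIter J A h f (m + 1) l z‖ ^ 2 ≤
        K * ∑ j ∈ Finset.range (l + 1), ‖√((law i).sigma.eval (z i)) ^ j • f j z‖ ^ 2 := by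
  obtain ⟨K, hK0, hK⟩ := exists_energy_bound J hc hC l
  refine ⟨K, hK0, fun {i A k} hl hA {h} hh f z hz M => ?_⟩
  exact hK (fun r => A r z) (√((law i).sigma.eval (z i))) h (Real.sqrt_nonneg _) hh (hA.lower z)
    (hA.symm z) (hA.coer z) (fun r hr => hA.bound r (hr.trans hl) z hz)
    (fun m r => eulerIter J A h f m r z) (fun m r _ => hA.eulerIter_spec hh f m r z) M

theorem exists_norm_eulerIter_le (hA : SmoothFamily law i k J A c C) {h : ℝ} (hh : 0 < h)
    (f : ℕ → (Fin N → ℝ) → D) (m : ℕ) {l : ℕ} (hl : l ≤ k) :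
    ∃ K : ℝ, 0 ≤ K ∧ ∀ z ∈ box law,
      ‖√((law i).sigma.eval (z i)) ^ l • eulerIter J A h f m l z‖ ≤
        K * ∑ j ∈ Finset.range (l + 1), ‖√((law i).sigma.eval (z i)) ^ j • f j z‖ := by
  rcases m with _ | m
  · refine ⟨1, zero_le_one, fun z _ => ?_⟩
    rw [one_mul]
    exact Finset.single_le_sum (f := fun j => ‖√((law i).sigma.eval (z i)) ^ j • f j z‖)
      (fun _ _ => norm_nonneg _) (Finset.mem_range.2 (Nat.lt_succ_self l))
  · obtain ⟨K, hK0, hK⟩ := exists_energy_bound_eulerIter (law := law) J hA.pos hA.nonneg l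
    refine ⟨√(K / h), Real.sqrt_nonneg _, fun z hz => ?_⟩
    have h1 := hK hl hA hh f z hz (m + 1)
    rw [Finset.sum_range_succ] at h1
    set s := √((law i).sigma.eval (z i)) with hs
    have h2 : 0 ≤ ∑ m ∈ Finset.range m, ‖s ^ l • eulerIter J A h f (m + 1) l z‖ ^ 2 :=
      Finset.sum_nonneg fun _ _ => sq_nonneg _
    have h3 : ∑ j ∈ Finset.range (l + 1), ‖s ^ j • f j z‖ ^ 2 ≤
        (∑ j ∈ Finset.range (l + 1), ‖s ^ j • f j z‖) ^ 2 :=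
      Finset.sum_sq_le_sq_sum_of_nonneg fun _ _ => norm_nonneg _
    have h4 : h * ‖s ^ l • eulerIter J A h f (m + 1) l z‖ ^ 2 ≤
        K * (∑ j ∈ Finset.range (l + 1), ‖s ^ j • f j z‖) ^ 2 := by
      have h5 := mul_le_mul_of_nonneg_left h3 hK0
      have h6 := mul_nonneg hh.le h2
      have h7 := sq_nonneg ‖s ^ l • J (eulerIter J A h f (m + 1) l z)‖
      rw [mul_add] at h1
      linarith
    refine (le_abs_self _).trans (abs_le_of_sq_le_sq ?_ (mul_nonneg (Real.sqrt_nonneg _)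
      (Finset.sum_nonneg fun _ _ => norm_nonneg _)))
    rw [mul_pow, Real.sq_sqrt (by positivity), div_mul_eq_mul_div, le_div_iff₀ hh, mul_comm]
    exact h4

variable [SecondCountableTopology D] [SecondCountableTopology H]

theorem memLp_eulerIter [∀ i, IsProbabilityMeasure (law i).measure]
    (hA : SmoothFamily law i k J A c C) {h : ℝ} (hh : 0 < h)
    {f : ℕ → (Fin N → ℝ) → D} (hf : SmoothChain law i k f) (m : ℕ) {l : ℕ} (hl : l ≤ k) :
    MemLp (fun z => √((law i).sigma.eval (z i)) ^ l • eulerIter J A h f m l z) 2 (piLaw law) := by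
  obtain ⟨K, hK0, hK⟩ := hA.exists_norm_eulerIter_le hh f m hl
  have h1 : MemLp (fun z => ∑ j ∈ Finset.range (l + 1),
      ‖√((law i).sigma.eval (z i)) ^ j • f j z‖) 2 (piLaw law) :=
    memLp_finsetSum _ fun j _ => (hf.memLp j).norm
  have hs : Continuous fun z : Fin N → ℝ => √((law i).sigma.eval (z i)) ^ l := by
    have := (law i).sigma.continuous
    fun_prop
  refine (h1.const_mul K).mono' (hs.stronglyMeasurable.smul
    (hA.stronglyMeasurable_eulerIter hh hf m l hl)).aestronglyMeasurable ?_
  filter_upwards [ae_mem_box law] with z hz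
  exact hK z hz

theorem locallyIntegrableOn_eulerIter (hA : SmoothFamily law i k J A c C) {h : ℝ} (hh : 0 < h)
    {f : ℕ → (Fin N → ℝ) → D} (hf : SmoothChain law i k f) (m : ℕ) {l : ℕ} (hl : l ≤ k) :
    LocallyIntegrableOn (eulerIter J A h f m l) (box law) := by
  obtain ⟨K, hK0, hK⟩ := hA.exists_norm_eulerIter_le hh f m hl
  have hpos : ∀ z ∈ box law, 0 < √((law i).sigma.eval (z i)) ^ l := fun z hz =>
    pow_pos (Real.sqrt_pos.2 ((law i).sigma_pos (hz i))) l
  have hcont : ContinuousOn (fun z => (√((law i).sigma.eval (z i)) ^ l)⁻¹ *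
      (K * ∑ j ∈ Finset.range (l + 1), ‖√((law i).sigma.eval (z i)) ^ j • f j z‖))
      (box law) := by
    have h1 := (law i).sigma.continuous
    have h2 := hf.cont
    refine ContinuousOn.mul (ContinuousOn.inv₀ (by fun_prop) fun z hz => (hpos z hz).ne') ?_
    fun_prop
  intro z₀ hz₀
  obtain ⟨u, hu, hint⟩ := hcont.locallyIntegrableOn (isOpen_box law).measurableSet z₀ hz₀
    (μ := volume)
  refine ⟨u ∩ box law, inter_mem hu self_mem_nhdsWithin, ?_⟩
  refine (hint.mono_set inter_subset_left).mono'
    (hA.stronglyMeasurable_eulerIter hh hf m l hl).aestronglyMeasurable ?_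
  refine ae_restrict_of_ae_restrict_of_subset inter_subset_right
    ((ae_restrict_iff' (isOpen_box law).measurableSet).2 (Eventually.of_forall fun z hz => ?_))
  have h1 := hK z hz
  have h2 := hpos z hz
  rw [norm_smul, Real.norm_of_nonneg h2.le] at h1
  rw [inv_mul_eq_div, le_div_iff₀ h2, mul_comm]
  exact h1

/-- The images of the Euler iterates under a bounded operator have weighted weak derivatives up to
the order `k` in direction `i`. -/
theorem weakChain_clm_eulerIter [∀ i, IsProbabilityMeasure (law i).measure]
    {E : Type*} [NormedAddCommGroup E] [InnerProductSpace ℝ E] [CompleteSpace E] (T : D →L[ℝ] E)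
    (hA : SmoothFamily law i k J A c C) {h : ℝ} (hh : 0 < h)
    {f : ℕ → (Fin N → ℝ) → D} (hf : SmoothChain law i k f) (m : ℕ) :
    WeakChain law i k fun l z => T (eulerIter J A h f m l z) where
  weak l hl := by
    have hloc : ∀ l ≤ k, LocallyIntegrableOn (fun z => T (eulerIter J A h f m l z)) (box law) := by
      intro l hl z hz
      obtain ⟨u, hu, hint⟩ := hA.locallyIntegrableOn_eulerIter hh hf m hl z hz
      exact ⟨u, hu, T.integrable_comp hint⟩
    exact isWeakPartial_of_hasWeakDerivAt law i (hloc l hl.le) (hloc (l + 1) hl)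
      fun z hz => (hA.hasWeakDerivAt_eulerIter hh hf m l hl z hz).clm T
  memLp l hl := by
    have := T.comp_memLp' (hA.memLp_eulerIter hh hf m hl)
    refine this.ae_eq (Eventually.of_forall fun z => ?_)
    simp only [Function.comp_apply, map_smul]

/-- The integrated energy estimate. -/
theorem exists_integral_energy_bound [∀ i, IsProbabilityMeasure (law i).measure]
    (J : D →L[ℝ] H) {c C : ℝ} (hc : 0 < c) (hC : 0 ≤ C) (l : ℕ) :
    ∃ K : ℝ, 0 ≤ K ∧ ∀ {i : Fin N} {A : ℕ → (Fin N → ℝ) → D →L[ℝ] H} {k : ℕ}, l ≤ k →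
      SmoothFamily law i k J A c C → ∀ {h : ℝ}, 0 < h → ∀ {f : ℕ → (Fin N → ℝ) → D},
      SmoothChain law i k f → ∀ M,
        ∫ z, ‖√((law i).sigma.eval (z i)) ^ l • J (eulerIter J A h f M l z)‖ ^ 2 ∂(piLaw law) +
          h * ∑ m ∈ Finset.range M, ∫ z,
            ‖√((law i).sigma.eval (z i)) ^ l • eulerIter J A h f (m + 1) l z‖ ^ 2 ∂(piLaw law) ≤
        K * ∑ j ∈ Finset.range (l + 1),
          ∫ z, ‖√((law i).sigma.eval (z i)) ^ j • f j z‖ ^ 2 ∂(piLaw law) := by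
  obtain ⟨K, hK0, hK⟩ := exists_energy_bound_eulerIter (law := law) J hc hC l
  refine ⟨K, hK0, fun {i A k} hl hA {h} hh {f} hf M => ?_⟩
  have h1 : Integrable (fun z =>
      ‖√((law i).sigma.eval (z i)) ^ l • J (eulerIter J A h f M l z)‖ ^ 2) (piLaw law) := by
    have := J.comp_memLp' (hA.memLp_eulerIter hh hf M hl)
    refine (integrable_norm_sq_of_memLp this).congr (Eventually.of_forall fun z => ?_)
    simp only [Function.comp_apply, map_smul]
  have h2 : ∀ m, Integrable (fun z =>
      ‖√((law i).sigma.eval (z i)) ^ l • eulerIter J A h f (m + 1) l z‖ ^ 2) (piLaw law) := fun m =>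
    integrable_norm_sq_of_memLp (hA.memLp_eulerIter hh hf (m + 1) hl)
  have h3 : ∀ j, Integrable (fun z => ‖√((law i).sigma.eval (z i)) ^ j • f j z‖ ^ 2)
      (piLaw law) := fun j => integrable_norm_sq_of_memLp (hf.memLp j)
  rw [← integral_finsetSum _ fun m _ => h2 m, ← integral_finsetSum _ fun j _ => h3 j,
    ← integral_const_mul, ← integral_const_mul,
    ← integral_add h1 ((integrable_finsetSum _ fun m _ => h2 m).const_mul h)]
  refine integral_mono_ae (h1.add ((integrable_finsetSum _ fun m _ => h2 m).const_mul h))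
    ((integrable_finsetSum _ fun j _ => h3 j).const_mul K) ?_
  filter_upwards [ae_mem_box law] with z hz
  exact hK hl hA hh f z hz M

end SmoothFamily

end Iterates

end RandomEvolution

/-! ### Polynomial chaos approximation of the implicit Euler iterates -/

namespace RandomEvolution

variable {N : ℕ}

/-- The `m`-th implicit Euler iterate at the parameter `z`. -/
noncomputable def eulerPoint {Z D H : Type*} [NormedAddCommGroup D] [InnerProductSpace ℝ D]
    [NormedAddCommGroup H] [InnerProductSpace ℝ H] (J : D →L[ℝ] H) (A : Z → D →L[ℝ] H) (h : ℝ)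
    (f : Z → D) (m : ℕ) (z : Z) : D :=
  (fun d => eulerSolve J (A z) h (J d))^[m] (f z)

theorem eulerIter_zero_right {Z D H : Type*} [NormedAddCommGroup D] [InnerProductSpace ℝ D]
    [NormedAddCommGroup H] [InnerProductSpace ℝ H] (J : D →L[ℝ] H) (A : ℕ → Z → D →L[ℝ] H) (h : ℝ)
    (f : ℕ → Z → D) (m : ℕ) : eulerIter J A h f m 0 = eulerPoint J (A 0) h (f 0) m := by
  induction m with
  | zero => rfl
  | succ m ih =>
    funext z
    rw [eulerIter, eulerChain_eq]
    simp only [Finset.range_zero, Finset.sum_empty, smul_zero, sub_zero]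
    rw [ih]
    simp only [eulerPoint, Function.iterate_succ_apply']
    rfl

variable {D H : Type*} [NormedAddCommGroup D] [InnerProductSpace ℝ D] [CompleteSpace D]
  [NormedAddCommGroup H] [InnerProductSpace ℝ H] [CompleteSpace H]
  [SecondCountableTopology D] [SecondCountableTopology H]
  {law : Fin N → NoiseLaw} [∀ i, IsProbabilityMeasure (law i).measure]

/-- The truncation errors of the polynomial chaos expansions of the Euler iterates: in `H` for the
last iterate, and in `D`, summed over the time steps, for all of them. -/
theorem exists_chaos_rate_eulerPoint (hN : 1 ≤ N) (J : D →L[ℝ] H) {c C : ℝ} (hc : 0 < c)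
    (hC : 0 ≤ C) (k : ℕ) : ∃ K : ℝ, 0 ≤ K ∧
      ∀ {A : Fin N → ℕ → (Fin N → ℝ) → D →L[ℝ] H} {A₀ : (Fin N → ℝ) → D →L[ℝ] H},
      (∀ i, SmoothFamily law i k J (A i) c C) → (∀ i, A i 0 = A₀) → ∀ {h : ℝ}, 0 < h →
      ∀ {f : Fin N → ℕ → (Fin N → ℝ) → D} {f₀ : (Fin N → ℝ) → D},
      (∀ i, SmoothChain law i k (f i)) → (∀ i, f i 0 = f₀) → ∀ n M : ℕ,
        (n : ℝ) ^ k * ∫ z, ‖J (eulerPoint J A₀ h f₀ M z) -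
            chaosSum law n (fun z => J (eulerPoint J A₀ h f₀ M z)) z‖ ^ 2 ∂(piLaw law) +
          h * ∑ m ∈ Finset.range M, (n : ℝ) ^ k * ∫ z, ‖eulerPoint J A₀ h f₀ (m + 1) z -
            chaosSum law n (eulerPoint J A₀ h f₀ (m + 1)) z‖ ^ 2 ∂(piLaw law) ≤
        K * ∑ i, ∑ j ∈ Finset.range (k + 1),
          ∫ z, ‖√((law i).sigma.eval (z i)) ^ j • f i j z‖ ^ 2 ∂(piLaw law) := by
  obtain ⟨K₀, hK₀, hE₀⟩ := SmoothFamily.exists_integral_energy_bound (law := law) J hc hC 0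
  obtain ⟨K₁, hK₁, hE₁⟩ := SmoothFamily.exists_integral_energy_bound (law := law) J hc hC k
  have hcc := chaosConst_nonneg law k
  refine ⟨chaosConst law k * (K₀ + K₁), by positivity, ?_⟩
  intro A A₀ hA hA₀ h hh f f₀ hf hf₀ n M
  set u := eulerPoint J A₀ h f₀
  set w : Fin N → ℕ → ℕ → (Fin N → ℝ) → D := fun i => eulerIter J (A i) h (f i) with hw
  have hw0 : ∀ i m, w i m 0 = u m := fun i m => by
    have h1 := eulerIter_zero_right J (A i) h (f i) m
    rw [hA₀, hf₀] at h1
    exact h1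
  set S := ∑ i, ∑ j ∈ Finset.range (k + 1),
    ∫ z, ‖√((law i).sigma.eval (z i)) ^ j • f i j z‖ ^ 2 ∂(piLaw law) with hS
  set Si : Fin N → ℝ := fun i => ∑ j ∈ Finset.range (k + 1),
    ∫ z, ‖√((law i).sigma.eval (z i)) ^ j • f i j z‖ ^ 2 ∂(piLaw law) with hSi
  have hSi0 : ∀ i, 0 ≤ Si i := fun i => Finset.sum_nonneg fun j _ =>
    integral_nonneg fun z => by positivity
  have hchain : ∀ i m, WeakChain law i k (w i m) := fun i m => by
    simpa using (hA i).weakChain_clm_eulerIter (ContinuousLinearMap.id ℝ D) hh (hf i) m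
  have hchainJ : ∀ i m, WeakChain law i k (fun l z => J (w i m l z)) := fun i m =>
    (hA i).weakChain_clm_eulerIter J hh (hf i) m
  have i₀ : Fin N := ⟨0, hN⟩
  have hmem : ∀ m, MemLp (u m) 2 (piLaw law) := fun m => by
    have := (hchain i₀ m).memLp 0 (Nat.zero_le _)
    simpa [hw0] using this
  have hrate : ∀ m, (n : ℝ) ^ k * ∫ z, ‖u m z - chaosSum law n (u m) z‖ ^ 2 ∂(piLaw law) ≤
      chaosConst law k * (∫ z, ‖u m z‖ ^ 2 ∂(piLaw law) +
        ∑ i, ∫ z, ‖√((law i).sigma.eval (z i)) ^ k • w i m k z‖ ^ 2 ∂(piLaw law)) := fun m =>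
    pow_mul_integral_norm_sub_chaosSum_sq_le (fun i => hchain i m) (fun i => hw0 i m) (hmem m) n
  have hrateJ : (n : ℝ) ^ k * ∫ z, ‖J (u M z) - chaosSum law n (fun z => J (u M z)) z‖ ^ 2
      ∂(piLaw law) ≤ chaosConst law k * (∫ z, ‖J (u M z)‖ ^ 2 ∂(piLaw law) +
        ∑ i, ∫ z, ‖√((law i).sigma.eval (z i)) ^ k • J (w i M k z)‖ ^ 2 ∂(piLaw law)) :=
    pow_mul_integral_norm_sub_chaosSum_sq_le (fun i => hchainJ i M)
      (fun i => by funext z; rw [hw0]; rfl) (J.comp_memLp' (hmem M)) n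
  -- the energy estimates for the iterates and for their derivatives of order `k`
  have e0 : ∫ z, ‖J (u M z)‖ ^ 2 ∂(piLaw law) +
      h * ∑ m ∈ Finset.range M, ∫ z, ‖u (m + 1) z‖ ^ 2 ∂(piLaw law) ≤ K₀ * S := by
    have h1 := hE₀ (Nat.zero_le k) (hA i₀) hh (hf i₀) M
    have h2 : ∀ m, eulerIter J (A i₀) h (f i₀) m 0 = u m := hw0 i₀
    simp only [pow_zero, one_smul, h2, zero_add, Finset.sum_range_one] at h1
    refine h1.trans (mul_le_mul_of_nonneg_left ?_ hK₀)
    have h3 : ∫ z, ‖f i₀ 0 z‖ ^ 2 ∂(piLaw law) ≤ Si i₀ := by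
      have := Finset.single_le_sum (f := fun j =>
        ∫ z, ‖√((law i₀).sigma.eval (z i₀)) ^ j • f i₀ j z‖ ^ 2 ∂(piLaw law))
        (fun j _ => integral_nonneg fun z => by positivity)
        (Finset.mem_range.2 (Nat.succ_pos k))
      simpa using this
    exact h3.trans (Finset.single_le_sum (f := Si) (fun i _ => hSi0 i) (Finset.mem_univ i₀))
  have e1 : ∀ i, ∫ z, ‖√((law i).sigma.eval (z i)) ^ k • J (w i M k z)‖ ^ 2 ∂(piLaw law) +
      h * ∑ m ∈ Finset.range M,
        ∫ z, ‖√((law i).sigma.eval (z i)) ^ k • w i (m + 1) k z‖ ^ 2 ∂(piLaw law) ≤ K₁ * Si i :=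
    fun i => hE₁ le_rfl (hA i) hh (hf i) M
  have e2 := Finset.sum_le_sum fun i (_ : i ∈ Finset.univ) => e1 i
  rw [← Finset.mul_sum, Finset.sum_add_distrib, ← Finset.mul_sum, Finset.sum_comm] at e2
  have e3 : h * ∑ m ∈ Finset.range M, (n : ℝ) ^ k *
      ∫ z, ‖u (m + 1) z - chaosSum law n (u (m + 1)) z‖ ^ 2 ∂(piLaw law) ≤
      chaosConst law k * (h * ∑ m ∈ Finset.range M, ∫ z, ‖u (m + 1) z‖ ^ 2 ∂(piLaw law) +
        h * ∑ m ∈ Finset.range M, ∑ i,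
          ∫ z, ‖√((law i).sigma.eval (z i)) ^ k • w i (m + 1) k z‖ ^ 2 ∂(piLaw law)) := by
    rw [← mul_add, ← Finset.sum_add_distrib, mul_left_comm, Finset.mul_sum (f := fun m =>
      ∫ z, ‖u (m + 1) z‖ ^ 2 ∂(piLaw law) + ∑ i,
        ∫ z, ‖√((law i).sigma.eval (z i)) ^ k • w i (m + 1) k z‖ ^ 2 ∂(piLaw law))]
    exact mul_le_mul_of_nonneg_left (Finset.sum_le_sum fun m _ => hrate (m + 1)) hh.le
  have e4 := mul_le_mul_of_nonneg_left (add_le_add e0 e2) hcc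
  have e5 : ∑ i, Si i = S := rfl
  rw [e5] at e4
  calc _ ≤ chaosConst law k * (∫ z, ‖J (u M z)‖ ^ 2 ∂(piLaw law) +
        ∑ i, ∫ z, ‖√((law i).sigma.eval (z i)) ^ k • J (w i M k z)‖ ^ 2 ∂(piLaw law)) +
        chaosConst law k * (h * ∑ m ∈ Finset.range M, ∫ z, ‖u (m + 1) z‖ ^ 2 ∂(piLaw law) +
        h * ∑ m ∈ Finset.range M, ∑ i,
          ∫ z, ‖√((law i).sigma.eval (z i)) ^ k • w i (m + 1) k z‖ ^ 2 ∂(piLaw law)) :=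
        add_le_add hrateJ e3
    _ ≤ _ := by
        rw [mul_assoc, add_mul]
        linarith

end RandomEvolution

/-! ### Bounded operators represented by sesquilinear forms -/

namespace RandomEvolution

section Representation

variable {𝕜 : Type*} [RCLike 𝕜] {H : Type*} [NormedAddCommGroup H] [InnerProductSpace 𝕜 H]

theorem real_inner_eq_re [InnerProductSpace ℝ H] (x y : H) :
    inner ℝ x y = RCLike.re (inner 𝕜 x y) := by
  have h1 := norm_add_sq (𝕜 := 𝕜) x y
  have h2 := norm_add_sq_real x y
  linarith

theorem eq_of_forall_inner_denseRange {V : Type*} {j : V → H} (hjd : DenseRange j) {x y : H}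
    (h : ∀ v, inner 𝕜 (j v) x = inner 𝕜 (j v) y) : x = y := by
  rw [← sub_eq_zero]
  exact hjd.eq_zero_of_inner_right 𝕜 fun v => by rw [inner_sub_right, h, sub_self]

theorem norm_le_of_forall_inner_denseRange {V : Type*} {j : V → H} (hjd : DenseRange j) {x : H}
    {C : ℝ} (hC : 0 ≤ C) (h : ∀ v, ‖inner 𝕜 (j v) x‖ ≤ C * ‖j v‖) : ‖x‖ ≤ C := by
  have h1 : ∀ y : H, ‖inner 𝕜 y x‖ ≤ C * ‖y‖ := fun y =>
    hjd.induction_on y (isClosed_le (by fun_prop) (by fun_prop)) h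
  rcases (norm_nonneg x).eq_or_lt with h0 | h0
  · rwa [← h0]
  · have h2 := h1 x
    rw [inner_self_eq_norm_sq_to_K, norm_pow, RCLike.norm_ofReal, abs_norm] at h2
    nlinarith

/-- A form that is bounded in its second argument with respect to the norm of `H` is represented by
a bounded operator into `H`. -/
theorem exists_clm_of_form [CompleteSpace H] {V : Type*} [AddCommGroup V] [Module 𝕜 V]
    {D : Type*} [NormedAddCommGroup D] [NormedSpace 𝕜 D] (j : V →ₗ[𝕜] H)
    (hj : Function.Injective j) (hjd : DenseRange j) (b : D →ₗ[𝕜] V →ₗ⋆[𝕜] 𝕜) {C : ℝ}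
    (hC : 0 ≤ C) (hb : ∀ d v, ‖b d v‖ ≤ C * ‖d‖ * ‖j v‖) :
    ∃ T : D →L[𝕜] H, (∀ d v, b d v = inner 𝕜 (j v) (T d)) ∧ ∀ d, ‖T d‖ ≤ C * ‖d‖ := by
  have key : ∀ d, ∃ y : H, ∀ v, b d v = inner 𝕜 (j v) y := by
    intro d
    set e := LinearEquiv.ofInjective j hj with he
    have hje : ∀ w : LinearMap.range j, j (e.symm w) = w := fun w =>
      congrArg Subtype.val (e.apply_symm_apply w)
    let φ₀ : LinearMap.range j →ₗ[𝕜] 𝕜 :=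
      { toFun := fun w => starRingEnd 𝕜 (b d (e.symm w))
        map_add' := fun x y => by simp only [map_add]
        map_smul' := fun c x => by
          simp only [map_smul, LinearMap.map_smulₛₗ, smul_eq_mul, map_mul, RingHom.id_apply,
            RCLike.conj_conj] }
    let φ : LinearMap.range j →L[𝕜] 𝕜 := φ₀.mkContinuous (C * ‖d‖) fun w => by
      change ‖starRingEnd 𝕜 (b d (e.symm w))‖ ≤ _
      rw [RCLike.norm_conj]
      have := hb d (e.symm w)
      rwa [hje] at this
    obtain ⟨g, hg, -⟩ := exists_extension_norm_eq (LinearMap.range j) φ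
    refine ⟨(InnerProductSpace.toDual 𝕜 H).symm g, fun v => ?_⟩
    rw [← inner_conj_symm, InnerProductSpace.toDual_symm_apply, hg ⟨j v, v, rfl⟩]
    change b d v = starRingEnd 𝕜 (starRingEnd 𝕜 (b d (e.symm (e v))))
    rw [e.symm_apply_apply, RCLike.conj_conj]
  choose T hT using key
  have hTb : ∀ d, ‖T d‖ ≤ C * ‖d‖ := fun d =>
    norm_le_of_forall_inner_denseRange (𝕜 := 𝕜) hjd (by positivity) fun v => by
      rw [← hT]
      exact hb d v
  let T₀ : D →ₗ[𝕜] H :=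
    { toFun := T
      map_add' := fun x y => eq_of_forall_inner_denseRange (𝕜 := 𝕜) hjd fun v => by
        rw [← hT, inner_add_right, ← hT, ← hT, map_add, LinearMap.add_apply]
      map_smul' := fun c x => eq_of_forall_inner_denseRange (𝕜 := 𝕜) hjd fun v => by
        rw [← hT, RingHom.id_apply, inner_smul_right, ← hT, map_smul, LinearMap.smul_apply,
          smul_eq_mul] }
  exact ⟨T₀.mkContinuous C hTb, hT, hTb⟩

end Representation

/-! ### Weak differentiability and measurability tested on dense sets -/

section Dense

variable {H : Type*} [NormedAddCommGroup H] [InnerProductSpace ℝ H]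

/-- A function whose inner products with a dense set are differentiable, with a locally bounded
derivative, is weakly differentiable: the bound makes the difference quotients bounded. -/
theorem hasWeakDerivAt_of_denseRange [CompleteSpace H] {V : Type*} {j : V → H} (hjd : DenseRange j)
    {f f' : ℝ → H} {s M : ℝ} (hM : 0 ≤ M) (h : ∀ᶠ t in 𝓝 s,
      (∀ v, HasDerivAt (fun t => inner ℝ (j v) (f t)) (inner ℝ (j v) (f' t)) t) ∧ ‖f' t‖ ≤ M) :
    HasWeakDerivAt f (f' s) s := by
  -- `f` is Lipschitz near `s`, by the mean value inequality tested on the dense set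
  have hlip : ∀ᶠ t in 𝓝 s, ‖f t - f s‖ ≤ M * |t - s| := by
    obtain ⟨ε, hε, hb⟩ := Metric.eventually_nhds_iff_ball.1 h
    filter_upwards [Metric.ball_mem_nhds s hε] with t ht
    refine norm_le_of_forall_inner_denseRange (𝕜 := ℝ) hjd (by positivity) fun v => ?_
    have h1 := (convex_ball s ε).norm_image_sub_le_of_norm_hasDerivWithin_le
      (f := fun t => inner ℝ (j v) (f t)) (f' := fun t => inner ℝ (j v) (f' t)) (C := M * ‖j v‖)
      (fun x hx => ((hb x hx).1 v).hasDerivWithinAt)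
      (fun x hx => (norm_inner_le_norm _ _).trans (by
        rw [mul_comm]
        exact mul_le_mul_of_nonneg_right (hb x hx).2 (norm_nonneg _)))
      (Metric.mem_ball_self hε) ht
    rw [inner_sub_right]
    refine h1.trans (le_of_eq ?_)
    rw [Real.norm_eq_abs]
    ring
  have hs := h.self_of_nhds
  intro L
  obtain ⟨y, hy⟩ : ∃ y : H, ∀ x, L x = inner ℝ y x :=
    ⟨(InnerProductSpace.toDual ℝ H).symm L, fun x => by rw [InnerProductSpace.toDual_symm_apply]⟩
  simp only [hy]
  rw [hasDerivAt_iff_isLittleO, Asymptotics.isLittleO_iff]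
  intro ε hε
  set B : ℝ := M + ‖f' s‖ + 1 with hB
  have hB0 : 0 < B := by positivity
  obtain ⟨v, hv⟩ := hjd.exists_dist_lt y (ε := ε / (2 * B)) (by positivity)
  have h1 := (hasDerivAt_iff_isLittleO.1 (hs.1 v)).def (c := ε / 2) (by positivity)
  filter_upwards [h1, hlip] with t h2 h3
  rw [smul_eq_mul, Real.norm_eq_abs, Real.norm_eq_abs] at h2 ⊢
  set x : H := f t - f s - (t - s) • f' s with hx
  have h4 : inner ℝ y (f t) - inner ℝ y (f s) - (t - s) * inner ℝ y (f' s) =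
      inner ℝ (y - j v) x + (inner ℝ (j v) (f t) - inner ℝ (j v) (f s) -
        (t - s) * inner ℝ (j v) (f' s)) := by
    rw [hx]
    simp only [inner_sub_left, inner_sub_right, real_inner_smul_right]
    ring
  have h5 : ‖x‖ ≤ B * |t - s| := by
    calc ‖x‖ ≤ ‖f t - f s‖ + ‖(t - s) • f' s‖ := norm_sub_le _ _
      _ ≤ M * |t - s| + |t - s| * ‖f' s‖ := by
          rw [norm_smul, Real.norm_eq_abs]
          gcongr
      _ ≤ B * |t - s| := by
          rw [hB]
          nlinarith [abs_nonneg (t - s)]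
  have h6 : |inner ℝ (y - j v) x| ≤ ε / 2 * |t - s| := by
    calc |inner ℝ (y - j v) x| ≤ ‖y - j v‖ * ‖x‖ := abs_real_inner_le_norm _ _
      _ ≤ ε / (2 * B) * (B * |t - s|) := by
          gcongr
          rw [← dist_eq_norm]
          exact hv.le
      _ = ε / 2 * |t - s| := by
          field_simp
  rw [h4]
  calc |_ + _| ≤ |inner ℝ (y - j v) x| + _ := abs_add_le _ _
    _ ≤ ε / 2 * |t - s| + ε / 2 * |t - s| := add_le_add h6 h2
    _ = ε * |t - s| := by ring

/-- A weakly measurable function with values in a separable Hilbert space is strongly measurable;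
measurability of the inner products with a dense set of vectors suffices. -/
theorem stronglyMeasurable_of_inner_denseRange [CompleteSpace H] [SecondCountableTopology H]
    {Z : Type*} [MeasurableSpace Z] {V : Type*} {j : V → H} (hjd : DenseRange j) {f : Z → H}
    (h : ∀ v, Measurable fun z => inner ℝ (j v) (f z)) : StronglyMeasurable f := by
  have h1 : ∀ y : H, Measurable fun z => inner ℝ y (f z) := by
    intro y
    obtain ⟨u, hu, hu'⟩ := mem_closure_iff_seq_limit.1 (hjd y)
    choose v hv using hu
    refine measurable_of_tendsto_metrizable (f := fun n z => inner ℝ (j (v n)) (f z))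
      (fun n => h (v n)) (tendsto_pi_nhds.2 fun z => ?_)
    simp only [hv]
    exact hu'.inner tendsto_const_nhds
  -- approximate `f` by its projections onto finite-dimensional subspaces
  set U : ℕ → Submodule ℝ H := fun n =>
    Submodule.span ℝ (TopologicalSpace.denseSeq H '' (Finset.range n : Set ℕ)) with hU
  have hfin : ∀ n, FiniteDimensional ℝ (U n) := fun n =>
    FiniteDimensional.span_of_finite ℝ ((Finset.finite_toSet _).image _)
  have hmono : Monotone U := fun m n hmn => Submodule.span_mono (image_mono (by
    simpa using Finset.range_mono hmn))
  have hdense : ⊤ ≤ (⨆ n, U n).topologicalClosure := by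
    rw [top_le_iff, ← Submodule.dense_iff_topologicalClosure_eq_top]
    refine (TopologicalSpace.denseRange_denseSeq H).mono ?_
    rintro _ ⟨n, rfl⟩
    refine (le_iSup U (n + 1)) (Submodule.subset_span ⟨n, ?_, rfl⟩)
    simp
  refine stronglyMeasurable_of_tendsto (f := fun n z => (U n).starProjection (f z)) atTop
    (fun n => ?_) (tendsto_pi_nhds.2 fun z => Submodule.starProjection_tendsto_self U hmono _ hdense)
  have h2 : (fun z => (U n).starProjection (f z)) = fun z =>
      ∑ i, inner ℝ ((stdOrthonormalBasis ℝ (U n) i : U n) : H) (f z) •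
        ((stdOrthonormalBasis ℝ (U n) i : U n) : H) := by
    funext z
    rw [Submodule.starProjection_apply,
      ← (stdOrthonormalBasis ℝ (U n)).sum_repr ((U n).orthogonalProjectionOnto (f z))]
    rw [Submodule.coe_sum]
    refine Finset.sum_congr rfl fun i _ => ?_
    rw [Submodule.coe_smul, OrthonormalBasis.repr_apply_apply,
      Submodule.inner_orthogonalProjectionOnto_eq_of_mem_left]
  rw [h2]
  exact Finset.stronglyMeasurable_fun_sum _ fun i _ => (h1 _).stronglyMeasurable.smul_const _

end Dense

/-! ### Iterated partial derivatives -/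

section PartialDeriv

variable {N : ℕ} {F G : Type*} [NormedAddCommGroup F] [NormedSpace ℝ F] [NormedAddCommGroup G]
  [NormedSpace ℝ G]

theorem contDiff_partialDeriv (i : Fin N) {m : ℕ} {f : (Fin N → ℝ) → F}
    (hf : ContDiff ℝ ((m + 1 : ℕ) : ℕ∞ω) f) : ContDiff ℝ (m : ℕ∞ω) (partialDeriv i f) := by
  have h1 : ContDiff ℝ (m : ℕ∞ω) (fderiv ℝ f) := hf.fderiv_right (by norm_cast)
  exact h1.clm_apply contDiff_const

theorem contDiff_iterate_partialDeriv (i : Fin N) (l : ℕ) {m : ℕ} {f : (Fin N → ℝ) → F}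
    (hf : ContDiff ℝ ((m + l : ℕ) : ℕ∞ω) f) : ContDiff ℝ (m : ℕ∞ω) ((partialDeriv i)^[l] f) := by
  induction l generalizing f with
  | zero => exact hf
  | succ l ih =>
    rw [Function.iterate_succ_apply]
    exact ih (contDiff_partialDeriv i hf)

theorem partialDeriv_add (i : Fin N) {f g : (Fin N → ℝ) → F} (hf : ContDiff ℝ 1 f)
    (hg : ContDiff ℝ 1 g) : partialDeriv i (f + g) = partialDeriv i f + partialDeriv i g := by
  funext z
  simp only [partialDeriv, Pi.add_apply]
  rw [fderiv_add (hf.differentiable one_ne_zero z) (hg.differentiable one_ne_zero z)]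
  rfl

theorem partialDeriv_clm (i : Fin N) (L : F →L[ℝ] G) {f : (Fin N → ℝ) → F} (hf : ContDiff ℝ 1 f) :
    partialDeriv i (L ∘ f) = L ∘ partialDeriv i f := by
  funext z
  simp only [partialDeriv, Function.comp_apply]
  rw [(L.hasFDerivAt.comp z (hf.differentiable one_ne_zero z).hasFDerivAt).fderiv]
  rfl

theorem iterate_partialDeriv_add (i : Fin N) (l : ℕ) {f g : (Fin N → ℝ) → F}
    (hf : ContDiff ℝ (l : ℕ∞ω) f) (hg : ContDiff ℝ (l : ℕ∞ω) g) :
    (partialDeriv i)^[l] (f + g) = (partialDeriv i)^[l] f + (partialDeriv i)^[l] g := by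
  induction l generalizing f g with
  | zero => rfl
  | succ l ih =>
    simp only [Function.iterate_succ_apply]
    rw [partialDeriv_add i (hf.of_le (by norm_cast; omega)) (hg.of_le (by norm_cast; omega))]
    exact ih (contDiff_partialDeriv i hf) (contDiff_partialDeriv i hg)

theorem iterate_partialDeriv_clm (i : Fin N) (l : ℕ) (L : F →L[ℝ] G) {f : (Fin N → ℝ) → F}
    (hf : ContDiff ℝ (l : ℕ∞ω) f) :
    (partialDeriv i)^[l] (L ∘ f) = L ∘ (partialDeriv i)^[l] f := by
  induction l generalizing f with
  | zero => rfl
  | succ l ih =>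
    simp only [Function.iterate_succ_apply]
    rw [partialDeriv_clm i L (hf.of_le (by norm_cast; omega))]
    exact ih (contDiff_partialDeriv i hf)

theorem multiDeriv_single (i : Fin N) (l : ℕ) (f : (Fin N → ℝ) → F) :
    multiDeriv (Pi.single i l) f = (partialDeriv i)^[l] f := by
  have key : ∀ L : List (Fin N), L.Nodup →
      L.foldr (fun k g => (partialDeriv k)^[(Pi.single i l : Fin N → ℕ) k] g) f =
        if i ∈ L then (partialDeriv i)^[l] f else f := by
    intro L
    induction L with
    | nil => simp
    | cons a L ih =>
      intro hL
      obtain ⟨ha, hL'⟩ := List.nodup_cons.1 hL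
      rw [List.foldr_cons, ih hL']
      by_cases hai : a = i
      · subst hai
        simp [ha]
      · have : i ≠ a := fun h => hai h.symm
        simp [hai, this]
  rw [multiDeriv, key _ (List.nodup_finRange N)]
  simp

end PartialDeriv

theorem weightPow_single {N : ℕ} (law : Fin N → NoiseLaw) (i : Fin N) (l : ℕ) (z : Fin N → ℝ) :
    weightPow law (Pi.single i l) z = (law i).weight (z i) ^ ((l : ℝ) / 2) := by
  rw [weightPow, Finset.prod_eq_single i]
  · simp
  · intro k _ hk
    simp [hk]
  · simp

theorem sqrt_sigma_pow_le_weightPow {N : ℕ} (law : Fin N → NoiseLaw) (i : Fin N) (l : ℕ)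
    {z : Fin N → ℝ} (hz : z ∈ box law) :
    √((law i).sigma.eval (z i)) ^ l ≤ weightPow law (Pi.single i l) z := by
  have h1 := (law i).sigma_pos (hz i)
  have h2 := (law i).sigma_le_weight (x := z i)
  rw [weightPow_single, Real.sqrt_eq_rpow, ← Real.rpow_natCast, ← Real.rpow_mul h1.le,
    one_div_mul_eq_div]
  exact Real.rpow_le_rpow h1.le h2 (by positivity)

end RandomEvolution

/-! ### The operators associated with the random form on the whole box -/

namespace RandomEvolution

variable {𝕜 : Type*} [RCLike 𝕜] {N : ℕ}
  {H : Type*} [NormedAddCommGroup H] [InnerProductSpace 𝕜 H]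
  {V : Type*} [NormedAddCommGroup V] [InnerProductSpace 𝕜 V]
  {D : Type*} [NormedAddCommGroup D] [InnerProductSpace 𝕜 D]

/-- The assumptions on the random form `a`: almost surely bounded, coercive and symmetric, with
operators that have the common domain `D`, and with weighted bounds for the derivatives of order at
most `k`. The constants are those of boundedness (`K`) and coercivity (`κ`), of the equivalence of
the graph norm (`c`, `C₁`), and of the bounds for the derivatives (`C₂`). -/
structure RandomForm (law : Fin N → NoiseLaw) (j : V →L[𝕜] H) (ι : D →L[𝕜] V)
    (a : (Fin N → ℝ) → V →ₗ[𝕜] V →ₗ⋆[𝕜] 𝕜) (k : ℕ) (K κ c C₁ C₂ : ℝ) : Prop where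
  inj : Function.Injective j
  dense : DenseRange j
  form : ∀ᵐ z ∂(piLaw law), ∀ u v : V,
    ‖a z u v‖ ≤ K * ‖u‖ * ‖v‖ ∧ κ * ‖u‖ ^ 2 ≤ RCLike.re (a z u u)
  pos : 0 < κ
  symm : ∀ᵐ z ∂(piLaw law), ∀ u v : V, a z u v = starRingEnd 𝕜 (a z v u)
  pos' : 0 < c
  dom : ∀ᵐ z ∂(piLaw law),
    (∀ x : H, x ∈ (formOperator j (a z)).domain ↔ ∃ d : D, j (ι d) = x) ∧
    ∀ (d : D) (hd : j (ι d) ∈ (formOperator j (a z)).domain),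
      c * ‖d‖ ≤ graphNorm (formOperator j (a z)) ⟨j (ι d), hd⟩ ∧
      graphNorm (formOperator j (a z)) ⟨j (ι d), hd⟩ ≤ C₁ * ‖d‖
  smooth : ∀ u v : V, ContDiff ℝ (k : ℕ∞ω) fun z => a z u v
  nonneg : 0 ≤ C₂
  bound : ∀ᵐ z ∂(piLaw law), ∀ (d : D) (v : V) (α : Fin N → ℕ), ∑ i, α i ≤ k →
    ‖(weightPow law α z : 𝕜) * multiDeriv α (fun z => a z (ι d) v) z‖ ≤ C₂ * ‖d‖ * ‖j v‖

namespace RandomForm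

variable {law : Fin N → NoiseLaw}
  {j : V →L[𝕜] H} {ι : D →L[𝕜] V}
  {a : (Fin N → ℝ) → V →ₗ[𝕜] V →ₗ⋆[𝕜] 𝕜} {k : ℕ} {K κ c C₁ C₂ : ℝ}

theorem continuous (ha : RandomForm law j ι a k K κ c C₁ C₂) (u v : V) :
    Continuous fun z => a z u v := (ha.smooth u v).continuous

/-- The derivative of order `l` in direction `i` of the form. -/
theorem exists_derivForm (ha : RandomForm law j ι a k K κ c C₁ C₂) (i : Fin N) {l : ℕ}
    (hl : l ≤ k) (z : Fin N → ℝ) : ∃ b : D →ₗ[𝕜] V →ₗ⋆[𝕜] 𝕜, ∀ d v,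
      b d v = (partialDeriv i)^[l] (fun z => a z (ι d) v) z := by
  have hs : ∀ u v, ContDiff ℝ (l : ℕ∞ω) fun z => a z u v := fun u v =>
    (ha.smooth u v).of_le (by exact_mod_cast hl)
  refine ⟨LinearMap.mk₂'ₛₗ (RingHom.id 𝕜) (starRingEnd 𝕜)
    (fun d v => (partialDeriv i)^[l] (fun z => a z (ι d) v) z) ?_ ?_ ?_ ?_, fun d v => rfl⟩
  · intro d d' v
    have h1 := iterate_partialDeriv_add i l (hs (ι d) v) (hs (ι d') v)
    have h2 : (fun z => a z (ι (d + d')) v) = (fun z => a z (ι d) v) + fun z => a z (ι d') v := by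
      funext z
      simp
    rw [h2, h1, Pi.add_apply]
  · intro r d v
    have h1 := iterate_partialDeriv_clm i l (ContinuousLinearMap.mul ℝ 𝕜 r) (hs (ι d) v)
    have h2 : (fun z => a z (ι (r • d)) v) =
        (ContinuousLinearMap.mul ℝ 𝕜 r) ∘ fun z => a z (ι d) v := by
      funext z
      simp
    rw [h2, h1]
    rfl
  · intro d v v'
    have h1 := iterate_partialDeriv_add i l (hs (ι d) v) (hs (ι d) v')
    have h2 : (fun z => a z (ι d) (v + v')) = (fun z => a z (ι d) v) + fun z => a z (ι d) v' := by
      funext z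
      simp
    rw [h2, h1, Pi.add_apply]
  · intro r d v
    have h1 := iterate_partialDeriv_clm i l (ContinuousLinearMap.mul ℝ 𝕜 (starRingEnd 𝕜 r))
      (hs (ι d) v)
    have h2 : (fun z => a z (ι d) (r • v)) =
        (ContinuousLinearMap.mul ℝ 𝕜 (starRingEnd 𝕜 r)) ∘ fun z => a z (ι d) v := by
      funext z
      simp
    rw [h2, h1]
    rfl

/-- The coercivity constant of the operators relative to the norm of `H`. -/
noncomputable def coerConst (j : V →L[𝕜] H) (κ : ℝ) : ℝ := κ / (‖j‖ ^ 2 + 1)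

theorem coerConst_pos (ha : RandomForm law j ι a k K κ c C₁ C₂) : 0 < coerConst j κ :=
  div_pos ha.pos (by positivity)

theorem coerConst_mul_le (ha : RandomForm law j ι a k K κ c C₁ C₂) (v : V) :
    coerConst j κ * ‖j v‖ ^ 2 ≤ κ * ‖v‖ ^ 2 := by
  have hκ := ha.pos
  have h1 : ‖j v‖ ^ 2 ≤ (‖j‖ ^ 2 + 1) * ‖v‖ ^ 2 := by
    have := pow_le_pow_left₀ (norm_nonneg _) (j.le_opNorm v) 2
    rw [mul_pow] at this
    nlinarith [sq_nonneg ‖v‖]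
  rw [coerConst, div_mul_eq_mul_div, div_le_iff₀ (by positivity)]
  nlinarith

/-- The operators `A z : D → H` represent the form at every point of the box, not only almost
everywhere. -/
def Represents (law : Fin N → NoiseLaw) (j : V →L[𝕜] H) (ι : D →L[𝕜] V)
    (a : (Fin N → ℝ) → V →ₗ[𝕜] V →ₗ⋆[𝕜] 𝕜) (A : (Fin N → ℝ) → D →L[𝕜] H) : Prop :=
  ∀ z ∈ box law, ∀ d v, a z (ι d) v = inner 𝕜 (j v) (A z d)

theorem mem_graph_of_represents {A : (Fin N → ℝ) → D →L[𝕜] H}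
    (ha : RandomForm law j ι a k K κ c C₁ C₂)
    (hA : Represents law j ι a A) {z : Fin N → ℝ} (hz : z ∈ box law) (d : D) :
    (j (ι d), A z d) ∈ (formOperator j (a z)).graph := by
  rw [formOperator_graph j ha.inj ha.dense]
  exact ⟨ι d, rfl, fun v => hA z hz d v⟩

/-- The constant in the lower bound for `‖A z d‖` in terms of `‖d‖`. -/
noncomputable def lowerConst (j : V →L[𝕜] H) (κ c : ℝ) : ℝ := c / (1 + (coerConst j κ)⁻¹)

theorem lowerConst_pos (ha : RandomForm law j ι a k K κ c C₁ C₂) : 0 < lowerConst j κ c := by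
  have := ha.coerConst_pos
  exact div_pos ha.pos' (by positivity)

variable [∀ i, IsProbabilityMeasure (law i).measure]

theorem norm_le (ha : RandomForm law j ι a k K κ c C₁ C₂) {z : Fin N → ℝ} (hz : z ∈ box law)
    (u v : V) : ‖a z u v‖ ≤ K * ‖u‖ * ‖v‖ := by
  obtain ⟨x, hx, hlim⟩ := exists_seq_tendsto_of_ae law ha.form hz
  exact le_of_tendsto' (((ha.continuous u v).tendsto z).comp hlim).norm fun n => ((hx n).2 u v).1

theorem coercive (ha : RandomForm law j ι a k K κ c C₁ C₂) {z : Fin N → ℝ} (hz : z ∈ box law)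
    (u : V) : κ * ‖u‖ ^ 2 ≤ RCLike.re (a z u u) := by
  obtain ⟨x, hx, hlim⟩ := exists_seq_tendsto_of_ae law ha.form hz
  exact ge_of_tendsto' ((RCLike.continuous_re.tendsto _).comp
    (((ha.continuous u u).tendsto z).comp hlim)) fun n => ((hx n).2 u u).2

theorem conj_symm (ha : RandomForm law j ι a k K κ c C₁ C₂) {z : Fin N → ℝ} (hz : z ∈ box law)
    (u v : V) : a z u v = starRingEnd 𝕜 (a z v u) := by
  obtain ⟨x, hx, hlim⟩ := exists_seq_tendsto_of_ae law ha.symm hz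
  have h1 := ((ha.continuous u v).tendsto z).comp hlim
  have h2 := (RCLike.continuous_conj.tendsto _).comp (((ha.continuous v u).tendsto z).comp hlim)
  refine tendsto_nhds_unique h1 (h2.congr fun n => ?_)
  exact ((hx n).2 u v).symm

/-- The bound for the pure derivatives holds at every point of the box, as both sides are continuous
and sets of full measure are dense. The weight is lowered from `√ρ_i` to `√σ_i`. -/
theorem norm_iterate_partialDeriv_le (ha : RandomForm law j ι a k K κ c C₁ C₂) (i : Fin N) {l : ℕ}
    (hl : l ≤ k) {z : Fin N → ℝ} (hz : z ∈ box law) (d : D) (v : V) :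
    √((law i).sigma.eval (z i)) ^ l * ‖(partialDeriv i)^[l] (fun z => a z (ι d) v) z‖ ≤
      C₂ * ‖d‖ * ‖j v‖ := by
  obtain ⟨x, hx, hlim⟩ := exists_seq_tendsto_of_ae law ha.bound hz
  have h1 : Continuous ((partialDeriv i)^[l] fun z => a z (ι d) v) := by
    refine (contDiff_iterate_partialDeriv i l (m := k - l) ?_).continuous
    rw [Nat.sub_add_cancel hl]
    exact ha.smooth _ _
  have h2 : Continuous fun z : Fin N → ℝ => √((law i).sigma.eval (z i)) ^ l *
      ‖(partialDeriv i)^[l] (fun z => a z (ι d) v) z‖ := by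
    have := (law i).sigma.continuous
    fun_prop
  refine le_of_tendsto' ((h2.tendsto z).comp hlim) fun n => ?_
  have h3 := (hx n).2 d v (Pi.single i l) (by simpa using hl)
  rw [multiDeriv_single, norm_mul, RCLike.norm_ofReal] at h3
  refine le_trans ?_ h3
  simp only [Function.comp_apply]
  gcongr
  exact (sqrt_sigma_pow_le_weightPow law i l (hx n).1).trans (le_abs_self _)

/-- The derivatives of the form extend from `V` to `H` in the second argument, hence are represented
by operators from `D` to `H`. -/
theorem exists_derivOperator [CompleteSpace H] (ha : RandomForm law j ι a k K κ c C₁ C₂)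
    (i : Fin N) {l : ℕ} (hl : l ≤ k) {z : Fin N → ℝ} (hz : z ∈ box law) :
    ∃ T : D →L[𝕜] H,
      (∀ d v, (partialDeriv i)^[l] (fun z => a z (ι d) v) z = inner 𝕜 (j v) (T d)) ∧
      ∀ d, √((law i).sigma.eval (z i)) ^ l * ‖T d‖ ≤ C₂ * ‖d‖ := by
  obtain ⟨b, hb⟩ := ha.exists_derivForm i hl z
  have hpos : 0 < √((law i).sigma.eval (z i)) ^ l :=
    pow_pos (Real.sqrt_pos.2 ((law i).sigma_pos (hz i))) l
  obtain ⟨T, hT, hT'⟩ := exists_clm_of_form (j : V →ₗ[𝕜] H) ha.inj ha.dense b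
    (C := C₂ / √((law i).sigma.eval (z i)) ^ l) (div_nonneg ha.nonneg hpos.le) (fun d v => by
      have h1 := ha.norm_iterate_partialDeriv_le i hl hz d v
      rw [hb, div_mul_eq_mul_div, div_mul_eq_mul_div, le_div_iff₀ hpos, mul_comm]
      exact h1)
  refine ⟨T, fun d v => by rw [← hb, hT]; rfl, fun d => ?_⟩
  have := hT' d
  rwa [div_mul_eq_mul_div, le_div_iff₀ hpos, mul_comm] at this

section Operator

variable {A : (Fin N → ℝ) → D →L[𝕜] H}

theorem coer_operator (ha : RandomForm law j ι a k K κ c C₁ C₂) (hA : Represents law j ι a A)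
    {z : Fin N → ℝ} (hz : z ∈ box law) (d : D) :
    coerConst j κ * ‖j (ι d)‖ ^ 2 ≤ RCLike.re (inner 𝕜 (j (ι d)) (A z d)) := by
  rw [← hA z hz]
  exact (ha.coerConst_mul_le (ι d)).trans (ha.coercive hz (ι d))

theorem symm_operator (ha : RandomForm law j ι a k K κ c C₁ C₂) (hA : Represents law j ι a A)
    {z : Fin N → ℝ} (hz : z ∈ box law) (d e : D) :
    inner 𝕜 (j (ι d)) (A z e) = inner 𝕜 (A z d) (j (ι e)) := by
  rw [← hA z hz, ← inner_conj_symm (A z d), ← hA z hz]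
  exact ha.conj_symm hz _ _

theorem coerConst_mul_norm_le (ha : RandomForm law j ι a k K κ c C₁ C₂)
    (hA : Represents law j ι a A) {z : Fin N → ℝ} (hz : z ∈ box law) (d : D) :
    coerConst j κ * ‖j (ι d)‖ ≤ ‖A z d‖ := by
  have h1 := ha.coer_operator hA hz d
  have h2 := (RCLike.re_le_norm _).trans (norm_inner_le_norm (𝕜 := 𝕜) (j (ι d)) (A z d))
  rcases (norm_nonneg (j (ι d))).eq_or_lt with h3 | h3
  · rw [← h3, mul_zero]
    exact norm_nonneg _
  · nlinarith

/-- The lower bound of the graph norm, without the term `‖j (ι d)‖`, which coercivity absorbs. -/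
theorem ae_lower (ha : RandomForm law j ι a k K κ c C₁ C₂) (hA : Represents law j ι a A) :
    ∀ᵐ z ∂(piLaw law), ∀ d, lowerConst j κ c * ‖d‖ ≤ ‖A z d‖ := by
  filter_upwards [ha.dom, ae_mem_box law] with z hdom hz d
  have hg := ha.mem_graph_of_represents hA hz d
  have hd : j (ι d) ∈ (formOperator j (a z)).domain := (hdom.1 _).2 ⟨d, rfl⟩
  have hval : formOperator j (a z) ⟨j (ι d), hd⟩ = A z d :=
    LinearPMap.mem_graph_snd_inj _ (LinearPMap.mem_graph _ ⟨j (ι d), hd⟩) hg rfl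
  have h1 := (hdom.2 d hd).1
  rw [graphNorm, hval] at h1
  have hc := ha.coerConst_pos
  have h2 : ‖j (ι d)‖ ≤ (coerConst j κ)⁻¹ * ‖A z d‖ := by
    rw [inv_mul_eq_div, le_div_iff₀ hc, mul_comm]
    exact ha.coerConst_mul_norm_le hA hz d
  have h3 : √(‖A z d‖ ^ 2 + ‖j (ι d)‖ ^ 2) ≤ ‖A z d‖ + ‖j (ι d)‖ := by
    rw [Real.sqrt_le_left (by positivity)]
    nlinarith [norm_nonneg (A z d), norm_nonneg (j (ι d))]
  rw [lowerConst, div_mul_eq_mul_div, div_le_iff₀ (by positivity)]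
  have h4 : c * ‖d‖ ≤ ‖A z d‖ + ‖j (ι d)‖ := h1.trans h3
  linarith

/-- Lax–Milgram for the form at a point of the box. -/
theorem exists_form_solution [CompleteSpace V] [CompleteSpace H]
    (ha : RandomForm law j ι a k K κ c C₁ C₂) {z : Fin N → ℝ} (hz : z ∈ box law) (g : H) :
    ∃ w : V, ∀ v, a z w v = inner 𝕜 (j v) g := by
  have hK : ∀ u v, ‖a z u v‖ ≤ |K| * ‖u‖ * ‖v‖ := fun u v => (ha.norm_le hz u v).trans (by
    gcongr
    exact le_abs_self K)
  obtain ⟨T, hT, -⟩ := exists_clm_of_form (LinearMap.id : V →ₗ[𝕜] V) Function.injective_id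
    Function.surjective_id.denseRange (a z) (abs_nonneg K) hK
  have hunit : IsUnit T := by
    refine ContinuousLinearMap.isUnit_of_forall_le_norm_inner_map T (c := ⟨κ, ha.pos.le⟩) ha.pos
      fun x => ?_
    have h1 := ha.coercive hz x
    rw [hT] at h1
    rw [mul_comm, norm_inner_symm]
    exact h1.trans (RCLike.re_le_norm _)
  obtain ⟨w, hw⟩ := ((ContinuousLinearMap.isUnit_iff_bijective).1 hunit).2 (j.adjoint g)
  refine ⟨w, fun v => ?_⟩
  rw [hT, hw]
  exact ContinuousLinearMap.adjoint_inner_right j v g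

/-- The variational solution lies in the domain of the form operator, which is almost surely `D`. -/
theorem ae_surjective [CompleteSpace V] [CompleteSpace H]
    (ha : RandomForm law j ι a k K κ c C₁ C₂) (hA : Represents law j ι a A) :
    ∀ᵐ z ∂(piLaw law), Function.Surjective (A z) := by
  filter_upwards [ha.dom, ae_mem_box law] with z hdom hz g
  obtain ⟨w, hw⟩ := ha.exists_form_solution hz g
  have hg : (j w, g) ∈ (formOperator j (a z)).graph := by
    rw [formOperator_graph j ha.inj ha.dense]
    exact ⟨w, rfl, hw⟩
  obtain ⟨d, hd⟩ := (hdom.1 _).1 (LinearPMap.mem_domain_of_mem_graph hg)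
  refine ⟨d, eq_of_forall_inner_denseRange (𝕜 := 𝕜) ha.dense fun v => ?_⟩
  rw [← hA z hz, ha.inj hd, hw]

/-- The operators depend continuously on the parameter, by the bounds for the first derivatives. -/
theorem continuousAt_operator (ha : RandomForm law j ι a k K κ c C₁ C₂) (hk : 1 ≤ k)
    (hA : Represents law j ι a A) {z : Fin N → ℝ} (hz : z ∈ box law) : ContinuousAt A z := by
  have hC := ha.nonneg
  set s : (Fin N → ℝ) → ℝ := fun w => ∑ i, (√((law i).sigma.eval (w i)))⁻¹ with hs
  have hscont : ContinuousAt s z := by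
    refine tendsto_finsetSum _ fun i _ => ?_
    have h1 : Continuous fun w : Fin N → ℝ => √((law i).sigma.eval (w i)) := by
      have := (law i).sigma.continuous
      fun_prop
    exact h1.continuousAt.inv₀ (Real.sqrt_pos.2 ((law i).sigma_pos (hz i))).ne'
  have h1 : ∀ᶠ w in 𝓝 z, w ∈ box law ∧ s w < s z + 1 :=
    (show ∀ᶠ w in 𝓝 z, w ∈ box law from (isOpen_box law).mem_nhds hz).and
      (hscont.eventually_lt_const (lt_add_one _))
  obtain ⟨ε, hε, hb⟩ := Metric.eventually_nhds_iff_ball.1 h1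
  have hsz : 0 ≤ s z := Finset.sum_nonneg fun i _ => inv_nonneg.2 (Real.sqrt_nonneg _)
  set M : ℝ := C₂ * (s z + 1) with hM
  have hM0 : 0 ≤ M := by positivity
  have hlip : ∀ᶠ w in 𝓝 z, ‖A w - A z‖ ≤ M * ‖w - z‖ := by
    filter_upwards [Metric.ball_mem_nhds z hε] with w hw
    refine ContinuousLinearMap.opNorm_le_bound _ (by positivity) fun d => ?_
    refine norm_le_of_forall_inner_denseRange (𝕜 := 𝕜) ha.dense (by positivity) fun v => ?_
    set f : (Fin N → ℝ) → 𝕜 := fun z => a z (ι d) v with hf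
    have hfd : ∀ x, DifferentiableAt ℝ f x := fun x =>
      (ha.smooth (ι d) v).differentiable (by exact_mod_cast Nat.one_le_iff_ne_zero.1 hk) x
    have h2 := (convex_ball z ε).norm_image_sub_le_of_norm_fderiv_le (𝕜 := ℝ) (f := f)
      (C := M * (‖d‖ * ‖j v‖)) (fun x _ => hfd x) (fun x hx => ?_) (Metric.mem_ball_self hε) hw
    · rw [sub_apply, inner_sub_right, ← hA w (hb w hw).1, ← hA z hz]
      refine h2.trans (le_of_eq ?_)
      ring
    · refine ContinuousLinearMap.opNorm_le_bound _ (by positivity) fun y => ?_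
      have hy : y = ∑ i, y i • (Pi.single i (1 : ℝ) : Fin N → ℝ) := by
        ext k
        simp [Finset.sum_apply, Pi.single_apply]
      have hxb := hb x hx
      calc ‖fderiv ℝ f x y‖ = ‖∑ i, y i • partialDeriv i f x‖ := by
            conv_lhs => rw [hy]
            simp only [map_sum, map_smul, partialDeriv]
        _ ≤ ∑ i, ‖y‖ * ((√((law i).sigma.eval (x i)))⁻¹ * (C₂ * ‖d‖ * ‖j v‖)) := by
            refine (norm_sum_le _ _).trans (Finset.sum_le_sum fun i _ => ?_)
            rw [norm_smul]
            have h3 := ha.norm_iterate_partialDeriv_le i hk hxb.1 d v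
            rw [pow_one, Function.iterate_one] at h3
            have h4 : 0 < √((law i).sigma.eval (x i)) :=
              Real.sqrt_pos.2 ((law i).sigma_pos (hxb.1 i))
            gcongr
            · exact norm_le_pi_norm y i
            · rw [inv_mul_eq_div, le_div_iff₀ h4, mul_comm]
              exact h3
        _ = s x * (C₂ * ‖d‖ * ‖j v‖ * ‖y‖) := by
            rw [hs, Finset.sum_mul]
            refine Finset.sum_congr rfl fun i _ => ?_
            ring
        _ ≤ (s z + 1) * (C₂ * ‖d‖ * ‖j v‖ * ‖y‖) := by
            gcongr
            exact hxb.2.le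
        _ = _ := by
            rw [hM]
            ring
  rw [ContinuousAt, tendsto_iff_norm_sub_tendsto_zero]
  refine squeeze_zero' (Eventually.of_forall fun w => norm_nonneg _) hlip ?_
  have : Tendsto (fun w => M * ‖w - z‖) (𝓝 z) (𝓝 (M * ‖z - z‖)) :=
    Continuous.tendsto (by fun_prop) z
  simpa using this

theorem lower_operator (ha : RandomForm law j ι a k K κ c C₁ C₂) (hk : 1 ≤ k)
    (hA : Represents law j ι a A) {z : Fin N → ℝ} (hz : z ∈ box law) (d : D) :
    lowerConst j κ c * ‖d‖ ≤ ‖A z d‖ := by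
  obtain ⟨x, hx, hlim⟩ := exists_seq_tendsto_of_ae law (ha.ae_lower hA) hz
  have h1 := (ha.continuousAt_operator hk hA hz).tendsto.comp hlim
  have h2 : Tendsto (fun n => A (x n) d) atTop (𝓝 (A z d)) :=
    ((ContinuousLinearMap.apply 𝕜 H d).continuous.tendsto _).comp h1
  exact ge_of_tendsto' h2.norm fun n => (hx n).2 d

/-- Surjectivity at every point of the box: the preimages of `g` under nearby operators are
bounded, so `g` is in the closure of the range, which is closed. -/
theorem surjective_operator [CompleteSpace D] [CompleteSpace V] [CompleteSpace H]
    (ha : RandomForm law j ι a k K κ c C₁ C₂) (hk : 1 ≤ k)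
    (hA : Represents law j ι a A) {z : Fin N → ℝ} (hz : z ∈ box law) :
    Function.Surjective (A z) := by
  have hc := ha.lowerConst_pos
  have hanti : AntilipschitzWith (Real.toNNReal (lowerConst j κ c)⁻¹) (A z) := by
    refine (A z).antilipschitz_of_bound fun d => ?_
    rw [Real.coe_toNNReal _ (by positivity), inv_mul_eq_div, le_div_iff₀ hc, mul_comm]
    exact ha.lower_operator hk hA hz d
  have hclosed : IsClosed (range (A z)) := hanti.isClosed_range (A z).uniformContinuous
  intro g
  obtain ⟨x, hx, hlim⟩ := exists_seq_tendsto_of_ae law (ha.ae_surjective hA) hz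
  choose d hd using fun n => (hx n).2 g
  have h1 := (ha.continuousAt_operator hk hA hz).tendsto.comp hlim
  rw [tendsto_iff_norm_sub_tendsto_zero] at h1
  have hdn : ∀ n, ‖d n‖ ≤ ‖g‖ / lowerConst j κ c := fun n => by
    rw [le_div_iff₀ hc, mul_comm, ← hd n]
    exact ha.lower_operator hk hA (hx n).1 (d n)
  suffices h2 : Tendsto (fun n => A z (d n)) atTop (𝓝 g) from
    hclosed.mem_of_tendsto h2 (Eventually.of_forall fun n => mem_range_self _)
  rw [tendsto_iff_norm_sub_tendsto_zero]
  refine squeeze_zero (fun n => norm_nonneg _) (fun n => ?_)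
    (by simpa using h1.mul_const (‖g‖ / lowerConst j κ c))
  calc ‖A z (d n) - g‖ = ‖(A (x n) - A z) (d n)‖ := by
        rw [sub_apply, hd n, norm_sub_rev]
    _ ≤ ‖A (x n) - A z‖ * ‖d n‖ := ContinuousLinearMap.le_opNorm _ _
    _ ≤ _ := by
        gcongr
        exact hdn n

end Operator

end RandomForm

end RandomEvolution

/-! ### The smooth family of operators of a random form -/

namespace RandomEvolution

variable {𝕜 : Type*} [RCLike 𝕜] {N : ℕ}
  {H : Type*} [NormedAddCommGroup H] [InnerProductSpace 𝕜 H] [CompleteSpace H]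
  {V : Type*} [NormedAddCommGroup V] [InnerProductSpace 𝕜 V] [CompleteSpace V]
  {D : Type*} [NormedAddCommGroup D] [InnerProductSpace 𝕜 D] [CompleteSpace D]

namespace RandomForm

variable {law : Fin N → NoiseLaw} [∀ i, IsProbabilityMeasure (law i).measure]
  {j : V →L[𝕜] H} {ι : D →L[𝕜] V}
  {a : (Fin N → ℝ) → V →ₗ[𝕜] V →ₗ⋆[𝕜] 𝕜} {k : ℕ} {K κ c C₁ C₂ : ℝ}

/-- `D` is separable because it is isomorphic to `H` through any one of the operators. -/
theorem secondCountableTopology_domain [SecondCountableTopology H] (hN : 1 ≤ N)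
    (ha : RandomForm law j ι a k K κ c C₁ C₂) (hk : 1 ≤ k) : SecondCountableTopology D := by
  obtain ⟨z₀, hz₀⟩ := (ae_mem_box law).exists
  have key : ∀ z, ∃ T : D →L[𝕜] H, z ∈ box law → ∀ d v, a z (ι d) v = inner 𝕜 (j v) (T d) := by
    intro z
    by_cases hz : z ∈ box law
    · obtain ⟨T, hT, -⟩ := ha.exists_derivOperator ⟨0, hN⟩ (Nat.zero_le k) hz
      exact ⟨T, fun _ => hT⟩
    · exact ⟨0, fun h => absurd h hz⟩
  choose A hA using key
  have hc := ha.lowerConst_pos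
  have hinj : Function.Injective (A z₀) := by
    refine (injective_iff_map_eq_zero _).2 fun d hd => ?_
    have h1 := ha.lower_operator hk hA hz₀ d
    rw [hd, norm_zero] at h1
    exact norm_le_zero_iff.1 (nonpos_of_mul_nonpos_right h1 hc)
  have hsurj := ha.surjective_operator hk hA hz₀
  exact (ContinuousLinearEquiv.ofBijective (A z₀) (LinearMap.ker_eq_bot.2 hinj)
    (LinearMap.range_eq_top.2 hsurj)).toHomeomorph.secondCountableTopology

variable [InnerProductSpace ℝ H] [IsScalarTower ℝ 𝕜 H] [InnerProductSpace ℝ D] [IsScalarTower ℝ 𝕜 D]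

/-- Outside the box the operators are frozen at a fixed point of the box, so that invertibility and
coercivity hold everywhere and not only almost everywhere. -/
theorem exists_smoothFamily [SecondCountableTopology H] (hN : 1 ≤ N)
    (ha : RandomForm law j ι a k K κ c C₁ C₂) (hk : 1 ≤ k) :
    ∃ (A₀ : (Fin N → ℝ) → D →L[𝕜] H) (A : Fin N → ℕ → (Fin N → ℝ) → D →L[ℝ] H),
      Represents law j ι a A₀ ∧
      (∀ i, SmoothFamily law i k ((j.comp ι).restrictScalars ℝ) (A i)
        (min (coerConst j κ) (lowerConst j κ c)) C₂) ∧
      ∀ i, A i 0 = fun z => (A₀ z).restrictScalars ℝ := by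
  classical
  obtain ⟨z₀, hz₀⟩ := (ae_mem_box law).exists
  have key : ∀ (i : Fin N) (l : ℕ) (z : Fin N → ℝ), ∃ T : D →L[𝕜] H, l ≤ k → z ∈ box law →
      (∀ d v, (partialDeriv i)^[l] (fun z => a z (ι d) v) z = inner 𝕜 (j v) (T d)) ∧
      ∀ d, √((law i).sigma.eval (z i)) ^ l * ‖T d‖ ≤ C₂ * ‖d‖ := by
    intro i l z
    by_cases h : l ≤ k ∧ z ∈ box law
    · obtain ⟨T, hT⟩ := ha.exists_derivOperator i h.1 h.2
      exact ⟨T, fun _ _ => hT⟩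
    · exact ⟨0, fun h1 h2 => absurd ⟨h1, h2⟩ h⟩
  choose B hB using key
  set r : (Fin N → ℝ) → (Fin N → ℝ) := fun z => if z ∈ box law then z else z₀ with hr
  have hrm : Measurable r :=
    Measurable.ite (isOpen_box law).measurableSet measurable_id measurable_const
  have hrbox : ∀ z, r z ∈ box law := fun z => by
    by_cases hz : z ∈ box law
    · simpa only [hr, if_pos hz] using hz
    · simpa only [hr, if_neg hz] using hz₀
  have hrz : ∀ z ∈ box law, r z = z := fun z hz => if_pos hz
  set i₀ : Fin N := ⟨0, hN⟩
  have hrep : Represents law j ι a (B i₀ 0) := fun z hz d v => (hB i₀ 0 z (Nat.zero_le k) hz).1 d v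
  have hrep' : Represents law j ι a fun z => B i₀ 0 (r z) := fun z hz d v => by
    beta_reduce
    rw [hrz z hz]
    exact hrep z hz d v
  have huniq : ∀ i, B i 0 ∘ r = B i₀ 0 ∘ r := fun i => by
    funext z
    refine ContinuousLinearMap.ext fun d => eq_of_forall_inner_denseRange (𝕜 := 𝕜) ha.dense
      fun v => ?_
    exact ((hB i 0 (r z) (Nat.zero_le k) (hrbox z)).1 d v).symm.trans
      ((hB i₀ 0 (r z) (Nat.zero_le k) (hrbox z)).1 d v)
  have huniq' : ∀ i z, B i 0 (r z) = B i₀ 0 (r z) := fun i z => congrFun (huniq i) z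
  refine ⟨fun z => B i₀ 0 (r z), fun i l z => (B i l (r z)).restrictScalars ℝ, hrep', fun i => ?_,
    fun i => funext fun z => by beta_reduce; rw [huniq']⟩
  have hinner : ∀ l ≤ k, ∀ z d v, inner ℝ (j v) (B i l (r z) d) =
      RCLike.re ((partialDeriv i)^[l] (fun z => a z (ι d) v) (r z)) := fun l hl z d v => by
    rw [real_inner_eq_re (𝕜 := 𝕜), (hB i l (r z) hl (hrbox z)).1]
  refine ⟨lt_min ha.coerConst_pos ha.lowerConst_pos, ha.nonneg, ?_, ?_, ?_, ?_, ?_, ?_, ?_⟩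
  · intro l hl z hz d
    have hσ : 0 < √((law i).sigma.eval (z i)) := Real.sqrt_pos.2 ((law i).sigma_pos (hz i))
    have hw : Tendsto (fun t => (√((law i).sigma.eval t) ^ (l + 1))⁻¹) (𝓝 (z i))
        (𝓝 (√((law i).sigma.eval (z i)) ^ (l + 1))⁻¹) := by
      have h1 : Continuous fun t : ℝ => √((law i).sigma.eval t) ^ (l + 1) := by
        have := (law i).sigma.continuous
        fun_prop
      exact (h1.tendsto (z i)).inv₀ (pow_pos hσ _).ne'
    have hM : 0 ≤ C₂ * ‖d‖ * ((√((law i).sigma.eval (z i)) ^ (l + 1))⁻¹ + 1) := by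
      have := ha.nonneg
      positivity
    have h2 : HasWeakDerivAt (fun t => B i l (r (Function.update z i t)) d)
        ((fun t => B i (l + 1) (r (Function.update z i t)) d) (z i)) (z i) := by
      refine hasWeakDerivAt_of_denseRange ha.dense
        (f' := fun t => B i (l + 1) (r (Function.update z i t)) d) hM ?_
      filter_upwards [(SmoothFamily.update_mem_box_eventually hz i).eventually_nhds,
        hw.eventually_lt_const (lt_add_one _)] with t ht ht'
      refine ⟨fun v => ?_, ?_⟩
      · simp only [hinner l hl.le, hinner (l + 1) hl]
        have hd : Differentiable ℝ ((partialDeriv i)^[l] fun z => a z (ι d) v) := by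
          refine (contDiff_iterate_partialDeriv i l (m := k - l) ?_).differentiable
            (by exact_mod_cast (Nat.sub_pos_of_lt hl).ne')
          rw [Nat.sub_add_cancel hl.le]
          exact ha.smooth _ _
        have h3 := partialDeriv_eq_deriv (i := i) (hd (Function.update z i t))
        simp only [Function.update_idem, Function.update_self] at h3
        have h4 := (RCLike.reCLM (K := 𝕜)).hasFDerivAt.comp_hasDerivAt t h3
        rw [hrz _ ht.self_of_nhds, Function.iterate_succ_apply']
        refine HasDerivAt.congr_of_eventuallyEq h4 ?_
        filter_upwards [ht] with s hs
        rw [hrz _ hs]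
        rfl
      · have hb := ht.self_of_nhds
        rw [hrz _ hb]
        have h3 := (hB i (l + 1) _ hl hb).2 d
        have h4 : 0 < √((law i).sigma.eval (Function.update z i t i)) :=
          Real.sqrt_pos.2 ((law i).sigma_pos (hb i))
        rw [Function.update_self] at h3 h4
        calc ‖B i (l + 1) (Function.update z i t) d‖
            ≤ C₂ * ‖d‖ * (√((law i).sigma.eval t) ^ (l + 1))⁻¹ := by
              rw [← div_eq_mul_inv, le_div_iff₀ (pow_pos h4 _), mul_comm]
              exact h3
          _ ≤ _ := by
              have := ha.nonneg
              gcongr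
    simp only [Function.update_eq_self] at h2
    exact h2
  · intro l hl z hz d
    have h1 := (hB i l (r z) hl (hrbox z)).2 d
    rw [hrz z hz] at h1
    change √((law i).sigma.eval (z i)) ^ l * ‖B i l (r z) d‖ ≤ C₂ * ‖d‖
    rwa [hrz z hz]
  · intro z d
    refine (mul_le_mul_of_nonneg_right (min_le_right _ _) (norm_nonneg d)).trans ?_
    change _ ≤ ‖B i 0 (r z) d‖
    rw [huniq']
    exact ha.lower_operator hk hrep (hrbox z) d
  · intro z
    change Function.Surjective (B i 0 (r z))
    rw [huniq']
    exact ha.surjective_operator hk hrep (hrbox z)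
  · intro z d e
    change inner ℝ (j (ι d)) (B i 0 (r z) e) = inner ℝ (B i 0 (r z) d) (j (ι e))
    rw [huniq', real_inner_eq_re (𝕜 := 𝕜), real_inner_eq_re (𝕜 := 𝕜),
      ha.symm_operator hrep (hrbox z)]
  · intro z d
    refine (mul_le_mul_of_nonneg_right (min_le_left _ _) (sq_nonneg _)).trans ?_
    change coerConst j κ * ‖j (ι d)‖ ^ 2 ≤ inner ℝ (j (ι d)) (B i 0 (r z) d)
    rw [huniq', real_inner_eq_re (𝕜 := 𝕜)]
    exact ha.coer_operator hrep (hrbox z) d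
  · intro l hl d
    refine stronglyMeasurable_of_inner_denseRange ha.dense fun v => ?_
    change Measurable fun z => inner ℝ (j v) (B i l (r z) d)
    simp only [hinner l hl]
    have h1 : Continuous ((partialDeriv i)^[l] fun z => a z (ι d) v) := by
      refine (contDiff_iterate_partialDeriv i l (m := k - l) ?_).continuous
      rw [Nat.sub_add_cancel hl]
      exact ha.smooth _ _
    exact (RCLike.continuous_re.comp h1).measurable.comp hrm

end RandomForm

end RandomEvolution

/-! ### The multiplication operator is maximal monotone -/

namespace RandomEvolution

variable {𝕜 : Type*} [RCLike 𝕜] {N : ℕ}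
  {H : Type*} [NormedAddCommGroup H] [InnerProductSpace 𝕜 H]
  {V : Type*} [NormedAddCommGroup V] [InnerProductSpace 𝕜 V]
  {D : Type*} [NormedAddCommGroup D] [InnerProductSpace 𝕜 D]

theorem re_inner_Lp {X : Type*} [MeasurableSpace X] {μ : Measure X} (f g : Lp H 2 μ) :
    RCLike.re (inner 𝕜 f g) = ∫ x, RCLike.re (inner 𝕜 (f x) (g x)) ∂μ := by
  rw [L2.inner_def, integral_re (L2.integrable_inner f g)]

theorem norm_toLp_sq {X : Type*} [MeasurableSpace X] {μ : Measure X} {E : Type*}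
    [NormedAddCommGroup E] {f : X → E} (hf : MemLp f 2 μ) :
    ‖hf.toLp‖ ^ 2 = ∫ x, ‖f x‖ ^ 2 ∂μ := by
  rw [Lp.norm_toLp, toReal_eLpNorm_sq hf]

/-- One Euler step of a monotone operator is a contraction. -/
theorem norm_le_of_euler_eq [InnerProductSpace ℝ H] {x y g : H} {h : ℝ} (hh : 0 ≤ h)
    (hxy : 0 ≤ inner ℝ x y) (hg : x + h • y = g) : h * ‖y‖ ≤ ‖g‖ := by
  have h1 := norm_add_sq_real x (h • y)
  rw [hg, inner_smul_right, norm_smul, Real.norm_of_nonneg hh] at h1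
  refine (sq_le_sq₀ (by positivity) (norm_nonneg _)).1 ?_
  nlinarith [sq_nonneg ‖x‖, mul_nonneg hh hxy]

theorem memLp_embedding (j : V →L[𝕜] H) (ι : D →L[𝕜] V) {μ : Measure (Fin N → ℝ)}
    {w : (Fin N → ℝ) → D} (hw : MemLp w 2 μ) : MemLp (fun z => j (ι (w z))) 2 μ :=
  (j.comp ι).comp_memLp' hw

theorem liftEmbedding_toLp (j : V →L[𝕜] H) (ι : D →L[𝕜] V) {μ : Measure (Fin N → ℝ)}
    {w : (Fin N → ℝ) → D} (hw : MemLp w 2 μ) :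
    liftEmbedding μ (j.comp ι) hw.toLp = (memLp_embedding j ι hw).toLp := by
  refine Lp.ext ?_
  filter_upwards [ContinuousLinearMap.coeFn_compLpL (j.comp ι) hw.toLp, hw.coeFn_toLp,
    (memLp_embedding j ι hw).coeFn_toLp] with z h1 h2 h3
  rw [liftEmbedding, h1, h2, h3]
  rfl

variable {law : Fin N → NoiseLaw}
  {j : V →L[𝕜] H} {ι : D →L[𝕜] V}
  {a : (Fin N → ℝ) → V →ₗ[𝕜] V →ₗ⋆[𝕜] 𝕜} {k : ℕ} {K κ c C₁ C₂ c' : ℝ}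

theorem RandomForm.mem_multiplicationOperator_graph
    [∀ i, IsProbabilityMeasure (law i).measure] (ha : RandomForm law j ι a k K κ c C₁ C₂)
    {A : (Fin N → ℝ) → D →L[𝕜] H} (hA : Represents law j ι a A) {w : (Fin N → ℝ) → D} {f g : Lp H 2 (piLaw law)}
    (hf : f =ᵐ[piLaw law] fun z => j (ι (w z))) (hg : g =ᵐ[piLaw law] fun z => A z (w z)) :
    (f, g) ∈ (multiplicationOperator (piLaw law) fun z => formOperator j (a z)).graph := by
  rw [multiplicationOperator_graph]
  change ∀ᵐ z ∂(piLaw law), (f z, g z) ∈ (formOperator j (a z)).graph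
  filter_upwards [hf, hg, ae_mem_box law] with z h1 h2 hz
  rw [h1, h2]
  exact ha.mem_graph_of_represents hA hz (w z)

variable [SecondCountableTopology H] [SecondCountableTopology D]
  [InnerProductSpace ℝ H] [IsScalarTower ℝ 𝕜 H] [InnerProductSpace ℝ D] [IsScalarTower ℝ 𝕜 D]
  {i : Fin N} {A : (Fin N → ℝ) → D →L[𝕜] H} {B : ℕ → (Fin N → ℝ) → D →L[ℝ] H}

theorem eulerPoint_succ {Z D H : Type*} [NormedAddCommGroup D] [InnerProductSpace ℝ D]
    [NormedAddCommGroup H] [InnerProductSpace ℝ H] (J : D →L[ℝ] H) (A : Z → D →L[ℝ] H) (h : ℝ)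
    (f : Z → D) (m : ℕ) : eulerPoint J A h f (m + 1) =
      fun z => eulerSolve J (A z) h (J (eulerPoint J A h f m z)) := by
  funext z
  rw [eulerPoint, Function.iterate_succ_apply']
  rfl

namespace SmoothFamily

theorem memLp_eulerStep [CompleteSpace H] [CompleteSpace D]
    (hS : SmoothFamily law i k ((j.comp ι).restrictScalars ℝ) B c' C₂) {h : ℝ} (hh : 0 < h)
    {g : (Fin N → ℝ) → H} (hg : StronglyMeasurable g) (hg' : MemLp g 2 (piLaw law)) :
    MemLp (fun z => eulerSolve ((j.comp ι).restrictScalars ℝ) (B 0 z) h (g z)) 2 (piLaw law) := by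
  refine hg'.of_le_mul (c := (h * c')⁻¹)
    (stronglyMeasurable_eulerSolve (hS.meas 0 (Nat.zero_le k)) (hS.bijective hh) hg).aestronglyMeasurable (Eventually.of_forall fun z => ?_)
  set d := eulerSolve ((j.comp ι).restrictScalars ℝ) (B 0 z) h (g z)
  have hc := hS.pos
  have h1 := norm_le_of_euler_eq hh.le ((mul_nonneg hc.le (sq_nonneg _)).trans (hS.coer z d))
    (eulerSolve_spec (hS.bijective hh z) (g z))
  have h2 := mul_le_mul_of_nonneg_left (hS.lower z d) hh.le
  rw [inv_mul_eq_div, le_div_iff₀ (by positivity)]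
  linarith

theorem eulerPoint_mem [CompleteSpace H] [CompleteSpace D]
    (hS : SmoothFamily law i k ((j.comp ι).restrictScalars ℝ) B c' C₂) {h : ℝ} (hh : 0 < h)
    {f : (Fin N → ℝ) → D} (hf : StronglyMeasurable f) (hf' : MemLp f 2 (piLaw law)) (m : ℕ) :
    StronglyMeasurable (eulerPoint ((j.comp ι).restrictScalars ℝ) (B 0) h f m) ∧
      MemLp (eulerPoint ((j.comp ι).restrictScalars ℝ) (B 0) h f m) 2 (piLaw law) := by
  induction m with
  | zero => exact ⟨hf, hf'⟩
  | succ m ih =>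
    have h1 : StronglyMeasurable fun z => ((j.comp ι).restrictScalars ℝ)
        (eulerPoint ((j.comp ι).restrictScalars ℝ) (B 0) h f m z) :=
      ((j.comp ι).restrictScalars ℝ).continuous.comp_stronglyMeasurable ih.1
    have h2 := memLp_embedding j ι ih.2
    rw [eulerPoint_succ]
    exact ⟨stronglyMeasurable_eulerSolve (hS.meas 0 (Nat.zero_le k)) (hS.bijective hh) h1, hS.memLp_eulerStep hh h1 h2⟩

variable [∀ i, IsProbabilityMeasure (law i).measure]

/-- The operators `A z` map square integrable functions to square integrable functions. -/
theorem memLp_operator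
    (hS : SmoothFamily law i k ((j.comp ι).restrictScalars ℝ) B c' C₂)
    (hB : B 0 = fun z => (A z).restrictScalars ℝ) {w : (Fin N → ℝ) → D}
    (hw : MemLp w 2 (piLaw law)) : MemLp (fun z => A z (w z)) 2 (piLaw law) := by
  have hm := fun d => hS.meas 0 (Nat.zero_le k) d
  have hb := fun z hz d => hS.bound 0 (Nat.zero_le k) z hz d
  simp only [hB, pow_zero, one_mul] at hm hb
  refine hw.of_le_mul (c := C₂) ?_ ?_
  · refine ⟨fun z => A z (hw.1.mk w z), stronglyMeasurable_clm_apply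
      (A := fun z => (A z).restrictScalars ℝ) hm hw.1.stronglyMeasurable_mk, ?_⟩
    filter_upwards [hw.1.ae_eq_mk] with z hz
    rw [← hz]
  · filter_upwards [ae_mem_box law] with z hz
    exact hb z hz (w z)

theorem integral_norm_operator_sq_le
    (hS : SmoothFamily law i k ((j.comp ι).restrictScalars ℝ) B c' C₂)
    (hB : B 0 = fun z => (A z).restrictScalars ℝ) {w : (Fin N → ℝ) → D}
    (hw : MemLp w 2 (piLaw law)) :
    ∫ z, ‖A z (w z)‖ ^ 2 ∂(piLaw law) ≤ C₂ ^ 2 * ∫ z, ‖w z‖ ^ 2 ∂(piLaw law) := by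
  have hb := fun z hz d => hS.bound 0 (Nat.zero_le k) z hz d
  simp only [hB, pow_zero, one_mul] at hb
  rw [← integral_const_mul]
  refine integral_mono_ae (integrable_norm_sq_of_memLp (hS.memLp_operator hB hw))
    ((integrable_norm_sq_of_memLp hw).const_mul _) ?_
  filter_upwards [ae_mem_box law] with z hz
  rw [← mul_pow]
  exact pow_le_pow_left₀ (norm_nonneg _) (hb z hz (w z)) 2

end SmoothFamily

variable [CompleteSpace H] [CompleteSpace D] [∀ i, IsProbabilityMeasure (law i).measure]

namespace RandomForm

theorem exists_mem_multiplicationOperator_graph (ha : RandomForm law j ι a k K κ c C₁ C₂)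
    (hA : Represents law j ι a A)
    (hS : SmoothFamily law i k ((j.comp ι).restrictScalars ℝ) B c' C₂)
    (hB : B 0 = fun z => (A z).restrictScalars ℝ) {h : ℝ} (hh : 0 < h) {g : (Fin N → ℝ) → H}
    (hg : StronglyMeasurable g) (hg' : MemLp g 2 (piLaw law)) :
    ∃ y : Lp H 2 (piLaw law),
      ((memLp_embedding j ι (hS.memLp_eulerStep hh hg hg')).toLp, y) ∈
        (multiplicationOperator (piLaw law) fun z => formOperator j (a z)).graph ∧
      (memLp_embedding j ι (hS.memLp_eulerStep hh hg hg')).toLp + (h : 𝕜) • y =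
        hg'.toLp := by
  have hw := hS.memLp_eulerStep hh hg hg'
  have hAw := hS.memLp_operator hB hw
  refine ⟨hAw.toLp, ha.mem_multiplicationOperator_graph hA
    (memLp_embedding j ι hw).coeFn_toLp hAw.coeFn_toLp, ?_⟩
  refine Lp.ext ?_
  filter_upwards [Lp.coeFn_add (memLp_embedding j ι hw).toLp ((h : 𝕜) • hAw.toLp),
    Lp.coeFn_smul (h : 𝕜) hAw.toLp, (memLp_embedding j ι hw).coeFn_toLp,
    hAw.coeFn_toLp, hg'.coeFn_toLp] with z h1 h2 h3 h4 h5
  rw [h1, Pi.add_apply, h2, Pi.smul_apply, h3, h4, h5, ← RCLike.real_smul_eq_coe_smul]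
  have h6 := eulerSolve_spec (hS.bijective hh z) (g z)
  simp only [hB] at h6 ⊢
  exact h6

/-- The resolvent is found pointwise, by `eulerSolve`, and is measurable in the parameter. -/
theorem maxMonotone_multiplicationOperator (ha : RandomForm law j ι a k K κ c C₁ C₂)
    (hA : Represents law j ι a A)
    (hS : SmoothFamily law i k ((j.comp ι).restrictScalars ℝ) B c' C₂)
    (hB : B 0 = fun z => (A z).restrictScalars ℝ) :
    MaxMonotone (multiplicationOperator (piLaw law) fun z => formOperator j (a z)) where
  mono := by
    intro x y hxy
    rw [multiplicationOperator_graph] at hxy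
    have hxy' : ∀ᵐ z ∂(piLaw law), (x z, y z) ∈ (formOperator j (a z)).graph := hxy
    rw [re_inner_Lp]
    refine integral_nonneg_of_ae ?_
    filter_upwards [hxy', ae_mem_box law] with z hz hz'
    rw [formOperator_graph j ha.inj ha.dense] at hz
    obtain ⟨w, hw, hw'⟩ := hz
    change 0 ≤ RCLike.re (inner 𝕜 (x z) (y z))
    have hw : j w = x z := hw
    rw [← hw, ← hw' w]
    exact (mul_nonneg ha.pos.le (sq_nonneg _)).trans (ha.coercive hz' w)
  surj := by
    intro r hr g
    obtain ⟨y, h1, h2⟩ := ha.exists_mem_multiplicationOperator_graph hA hS hB hr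
      (Lp.stronglyMeasurable g) (Lp.memLp g)
    exact ⟨_, y, h1, h2.trans (Lp.toLp_coeFn g _)⟩

end RandomForm

/-- The powers of the resolvent of the multiplication operator are computed pointwise. -/
theorem RandomForm.resolvent_pow_eq (ha : RandomForm law j ι a k K κ c C₁ C₂)
    (hA : Represents law j ι a A)
    (hS : SmoothFamily law i k ((j.comp ι).restrictScalars ℝ) B c' C₂)
    (hB : B 0 = fun z => (A z).restrictScalars ℝ)
    (hM : MaxMonotone (multiplicationOperator (piLaw law) fun z => formOperator j (a z)))
    {h : ℝ} (hh : 0 < h) {f : (Fin N → ℝ) → D} (hf : StronglyMeasurable f)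
    (hf' : MemLp f 2 (piLaw law)) (m : ℕ) :
    (hM.resolvent h ^ m) (memLp_embedding j ι hf').toLp =
      (memLp_embedding j ι (hS.eulerPoint_mem hh hf hf' m).2).toLp := by
  induction m with
  | zero => rfl
  | succ m ih =>
    rw [pow_succ', ContinuousLinearMap.mul_def, ContinuousLinearMap.comp_apply, ih]
    have h1 : StronglyMeasurable fun z => j (ι
        (eulerPoint ((j.comp ι).restrictScalars ℝ) (B 0) h f m z)) :=
      (j.comp ι).continuous.comp_stronglyMeasurable (hS.eulerPoint_mem hh hf hf' m).1
    obtain ⟨y, h2, h3⟩ := ha.exists_mem_multiplicationOperator_graph hA hS hB hh h1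
      (memLp_embedding j ι (hS.eulerPoint_mem hh hf hf' m).2)
    rw [← h3, hM.resolvent_eq hh h2]
    refine Lp.ext ?_
    filter_upwards [MemLp.coeFn_toLp (memLp_embedding j ι
        (hS.eulerPoint_mem hh hf hf' (m + 1)).2), MemLp.coeFn_toLp (memLp_embedding j ι
        (hS.memLp_eulerStep hh h1 (memLp_embedding j ι
          (hS.eulerPoint_mem hh hf hf' m).2)))] with z h4 h5
    rw [h4, h5, eulerPoint_succ]
    rfl

end RandomEvolution

/-! ### The Galerkin operators are maximal monotone -/

namespace RandomEvolution

theorem pcProjection_eq_self {𝕜 : Type*} [RCLike 𝕜] {N : ℕ} {μ : Measure (Fin N → ℝ)} {E : Type*}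
    [NormedAddCommGroup E] [InnerProductSpace 𝕜 E] [CompleteSpace E] {n : ℕ} {f : Lp E 2 μ}
    (hf : f ∈ polySubspace μ 𝕜 E n) : pcProjection (𝕜 := 𝕜) μ n f = f :=
  (Submodule.starProjection_eq_self_iff).2 (Submodule.le_topologicalClosure _ hf)

theorem norm_pcProjection_apply_le {𝕜 : Type*} [RCLike 𝕜] {N : ℕ} {μ : Measure (Fin N → ℝ)} {E : Type*}
    [NormedAddCommGroup E] [InnerProductSpace 𝕜 E] [CompleteSpace E] (n : ℕ) (f : Lp E 2 μ) :
    ‖pcProjection (𝕜 := 𝕜) μ n f‖ ≤ ‖f‖ :=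
  Submodule.norm_starProjection_apply_le _ _

theorem inner_pcProjection_right {𝕜 : Type*} [RCLike 𝕜] {N : ℕ} {μ : Measure (Fin N → ℝ)} {E : Type*}
    [NormedAddCommGroup E] [InnerProductSpace 𝕜 E] [CompleteSpace E] {n : ℕ} {f : Lp E 2 μ}
    (hf : f ∈ polySubspace μ 𝕜 E n) (g : Lp E 2 μ) :
    inner 𝕜 f (pcProjection (𝕜 := 𝕜) μ n g) = inner 𝕜 f g := by
  rw [pcProjection, ← Submodule.inner_starProjection_left_eq_right]
  change inner 𝕜 (pcProjection (𝕜 := 𝕜) μ n f) g = _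
  rw [pcProjection_eq_self hf]

section PolySubspace

variable {𝕜 : Type*} [RCLike 𝕜] {N : ℕ}
  {law : Fin N → NoiseLaw} [∀ i, IsProbabilityMeasure (law i).measure]
  {E : Type*} [NormedAddCommGroup E] [InnerProductSpace 𝕜 E] [NormedSpace ℝ E]
  [IsScalarTower ℝ 𝕜 E]

theorem toLp_chaosSum_mem_polySubspace (n : ℕ) (f : (Fin N → ℝ) → E) :
    (memLp_chaosSum law n f).toLp ∈ polySubspace (piLaw law) 𝕜 E n :=
  mem_polySubspace_of_ae_eq law (memLp_chaosSum law n f).coeFn_toLp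

variable [CompleteSpace E]

theorem mem_polySubspace_of_mem_closure {n : ℕ} {f : Lp E 2 (piLaw law)}
    (hf : f ∈ (polySubspace (piLaw law) 𝕜 E n).topologicalClosure) :
    (memLp_chaosSum law n f).toLp = f ∧ f ∈ polySubspace (piLaw law) 𝕜 E n := by
  have h1 := (Submodule.starProjection_eq_self_iff).2 hf
  rw [starProjection_polySubspace] at h1
  refine ⟨h1, ?_⟩
  have h2 := toLp_chaosSum_mem_polySubspace (𝕜 := 𝕜) (law := law) n f
  rwa [h1] at h2

theorem isClosed_polySubspace (n : ℕ) :
    IsClosed (polySubspace (piLaw law) 𝕜 E n : Set (Lp E 2 (piLaw law))) := by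
  refine isClosed_of_closure_subset fun f hf => ?_
  exact (mem_polySubspace_of_mem_closure hf).2

theorem pcProjection_eq_toLp (n : ℕ) (f : Lp E 2 (piLaw law)) :
    pcProjection (𝕜 := 𝕜) (piLaw law) n f = (memLp_chaosSum law n f).toLp :=
  starProjection_polySubspace law n f

theorem pcProjection_mem (n : ℕ) (f : Lp E 2 (piLaw law)) :
    pcProjection (𝕜 := 𝕜) (piLaw law) n f ∈ polySubspace (piLaw law) 𝕜 E n := by
  rw [pcProjection_eq_toLp]
  exact toLp_chaosSum_mem_polySubspace n f

end PolySubspace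

variable {𝕜 : Type*} [RCLike 𝕜] {N : ℕ}
  {H : Type*} [NormedAddCommGroup H] [InnerProductSpace 𝕜 H]
  {V : Type*} [NormedAddCommGroup V] [InnerProductSpace 𝕜 V]
  {D : Type*} [NormedAddCommGroup D] [InnerProductSpace 𝕜 D]

theorem liftEmbedding_mem_polySubspace (j : V →L[𝕜] H) {μ : Measure (Fin N → ℝ)} {n : ℕ}
    {w : Lp V 2 μ} (hw : w ∈ polySubspace μ 𝕜 V n) :
    liftEmbedding μ j w ∈ polySubspace μ 𝕜 H n := by
  obtain ⟨e, he⟩ := hw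
  refine ⟨fun α => j (e α), ?_⟩
  filter_upwards [he, ContinuousLinearMap.coeFn_compLpL j w] with z h1 h2
  rw [liftEmbedding, h2, h1]
  simp only [map_sum, map_smul]

theorem integral_norm_mul_norm_le {X : Type*} [MeasurableSpace X] {μ : Measure X} (f : Lp V 2 μ)
    (g : Lp H 2 μ) : ∫ x, ‖f x‖ * ‖g x‖ ∂μ ≤ ‖f‖ * ‖g‖ := by
  have h1 : ∫ x, ‖f x‖ * ‖g x‖ ∂μ = inner ℝ (Lp.memLp f).norm.toLp (Lp.memLp g).norm.toLp := by
    rw [L2.inner_def]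
    refine integral_congr_ae ?_
    filter_upwards [(Lp.memLp f).norm.coeFn_toLp, (Lp.memLp g).norm.coeFn_toLp] with x h1 h2
    rw [h1, h2]
    simp [mul_comm]
  rw [h1]
  refine (real_inner_le_norm _ _).trans (le_of_eq ?_)
  rw [Lp.norm_toLp, Lp.norm_toLp, eLpNorm_norm, eLpNorm_norm, Lp.norm_def, Lp.norm_def]

namespace RandomForm

variable {law : Fin N → NoiseLaw} [∀ i, IsProbabilityMeasure (law i).measure]
  {j : V →L[𝕜] H} {ι : D →L[𝕜] V}
  {a : (Fin N → ℝ) → V →ₗ[𝕜] V →ₗ⋆[𝕜] 𝕜} {k : ℕ} {K κ c C₁ C₂ : ℝ}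

theorem continuous_form [CompleteSpace V] (ha : RandomForm law j ι a k K κ c C₁ C₂)
    {z : Fin N → ℝ} (hz : z ∈ box law) : Continuous fun p : V × V => a z p.1 p.2 := by
  obtain ⟨T, hT, -⟩ := exists_clm_of_form (LinearMap.id : V →ₗ[𝕜] V) Function.injective_id
    Function.surjective_id.denseRange (a z) (abs_nonneg K) fun u v => by
      refine (ha.norm_le hz u v).trans ?_
      rw [LinearMap.id_apply]
      gcongr
      exact le_abs_self K
  simp only [hT, LinearMap.id_apply]
  fun_prop

theorem aestronglyMeasurable_form [CompleteSpace V] [SecondCountableTopology V]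
    (ha : RandomForm law j ι a k K κ c C₁ C₂) (w v : Lp V 2 (piLaw law)) :
    AEStronglyMeasurable (fun z => a z (w z) (v z)) (piLaw law) := by
  let _ : MeasurableSpace V := borel V
  have _ : BorelSpace V := ⟨rfl⟩
  have h1 : StronglyMeasurable (Function.uncurry fun (p : V × V) (z : Fin N → ℝ) =>
      (box law).indicator (fun z => a z p.1 p.2) z) := by
    refine stronglyMeasurable_uncurry_of_continuous_of_stronglyMeasurable (fun z => ?_) fun p => ?_
    · by_cases hz : z ∈ box law
      · simp only [indicator_of_mem hz]
        exact ha.continuous_form hz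
      · simp only [indicator_of_notMem hz]
        exact continuous_const
    · exact (ha.continuous p.1 p.2).stronglyMeasurable.indicator (isOpen_box law).measurableSet
  refine ⟨_, h1.comp_measurable (((Lp.stronglyMeasurable w).measurable.prodMk
    (Lp.stronglyMeasurable v).measurable).prodMk measurable_id), ?_⟩
  filter_upwards [ae_mem_box law] with z hz
  simp [indicator_of_mem hz]

theorem integrable_form [CompleteSpace V] [SecondCountableTopology V]
    (ha : RandomForm law j ι a k K κ c C₁ C₂) (w v : Lp V 2 (piLaw law)) :
    Integrable (fun z => a z (w z) (v z)) (piLaw law) := by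
  have h1 : Integrable (fun z => ‖w z‖ * ‖v z‖) (piLaw law) :=
    MemLp.integrable_mul (Lp.memLp w).norm (Lp.memLp v).norm
  refine (h1.const_mul K).mono' (ha.aestronglyMeasurable_form w v) ?_
  filter_upwards [ae_mem_box law] with z hz
  rw [← mul_assoc]
  exact ha.norm_le hz _ _

theorem norm_integratedForm_le [CompleteSpace V] [SecondCountableTopology V]
    (ha : RandomForm law j ι a k K κ c C₁ C₂) (w v : Lp V 2 (piLaw law)) :
    ‖integratedForm (piLaw law) a w v‖ ≤ |K| * ‖w‖ * ‖v‖ := by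
  have h1 : Integrable (fun z => ‖w z‖ * ‖v z‖) (piLaw law) :=
    MemLp.integrable_mul (Lp.memLp w).norm (Lp.memLp v).norm
  calc ‖integratedForm (piLaw law) a w v‖
      ≤ ∫ z, |K| * (‖w z‖ * ‖v z‖) ∂(piLaw law) := by
        refine norm_integral_le_of_norm_le (h1.const_mul _) ?_
        filter_upwards [ae_mem_box law] with z hz
        refine (ha.norm_le hz _ _).trans ?_
        rw [mul_assoc]
        gcongr
        exact le_abs_self K
    _ ≤ |K| * ‖w‖ * ‖v‖ := by
        rw [integral_const_mul, mul_assoc]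
        gcongr
        exact integral_norm_mul_norm_le w v

theorem coercive_integratedForm [CompleteSpace V] [SecondCountableTopology V]
    (ha : RandomForm law j ι a k K κ c C₁ C₂) (w : Lp V 2 (piLaw law)) :
    κ * ‖w‖ ^ 2 ≤ RCLike.re (integratedForm (piLaw law) a w w) := by
  rw [integratedForm, ← integral_re (ha.integrable_form w w), norm_Lp_sq, ← integral_const_mul]
  refine integral_mono_ae ((integrable_norm_sq_of_memLp (Lp.memLp w)).const_mul _)
    (ha.integrable_form w w).re ?_
  filter_upwards [ae_mem_box law] with z hz
  exact ha.coercive hz (w z)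

/-- The sesquilinear form `(w, v) ↦ (j w | j v) + r 𝐚(w, v)` whose Galerkin equations define the
resolvent of the Galerkin operator. -/
theorem exists_resolventForm [CompleteSpace V] [SecondCountableTopology V]
    (ha : RandomForm law j ι a k K κ c C₁ C₂) (r : ℝ)
    (S : Submodule 𝕜 (Lp V 2 (piLaw law))) : ∃ b : S →ₗ[𝕜] S →ₗ⋆[𝕜] 𝕜, ∀ w v, b w v =
      inner 𝕜 (liftEmbedding (piLaw law) j v) (liftEmbedding (piLaw law) j w) +
        (r : 𝕜) * integratedForm (piLaw law) a w v := by
  have h1 : ∀ w w' v : Lp V 2 (piLaw law), integratedForm (piLaw law) a (w + w') v =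
      integratedForm (piLaw law) a w v + integratedForm (piLaw law) a w' v := by
    intro w w' v
    rw [integratedForm, integratedForm, integratedForm,
      ← integral_add (ha.integrable_form w v) (ha.integrable_form w' v)]
    refine integral_congr_ae ?_
    filter_upwards [Lp.coeFn_add w w'] with z hz
    rw [hz, Pi.add_apply, map_add, LinearMap.add_apply]
  have h2 : ∀ (s : 𝕜) (w v : Lp V 2 (piLaw law)), integratedForm (piLaw law) a (s • w) v =
      s * integratedForm (piLaw law) a w v := by
    intro s w v
    rw [integratedForm, integratedForm, ← integral_const_mul]
    refine integral_congr_ae ?_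
    filter_upwards [Lp.coeFn_smul s w] with z hz
    rw [hz, Pi.smul_apply, map_smul, LinearMap.smul_apply, smul_eq_mul]
  have h3 : ∀ w v v' : Lp V 2 (piLaw law), integratedForm (piLaw law) a w (v + v') =
      integratedForm (piLaw law) a w v + integratedForm (piLaw law) a w v' := by
    intro w v v'
    rw [integratedForm, integratedForm, integratedForm,
      ← integral_add (ha.integrable_form w v) (ha.integrable_form w v')]
    refine integral_congr_ae ?_
    filter_upwards [Lp.coeFn_add v v'] with z hz
    rw [hz, Pi.add_apply, map_add]
  have h4 : ∀ (s : 𝕜) (w v : Lp V 2 (piLaw law)), integratedForm (piLaw law) a w (s • v) =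
      starRingEnd 𝕜 s * integratedForm (piLaw law) a w v := by
    intro s w v
    rw [integratedForm, integratedForm, ← integral_const_mul]
    refine integral_congr_ae ?_
    filter_upwards [Lp.coeFn_smul s v] with z hz
    rw [hz, Pi.smul_apply, LinearMap.map_smulₛₗ, smul_eq_mul]
  refine ⟨LinearMap.mk₂'ₛₗ (RingHom.id 𝕜) (starRingEnd 𝕜)
    (fun w v => inner 𝕜 (liftEmbedding (piLaw law) j v) (liftEmbedding (piLaw law) j w) +
      (r : 𝕜) * integratedForm (piLaw law) a w v) ?_ ?_ ?_ ?_, fun w v => rfl⟩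
  · intro w w' v
    rw [Submodule.coe_add, map_add, inner_add_right, h1]
    ring
  · intro s w v
    rw [Submodule.coe_smul, map_smul, inner_smul_right, h2, RingHom.id_apply, smul_eq_mul]
    ring
  · intro w v v'
    rw [Submodule.coe_add, map_add, inner_add_left, h3]
    ring
  · intro s w v
    rw [Submodule.coe_smul, map_smul, inner_smul_left, h4, smul_eq_mul]
    ring

/-- Lax–Milgram for the Galerkin equations. -/
theorem exists_galerkin_solution [CompleteSpace V] [SecondCountableTopology V]
    (ha : RandomForm law j ι a k K κ c C₁ C₂) {r : ℝ} (hr : 0 < r)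
    (S : Submodule 𝕜 (Lp V 2 (piLaw law))) [CompleteSpace S] [CompleteSpace H]
    (g : Lp H 2 (piLaw law)) : ∃ w ∈ S, ∀ v ∈ S,
      inner 𝕜 (liftEmbedding (piLaw law) j v) (liftEmbedding (piLaw law) j w) +
        (r : 𝕜) * integratedForm (piLaw law) a w v =
      inner 𝕜 (liftEmbedding (piLaw law) j v) g := by
  obtain ⟨b, hb⟩ := ha.exists_resolventForm r S
  set L := liftEmbedding (piLaw law) j with hL
  obtain ⟨T, hT, -⟩ := exists_clm_of_form (LinearMap.id : S →ₗ[𝕜] S) Function.injective_id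
    Function.surjective_id.denseRange b (C := ‖L‖ * ‖L‖ + r * |K|) (by positivity) fun w v => by
      rw [hb]
      refine (norm_add_le _ _).trans ?_
      rw [norm_mul, RCLike.norm_ofReal, abs_of_pos hr]
      have h1 := norm_inner_le_norm (𝕜 := 𝕜) (L v) (L w)
      have h2 := mul_le_mul (L.le_opNorm v) (L.le_opNorm w) (norm_nonneg _) (by positivity)
      have h3 := mul_le_mul_of_nonneg_left (ha.norm_integratedForm_le w v) hr.le
      simp only [LinearMap.id_apply, Submodule.coe_norm]
      nlinarith
  have hunit : IsUnit T := by
    refine ContinuousLinearMap.isUnit_of_forall_le_norm_inner_map T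
      (c := ⟨r * κ, (mul_pos hr ha.pos).le⟩) (mul_pos hr ha.pos) fun w => ?_
    have h1 := mul_le_mul_of_nonneg_left (ha.coercive_integratedForm (w : Lp V 2 (piLaw law))) hr.le
    have h2 : RCLike.re (inner 𝕜 w (T w)) =
        ‖L w‖ ^ 2 + r * RCLike.re (integratedForm (piLaw law) a w w) := by
      have h3 := hT w w
      rw [LinearMap.id_apply] at h3
      rw [← h3, hb, map_add, inner_self_eq_norm_sq, RCLike.re_ofReal_mul]
    have h4 := RCLike.re_le_norm (inner 𝕜 w (T w))
    rw [norm_inner_symm]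
    change ‖(w : Lp V 2 (piLaw law))‖ ^ 2 * (r * κ) ≤ _
    nlinarith [sq_nonneg ‖L w‖]
  obtain ⟨w, hw⟩ := ((ContinuousLinearMap.isUnit_iff_bijective).1 hunit).2
    ((L.comp S.subtypeL).adjoint g)
  refine ⟨w, w.2, fun v hv => ?_⟩
  have h1 := hb w ⟨v, hv⟩
  rw [hT, hw] at h1
  rw [← h1, LinearMap.id_apply, ContinuousLinearMap.adjoint_inner_right]
  rfl

variable [CompleteSpace H]
  [NormedSpace ℝ V] [IsScalarTower ℝ 𝕜 V] [NormedSpace ℝ H] [IsScalarTower ℝ 𝕜 H]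

/-- The vector-valued polynomials with coefficients in `V` are dense among those with coefficients
in `H`. -/
theorem eq_zero_of_forall_inner_polySubspace (ha : RandomForm law j ι a k K κ c C₁ C₂) {n : ℕ}
    {y : Lp H 2 (piLaw law)} (hy : y ∈ polySubspace (piLaw law) 𝕜 H n)
    (h : ∀ v ∈ polySubspace (piLaw law) 𝕜 V n,
      inner 𝕜 (liftEmbedding (piLaw law) j v) y = 0) : y = 0 := by
  have h1 : ∀ α ∈ multiIndices N n, coef law y α = 0 := by
    intro α hα
    refine ha.dense.eq_zero_of_inner_right 𝕜 fun v => ?_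
    have hm : MemLp (fun z => ∑ β ∈ multiIndices N n, chaos law β z • (if β = α then v else 0)) 2
        (piLaw law) := memLp_sum_smul (memLp_chaos law) _ _
    have h2 := h hm.toLp (mem_polySubspace_of_ae_eq law hm.coeFn_toLp)
    rw [L2.inner_def] at h2
    rw [coef, ← integral_inner (integrable_smul_of_memLp (memLp_chaos law α) (Lp.memLp y)), ← h2]
    refine integral_congr_ae ?_
    filter_upwards [ContinuousLinearMap.coeFn_compLpL j hm.toLp, hm.coeFn_toLp] with z h3 h4
    rw [liftEmbedding, h3, h4]
    simp only [smul_ite, smul_zero, Finset.sum_ite_eq', hα, if_true]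
    rw [RCLike.real_smul_eq_coe_smul (K := 𝕜), RCLike.real_smul_eq_coe_smul (K := 𝕜), map_smul,
      inner_smul_left, inner_smul_right, RCLike.conj_ofReal]
  rw [← pcProjection_eq_self hy, pcProjection_eq_toLp]
  refine Lp.ext ?_
  filter_upwards [(memLp_chaosSum law n y).coeFn_toLp, Lp.coeFn_zero H 2 (piLaw law)] with z h2 h3
  rw [h2, h3, chaosSum, Pi.zero_apply]
  exact Finset.sum_eq_zero fun α hα => by rw [h1 α hα, smul_zero]

theorem galerkinOperator_graph (ha : RandomForm law j ι a k K κ c C₁ C₂) (n : ℕ) :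
    (galerkinOperator (piLaw law) j a n).graph = galerkinGraph (piLaw law) j a n := by
  refine Submodule.toLinearPMap_graph_eq _ ?_
  rintro ⟨x, y⟩ ⟨hy, w, hw, hwx, hv⟩ (rfl : x = 0)
  refine ha.eq_zero_of_forall_inner_polySubspace hy fun v hv' => ?_
  rw [← (hv v hv').2, integratedForm]
  refine integral_eq_zero_of_ae ?_
  have h1 : liftEmbedding (piLaw law) j w = 0 := by rw [hwx, map_zero]
  have h2 := ContinuousLinearMap.coeFn_compLpL j w
  change liftEmbedding (piLaw law) j w =ᵐ[piLaw law] _ at h2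
  rw [h1] at h2
  filter_upwards [h2, Lp.coeFn_zero H 2 (piLaw law)] with z h3 h4
  have h5 : w z = 0 := ha.inj (by rw [map_zero, ← h3, h4, Pi.zero_apply])
  rw [h5, map_zero, LinearMap.zero_apply, Pi.zero_apply]

/-- The operator vanishes on the orthogonal complement of `polySubspace`, so that the right-hand side
of the resolvent equation is split into its two components. -/
theorem maxMonotone_galerkinOperator [CompleteSpace V] [SecondCountableTopology V]
    (ha : RandomForm law j ι a k K κ c C₁ C₂) (n : ℕ) :
    MaxMonotone (galerkinOperator (piLaw law) j a n) where
  mono := by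
    intro x y hxy
    rw [ha.galerkinOperator_graph] at hxy
    obtain ⟨hy, w, hw, hwx, hv⟩ := hxy
    rw [← inner_conj_symm, ← inner_pcProjection_right hy, inner_conj_symm]
    change liftEmbedding (piLaw law) j w = pcProjection (𝕜 := 𝕜) (piLaw law) n x at hwx
    rw [← hwx, ← (hv w hw).2]
    exact (mul_nonneg ha.pos.le (sq_nonneg _)).trans (ha.coercive_integratedForm w)
  surj := by
    intro r hr g
    have _ : CompleteSpace (polySubspace (piLaw law) 𝕜 V n) :=
      (isClosed_polySubspace n).completeSpace_coe
    have hr' : (r : 𝕜) ≠ 0 := by exact_mod_cast hr.ne'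
    set R := pcProjection (𝕜 := 𝕜) (H := H) (piLaw law) n with hR
    obtain ⟨w, hw, hwv⟩ := ha.exists_galerkin_solution hr (polySubspace (piLaw law) 𝕜 V n) (R g)
    set L := liftEmbedding (piLaw law) j with hL
    have hLw : L w ∈ polySubspace (piLaw law) 𝕜 H n := liftEmbedding_mem_polySubspace j hw
    refine ⟨L w + (g - R g), (r : 𝕜)⁻¹ • (R g - L w), ?_, ?_⟩
    · rw [ha.galerkinOperator_graph]
      refine ⟨Submodule.smul_mem _ _ (Submodule.sub_mem _ (pcProjection_mem n g) hLw), w, hw, ?_,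
        fun v hv => ⟨ha.integrable_form w v, ?_⟩⟩
      · change L w = R (L w + (g - R g))
        rw [map_add, map_sub, hR, pcProjection_eq_self hLw,
          pcProjection_eq_self (pcProjection_mem n g), sub_self, add_zero]
      · change integratedForm (piLaw law) a w v = inner 𝕜 (L v) ((r : 𝕜)⁻¹ • (R g - L w))
        rw [inner_smul_right, inner_sub_right, ← hwv v hv, add_sub_cancel_left,
          inv_mul_cancel_left₀ hr']
    · rw [smul_smul, mul_inv_cancel₀ hr', one_smul]
      abel

end RandomForm

end RandomEvolution

/-! ### The error of the Galerkin semigroups -/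

namespace RandomEvolution

/-- Stability of the implicit Euler scheme: the defects `r` add up. -/
theorem norm_pow_apply_sub_le_sum {𝕜 : Type*} [RCLike 𝕜] {X : Type*} [NormedAddCommGroup X]
    [NormedSpace 𝕜 X] {J : X →L[𝕜] X} (hJ : ∀ x, ‖J x‖ ≤ ‖x‖) {h : ℝ} (hh : 0 ≤ h) {u r : ℕ → X}
    (hu : ∀ m, J (u m - (h : 𝕜) • r m) = u (m + 1)) (m : ℕ) :
    ‖(J ^ m) (u 0) - u m‖ ≤ h * ∑ i ∈ Finset.range m, ‖r i‖ := by
  induction m with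
  | zero => simp
  | succ m ih =>
    have h1 : (J ^ (m + 1)) (u 0) - u (m + 1) = J ((J ^ m) (u 0) - u m + (h : 𝕜) • r m) := by
      rw [pow_succ', ContinuousLinearMap.mul_def, ContinuousLinearMap.comp_apply, ← hu m,
        ← map_sub]
      congr 1
      abel
    rw [h1, Finset.sum_range_succ, mul_add]
    refine (hJ _).trans ((norm_add_le _ _).trans (add_le_add ih ?_))
    rw [norm_smul, RCLike.norm_ofReal, abs_of_nonneg hh]

section Projection

variable {𝕜 : Type*} [RCLike 𝕜] {N : ℕ}
  {H : Type*} [NormedAddCommGroup H] [InnerProductSpace 𝕜 H] [CompleteSpace H]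
  [NormedSpace ℝ H] [IsScalarTower ℝ 𝕜 H]
  {law : Fin N → NoiseLaw} [∀ i, IsProbabilityMeasure (law i).measure]

theorem norm_pcProjection_toLp_sub (n : ℕ) {g : (Fin N → ℝ) → H} (hg : MemLp g 2 (piLaw law)) :
    ‖pcProjection (𝕜 := 𝕜) (piLaw law) n hg.toLp - hg.toLp‖ =
      √(∫ z, ‖g z - chaosSum law n g z‖ ^ 2 ∂(piLaw law)) := by
  have h1 : pcProjection (𝕜 := 𝕜) (piLaw law) n hg.toLp - hg.toLp =
      ((memLp_chaosSum law n g).sub hg).toLp := by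
    rw [pcProjection_eq_toLp, MemLp.toLp_sub (memLp_chaosSum law n g) hg]
    congr 1
    rw [MemLp.toLp_eq_toLp_iff, chaosSum_congr law hg.coeFn_toLp]
  rw [h1, eq_comm, Real.sqrt_eq_iff_mul_self_eq (integral_nonneg fun z => sq_nonneg _)
    (norm_nonneg _), ← sq, norm_toLp_sq]
  refine integral_congr_ae (Eventually.of_forall fun z => ?_)
  simp only [Pi.sub_apply, norm_sub_rev]

theorem pcProjection_toLp_embedding {V : Type*} [NormedAddCommGroup V]
    [InnerProductSpace 𝕜 V] {D : Type*} [NormedAddCommGroup D] [InnerProductSpace 𝕜 D]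
    [CompleteSpace D] [NormedSpace ℝ D] [IsScalarTower ℝ 𝕜 D] (j : V →L[𝕜] H) (ι : D →L[𝕜] V) (n : ℕ)
    {w : (Fin N → ℝ) → D} (hw : MemLp w 2 (piLaw law)) :
    pcProjection (𝕜 := 𝕜) (piLaw law) n (memLp_embedding j ι hw).toLp =
      (memLp_embedding j ι (memLp_chaosSum law n w)).toLp := by
  rw [pcProjection_eq_toLp]
  refine Lp.ext ?_
  filter_upwards [MemLp.coeFn_toLp (memLp_chaosSum law n (memLp_embedding j ι hw).toLp),
    (memLp_embedding j ι (memLp_chaosSum law n w)).coeFn_toLp] with z h1 h2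
  rw [h1, h2, chaosSum_congr law (memLp_embedding j ι hw).coeFn_toLp]
  exact chaosSum_clm law ((j.comp ι).restrictScalars ℝ) hw n z

end Projection

variable {𝕜 : Type*} [RCLike 𝕜] {N : ℕ}
  {H : Type*} [NormedAddCommGroup H] [InnerProductSpace 𝕜 H] [CompleteSpace H]
  {V : Type*} [NormedAddCommGroup V] [InnerProductSpace 𝕜 V] [CompleteSpace V]
  {D : Type*} [NormedAddCommGroup D] [InnerProductSpace 𝕜 D] [CompleteSpace D]
  [SecondCountableTopology V]
  [InnerProductSpace ℝ H] [IsScalarTower ℝ 𝕜 H] [InnerProductSpace ℝ D] [IsScalarTower ℝ 𝕜 D]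
  [NormedSpace ℝ V] [IsScalarTower ℝ 𝕜 V]
  {law : Fin N → NoiseLaw} [∀ i, IsProbabilityMeasure (law i).measure]
  {j : V →L[𝕜] H} {ι : D →L[𝕜] V}
  {a : (Fin N → ℝ) → V →ₗ[𝕜] V →ₗ⋆[𝕜] 𝕜} {k : ℕ} {K κ c C₁ C₂ c' : ℝ}
  {i : Fin N} {A : (Fin N → ℝ) → D →L[𝕜] H} {B : ℕ → (Fin N → ℝ) → D →L[ℝ] H}

namespace RandomForm

theorem mem_galerkinOperator_graph (ha : RandomForm law j ι a k K κ c C₁ C₂)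
    (hA : Represents law j ι a A) (n : ℕ) {w : (Fin N → ℝ) → D} (hw : MemLp w 2 (piLaw law))
    (hAw : MemLp (fun z => A z (chaosSum law n w z)) 2 (piLaw law)) :
    (pcProjection (𝕜 := 𝕜) (piLaw law) n (memLp_embedding j ι hw).toLp,
      pcProjection (𝕜 := 𝕜) (piLaw law) n hAw.toLp) ∈
        (galerkinOperator (piLaw law) j a n).graph := by
  rw [ha.galerkinOperator_graph]
  set W := liftEmbedding (piLaw law) ι (memLp_chaosSum law n w).toLp with hW
  have hWz : W =ᵐ[piLaw law] fun z => ι (chaosSum law n w z) := by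
    filter_upwards [ContinuousLinearMap.coeFn_compLpL ι (memLp_chaosSum law n w).toLp,
      (memLp_chaosSum law n w).coeFn_toLp] with z h1 h2
    rw [hW, liftEmbedding, h1, h2]
  refine ⟨pcProjection_mem n _, W, liftEmbedding_mem_polySubspace ι
    (toLp_chaosSum_mem_polySubspace n w), ?_, fun v hv => ⟨ha.integrable_form W v, ?_⟩⟩
  · change _ = pcProjection (𝕜 := 𝕜) (piLaw law) n
      (pcProjection (𝕜 := 𝕜) (piLaw law) n (memLp_embedding j ι hw).toLp)
    rw [pcProjection_eq_self (pcProjection_mem n _), pcProjection_toLp_embedding j ι n hw]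
    refine Lp.ext ?_
    filter_upwards [ContinuousLinearMap.coeFn_compLpL j W, hWz,
      (memLp_embedding j ι (memLp_chaosSum law n w)).coeFn_toLp] with z h1 h2 h3
    rw [liftEmbedding, h1, h2, h3]
  · change _ = inner 𝕜 _ (pcProjection (𝕜 := 𝕜) (piLaw law) n hAw.toLp)
    rw [inner_pcProjection_right (liftEmbedding_mem_polySubspace j hv), L2.inner_def,
      integratedForm]
    refine integral_congr_ae ?_
    filter_upwards [ContinuousLinearMap.coeFn_compLpL j v, hWz, hAw.coeFn_toLp,
      ae_mem_box law] with z h1 h2 h3 h4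
    rw [liftEmbedding, h1, h2, h3, hA z h4]

variable [SecondCountableTopology H] [SecondCountableTopology D]

/-- One Euler step: the projection of the exact iterate solves the Galerkin step up to the defect
`𝐑_n 𝐀 (1 - S_n) w`, where `S_n w` is the truncated expansion of the new iterate `w`. -/
theorem resolvent_galerkin_eq (ha : RandomForm law j ι a k K κ c C₁ C₂)
    (hA : Represents law j ι a A)
    (hS : SmoothFamily law i k ((j.comp ι).restrictScalars ℝ) B c' C₂)
    (hB : B 0 = fun z => (A z).restrictScalars ℝ) {n : ℕ}
    (hG : MaxMonotone (galerkinOperator (piLaw law) j a n)) {h : ℝ} (hh : 0 < h)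
    {w : (Fin N → ℝ) → D} (hw : MemLp w 2 (piLaw law)) {U : Lp H 2 (piLaw law)}
    (hU : U =ᵐ[piLaw law] fun z => j (ι (w z)) + h • A z (w z)) :
    ∃ r : Lp H 2 (piLaw law),
      hG.resolvent h (pcProjection (𝕜 := 𝕜) (piLaw law) n U - (h : 𝕜) • r) =
        pcProjection (𝕜 := 𝕜) (piLaw law) n (memLp_embedding j ι hw).toLp ∧
      ‖r‖ ^ 2 ≤ C₂ ^ 2 * ∫ z, ‖w z - chaosSum law n w z‖ ^ 2 ∂(piLaw law) := by
  have hs := memLp_chaosSum law n w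
  have hAs := hS.memLp_operator hB hs
  have hd : MemLp (fun z => w z - chaosSum law n w z) 2 (piLaw law) := hw.sub hs
  have hAd := hS.memLp_operator hB hd
  set R := pcProjection (𝕜 := 𝕜) (H := H) (piLaw law) n with hR
  refine ⟨R hAd.toLp, ?_, ?_⟩
  · have h1 : R U - (h : 𝕜) • R hAd.toLp =
        R (memLp_embedding j ι hw).toLp + (h : 𝕜) • R hAs.toLp := by
      rw [sub_eq_iff_eq_add, add_assoc, ← smul_add, ← map_add, ← map_smul, ← map_add]
      congr 1
      refine Lp.ext ?_
      filter_upwards [hU, Lp.coeFn_add (memLp_embedding j ι hw).toLp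
          ((h : 𝕜) • (hAs.toLp + hAd.toLp)), Lp.coeFn_smul (h : 𝕜) (hAs.toLp + hAd.toLp),
        Lp.coeFn_add hAs.toLp hAd.toLp, hAs.coeFn_toLp, hAd.coeFn_toLp,
        (memLp_embedding j ι hw).coeFn_toLp] with z h1 h2 h3 h4 h5 h6 h7
      rw [h1, h2, Pi.add_apply, h3, Pi.smul_apply, h4, Pi.add_apply, h5, h6, h7, ← map_add,
        add_sub_cancel, RCLike.real_smul_eq_coe_smul (K := 𝕜)]
    rw [h1]
    exact hG.resolvent_eq hh (ha.mem_galerkinOperator_graph hA n hw hAs)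
  · refine (pow_le_pow_left₀ (norm_nonneg _) (norm_pcProjection_apply_le n hAd.toLp) 2).trans ?_
    rw [norm_toLp_sq]
    exact hS.integral_norm_operator_sq_le hB hd

/-- The error of the fully discrete Galerkin scheme in terms of the truncation errors of the
exact Euler iterates `u`. -/
theorem norm_galerkin_resolvent_pow_sub_le (ha : RandomForm law j ι a k K κ c C₁ C₂)
    (hA : Represents law j ι a A)
    (hS : SmoothFamily law i k ((j.comp ι).restrictScalars ℝ) B c' C₂)
    (hB : B 0 = fun z => (A z).restrictScalars ℝ) {n : ℕ}
    (hG : MaxMonotone (galerkinOperator (piLaw law) j a n)) {h : ℝ} (hh : 0 < h)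
    {u : ℕ → (Fin N → ℝ) → D} (hu : ∀ m, MemLp (u m) 2 (piLaw law))
    (hstep : ∀ m z, j (ι (u m z)) = j (ι (u (m + 1) z)) + h • A z (u (m + 1) z)) (m : ℕ) :
    ‖(hG.resolvent h ^ m)
          (pcProjection (𝕜 := 𝕜) (piLaw law) n (memLp_embedding j ι (hu 0)).toLp) -
        pcProjection (𝕜 := 𝕜) (piLaw law) n (memLp_embedding j ι (hu m)).toLp‖ ≤
      C₂ * √(m * h) * √(h * ∑ l ∈ Finset.range m,
          ∫ z, ‖u (l + 1) z - chaosSum law n (u (l + 1)) z‖ ^ 2 ∂(piLaw law)) := by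
  choose r hr hr' using fun m => ha.resolvent_galerkin_eq hA hS hB hG hh (hu (m + 1))
    ((memLp_embedding j ι (hu m)).coeFn_toLp.trans (Eventually.of_forall (hstep m)))
  refine (norm_pow_apply_sub_le_sum (hG.norm_resolvent_apply_le h) hh.le
    (u := fun m => pcProjection (𝕜 := 𝕜) (piLaw law) n (memLp_embedding j ι (hu m)).toLp)
    (r := r) hr m).trans ?_
  set e : ℕ → ℝ := fun m => ∫ z, ‖u m z - chaosSum law n (u m) z‖ ^ 2 ∂(piLaw law) with he
  have hC := hS.nonneg
  have h5 : 0 ≤ h * ∑ l ∈ Finset.range m, e (l + 1) :=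
    mul_nonneg hh.le (Finset.sum_nonneg fun l _ => integral_nonneg fun z => sq_nonneg _)
  refine (sq_le_sq₀ (by positivity) (by positivity)).1 ?_
  rw [mul_pow, mul_pow, mul_pow, Real.sq_sqrt (by positivity), Real.sq_sqrt h5]
  have h6 := sq_sum_le_card_mul_sum_sq (s := Finset.range m) (f := fun l => ‖r l‖)
  rw [Finset.card_range] at h6
  have h7 : ∑ l ∈ Finset.range m, ‖r l‖ ^ 2 ≤ C₂ ^ 2 * ∑ l ∈ Finset.range m, e (l + 1) := by
    rw [Finset.mul_sum]
    exact Finset.sum_le_sum fun l _ => hr' l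
  calc h ^ 2 * (∑ l ∈ Finset.range m, ‖r l‖) ^ 2
      ≤ h ^ 2 * (m * (C₂ ^ 2 * ∑ l ∈ Finset.range m, e (l + 1))) := by
        gcongr
        exact h6.trans (by gcongr)
    _ = _ := by ring

/-- The error of the Galerkin–Euler scheme after `m` steps: accumulated defects plus the truncation
error of the exact iterate. -/
theorem norm_resolvent_pow_sub_le (ha : RandomForm law j ι a k K κ c C₁ C₂)
    (hA : Represents law j ι a A)
    (hS : SmoothFamily law i k ((j.comp ι).restrictScalars ℝ) B c' C₂)
    (hB : B 0 = fun z => (A z).restrictScalars ℝ)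
    (hM : MaxMonotone (multiplicationOperator (piLaw law) fun z => formOperator j (a z))) {n : ℕ}
    (hG : MaxMonotone (galerkinOperator (piLaw law) j a n)) {h : ℝ} (hh : 0 < h)
    {f : (Fin N → ℝ) → D} (hf : StronglyMeasurable f) (hf' : MemLp f 2 (piLaw law)) (m : ℕ)
    {u : ℕ → (Fin N → ℝ) → D}
    (hu : ∀ m, eulerPoint ((j.comp ι).restrictScalars ℝ) (B 0) h f m = u m) :
    ‖(hG.resolvent h ^ m) (pcProjection (𝕜 := 𝕜) (piLaw law) n (memLp_embedding j ι hf').toLp) -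
        (hM.resolvent h ^ m) (memLp_embedding j ι hf').toLp‖ ≤
      C₂ * √(m * h) * √(h * ∑ l ∈ Finset.range m,
          ∫ z, ‖u (l + 1) z - chaosSum law n (u (l + 1)) z‖ ^ 2 ∂(piLaw law)) +
        √(∫ z, ‖j (ι (u m z)) - chaosSum law n (fun z => j (ι (u m z))) z‖ ^ 2 ∂(piLaw law)) := by
  have hmem : ∀ m, MemLp (u m) 2 (piLaw law) := fun m => by
    rw [← hu]
    exact (hS.eulerPoint_mem hh hf hf' m).2
  have hstep : ∀ m z, j (ι (u m z)) = j (ι (u (m + 1) z)) + h • A z (u (m + 1) z) := by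
    intro m z
    rw [← hu (m + 1), eulerPoint_succ, hu m]
    have h2 := eulerSolve_spec (hS.bijective hh z) (((j.comp ι).restrictScalars ℝ) (u m z))
    simp only [hB] at h2 ⊢
    exact h2.symm
  have h1 := ha.norm_galerkin_resolvent_pow_sub_le hA hS hB hG hh hmem hstep m
  have h2 := ha.resolvent_pow_eq hA hS hB hM hh hf hf' m
  have h3 := norm_pcProjection_toLp_sub (𝕜 := 𝕜) n (memLp_embedding j ι (hmem m))
  have h0 : f = u 0 := hu 0
  simp only [hu] at h2
  subst h0
  rw [h2]
  exact (norm_sub_le_norm_sub_add_norm_sub _ _ _).trans (add_le_add h1 h3.le)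

end RandomForm

end RandomEvolution

/-! ### The rate of convergence for functions with weak derivatives -/

namespace RandomEvolution

variable {𝕜 : Type*} [RCLike 𝕜] {N : ℕ}
  {H : Type*} [NormedAddCommGroup H] [InnerProductSpace 𝕜 H] [CompleteSpace H]
  {V : Type*} [NormedAddCommGroup V] [InnerProductSpace 𝕜 V] [CompleteSpace V]
  {D : Type*} [NormedAddCommGroup D] [InnerProductSpace 𝕜 D] [CompleteSpace D]
  [SecondCountableTopology H] [SecondCountableTopology V] [SecondCountableTopology D]
  [InnerProductSpace ℝ H] [IsScalarTower ℝ 𝕜 H] [InnerProductSpace ℝ D] [IsScalarTower ℝ 𝕜 D]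
  [NormedSpace ℝ V] [IsScalarTower ℝ 𝕜 V]
  {law : Fin N → NoiseLaw} [∀ i, IsProbabilityMeasure (law i).measure]
  {j : V →L[𝕜] H} {ι : D →L[𝕜] V}
  {a : (Fin N → ℝ) → V →ₗ[𝕜] V →ₗ⋆[𝕜] 𝕜} {ℓ : ℕ} {K κ c C₁ C₂ c' : ℝ}
  {A : (Fin N → ℝ) → D →L[𝕜] H} {B : Fin N → ℕ → (Fin N → ℝ) → D →L[ℝ] H}

/-- The sum of the squared weighted norms of the pure derivatives of order at most `k`. -/
noncomputable def chainEnergy {E : Type*} [NormedAddCommGroup E] [NormedSpace ℝ E]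
    (law : Fin N → NoiseLaw) (k : ℕ) (F : Fin N → ℕ → (Fin N → ℝ) → E) : ℝ :=
  ∑ i, ∑ l ∈ Finset.range (k + 1),
    ∫ z, ‖√((law i).sigma.eval (z i)) ^ l • F i l z‖ ^ 2 ∂(piLaw law)

namespace RandomForm

/-- The estimate for initial values that can be differentiated pointwise. The bounds of
`exists_chaos_rate_eulerPoint` for the squared errors carry `n ^ (2 * ℓ)`, and they do not depend on
the number of steps, which tends to infinity. -/
theorem exists_semigroup_rate_of_smoothChain (hN : 1 ≤ N)
    (ha : RandomForm law j ι a (2 * ℓ) K κ c C₁ C₂) (hA : Represents law j ι a A)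
    (hS : ∀ i, SmoothFamily law i (2 * ℓ) ((j.comp ι).restrictScalars ℝ) (B i) c' C₂)
    (hB : ∀ i, B i 0 = fun z => (A z).restrictScalars ℝ)
    (hM : MaxMonotone (multiplicationOperator (piLaw law) fun z => formOperator j (a z)))
    (hG : ∀ n, MaxMonotone (galerkinOperator (piLaw law) j a n)) :
    ∃ L : ℝ, 0 ≤ L ∧ ∀ {f : Fin N → ℕ → (Fin N → ℝ) → D} {f₀ : (Fin N → ℝ) → D},
      (∀ i, SmoothChain law i (2 * ℓ) (f i)) → (∀ i, f i 0 = f₀) →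
      ∀ (hf₀ : MemLp f₀ 2 (piLaw law)) (n : ℕ) {t : ℝ}, 0 < t →
      (n : ℝ) ^ ℓ * ‖(hG n).semigroup t
            (pcProjection (𝕜 := 𝕜) (piLaw law) n (memLp_embedding j ι hf₀).toLp) -
          hM.semigroup t (memLp_embedding j ι hf₀).toLp‖ ≤
        (1 + √t) * L * √(chainEnergy law (2 * ℓ) f) := by
  set i₀ : Fin N := ⟨0, hN⟩
  have hC := (hS i₀).nonneg
  obtain ⟨K', hK', hrate⟩ := exists_chaos_rate_eulerPoint (law := law) hN
    ((j.comp ι).restrictScalars ℝ) (hS i₀).pos hC (2 * ℓ)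
  refine ⟨(C₂ + 1) * √K', by positivity, ?_⟩
  intro f f₀ hf hf0 hf₀ n t ht
  have hfm : StronglyMeasurable f₀ := by
    rw [← hf0 i₀]
    exact ((hf i₀).cont 0).stronglyMeasurable
  have hQ : 0 ≤ chainEnergy law (2 * ℓ) f := Finset.sum_nonneg fun i _ =>
    Finset.sum_nonneg fun l _ => integral_nonneg fun z => sq_nonneg _
  have hlim := ((((hG n).tendsto_euler ht
    (pcProjection (𝕜 := 𝕜) (piLaw law) n (memLp_embedding j ι hf₀).toLp)).sub
    (hM.tendsto_euler ht (memLp_embedding j ι hf₀).toLp)).norm).const_mul ((n : ℝ) ^ ℓ)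
  refine le_of_tendsto hlim ?_
  filter_upwards [eventually_gt_atTop 0] with m hm
  have hm' : (0 : ℝ) < m := by exact_mod_cast hm
  have hh : 0 < t / m := by positivity
  set u := eulerPoint ((j.comp ι).restrictScalars ℝ) (B i₀ 0) (t / m) f₀ with hu
  have h1 := ha.norm_resolvent_pow_sub_le hA (hS i₀) (hB i₀) hM (hG n) hh hfm hf₀ m (u := u)
    fun _ => rfl
  have h2 := hrate (A := B) (A₀ := B i₀ 0) hS (fun i => by rw [hB, hB]) hh hf hf0 n m
  rw [← hu, ← Finset.mul_sum, mul_left_comm] at h2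
  set I₁ := ∫ z, ‖j (ι (u m z)) - chaosSum law n (fun z => j (ι (u m z))) z‖ ^ 2 ∂(piLaw law)
    with hI₁
  set I₂ := t / m * ∑ l ∈ Finset.range m,
    ∫ z, ‖u (l + 1) z - chaosSum law n (u (l + 1)) z‖ ^ 2 ∂(piLaw law) with hI₂
  have hI₁0 : 0 ≤ I₁ := integral_nonneg fun z => sq_nonneg _
  have hI₂0 : 0 ≤ I₂ := mul_nonneg hh.le
    (Finset.sum_nonneg fun l _ => integral_nonneg fun z => sq_nonneg _)
  have h3 : (n : ℝ) ^ (2 * ℓ) * I₁ + (n : ℝ) ^ (2 * ℓ) * I₂ ≤ K' * chainEnergy law (2 * ℓ) f := h2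
  have h4 : ∀ x, 0 ≤ x → (n : ℝ) ^ (2 * ℓ) * x ≤ K' * chainEnergy law (2 * ℓ) f →
      (n : ℝ) ^ ℓ * √x ≤ √K' * √(chainEnergy law (2 * ℓ) f) := by
    intro x hx hx'
    rw [← Real.sqrt_mul hK']
    refine Real.le_sqrt_of_sq_le ?_
    rw [mul_pow, Real.sq_sqrt hx, ← pow_mul, mul_comm ℓ 2]
    exact hx'
  have hn : 0 ≤ (n : ℝ) ^ (2 * ℓ) := by positivity
  have h5 := h4 I₁ hI₁0 (by nlinarith [mul_nonneg hn hI₂0])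
  have h6 := h4 I₂ hI₂0 (by nlinarith [mul_nonneg hn hI₁0])
  have h7 : (m : ℝ) * (t / m) = t := by field_simp
  rw [h7] at h1
  set q := √K' * √(chainEnergy law (2 * ℓ) f) with hq
  have hq0 : 0 ≤ q := by positivity
  calc _ ≤ (n : ℝ) ^ ℓ * (C₂ * √t * √I₂ + √I₁) := mul_le_mul_of_nonneg_left h1 (by positivity)
    _ = C₂ * √t * ((n : ℝ) ^ ℓ * √I₂) + (n : ℝ) ^ ℓ * √I₁ := by ring
    _ ≤ C₂ * √t * q + q := by gcongr
    _ ≤ (1 + √t) * ((C₂ + 1) * q) := by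
        have h8 := mul_nonneg hC hq0
        have h9 := mul_nonneg (Real.sqrt_nonneg t) hq0
        nlinarith
    _ = _ := by
        rw [hq]
        ring

/-- The estimate for weakly differentiable initial values, by approximation with their truncated
expansions; the case `t = 0` follows by continuity of the orbits. -/
theorem exists_semigroup_rate_of_weakChain (hN : 1 ≤ N)
    (ha : RandomForm law j ι a (2 * ℓ) K κ c C₁ C₂) (hA : Represents law j ι a A)
    (hS : ∀ i, SmoothFamily law i (2 * ℓ) ((j.comp ι).restrictScalars ℝ) (B i) c' C₂)
    (hB : ∀ i, B i 0 = fun z => (A z).restrictScalars ℝ)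
    (hM : MaxMonotone (multiplicationOperator (piLaw law) fun z => formOperator j (a z)))
    (hG : ∀ n, MaxMonotone (galerkinOperator (piLaw law) j a n)) :
    ∃ L : ℝ, 0 ≤ L ∧ ∀ {F : Fin N → ℕ → (Fin N → ℝ) → D} {f : Lp D 2 (piLaw law)},
      (∀ i, WeakChain law i (2 * ℓ) (F i)) → (∀ i, F i 0 =ᵐ[piLaw law] f) →
      ∀ (n : ℕ) {t : ℝ}, 0 ≤ t →
      (n : ℝ) ^ ℓ * ‖(hG n).semigroup t
            (pcProjection (𝕜 := 𝕜) (piLaw law) n (liftEmbedding (piLaw law) (j.comp ι) f)) -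
          hM.semigroup t (liftEmbedding (piLaw law) (j.comp ι) f)‖ ≤
        (1 + √t) * L * √(chainEnergy law (2 * ℓ) F) := by
  obtain ⟨L, hL, hrate⟩ := ha.exists_semigroup_rate_of_smoothChain hN hA hS hB hM hG
  refine ⟨L, hL, ?_⟩
  intro F f hF hF0 n
  have key : ∀ t : ℝ, 0 < t → (n : ℝ) ^ ℓ * ‖(hG n).semigroup t
        (pcProjection (𝕜 := 𝕜) (piLaw law) n (liftEmbedding (piLaw law) (j.comp ι) f)) -
      hM.semigroup t (liftEmbedding (piLaw law) (j.comp ι) f)‖ ≤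
        (1 + √t) * L * √(chainEnergy law (2 * ℓ) F) := by
    intro t ht
    set Φ : Lp D 2 (piLaw law) →L[𝕜] Lp H 2 (piLaw law) :=
      (((hG n).semigroup t).comp (pcProjection (𝕜 := 𝕜) (piLaw law) n) - hM.semigroup t).comp
        (liftEmbedding (piLaw law) (j.comp ι)) with hΦ
    -- the truncated expansions of `f` are polynomials, and they converge to `f`
    have hlim : Tendsto (fun M => (memLp_chaosSum law M f).toLp) atTop (𝓝 f) := by
      rw [tendsto_iff_norm_sub_tendsto_zero]
      have h1 := (tendsto_integral_norm_sub_chaosSum_sq (Lp.memLp f)).sqrt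
      rw [Real.sqrt_zero] at h1
      refine h1.congr fun M => ?_
      rw [Real.sqrt_eq_iff_mul_self_eq (integral_nonneg fun z => sq_nonneg _) (norm_nonneg _),
        ← sq, norm_Lp_sq]
      refine integral_congr_ae ?_
      filter_upwards [Lp.coeFn_sub (memLp_chaosSum law M f).toLp f,
        (memLp_chaosSum law M f).coeFn_toLp] with z h2 h3
      rw [h2, Pi.sub_apply, h3, norm_sub_rev]
    have hlim' := ((Φ.continuous.tendsto f).comp hlim).norm.const_mul ((n : ℝ) ^ ℓ)
    refine le_of_tendsto' hlim' fun M => ?_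
    set g : Fin N → ℕ → (Fin N → ℝ) → D := fun i l z =>
      ∑ α ∈ multiIndices N M, chaosDeriv law i l α z • coef law (F i 0) α with hg
    have hg0 : ∀ i, g i 0 = chaosSum law M f := fun i => by
      funext z
      simp only [hg, chaosSum, chaosDeriv_zero, coef_congr law (hF0 i)]
    have h1 := hrate (f := g) (fun i => smoothChain_chaosDeriv law i (2 * ℓ) _ _) hg0
      (memLp_chaosSum law M f) n ht
    have h2 : chainEnergy law (2 * ℓ) g ≤ chainEnergy law (2 * ℓ) F := by
      refine Finset.sum_le_sum fun i _ => Finset.sum_le_sum fun l hl => ?_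
      exact (hF i).integral_norm_chaosDeriv_sum_sq_le
        (Nat.lt_succ_iff.1 (Finset.mem_range.1 hl)) M
    rw [← liftEmbedding_toLp j ι (memLp_chaosSum law M f)] at h1
    refine h1.trans ?_
    gcongr
  intro t ht
  rcases ht.eq_or_lt with rfl | ht
  · have h1 : Tendsto (fun t : ℝ => (n : ℝ) ^ ℓ * ‖(hG n).semigroup t
          (pcProjection (𝕜 := 𝕜) (piLaw law) n (liftEmbedding (piLaw law) (j.comp ι) f)) -
        hM.semigroup t (liftEmbedding (piLaw law) (j.comp ι) f)‖) (𝓝[>] 0)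
        (𝓝 ((n : ℝ) ^ ℓ * ‖(hG n).semigroup 0
          (pcProjection (𝕜 := 𝕜) (piLaw law) n (liftEmbedding (piLaw law) (j.comp ι) f)) -
        hM.semigroup 0 (liftEmbedding (piLaw law) (j.comp ι) f)‖)) := by
      refine Tendsto.const_mul _ (Tendsto.norm (Tendsto.sub ?_ ?_))
      · exact (((hG n).continuousOn_semigroup _) 0 self_mem_Ici).mono_left
          (nhdsWithin_mono _ Ioi_subset_Ici_self)
      · exact ((hM.continuousOn_semigroup _) 0 self_mem_Ici).mono_left
          (nhdsWithin_mono _ Ioi_subset_Ici_self)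
    have h2 : Tendsto (fun t : ℝ => (1 + √t) * L * √(chainEnergy law (2 * ℓ) F)) (𝓝[>] 0)
        (𝓝 ((1 + √0) * L * √(chainEnergy law (2 * ℓ) F))) :=
      Tendsto.mono_left (Continuous.tendsto (by fun_prop) 0) nhdsWithin_le_nhds
    refine le_of_tendsto_of_tendsto h1 h2 ?_
    filter_upwards [self_mem_nhdsWithin] with t ht
    exact key t ht
  · exact key t ht

end RandomForm

end RandomEvolution

/-! ### Weighted Sobolev functions have chains of weak derivatives -/

namespace RandomEvolution

variable {𝕜 : Type*} [RCLike 𝕜] {N : ℕ} {E : Type*} [NormedAddCommGroup E] [NormedSpace 𝕜 E]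
  {law : Fin N → NoiseLaw}

/-- If `φ • f` vanishes outside a compact subset of `U`, it is integrable. -/
theorem integrable_smul_of_locallyIntegrableOn [NormedSpace ℝ E] {U : Set (Fin N → ℝ)}
    {f : (Fin N → ℝ) → E} (hf : LocallyIntegrableOn f U)
    {φ : (Fin N → ℝ) → ℝ} (hφ : Continuous φ) (hc : HasCompactSupport φ) (hU : tsupport φ ⊆ U) :
    Integrable fun z => φ z • f z := by
  have h1 : IntegrableOn (fun z => φ z • f z) (tsupport φ) :=
    (hf.integrableOn_compact_subset hU hc).continuousOn_smul hφ.continuousOn hc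
  refine (integrableOn_iff_integrable_of_support_subset fun z hz => ?_).1 h1
  exact subset_tsupport _ fun h => hz (by simp [h])

/-- The real scalar multiplication used in the definition of weak derivatives is the only one
compatible with the given one. -/
theorem isWeakDeriv_iff [inst : NormedSpace ℝ E] [IsScalarTower ℝ 𝕜 E] {U : Set (Fin N → ℝ)}
    {α : Fin N → ℕ} {f g : (Fin N → ℝ) → E} :
    IsWeakDeriv 𝕜 U α f g ↔ LocallyIntegrableOn f U ∧ LocallyIntegrableOn g U ∧
      ∀ φ : (Fin N → ℝ) → ℝ, ContDiff ℝ ∞ φ → HasCompactSupport φ → tsupport φ ⊆ U →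
        ∫ z in U, multiDeriv α φ z • f z = (-1 : ℝ) ^ (∑ i, α i) • ∫ z in U, φ z • g z := by
  have h1 : inst = NormedSpace.restrictScalars ℝ 𝕜 E := by
    have h2 : inst.toModule = (NormedSpace.restrictScalars ℝ 𝕜 E).toModule :=
      Module.ext' _ _ fun r x => RCLike.real_smul_eq_coe_smul r x
    cases inst
    cases h2
    rfl
  subst h1
  exact Iff.rfl

theorem isWeakDeriv_weakDeriv {U : Set (Fin N → ℝ)} {α : Fin N → ℕ} {f : (Fin N → ℝ) → E}
    (h : ∃ g, IsWeakDeriv 𝕜 U α f g) : IsWeakDeriv 𝕜 U α f (weakDeriv 𝕜 U α f) := by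
  rw [weakDeriv, dif_pos h]
  exact h.choose_spec

variable [NormedSpace ℝ E] [IsScalarTower ℝ 𝕜 E]

/-- Consecutive pure derivatives are weak partial derivatives of one another: the definition of the
lower one is tested with `∂_i φ`. -/
theorem IsWeakDeriv.isWeakPartial {i : Fin N} {l : ℕ} {f g₀ g₁ : (Fin N → ℝ) → E}
    (h₀ : IsWeakDeriv 𝕜 (box law) (Pi.single i l) f g₀)
    (h₁ : IsWeakDeriv 𝕜 (box law) (Pi.single i (l + 1)) f g₁) : IsWeakPartial law i g₀ g₁ := by
  intro φ hφ hc hb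
  have h2 := (isWeakDeriv_iff.1 h₁).2.2 φ hφ hc hb
  have h3 := (isWeakDeriv_iff.1 h₀).2.2 (partialDeriv i φ)
    ((hφ.fderiv_right (m := ∞) (by norm_cast)).clm_apply contDiff_const)
    (hc.fderiv_apply (𝕜 := ℝ) _) ((tsupport_fderiv_apply_subset ℝ _).trans hb)
  rw [multiDeriv_single, Finset.sum_pi_single' , if_pos (Finset.mem_univ i)] at h2 h3
  rw [Function.iterate_succ_apply, h3, pow_succ, mul_neg_one, neg_smul, ← smul_neg] at h2
  exact smul_right_injective E (pow_ne_zero l (by norm_num : (-1 : ℝ) ≠ 0)) h2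

theorem IsWeakDeriv.ae_eq_of_zero [CompleteSpace E] {f g : (Fin N → ℝ) → E}
    (h : IsWeakDeriv 𝕜 (box law) 0 f g) : ∀ᵐ z, z ∈ box law → g z = f z := by
  have h' := isWeakDeriv_iff.1 h
  have h1 : ∀ᵐ z, z ∈ box law → (g - f) z = 0 := by
    refine (isOpen_box law).ae_eq_zero_of_integral_contDiff_smul_eq_zero (h'.2.1.sub h'.1)
      fun φ hφ hc hb => ?_
    have h2 := h'.2.2 φ hφ hc hb
    have h3 : multiDeriv 0 φ = φ := by
      simp [multiDeriv]
    have hint := fun {F : (Fin N → ℝ) → E} (hF : LocallyIntegrableOn F (box law)) =>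
      integrable_smul_of_locallyIntegrableOn hF hφ.continuous hc hb
    have h4 : ∀ F : (Fin N → ℝ) → E, ∫ z in box law, φ z • F z = ∫ z, φ z • F z := fun F =>
      setIntegral_eq_integral_of_forall_compl_eq_zero fun z hz => by
        rw [image_eq_zero_of_notMem_tsupport fun h => hz (hb h), zero_smul]
    rw [h3, h4, h4] at h2
    simp only [Pi.sub_apply, smul_sub]
    rw [integral_sub (hint h'.2.1) (hint h'.1), h2]
    simp
  filter_upwards [h1] with z hz hzb
  exact sub_eq_zero.1 (hz hzb)

theorem absolutelyContinuous_piLaw (law : Fin N → NoiseLaw)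
    [∀ i, IsProbabilityMeasure (law i).measure] : piLaw law ≪ volume.restrict (box law) := by
  refine Measure.ae_le_iff_absolutelyContinuous.1 fun s hs => ?_
  exact (ae_piLaw_iff law).2 ((ae_restrict_iff' (isOpen_box law).measurableSet).1 hs)

variable {E : Type*} [NormedAddCommGroup E] [NormedSpace 𝕜 E] [InnerProductSpace ℝ E]
  [IsScalarTower ℝ 𝕜 E] [∀ i, IsProbabilityMeasure (law i).measure]

/-- The Sobolev norm, with weight `ρ`, controls the pure derivatives with the smaller weight `σ`. -/
theorem MemSobolev.norm_le {k : ℕ} {f : (Fin N → ℝ) → E}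
    (hf : MemSobolev 𝕜 law (piLaw law) k f) (i : Fin N) {l : ℕ} (hl : l ≤ k) :
    MemLp (fun z => √((law i).sigma.eval (z i)) ^ l •
      weakDeriv 𝕜 (box law) (Pi.single i l) f z) 2 (piLaw law) ∧
    ∫ z, ‖√((law i).sigma.eval (z i)) ^ l •
      weakDeriv 𝕜 (box law) (Pi.single i l) f z‖ ^ 2 ∂(piLaw law) ≤
        sobolevNorm 𝕜 law (piLaw law) k f ^ 2 := by
  have hα : ∑ i', (Pi.single i l : Fin N → ℕ) i' ≤ k := by simpa using hl
  obtain ⟨hex, hm⟩ := hf.2 (Pi.single i l) hα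
  have hloc := (isWeakDeriv_iff.1 (isWeakDeriv_weakDeriv hex)).2.1
  set g := weakDeriv 𝕜 (box law) (Pi.single i l) f with hg
  have hle : ∀ᵐ z ∂(piLaw law), ‖√((law i).sigma.eval (z i)) ^ l • g z‖ ≤
      ‖(weightPow law (Pi.single i l) z : 𝕜) • g z‖ := by
    filter_upwards [ae_mem_box law] with z hz
    rw [norm_smul, norm_smul, RCLike.norm_ofReal, Real.norm_of_nonneg (by positivity)]
    gcongr
    exact (sqrt_sigma_pow_le_weightPow law i l hz).trans (le_abs_self _)
  have hmeas : AEStronglyMeasurable (fun z => √((law i).sigma.eval (z i)) ^ l • g z)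
      (piLaw law) := by
    have h1 : Continuous fun z : Fin N → ℝ => √((law i).sigma.eval (z i)) ^ l := by
      have := (law i).sigma.continuous
      fun_prop
    exact h1.aestronglyMeasurable.smul
      (hloc.aestronglyMeasurable.mono_ac (absolutelyContinuous_piLaw law))
  have hmem := hm.mono hmeas hle
  refine ⟨hmem, ?_⟩
  rw [← toReal_eLpNorm_sq hmem, sobolevNorm, Real.sq_sqrt (Finset.sum_nonneg fun _ _ => sq_nonneg _)]
  refine le_trans ?_ (Finset.single_le_sum (fun _ _ => sq_nonneg _) (mem_multiIndices.2 hα))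
  exact pow_le_pow_left₀ ENNReal.toReal_nonneg
    (ENNReal.toReal_mono hm.2.ne (eLpNorm_mono_ae hle)) 2

theorem MemSobolev.weakChain {k : ℕ} {f : (Fin N → ℝ) → E}
    (hf : MemSobolev 𝕜 law (piLaw law) k f) (i : Fin N) :
    WeakChain law i k fun l => weakDeriv 𝕜 (box law) (Pi.single i l) f where
  weak l hl := IsWeakDeriv.isWeakPartial
    (isWeakDeriv_weakDeriv (hf.2 (Pi.single i l) (by simpa using hl.le)).1)
    (isWeakDeriv_weakDeriv (hf.2 (Pi.single i (l + 1)) (by simpa using hl)).1)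
  memLp l hl := (hf.norm_le i hl).1

theorem MemSobolev.weakDeriv_zero [CompleteSpace E] {k : ℕ} {f : (Fin N → ℝ) → E}
    (hf : MemSobolev 𝕜 law (piLaw law) k f) (i : Fin N) :
    weakDeriv 𝕜 (box law) (Pi.single i 0) f =ᵐ[piLaw law] f := by
  have h1 := isWeakDeriv_weakDeriv (hf.2 (Pi.single i 0) (by simp)).1
  refine (ae_piLaw_iff law).2 ?_
  rw [Pi.single_zero] at h1 ⊢
  exact h1.ae_eq_of_zero

theorem MemSobolev.chainEnergy_le {k : ℕ} {f : (Fin N → ℝ) → E}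
    (hf : MemSobolev 𝕜 law (piLaw law) k f) :
    chainEnergy law k (fun i l => weakDeriv 𝕜 (box law) (Pi.single i l) f) ≤
      N * (k + 1) * sobolevNorm 𝕜 law (piLaw law) k f ^ 2 := by
  calc chainEnergy law k (fun i l => weakDeriv 𝕜 (box law) (Pi.single i l) f)
      ≤ ∑ i : Fin N, ∑ l ∈ Finset.range (k + 1), sobolevNorm 𝕜 law (piLaw law) k f ^ 2 :=
        Finset.sum_le_sum fun i _ => Finset.sum_le_sum fun l hl =>
          (hf.norm_le i (Nat.lt_succ_iff.1 (Finset.mem_range.1 hl))).2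
    _ = _ := by simp; ring

end RandomEvolution

/-! ### Generation and rate of convergence for random forms -/

namespace RandomEvolution

theorem jointLaw_eq_piLaw {N : ℕ} {law : Fin N → NoiseLaw}
    {Ω : Type*} [MeasurableSpace Ω] {P : Measure Ω} [IsProbabilityMeasure P]
    {Z : Fin N → Ω → ℝ} (hZ : ∀ i, Measurable (Z i)) (hind : iIndepFun Z P)
    (hlaw : ∀ i, P.map (Z i) = (law i).measure) : jointLaw P Z = piLaw law := by
  have h1 := (iIndepFun_iff_map_fun_eq_pi_map fun i => (hZ i).aemeasurable).1 hind
  simp only [hlaw] at h1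
  exact h1

variable {𝕜 : Type*} [RCLike 𝕜] {N : ℕ}
  {H : Type*} [NormedAddCommGroup H] [InnerProductSpace 𝕜 H] [CompleteSpace H]
  {V : Type*} [NormedAddCommGroup V] [InnerProductSpace 𝕜 V] [CompleteSpace V]
  {D : Type*} [NormedAddCommGroup D] [InnerProductSpace 𝕜 D] [CompleteSpace D]
  [SecondCountableTopology H] [SecondCountableTopology V]
  {law : Fin N → NoiseLaw} [∀ i, IsProbabilityMeasure (law i).measure]
  {j : V →L[𝕜] H} {ι : D →L[𝕜] V}
  {a : (Fin N → ℝ) → V →ₗ[𝕜] V →ₗ⋆[𝕜] 𝕜} {ℓ : ℕ} {K κ c C₁ C₂ : ℝ}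

/-- Generation and the rate of convergence; the constant grows like `1 + √t` in time. -/
theorem RandomForm.exists_semigroup_rate (hN : 1 ≤ N) (hℓ : 1 ≤ ℓ)
    (ha : RandomForm law j ι a (2 * ℓ) K κ c C₁ C₂) :
    ∃ (hM : MaxMonotone (multiplicationOperator (piLaw law) fun z => formOperator j (a z)))
      (hG : ∀ n, MaxMonotone (galerkinOperator (piLaw law) j a n)) (L : ℝ), 0 ≤ L ∧
      ∀ f : Lp D 2 (piLaw law), MemSobolev 𝕜 law (piLaw law) (2 * ℓ) f →
        ∀ n : ℕ, 1 ≤ n → ∀ t : ℝ, 0 ≤ t →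
          ‖(hG n).semigroup t
              (pcProjection (𝕜 := 𝕜) (piLaw law) n (liftEmbedding (piLaw law) (j.comp ι) f)) -
            hM.semigroup t (liftEmbedding (piLaw law) (j.comp ι) f)‖ ≤
          (1 + √t) * L * (n : ℝ) ^ (-(ℓ : ℤ)) * sobolevNorm 𝕜 law (piLaw law) (2 * ℓ) f := by
  let _ : InnerProductSpace ℝ H := InnerProductSpace.rclikeToReal 𝕜 H
  have _ : IsScalarTower ℝ 𝕜 H := RestrictScalars.isScalarTower ℝ 𝕜 H
  let _ : InnerProductSpace ℝ V := InnerProductSpace.rclikeToReal 𝕜 V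
  have _ : IsScalarTower ℝ 𝕜 V := RestrictScalars.isScalarTower ℝ 𝕜 V
  let _ : InnerProductSpace ℝ D := InnerProductSpace.rclikeToReal 𝕜 D
  have _ : IsScalarTower ℝ 𝕜 D := RestrictScalars.isScalarTower ℝ 𝕜 D
  have hk : 1 ≤ 2 * ℓ := by omega
  have _ : SecondCountableTopology D := ha.secondCountableTopology_domain hN hk
  obtain ⟨A, B, hA, hS, hB⟩ := ha.exists_smoothFamily hN hk
  have hM := ha.maxMonotone_multiplicationOperator hA (hS ⟨0, hN⟩) (hB ⟨0, hN⟩)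
  have hG := fun n => ha.maxMonotone_galerkinOperator n
  obtain ⟨L, hL, hrate⟩ := ha.exists_semigroup_rate_of_weakChain hN hA hS hB hM hG
  refine ⟨hM, hG, L * √(N * ((2 * ℓ : ℕ) + 1)), by positivity, fun f hf n hn t ht => ?_⟩
  have h1 := hrate (fun i => hf.weakChain i) (fun i => hf.weakDeriv_zero i) n ht
  have h2 : √(chainEnergy law (2 * ℓ) fun i l => weakDeriv 𝕜 (box law) (Pi.single i l) f) ≤
      √(N * ((2 * ℓ : ℕ) + 1)) * sobolevNorm 𝕜 law (piLaw law) (2 * ℓ) f := by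
    refine (Real.sqrt_le_sqrt hf.chainEnergy_le).trans (le_of_eq ?_)
    have h3 : 0 ≤ sobolevNorm 𝕜 law (piLaw law) (2 * ℓ) (f : (Fin N → ℝ) → D) :=
      Real.sqrt_nonneg _
    rw [Real.sqrt_mul (by positivity), Real.sqrt_sq h3]
  have hn' : (0 : ℝ) < (n : ℝ) ^ ℓ := pow_pos (by exact_mod_cast hn) ℓ
  have h3 : (1 + √t) * L *
      √(chainEnergy law (2 * ℓ) fun i l => weakDeriv 𝕜 (box law) (Pi.single i l) f) ≤
      (1 + √t) * L *
        (√(N * ((2 * ℓ : ℕ) + 1)) * sobolevNorm 𝕜 law (piLaw law) (2 * ℓ) f) := by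
    gcongr
  rw [zpow_neg, zpow_natCast]
  refine ((le_div_iff₀' hn').2 (h1.trans h3)).trans (le_of_eq ?_)
  field_simp

end RandomEvolution
theorem mainTheorem2 {𝕜 : Type*} [RCLike 𝕜]
    -- the random vector `Z` with independent normal, Gamma or Beta components
    {Ω : Type*} [MeasurableSpace Ω] (P : Measure Ω) [IsProbabilityMeasure P]
    {N : ℕ} (hN : 1 ≤ N) (Z : Fin N → Ω → ℝ) (hZ : ∀ i, Measurable (Z i))
    (hind : iIndepFun Z P) (law : Fin N → NoiseLaw)
    (hlaw : ∀ i, P.map (Z i) = (law i).measure)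
    -- separable Hilbert spaces, `V` densely embedded in `H`, and the common domain `D`
    {H : Type*} [NormedAddCommGroup H] [InnerProductSpace 𝕜 H] [CompleteSpace H]
    [TopologicalSpace.SeparableSpace H]
    {V : Type*} [NormedAddCommGroup V] [InnerProductSpace 𝕜 V] [CompleteSpace V]
    [TopologicalSpace.SeparableSpace V]
    (j : V →L[𝕜] H) (hj : Function.Injective j) (hjd : DenseRange j)
    {D : Type*} [NormedAddCommGroup D] [InnerProductSpace 𝕜 D] [CompleteSpace D]
    (ι : D →L[𝕜] V) (hι : Function.Injective ι)
    -- the random sesquilinear form: measurable, uniformly bounded and coercive, symmetric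
    (a : (Fin N → ℝ) → V →ₗ[𝕜] V →ₗ⋆[𝕜] 𝕜)
    (hmeas : ∀ u : V, Measurable fun z => a z u u)
    (hform : ∃ K κ : ℝ, 0 < K ∧ 0 < κ ∧ ∀ᵐ z ∂(jointLaw P Z), ∀ u v : V,
      ‖a z u v‖ ≤ K * ‖u‖ * ‖v‖ ∧ κ * ‖u‖ ^ 2 ≤ RCLike.re (a z u u))
    (hsymm : ∀ᵐ z ∂(jointLaw P Z), ∀ u v : V, a z u v = starRingEnd 𝕜 (a z v u))
    -- `dom A_z = D` almost surely, with uniformly equivalent graph norms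
    (hdom : ∃ c C : ℝ, 0 < c ∧ 0 < C ∧ ∀ᵐ z ∂(jointLaw P Z),
      (∀ x : H, x ∈ (formOperator j (a z)).domain ↔ ∃ d : D, j (ι d) = x) ∧
      ∀ (d : D) (hd : j (ι d) ∈ (formOperator j (a z)).domain),
        c * ‖d‖ ≤ graphNorm (formOperator j (a z)) ⟨j (ι d), hd⟩ ∧
        graphNorm (formOperator j (a z)) ⟨j (ι d), hd⟩ ≤ C * ‖d‖)
    -- regularity in `z` and the derivative bounds up to order `2 ℓ`
    (ℓ : ℕ) (hℓ : 1 ≤ ℓ)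
    (hsmooth : ∀ u v : V, ContDiff ℝ ((2 * ℓ : ℕ) : WithTop ℕ∞) fun z => a z u v)
    (hbound : ∃ C : ℝ, 0 ≤ C ∧ ∀ᵐ z ∂(jointLaw P Z), ∀ (d : D) (v : V) (α : Fin N → ℕ),
      ∑ i, α i ≤ 2 * ℓ →
        ‖(weightPow law α z : 𝕜) * multiDeriv α (fun z => a z (ι d) v) z‖ ≤
          C * ‖d‖ * ‖j v‖) :
    -- `-𝐀` and `-𝐑_n 𝐀 𝐑_n` generate semigroups `T` and `Tₙ`, and these satisfy:
    ∃ (T : ℝ → Lp H 2 (jointLaw P Z) →L[𝕜] Lp H 2 (jointLaw P Z))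
      (Tₙ : ℕ → ℝ → Lp H 2 (jointLaw P Z) →L[𝕜] Lp H 2 (jointLaw P Z)),
      Generates (-multiplicationOperator (jointLaw P Z) fun z => formOperator j (a z)) T ∧
      (∀ n, Generates (-galerkinOperator (jointLaw P Z) j a n) (Tₙ n)) ∧
      ∀ Tbar : ℝ, 0 < Tbar → ∃ C : ℝ, 0 < C ∧
        -- the semigroup estimate
        (∀ f : Lp D 2 (jointLaw P Z), MemSobolev 𝕜 law (jointLaw P Z) (2 * ℓ) f →
          ∀ n : ℕ, 1 ≤ n → ∀ t ∈ Icc 0 Tbar,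
            ‖Tₙ n t (pcProjection (𝕜 := 𝕜) (jointLaw P Z) n
                  (liftEmbedding (jointLaw P Z) (j.comp ι) f)) -
                T t (liftEmbedding (jointLaw P Z) (j.comp ι) f)‖ ≤
              C * (n : ℝ) ^ (-(ℓ : ℤ)) * sobolevNorm 𝕜 law (jointLaw P Z) (2 * ℓ) f) ∧
        -- the error estimate for the mild solutions
        (∀ u₀ : Lp D 2 (jointLaw P Z), MemSobolev 𝕜 law (jointLaw P Z) (2 * ℓ) u₀ →
          ∀ n : ℕ, 1 ≤ n → ∀ u uₙ : ℝ → Lp H 2 (jointLaw P Z),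
            IsMildSolution
              (-multiplicationOperator (jointLaw P Z) fun z => formOperator j (a z))
              (liftEmbedding (jointLaw P Z) (j.comp ι) u₀) u →
            IsMildSolution (-galerkinOperator (jointLaw P Z) j a n)
              (pcProjection (𝕜 := 𝕜) (jointLaw P Z) n
                (liftEmbedding (jointLaw P Z) (j.comp ι) u₀)) uₙ →
            ∀ t ∈ Icc 0 Tbar,
              ‖uₙ t - u t‖ ≤
                C * (n : ℝ) ^ (-(ℓ : ℤ)) * sobolevNorm 𝕜 law (jointLaw P Z) (2 * ℓ) u₀) := by
  have hprob : ∀ i, IsProbabilityMeasure (law i).measure := fun i =>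
    hlaw i ▸ Measure.isProbabilityMeasure_map (hZ i).aemeasurable
  have hμ := jointLaw_eq_piLaw hZ hind hlaw
  generalize jointLaw P Z = μ at *
  subst hμ
  have _ : SecondCountableTopology H := UniformSpace.secondCountable_of_separable H
  have _ : SecondCountableTopology V := UniformSpace.secondCountable_of_separable V
  obtain ⟨K, κ, -, hκ, hform⟩ := hform
  obtain ⟨c, C₁, hc, -, hdom⟩ := hdom
  obtain ⟨C₂, hC₂, hbound⟩ := hbound
  have ha : RandomForm law j ι a (2 * ℓ) K κ c C₁ C₂ :=
    ⟨hj, hjd, hform, hκ, hsymm, hc, hdom, hsmooth, hC₂, hbound⟩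
  obtain ⟨hM, hG, L, hL, hrate⟩ := ha.exists_semigroup_rate hN hℓ
  refine ⟨hM.semigroup, fun n => (hG n).semigroup, hM.generates, fun n => (hG n).generates,
    fun Tbar hT => ⟨(1 + √Tbar) * L + 1, by positivity, ?_⟩⟩
  have key : ∀ f : Lp D 2 (piLaw law), MemSobolev 𝕜 law (piLaw law) (2 * ℓ) f →
      ∀ n : ℕ, 1 ≤ n → ∀ t ∈ Icc 0 Tbar,
        ‖(hG n).semigroup t
            (pcProjection (𝕜 := 𝕜) (piLaw law) n (liftEmbedding (piLaw law) (j.comp ι) f)) -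
          hM.semigroup t (liftEmbedding (piLaw law) (j.comp ι) f)‖ ≤
        ((1 + √Tbar) * L + 1) * (n : ℝ) ^ (-(ℓ : ℤ)) *
          sobolevNorm 𝕜 law (piLaw law) (2 * ℓ) f := by
    intro f hf n hn t ht
    refine (hrate f hf n hn t ht.1).trans ?_
    have h1 : (1 + √t) * L ≤ (1 + √Tbar) * L + 1 := by
      have := mul_le_mul_of_nonneg_right (Real.sqrt_le_sqrt ht.2) hL
      linarith
    have h2 : 0 ≤ sobolevNorm 𝕜 law (piLaw law) (2 * ℓ) f := Real.sqrt_nonneg _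
    gcongr
  refine ⟨key, fun u₀ hu₀ n hn u uₙ hu huₙ t ht => ?_⟩
  rw [hM.eq_semigroup_of_isMildSolution hu ht.1, (hG n).eq_semigroup_of_isMildSolution huₙ ht.1]
  exact key u₀ hu₀ n hn t ht
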